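/- Let $\nu>0$, let $P$ be smooth on $(0,\infty)$ with $P'>0$, let $\rho_0,u_0,u_1>0$, and let $(\hat\rho,\hat u)$, with $\hat\rho>0$ on $[0,1]$, be a steady solution of the compressible Navier-Stokes equations $$\rho_t+(\rho u)_x=0,\qquad (\rho u)_t+(\rho u^2+P(\rho))_x=\nu u_{xx}\qquad\text{on }[0,1]$$ with $\rho(0)=\rho_0$, $u(0)=u_0$, $u(1)=u_1$. Write $|\cdot|_2$ and $|\cdot|_{H^n}$ for the norms of $L^2(0,1)$ and $H^n(0,1)$, with $|(r,v)|_2^2=|r|_2^2+|v|_2^2$, $|(r,v)|_{H^1}^2=|r|_{H^1}^2+|v|_{H^1}^2$ and $|(r,v)|_{H^2\times H^3}^2=|r|_{H^2}^2+|v|_{H^3}^2$. Consider the equations for the perturbation $(r,v)=(\rho-\hat\rho,u-\hat u)$, $$r_t-\mathcal L_1(r,v)=\mathcal N_1,\qquad \hat\rho\,v_t-\mathcal L_2(r,v)=\mathcal N_2,\qquad r(t,0)=v(t,0)=v(t,1)=0,\tag{$*$}$$ where $$\mathcal L_1(r,v)=-(\hat\rho v+\hat u r)_x,\qquad \mathcal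 L_2(r,v)=\nu v_{xx}-(\hat\rho\hat u v+P'(\hat\rho)r)_x-\hat u_x(\hat u r+\hat\rho v),\qquad \mathcal N_1=-(rv)_x,$$ $$\begin{aligned}\mathcal N_2={}&-\frac{\hat\rho}{\hat\rho+r}\Big[(\hat u v)_x r+\hat\rho v v_x+v r v_x+\big(P(r+\hat\rho)-P(\hat\rho)-P'(\hat\rho)r\big)_x\Big]\\&+\frac{r}{\hat\rho+r}\Big[(\hat\rho\hat u v+P'(\hat\rho)r)_x+\hat u_x(\hat u r+\hat\rho v)-\nu v_{xx}\Big].\end{aligned}$$ A solution on $[0,T]$ is a pair $(r,v)\in\mathcal C([0,T];H^1(0,1))$ that satisfies the boundary conditions for every $t\in[0,T]$ and the two equations weakly: for every $\psi\in C_c^\infty(0,1)$ the functions $t\mapsto\int_0^1 r\psi\,dx$ and $t\mapsto\int_0^1\hat\rho v\psi\,dx$ are differentiable on $[0,T]$, with derivatives $\langle\mathcal L_1+\mathcal N_1,\psi\rangle$ and $\langle\mathcal L_2+\mathcal N_2,\psi\rangle$, where $v_{xx}$ is understood as an element of $H^{-1}(0,1)$. (i) There exist $\varepsilon>0$, $C>0$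 and $\theta_0>0$, depending only on $\nu,P,\hat\rho,\hat u$, such that for every $T>0$ and every solution $(r,v)\in\mathcal C([0,T];H^1)$ of $(*)$ on $[0,T]$ with $\sup_{[0,T]}|(r,v)(t)|_{H^1}\le\varepsilon$, one has for all $0\le t\le T$ and all $\theta\le\theta_0$ $$|(r,v)(t)|_{H^1}^2\le Ce^{-\theta t}|(r,v)(0)|_{H^1}^2+C\int_0^t e^{-\theta(t-s)}|(r,v)(s)|_2^2\,ds.$$ (ii) There exist $\varepsilon>0$, $C>0$ and $\theta_1>0$, depending only on $\nu,P,\hat\rho,\hat u$, such that for every $T>0$ and every solution $(r,v)\in\mathcal C([0,T];H^2\times H^3)\cap\mathcal C^1([0,T];H^1)$ of $(*)$ on $[0,T]$ with $\sup_{[0,T]}|(r,v)(t)|_{H^2\times H^3}\le\varepsilon$, one has for all $0\le t\le T$ and all $\theta<\theta_1$ $$|(r,v)(t)|_{H^2\times H^3}^2\le Ce^{-\theta t}|(r,v)(0)|_{H^2\times H^3}^2+C\int_0^t e^{-\theta(t-s)}|(r,v)(s)|_2^2\,ds.$$ -/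

import Mathlib

open Set MeasureTheory
open scoped ContDiff

noncomputable section

namespace CompressibleNS

/-- The real Hilbert space `L²(0,1)`. -/
abbrev L2 : Type := Lp ℝ 2 (volume.restrict (Ioo (0 : ℝ) 1))

/-- Test functions: smooth functions with compact support contained in the open interval `(0,1)`. -/
structure IsTest (ψ : ℝ → ℝ) : Prop where
  smooth : ContDiff ℝ ∞ ψ
  compact : HasCompactSupport ψ
  supp : tsupport ψ ⊆ Ioo 0 1

theorem IsTest.memLp {ψ : ℝ → ℝ} (h : IsTest ψ) :
    MemLp ψ 2 (volume.restrict (Ioo (0 : ℝ) 1)) :=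
  (h.smooth.continuous.memLp_of_hasCompactSupport h.compact).restrict _

theorem IsTest.memLp_deriv {ψ : ℝ → ℝ} (h : IsTest ψ) :
    MemLp (deriv ψ) 2 (volume.restrict (Ioo (0 : ℝ) 1)) :=
  ((h.smooth.continuous_deriv (by simp)).memLp_of_hasCompactSupport h.compact.deriv).restrict _

/-- `g` is the weak derivative of `f` on `(0,1)`. -/
def IsWeakDeriv (f g : L2) : Prop :=
  ∀ ψ : ℝ → ℝ, IsTest ψ →
    ∫ x in Ioo (0 : ℝ) 1, f x * deriv ψ x = - ∫ x in Ioo (0 : ℝ) 1, g x * ψ x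

theorem integral_add_mul (f g : L2) {ψ : ℝ → ℝ}
    (hψ : MemLp ψ 2 (volume.restrict (Ioo (0 : ℝ) 1))) :
    ∫ x in Ioo (0 : ℝ) 1, (f + g : L2) x * ψ x
      = (∫ x in Ioo (0 : ℝ) 1, f x * ψ x) + ∫ x in Ioo (0 : ℝ) 1, g x * ψ x := by
  have hf : Integrable (fun x => f x * ψ x) (volume.restrict (Ioo (0 : ℝ) 1)) :=
    (Lp.memLp f).integrable_mul hψ
  have hg : Integrable (fun x => g x * ψ x) (volume.restrict (Ioo (0 : ℝ) 1)) :=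
    (Lp.memLp g).integrable_mul hψ
  rw [← integral_add hf hg]
  apply integral_congr_ae
  filter_upwards [Lp.coeFn_add f g] with x hx
  rw [hx]; simp [add_mul]

theorem integral_smul_mul (c : ℝ) (f : L2) (ψ : ℝ → ℝ) :
    ∫ x in Ioo (0 : ℝ) 1, (c • f : L2) x * ψ x = c * ∫ x in Ioo (0 : ℝ) 1, f x * ψ x := by
  rw [← integral_const_mul]
  apply integral_congr_ae
  filter_upwards [Lp.coeFn_smul c f] with x hx
  rw [hx]; simp [mul_assoc]

theorem integral_zero_mul (ψ : ℝ → ℝ) :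
    ∫ x in Ioo (0 : ℝ) 1, (0 : L2) x * ψ x = 0 := by
  have h := integral_smul_mul 0 0 ψ
  simpa using h

/-- The tuples `(f, f', …, f⁽ᵏ⁾)` of elements of `L²(0,1)`, each entry being the weak derivative of
the preceding one. The ambient norm is `(∑ⱼ |f⁽ʲ⁾|₂²)^(1/2)`. -/
def sobolev (k : ℕ) : Submodule ℝ (PiLp 2 (fun _ : Fin (k + 1) => L2)) where
  carrier := {u | ∀ i : Fin k, IsWeakDeriv (u i.castSucc) (u i.succ)}
  add_mem' := by
    intro u w hu hw i ψ hψ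
    simp only [PiLp.add_apply]
    rw [integral_add_mul _ _ hψ.memLp_deriv, integral_add_mul _ _ hψ.memLp,
      hu i ψ hψ, hw i ψ hψ]
    ring
  zero_mem' := by
    intro i ψ _
    simp only [PiLp.zero_apply]
    rw [integral_zero_mul, integral_zero_mul, neg_zero]
  smul_mem' := by
    intro c u hu i ψ hψ
    simp only [PiLp.smul_apply]
    rw [integral_smul_mul, integral_smul_mul, hu i ψ hψ]
    ring

/-- The Sobolev space `Hᵏ(0,1)`, with the norm `|f|_{Hᵏ}² = ∑_{j ≤ k} |f⁽ʲ⁾|₂²`. -/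
abbrev H (k : ℕ) : Type := ↥(sobolev k)

/-- The `j`-th weak derivative of `f ∈ Hᵏ(0,1)`, for `j ≤ k`; `D 0 f` is `f` itself. -/
def D {k : ℕ} (j : Fin (k + 1)) (f : H k) : L2 := f.1 j

/-- The inclusion of `Hᵏ⁺¹(0,1)` into `H¹(0,1)`. -/
def toH1 {k : ℕ} (f : H (k + 1)) : H 1 :=
  ⟨WithLp.toLp 2 (fun i : Fin 2 => f.1 (Fin.castLE (by omega) i)), by
    intro i
    have h := f.2 (Fin.castLE (by omega) i)
    exact h⟩

/-- The value at `a ∈ [0,1]` of (the continuous representative on `[0,1]` of) `f ∈ H¹(0,1)`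
is zero. -/
def VanishesAt (f : H 1) (a : ℝ) : Prop :=
  ∃ g : ℝ → ℝ, ContinuousOn g (Icc 0 1) ∧
    (⇑(D 0 f) =ᵐ[volume.restrict (Ioo (0 : ℝ) 1)] g) ∧ g a = 0

/-- `(ρh, uh)` is a (classical) steady solution, with positive density, of
`ρ_t + (ρ u)_x = 0`, `(ρ u)_t + (ρ u² + P(ρ))_x = ν u_xx` on `[0,1]` with the boundary conditions
`ρ = ρ₀`, `u = u₀` at `x = 0` and `u = u₁` at `x = 1`. -/
structure IsSteady (ν : ℝ) (P : ℝ → ℝ) (ρ₀ u₀ u₁ : ℝ) (ρh uh : ℝ → ℝ) : Prop where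
  contDiff_ρ : ContDiffOn ℝ 1 ρh (Icc 0 1)
  contDiff_u : ContDiffOn ℝ 2 uh (Icc 0 1)
  pos : ∀ x ∈ Icc (0 : ℝ) 1, 0 < ρh x
  mass : ∀ x ∈ Ioo (0 : ℝ) 1, deriv (fun y => ρh y * uh y) x = 0
  momentum : ∀ x ∈ Ioo (0 : ℝ) 1,
    deriv (fun y => ρh y * uh y ^ 2 + P (ρh y)) x = ν * deriv (deriv uh) x
  bc_ρ : ρh 0 = ρ₀
  bc_u_left : uh 0 = u₀
  bc_u_right : uh 1 = u₁

/-- `⟨𝓛₁(r,v), ψ⟩`, where `𝓛₁(r,v) = -(ρh v + uh r)_x`. -/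
def linMass (ρh uh : ℝ → ℝ) (r v : H 1) (ψ : ℝ → ℝ) : ℝ :=
  ∫ x in Ioo (0 : ℝ) 1, (ρh x * D 0 v x + uh x * D 0 r x) * deriv ψ x

/-- `⟨𝓛₂(r,v), ψ⟩`, where
`𝓛₂(r,v) = ν v_xx - (ρh uh v + P'(ρh) r)_x - uh_x (uh r + ρh v)`. -/
def linMomentum (ν : ℝ) (P ρh uh : ℝ → ℝ) (r v : H 1) (ψ : ℝ → ℝ) : ℝ :=
  - (ν * ∫ x in Ioo (0 : ℝ) 1, D 1 v x * deriv ψ x)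
  + (∫ x in Ioo (0 : ℝ) 1,
      (ρh x * uh x * D 0 v x + deriv P (ρh x) * D 0 r x) * deriv ψ x)
  - ∫ x in Ioo (0 : ℝ) 1, deriv uh x * (uh x * D 0 r x + ρh x * D 0 v x) * ψ x

/-- `⟨𝓝₁(r,v), ψ⟩`, where `𝓝₁(r,v) = -(r v)_x`. -/
def nonlinMass (r v : H 1) (ψ : ℝ → ℝ) : ℝ :=
  ∫ x in Ioo (0 : ℝ) 1, D 0 r x * D 0 v x * deriv ψ x

/-- The function `(uh v)_x r + ρh v v_x + v r v_x + (P(r + ρh) - P(ρh) - P'(ρh) r)_x`,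
with the derivatives of the products and of the compositions written out. -/
def quadTerm (P ρh uh : ℝ → ℝ) (r v : H 1) (x : ℝ) : ℝ :=
  (deriv uh x * D 0 v x + uh x * D 1 v x) * D 0 r x
  + ρh x * D 0 v x * D 1 v x + D 0 v x * D 0 r x * D 1 v x
  + (deriv P (D 0 r x + ρh x) * (D 1 r x + deriv ρh x) - deriv P (ρh x) * deriv ρh x
      - (deriv (deriv P) (ρh x) * deriv ρh x * D 0 r x + deriv P (ρh x) * D 1 r x))

/-- The function `(ρh uh v + P'(ρh) r)_x + uh_x (uh r + ρh v)`, with the derivatives of the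
products and of the composition written out. -/
def linTerm (P ρh uh : ℝ → ℝ) (r v : H 1) (x : ℝ) : ℝ :=
  (deriv ρh x * uh x + ρh x * deriv uh x) * D 0 v x + ρh x * uh x * D 1 v x
  + (deriv (deriv P) (ρh x) * deriv ρh x * D 0 r x + deriv P (ρh x) * D 1 r x)
  + deriv uh x * (uh x * D 0 r x + ρh x * D 0 v x)

/-- The weak derivative `((r / (ρh + r)) ψ)_x`, by the quotient and product rules. -/
def ratioTestDeriv (ρh : ℝ → ℝ) (r : H 1) (ψ : ℝ → ℝ) (x : ℝ) : ℝ :=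
  (D 1 r x * ρh x - D 0 r x * deriv ρh x) / (ρh x + D 0 r x) ^ 2 * ψ x
  + D 0 r x / (ρh x + D 0 r x) * deriv ψ x

/-- `⟨𝓝₂(r,v), ψ⟩`, where
`𝓝₂(r,v) = - ρh / (ρh + r) * quadTerm + r / (ρh + r) * (linTerm - ν v_xx)`
and where, since `v_xx` belongs to `H⁻¹(0,1)` only,
`⟨- ν (r / (ρh + r)) v_xx, ψ⟩ = ν ∫ v_x ((r / (ρh + r)) ψ)_x`. -/
def nonlinMomentum (ν : ℝ) (P ρh uh : ℝ → ℝ) (r v : H 1) (ψ : ℝ → ℝ) : ℝ :=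
  - (∫ x in Ioo (0 : ℝ) 1, ρh x / (ρh x + D 0 r x) * quadTerm P ρh uh r v x * ψ x)
  + (∫ x in Ioo (0 : ℝ) 1, D 0 r x / (ρh x + D 0 r x) * linTerm P ρh uh r v x * ψ x)
  + ν * ∫ x in Ioo (0 : ℝ) 1, D 1 v x * ratioTestDeriv ρh r ψ x

/-- `(r, v) ∈ C([0,T]; H¹(0,1))` is a (weak) solution on `[0,T]` of the perturbation equations
`r_t - 𝓛₁(r,v) = 𝓝₁(r,v)`, `ρh v_t - 𝓛₂(r,v) = 𝓝₂(r,v)` with the boundary conditions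
`r(t,0) = v(t,0) = v(t,1) = 0`. -/
structure IsSolution (ν : ℝ) (P ρh uh : ℝ → ℝ) (T : ℝ) (r v : ℝ → H 1) : Prop where
  cont_r : ContinuousOn r (Icc 0 T)
  cont_v : ContinuousOn v (Icc 0 T)
  mass : ∀ ψ : ℝ → ℝ, IsTest ψ → ∀ t ∈ Icc (0 : ℝ) T,
    HasDerivWithinAt (fun s => ∫ x in Ioo (0 : ℝ) 1, D 0 (r s) x * ψ x)
      (linMass ρh uh (r t) (v t) ψ + nonlinMass (r t) (v t) ψ) (Icc 0 T) t
  momentum : ∀ ψ : ℝ → ℝ, IsTest ψ → ∀ t ∈ Icc (0 : ℝ) T,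
    HasDerivWithinAt (fun s => ∫ x in Ioo (0 : ℝ) 1, ρh x * D 0 (v s) x * ψ x)
      (linMomentum ν P ρh uh (r t) (v t) ψ + nonlinMomentum ν P ρh uh (r t) (v t) ψ)
      (Icc 0 T) t
  bc_r : ∀ t ∈ Icc (0 : ℝ) T, VanishesAt (r t) 0
  bc_v_left : ∀ t ∈ Icc (0 : ℝ) T, VanishesAt (v t) 0
  bc_v_right : ∀ t ∈ Icc (0 : ℝ) T, VanishesAt (v t) 1

end CompressibleNS

end

/-! Write f = log(ρ/ρ̂), φ = f_x, w = v_x, b = (log ρ̂)_x. The mass equation becomes f_t + uφ + w +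
bv = 0. Adding ν times it to the momentum equation integrated once in x cancels the viscous term:
for the effective flux N = ρv + νφ, and modulo constants in x, (∫N)_t + uN + ∫(κN + G) = 0, where κ
= ρP'(ρ)/ν > 0 and G involves neither φ nor N but only f, v and w. So N solves a damped transport
equation, although the density itself is not diffused.

Three energies are added. The energy ½∫ûN² is damped by κ. Its weight û turns the leading convective
term into a boundary term, which has a good sign at the outflow end x = 1; at the inflow end v and f
vanish, so N = νφ = -νw/u there and the loss is at most a multiple of sup|w|². The energy ½ν∫w²
dissipates ∫ρv_t², and ∫ρv² dissipates ∫w². Since sup|w|² is interpolated between the norms of w and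
w_x, and w_x is expressed by v_t through the momentum equation, a small multiple of the second and a
large multiple of the third energy absorb everything except ‖f‖² + ‖v‖² (`exists_absorption`,
`LinSys.exists_dissipation`). Gronwall's argument then gives `exists_energy_estimate`.

At H¹ regularity these computations are only formal: N has neither an x-derivative nor a trace, and
v_t need not be square integrable. The first energy is therefore computed for the difference
quotient of ∫N with step h, and the inflow trace is replaced by a weighted energy of f on (0,h)
divided by h² (`space_energy_le`, `trace_energy_scaled_le`). The second is computed for the average
of w over [t,t+k], which by the momentum equation is an H¹ function of x. Replacing w by a bounded
function costs an error of size e/h, where e is the L² distance from w to its average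
(`SplitBound`); hence k is chosen after h. Compactness of the orbit in L² makes one pair h, k work
for all times (`exists_space_step`).

All this is done for a linear system with variable coefficients (`LinSys`), because it is used
twice. The perturbation itself satisfies it (`Background.exists_linSys`), which yields (i). Its time
derivative satisfies it with φ = (ρ_t/ρ)_x and w = v_xt (`Background.Pert2.linSys`). For (ii) the
source terms ‖ρ_t/ρ‖² and ‖v_t‖² of the second system are integrated in time by the dissipation of
the first (`Background.exists_estimate_two`), and the equations trade time derivatives for r_xx,
v_xx and v_xxx (`Background.Pert2.bnd_space`, `Background.Pert2.bnd_time`).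

Functions are encoded by their x-derivatives: a function vanishing at 0 is `prim F` with F in L².
Equations valid in H⁻¹ are integrated once in x and read modulo constants through `meanFree`. -/

noncomputable section

namespace CompressibleNS

open Filter Topology intervalIntegral unitInterval

/-! ### L² as a normed module over the continuous functions -/

/-- Continuous functions on `[0,1]`. -/
abbrev CI : Type := C(unitInterval, ℝ)

/-- Lebesgue measure on `(0,1)`. -/
abbrev leb : Measure ℝ := volume.restrict (Ioo (0 : ℝ) 1)

/-- The extension of a continuous function on `[0,1]` to `ℝ`, constant on both sides. -/
def ex (a : CI) : ℝ → ℝ := IccExtend zero_le_one a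

@[fun_prop]
theorem continuous_ex (a : CI) : Continuous (ex a) := a.continuous.Icc_extend'

theorem ex_of_mem (a : CI) {x : ℝ} (hx : x ∈ Icc (0 : ℝ) 1) : ex a x = a ⟨x, hx⟩ :=
  IccExtend_of_mem _ _ hx

theorem ex_coe (a : CI) (x : unitInterval) : ex a x = a x := by
  rw [ex_of_mem a x.2]

theorem abs_ex_le (a : CI) (x : ℝ) : |ex a x| ≤ ‖a‖ := a.norm_coe_le_norm _

@[simp] theorem ex_add (a b : CI) (x : ℝ) : ex (a + b) x = ex a x + ex b x := rfl
@[simp] theorem ex_sub (a b : CI) (x : ℝ) : ex (a - b) x = ex a x - ex b x := rfl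
@[simp] theorem ex_neg (a : CI) (x : ℝ) : ex (-a) x = -ex a x := rfl
@[simp] theorem ex_mul (a b : CI) (x : ℝ) : ex (a * b) x = ex a x * ex b x := rfl
@[simp] theorem ex_one (x : ℝ) : ex 1 x = 1 := rfl
@[simp] theorem ex_zero (x : ℝ) : ex 0 x = 0 := rfl
@[simp] theorem ex_smul (c : ℝ) (a : CI) (x : ℝ) : ex (c • a) x = c * ex a x := rfl

theorem memLp_ex_mul (a : CI) (F : L2) : MemLp (fun x => ex a x * F x) 2 leb := by
  refine MemLp.of_le_mul (c := ‖a‖) (Lp.memLp F) ?_ ?_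
  · exact (continuous_ex a).aestronglyMeasurable.mul (Lp.aestronglyMeasurable F)
  · refine Eventually.of_forall fun x => ?_
    rw [norm_mul]
    exact mul_le_mul_of_nonneg_right (abs_ex_le a x) (norm_nonneg _)

/-- The module structure over C[0,1] lets identities between coefficients and L² functions be closed
by `module`, with no almost-everywhere argument. -/
instance : SMul CI L2 := ⟨fun a F => (memLp_ex_mul a F).toLp⟩

theorem coeFn_csmul (a : CI) (F : L2) : ⇑(a • F) =ᵐ[leb] fun x => ex a x * F x :=
  (memLp_ex_mul a F).coeFn_toLp

instance : Module CI L2 where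
  one_smul F := by
    refine Lp.ext ?_
    filter_upwards [coeFn_csmul 1 F] with x h
    simp [h]
  mul_smul a b F := by
    refine Lp.ext ?_
    filter_upwards [coeFn_csmul (a * b) F, coeFn_csmul a (b • F), coeFn_csmul b F] with x h1 h2 h3
    rw [h1, h2, h3, ex_mul, mul_assoc]
  smul_zero a := by
    refine Lp.ext ?_
    filter_upwards [coeFn_csmul a 0, Lp.coeFn_zero ℝ 2 leb] with x h1 h2
    rw [h1, h2]; simp
  smul_add a F G := by
    refine Lp.ext ?_
    filter_upwards [coeFn_csmul a (F + G), coeFn_csmul a F, coeFn_csmul a G, Lp.coeFn_add F G,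
      Lp.coeFn_add (a • F) (a • G)] with x h1 h2 h3 h4 h5
    rw [h1, h5, h4]; simp [h2, h3, mul_add]
  add_smul a b F := by
    refine Lp.ext ?_
    filter_upwards [coeFn_csmul (a + b) F, coeFn_csmul a F, coeFn_csmul b F,
      Lp.coeFn_add (a • F) (b • F)] with x h1 h2 h3 h4
    rw [h1, h4]; simp [h2, h3, add_mul]
  zero_smul F := by
    refine Lp.ext ?_
    filter_upwards [coeFn_csmul 0 F, Lp.coeFn_zero ℝ 2 leb] with x h1 h2
    rw [h1, h2]; simp

instance : IsScalarTower ℝ CI L2 where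
  smul_assoc c a F := by
    refine Lp.ext ?_
    filter_upwards [coeFn_csmul (c • a) F, coeFn_csmul a F, Lp.coeFn_smul c (a • F)] with x h1 h2 h3
    rw [h1, h3]; simp [h2, mul_assoc]

theorem norm_csmul_le (a : CI) (F : L2) : ‖a • F‖ ≤ ‖a‖ * ‖F‖ := by
  refine Lp.norm_le_mul_norm_of_ae_le_mul ?_
  filter_upwards [coeFn_csmul a F] with x h
  rw [h, norm_mul]
  exact mul_le_mul_of_nonneg_right (abs_ex_le a x) (norm_nonneg _)

instance : IsBoundedSMul CI L2 := IsBoundedSMul.of_norm_smul_le norm_csmul_le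

/-- The constant function one. -/
def one2 : L2 := (memLp_const (1 : ℝ)).toLp

theorem coeFn_one2 : ⇑one2 =ᵐ[leb] fun _ => 1 := (memLp_const (1 : ℝ)).coeFn_toLp

/-- The inclusion of continuous functions in `L²`. -/
def emb : CI →L[ℝ] L2 :=
  LinearMap.mkContinuous
    { toFun := fun a => a • one2
      map_add' := fun a b => add_smul a b _
      map_smul' := fun c a => smul_assoc c a _ } ‖one2‖
    (fun a => by simpa [mul_comm] using norm_csmul_le a one2)

theorem emb_apply (a : CI) : emb a = a • one2 := rfl

theorem coeFn_emb (a : CI) : ⇑(emb a) =ᵐ[leb] ex a := by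
  filter_upwards [coeFn_csmul a one2, coeFn_one2] with x h1 h2
  rw [emb_apply, h1, h2, mul_one]

theorem emb_mul (a b : CI) : emb (a * b) = a • emb b := by
  simp only [emb_apply, mul_smul]

theorem norm_one2 : ‖one2‖ = 1 := by
  have h : ‖one2‖ ^ 2 = 1 := by
    rw [← real_inner_self_eq_norm_sq, L2.inner_def]
    have : (fun x => inner ℝ (one2 x) (one2 x)) =ᵐ[leb] fun _ => (1 : ℝ) := by
      filter_upwards [coeFn_one2] with x h
      simp [h]
    rw [integral_congr_ae this]
    simp [leb]
  nlinarith [norm_nonneg one2]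

theorem norm_emb_le (a : CI) : ‖emb a‖ ≤ ‖a‖ := by
  have := norm_csmul_le a one2
  rwa [norm_one2, mul_one] at this

theorem inner_eq (F G : L2) : inner ℝ F G = ∫ x in Ioo (0 : ℝ) 1, F x * G x := by
  rw [L2.inner_def]
  simp [mul_comm]

theorem csmul_inner (a : CI) (F G : L2) : inner ℝ (a • F) G = inner ℝ F (a • G) := by
  rw [inner_eq, inner_eq]
  refine integral_congr_ae ?_
  filter_upwards [coeFn_csmul a F, coeFn_csmul a G] with x h1 h2
  rw [h1, h2]; ring

theorem integrable_mul (F G : L2) : Integrable (fun x => F x * G x) leb :=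
  (Lp.memLp F).integrable_mul (Lp.memLp G)

theorem integrable_coe (F : L2) : Integrable F leb :=
  (Lp.memLp F).integrable (by norm_num)

/-- Used to extend product and chain rules from C¹ primitives to primitives of L² functions. -/
theorem dense_emb : DenseRange emb := by
  have h := BoundedContinuousFunction.toLp_denseRange (E := ℝ) (p := 2) leb ℝ (by norm_num)
  refine h.mono ?_
  rintro _ ⟨g, rfl⟩
  refine ⟨⟨fun x => g x, by fun_prop⟩, ?_⟩
  refine Lp.ext ?_
  filter_upwards [coeFn_emb ⟨fun x : unitInterval => g x, by fun_prop⟩,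
    BoundedContinuousFunction.coeFn_toLp (p := 2) (μ := leb) (𝕜 := ℝ) g,
    ae_restrict_mem measurableSet_Ioo] with x h1 h2 h3
  rw [h1, h2, ex_of_mem _ (Ioo_subset_Icc_self h3)]
  rfl

/-! ### Primitives and their product and chain rules -/

theorem measure_Ioo_subset {x : ℝ} (hx : x ∈ Icc (0 : ℝ) 1) :
    volume.restrict (Ioc 0 x) ≤ leb := by
  rw [leb, ← restrict_Ioo_eq_restrict_Ioc]
  exact Measure.restrict_mono (Ioo_subset_Ioo_right hx.2) le_rfl

theorem intervalIntegrable_of_leb {f : ℝ → ℝ} (hf : Integrable f leb) {x y : ℝ}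
    (hx : x ∈ Icc (0 : ℝ) 1) (hy : y ∈ Icc (0 : ℝ) 1) : IntervalIntegrable f volume x y := by
  have : IntegrableOn f (Icc 0 1) volume := by
    rw [integrableOn_Icc_iff_integrableOn_Ioo]; exact hf
  refine (this.mono_set ?_).intervalIntegrable
  exact (convex_Icc (0:ℝ) 1).ordConnected.uIcc_subset hx hy

theorem continuousOn_primitive_leb {f : ℝ → ℝ} (hf : Integrable f leb) :
    ContinuousOn (fun x => ∫ y in (0 : ℝ)..x, f y) (Icc 0 1) := by
  refine intervalIntegral.continuousOn_primitive_interval' (b₁ := 0) (b₂ := 1) ?_ ?_ |>.mono ?_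
  · exact intervalIntegrable_of_leb hf (by simp) (by simp)
  · simp
  · rw [uIcc_of_le zero_le_one]

/-- The primitive `x ↦ ∫₀ˣ F G` of a product. -/
def primMulFun (F G : L2) : CI :=
  ⟨fun x => ∫ y in (0 : ℝ)..x, F y * G y,
    (continuousOn_primitive_leb (integrable_mul F G)).comp_continuous continuous_subtype_val
      (fun x => x.2)⟩

theorem integral_interval_le {f : ℝ → ℝ} (hf : Integrable f leb) {x : ℝ} (hx : x ∈ Icc (0 : ℝ) 1) :
    |∫ y in (0 : ℝ)..x, f y| ≤ ∫ y in Ioo (0 : ℝ) 1, |f y| := by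
  rw [intervalIntegral.integral_of_le hx.1]
  refine (MeasureTheory.abs_integral_le_integral_abs).trans ?_
  exact integral_mono_measure (measure_Ioo_subset hx) (Eventually.of_forall fun _ => abs_nonneg _)
    hf.abs

theorem integral_abs_mul_le (F G : L2) : ∫ y in Ioo (0 : ℝ) 1, |F y * G y| ≤ ‖F‖ * ‖G‖ := by
  have h := real_inner_le_norm |F| |G|
  rw [inner_eq, norm_abs_eq_norm, norm_abs_eq_norm] at h
  refine le_trans (le_of_eq ?_) h
  refine integral_congr_ae ?_
  filter_upwards [Lp.coeFn_abs F, Lp.coeFn_abs G] with x h1 h2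
  rw [h1, h2, abs_mul]

theorem norm_primMulFun_le (F G : L2) : ‖primMulFun F G‖ ≤ ‖F‖ * ‖G‖ := by
  rw [ContinuousMap.norm_le _ (by positivity)]
  intro x
  exact (integral_interval_le (integrable_mul F G) x.2).trans (integral_abs_mul_le F G)

theorem primMul_congr {f g : ℝ → ℝ} (h : f =ᵐ[leb] g) {x : ℝ} (hx : x ∈ Icc (0 : ℝ) 1) :
    ∫ y in (0 : ℝ)..x, f y = ∫ y in (0 : ℝ)..x, g y := by
  rw [intervalIntegral.integral_of_le hx.1, intervalIntegral.integral_of_le hx.1]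
  exact integral_congr_ae (ae_mono (measure_Ioo_subset hx) h)

theorem intervalIntegrable_mul (F G : L2) (x : unitInterval) :
    IntervalIntegrable (fun y => F y * G y) volume 0 x :=
  intervalIntegrable_of_leb (integrable_mul F G) (by simp) x.2

/-- The bilinear map `(F, G) ↦ (x ↦ ∫₀ˣ F G)`. -/
def primMul : L2 →L[ℝ] L2 →L[ℝ] CI :=
  LinearMap.mkContinuous₂
    (LinearMap.mk₂ ℝ primMulFun
      (fun F F' G => by
        ext x
        change (∫ y in (0 : ℝ)..x, (F + F') y * G y) = (∫ y in (0 : ℝ)..x, F y * G y)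
          + ∫ y in (0 : ℝ)..x, F' y * G y
        rw [← intervalIntegral.integral_add (intervalIntegrable_mul F G x)
          (intervalIntegrable_mul F' G x)]
        refine primMul_congr ?_ x.2
        filter_upwards [Lp.coeFn_add F F'] with y h
        rw [h]; simp [add_mul])
      (fun c F G => by
        ext x
        change (∫ y in (0 : ℝ)..x, (c • F) y * G y) = c * (∫ y in (0 : ℝ)..x, F y * G y)
        rw [← intervalIntegral.integral_const_mul]
        refine primMul_congr ?_ x.2
        filter_upwards [Lp.coeFn_smul c F] with y h
        rw [h]; simp [mul_assoc])
      (fun F G G' => by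
        ext x
        change (∫ y in (0 : ℝ)..x, F y * (G + G') y) = (∫ y in (0 : ℝ)..x, F y * G y)
          + ∫ y in (0 : ℝ)..x, F y * G' y
        rw [← intervalIntegral.integral_add (intervalIntegrable_mul F G x)
          (intervalIntegrable_mul F G' x)]
        refine primMul_congr ?_ x.2
        filter_upwards [Lp.coeFn_add G G'] with y h
        rw [h]; simp [mul_add])
      (fun c F G => by
        ext x
        change (∫ y in (0 : ℝ)..x, F y * (c • G) y) = c * (∫ y in (0 : ℝ)..x, F y * G y)
        rw [← intervalIntegral.integral_const_mul]
        refine primMul_congr ?_ x.2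
        filter_upwards [Lp.coeFn_smul c G] with y h
        rw [h]; simp; ring)) 1
    (fun F G => by simpa using norm_primMulFun_le F G)

theorem primMul_apply (F G : L2) (x : unitInterval) :
    primMul F G x = ∫ y in (0 : ℝ)..x, F y * G y := rfl

theorem norm_primMul_le (F G : L2) : ‖primMul F G‖ ≤ ‖F‖ * ‖G‖ := norm_primMulFun_le F G

theorem primMul_csmul_left (a : CI) (F G : L2) : primMul (a • F) G = primMul F (a • G) := by
  ext x
  rw [primMul_apply, primMul_apply]
  refine primMul_congr ?_ x.2
  filter_upwards [coeFn_csmul a F, coeFn_csmul a G] with y h1 h2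
  rw [h1, h2]; ring

theorem primMul_comm (F G : L2) : primMul F G = primMul G F := by
  ext x
  rw [primMul_apply, primMul_apply]
  simp only [mul_comm]

theorem primMul_one (F G : L2) : primMul F G 1 = inner ℝ F G := by
  rw [primMul_apply, inner_eq, Icc.coe_one, intervalIntegral.integral_of_le zero_le_one,
    ← restrict_Ioo_eq_restrict_Ioc]

@[simp] theorem primMul_zero' (F G : L2) : primMul F G 0 = 0 := by
  rw [primMul_apply]; simp

/-- The primitive `x ↦ ∫₀ˣ F`. -/
def prim : L2 →L[ℝ] CI := primMul one2

theorem prim_apply (F : L2) (x : unitInterval) : prim F x = ∫ y in (0 : ℝ)..x, F y := by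
  rw [prim, primMul_apply]
  refine primMul_congr ?_ x.2
  filter_upwards [coeFn_one2] with y h
  rw [h, one_mul]

theorem norm_prim_le (F : L2) : ‖prim F‖ ≤ ‖F‖ := by
  have := norm_primMul_le one2 F
  rwa [norm_one2, one_mul] at this

@[simp] theorem prim_zero' (F : L2) : prim F 0 = 0 := primMul_zero' _ _

theorem primMul_emb (F : L2) (a : CI) : primMul F (emb a) = prim (a • F) := by
  rw [prim, emb_apply, ← primMul_csmul_left, primMul_comm]

theorem primMul_emb_left (F : L2) (a : CI) : primMul (emb a) F = prim (a • F) := by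
  rw [primMul_comm, primMul_emb]

/-- Constant functions. -/
def cst (c : ℝ) : CI := algebraMap ℝ CI c

@[simp] theorem cst_apply (c : ℝ) (x : unitInterval) : cst c x = c := rfl

theorem cst_eq (c : ℝ) : cst c = c • (1 : CI) := Algebra.algebraMap_eq_smul_one c

theorem cst_csmul (c : ℝ) (F : L2) : cst c • F = c • F := by
  rw [cst_eq, smul_assoc, one_smul]

theorem hasDerivAt_prim_emb (a : CI) {x : ℝ} (hx : x ∈ Ioo (0 : ℝ) 1) :
    HasDerivAt (ex (prim (emb a))) (ex a x) x := by
  have h1 : HasDerivAt (fun x => ∫ y in (0 : ℝ)..x, ex a y) (ex a x) x :=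
    (continuous_ex a).integral_hasStrictDerivAt 0 x |>.hasDerivAt
  refine h1.congr_of_eventuallyEq ?_
  filter_upwards [Icc_mem_nhds hx.1 hx.2] with y hy
  rw [ex_of_mem _ hy, prim_apply]
  exact primMul_congr (coeFn_emb a) hy

/-- The fundamental theorem of calculus. Differentiability is needed only inside (0,1), since `ex A`
is continuous up to the ends. -/
theorem eq_prim_of_hasDerivAt (A A' : CI)
    (h : ∀ x ∈ Ioo (0 : ℝ) 1, HasDerivAt (ex A) (ex A' x) x) :
    A = cst (A 0) + prim (emb A') := by
  ext x
  have h1 : ∫ y in (0 : ℝ)..x, ex A' y = ex A x - ex A 0 := by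
    refine intervalIntegral.integral_eq_sub_of_hasDerivAt_of_le x.2.1 (by fun_prop) ?_
      ((continuous_ex A').intervalIntegrable _ _)
    intro y hy
    exact h y ⟨hy.1, hy.2.trans_le x.2.2⟩
  rw [ContinuousMap.add_apply, prim_apply, primMul_congr (coeFn_emb A') x.2, h1, ex_coe,
    ex_of_mem A (by simp : (0 : ℝ) ∈ Icc (0 : ℝ) 1)]
  simp [cst_apply]

@[simp] theorem ex_cst (c x : ℝ) : ex (cst c) x = c := rfl

theorem hasDerivAt_ex_prim_emb (c : ℝ) (a : CI) {x : ℝ} (hx : x ∈ Ioo (0 : ℝ) 1) :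
    HasDerivAt (ex (cst c + prim (emb a))) (ex a x) x :=
  (hasDerivAt_prim_emb a hx).const_add c

/-- The product rule for primitives. -/
theorem mul_prim (c d : ℝ) (F G : L2) :
    (cst c + prim F) * (cst d + prim G) =
      cst (c * d) + prim ((cst c + prim F) • G + (cst d + prim G) • F) := by
  -- Both sides are continuous in (F, G), so by density the classical product rule for C¹ primitives
  -- is enough.
  refine isClosed_property2 (e := emb) (p := fun F G => (cst c + prim F) * (cst d + prim G) =
      cst (c * d) + prim ((cst c + prim F) • G + (cst d + prim G) • F)) dense_emb ?_ ?_ F G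
  · exact isClosed_eq (by fun_prop) (by fun_prop)
  · intro a b
    have h := eq_prim_of_hasDerivAt ((cst c + prim (emb a)) * (cst d + prim (emb b)))
      ((cst c + prim (emb a)) * b + (cst d + prim (emb b)) * a) (by
        intro x hx
        have := (hasDerivAt_ex_prim_emb c a hx).mul (hasDerivAt_ex_prim_emb d b hx)
        refine this.congr_deriv ?_
        simp only [ex_add, ex_mul]; ring)
    rw [h, map_add, emb_mul, emb_mul]
    simp

theorem prim_mul_prim (F G : L2) : prim F * prim G = prim (prim F • G + prim G • F) := by
  have h := mul_prim 0 0 F G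
  have h0 : cst 0 = 0 := by simp [cst]
  simpa [h0] using h

/-- By density F may be taken continuous, where this is the classical chain rule. `chain_prim` frees
it from the assumption that Φ is differentiable on the whole line. -/
theorem chain_prim_univ {Φ Φ' : ℝ → ℝ} (hΦ : ∀ y, HasDerivAt Φ (Φ' y) y) (hΦ' : Continuous Φ')
    (c : ℝ) (F : L2) :
    (⟨Φ, continuous_iff_continuousAt.2 fun y => (hΦ y).continuousAt⟩ : C(ℝ, ℝ)).comp
        (cst c + prim F) =
      cst (Φ c) + prim ((⟨Φ', hΦ'⟩ : C(ℝ, ℝ)).comp (cst c + prim F) • F) := by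
  set Ψ : C(ℝ, ℝ) := ⟨Φ, continuous_iff_continuousAt.2 fun y => (hΦ y).continuousAt⟩
  set Ψ' : C(ℝ, ℝ) := ⟨Φ', hΦ'⟩
  have h1 : Continuous fun a : CI => Ψ.comp a := ContinuousMap.continuous_postcomp Ψ
  have h2 : Continuous fun a : CI => Ψ'.comp a := ContinuousMap.continuous_postcomp Ψ'
  refine isClosed_property (e := emb) (p := fun F => Ψ.comp (cst c + prim F) =
      cst (Φ c) + prim (Ψ'.comp (cst c + prim F) • F)) dense_emb ?_ ?_ F
  · exact isClosed_eq (by fun_prop) (by fun_prop)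
  · intro a
    have h := eq_prim_of_hasDerivAt (Ψ.comp (cst c + prim (emb a)))
      (Ψ'.comp (cst c + prim (emb a)) * a) (by
        intro x hx
        exact (hΦ _).comp x (hasDerivAt_ex_prim_emb c a hx))
    rw [h, emb_mul]
    simp [Ψ]

/-- The chain rule for primitives. -/
theorem chain_prim {Φ Φ' : ℝ → ℝ} {m M : ℝ}
    (hΦ : ∀ y ∈ Icc m M, HasDerivAt Φ (Φ' y) y)
    (hΦ' : ContinuousOn Φ' (Icc m M)) (c : ℝ) (F : L2)
    (hF : ∀ x, (cst c + prim F) x ∈ Icc m M)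
    (A A' : CI) (hA : ∀ x, A x = Φ ((cst c + prim F) x))
    (hA' : ∀ x, A' x = Φ' ((cst c + prim F) x)) : A = cst (Φ c) + prim (A' • F) := by
  have hmM : m ≤ M := (hF 0).1.trans (hF 0).2
  have hc : c ∈ Icc m M := by simpa using hF 0
  -- Freezing Φ' outside [m,M] and integrating gives a C¹ function on the line that agrees with Φ on
  -- [m,M].
  let Ψ' : ℝ → ℝ := IccExtend hmM (fun y => Φ' y)
  have hΨ' : Continuous Ψ' := (continuousOn_iff_continuous_domRestrict.1 hΦ').Icc_extend'
  have hΨ'eq : ∀ y ∈ Icc m M, Ψ' y = Φ' y := fun y hy => IccExtend_of_mem _ _ hy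
  let Ψ : ℝ → ℝ := fun y => Φ m + ∫ z in m..y, Ψ' z
  have hΨ : ∀ y, HasDerivAt Ψ (Ψ' y) y := fun y =>
    ((hΨ'.integral_hasStrictDerivAt m y).hasDerivAt).const_add _
  have hΨeq : ∀ y ∈ Icc m M, Ψ y = Φ y := by
    intro y hy
    have : ∫ z in m..y, Ψ' z = Φ y - Φ m := by
      refine intervalIntegral.integral_eq_sub_of_hasDerivAt ?_ (hΨ'.intervalIntegrable _ _)
      intro z hz
      rw [uIcc_of_le hy.1] at hz
      have hz' : z ∈ Icc m M := ⟨hz.1, hz.2.trans hy.2⟩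
      rw [hΨ'eq z hz']
      exact hΦ z hz'
    simp [Ψ, this]
  have h := chain_prim_univ hΨ hΨ' c F
  have e1 : A = (⟨Ψ, continuous_iff_continuousAt.2 fun y => (hΨ y).continuousAt⟩ :
      C(ℝ, ℝ)).comp (cst c + prim F) := by
    ext x
    rw [hA x, ← hΨeq _ (hF x)]; rfl
  have e2 : A' = (⟨Ψ', hΨ'⟩ : C(ℝ, ℝ)).comp (cst c + prim F) := by
    ext x
    rw [hA' x, ← hΨ'eq _ (hF x)]; rfl
  rw [e1, h, ← e2, hΨeq c hc]

/-! ### Integration by parts modulo constants and one-dimensional interpolation -/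

/-- Integration by parts. -/
theorem inner_emb_prim_of_eq_zero (F G : L2) (hG : prim G 1 = 0) :
    inner ℝ (emb (prim F)) G = -inner ℝ F (emb (prim G)) := by
  have h := congrArg (fun a : CI => a 1) (prim_mul_prim F G)
  simp only [ContinuousMap.mul_apply, hG, mul_zero, map_add, ContinuousMap.add_apply,
    ← primMul_emb, primMul_one] at h
  rw [real_inner_comm]
  linarith

theorem inner_one2 (F : L2) : inner ℝ one2 F = prim F 1 := by
  rw [prim, primMul_one]

/-- The projection onto functions of mean zero. -/
def meanFree : L2 →L[ℝ] L2 :=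
  ContinuousLinearMap.id ℝ L2 - (innerSL ℝ one2).smulRight one2

theorem meanFree_apply (F : L2) : meanFree F = F - (prim F 1) • one2 := by
  simp [meanFree, inner_one2]

theorem inner_meanFree (F G : L2) (hG : prim G 1 = 0) :
    inner ℝ (meanFree F) G = inner ℝ F G := by
  rw [meanFree_apply, inner_sub_left, inner_smul_left, inner_one2, hG]
  simp

theorem emb_injective : Function.Injective emb := by
  intro a b h
  have h1 : ex a =ᵐ[leb] ex b := by
    have := coeFn_emb b
    rw [← h] at this
    exact (coeFn_emb a).symm.trans this
  have h2 : EqOn (ex a) (ex b) (Icc 0 1) := by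
    have h3 : EqOn (ex a) (ex b) (Ioo 0 1) :=
      Measure.eqOn_open_of_ae_eq h1 isOpen_Ioo (by fun_prop) (by fun_prop)
    have := h3.closure (continuous_ex a) (continuous_ex b)
    rwa [closure_Ioo zero_ne_one] at this
  ext x
  rw [← ex_coe, ← ex_coe]
  exact h2 x.2

/-- By Lebesgue's differentiation theorem F is almost everywhere the derivative of its primitive. -/
theorem prim_injective : Function.Injective prim := by
  rw [injective_iff_map_eq_zero]
  intro F h
  have h1 := (intervalIntegrable_of_leb (integrable_coe F) (x := 0) (y := 1) (by simp)
    (by simp)).ae_hasDerivAt_integral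
  have h2 : ∀ᵐ x ∂leb, F x = 0 := by
    filter_upwards [ae_restrict_of_ae h1, ae_restrict_mem measurableSet_Ioo] with x hx hx'
    have h3 := hx (by rw [uIcc_of_le zero_le_one]; exact Ioo_subset_Icc_self hx') 0 (by simp)
    have h4 : (fun x => ∫ y in (0 : ℝ)..x, F y) =ᶠ[𝓝 x] fun _ => 0 := by
      filter_upwards [Icc_mem_nhds hx'.1 hx'.2] with y hy
      have := prim_apply F ⟨y, hy⟩
      rw [h] at this
      exact this.symm
    exact h3.unique ((hasDerivAt_const x (0 : ℝ)).congr_of_eventuallyEq h4)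
  refine Lp.ext ?_
  filter_upwards [h2, Lp.coeFn_zero ℝ 2 leb] with x h3 h4
  rw [h3, h4]; rfl

/-- A square integrable primitive with a zero is controlled by interpolation. -/
theorem norm_sq_le_of_zero (c : ℝ) (F : L2) (x₀ : unitInterval)
    (h0 : (cst c + prim F) x₀ = 0) :
    ‖cst c + prim F‖ ^ 2 ≤ 4 * (‖emb (cst c + prim F)‖ * ‖F‖) := by
  set A := cst c + prim F with hA
  have h := mul_prim c c F F
  rw [← hA, ← two_smul ℝ, map_smul] at h
  -- This is A² = c² + 2∫AA'. Comparing it at x and at the zero x₀ removes c and bounds A(x)² by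
  -- 4‖A‖‖A'‖.
  have key : ∀ x, A x ^ 2 = c * c + 2 * primMul (emb A) F x := by
    intro x
    have := congrArg (fun a : CI => a x) h
    simp only [ContinuousMap.mul_apply, ContinuousMap.add_apply, cst_apply,
      ContinuousMap.smul_apply, smul_eq_mul, ← primMul_emb_left] at this
    rw [pow_two, this]
  have hb : ∀ x, |primMul (emb A) F x| ≤ ‖emb A‖ * ‖F‖ := fun x =>
    ((primMul (emb A) F).norm_coe_le_norm x).trans (norm_primMul_le _ _)
  have hx0 := key x₀
  rw [h0] at hx0
  have h1 : ‖A‖ ≤ Real.sqrt (4 * (‖emb A‖ * ‖F‖)) := by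
    rw [ContinuousMap.norm_le _ (Real.sqrt_nonneg _)]
    intro x
    refine Real.abs_le_sqrt ?_
    have := key x
    have h2 := abs_le.1 (hb x)
    have h3 := abs_le.1 (hb x₀)
    linarith
  calc ‖A‖ ^ 2 ≤ Real.sqrt (4 * (‖emb A‖ * ‖F‖)) ^ 2 := by gcongr
    _ = _ := Real.sq_sqrt (by positivity)

/-- Rolle's theorem for the primitive of A, which vanishes at both ends. -/
theorem exists_zero_of_mean_zero (A : CI) (hA : prim (emb A) 1 = 0) : ∃ x₀, A x₀ = 0 := by
  obtain ⟨c, hc, h⟩ := exists_hasDerivAt_eq_zero (f := ex (prim (emb A))) (f' := ex A)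
    zero_lt_one (by fun_prop) (by
      rw [ex_of_mem _ (by simp : (0 : ℝ) ∈ Icc (0 : ℝ) 1),
        ex_of_mem _ (by simp : (1 : ℝ) ∈ Icc (0 : ℝ) 1)]
      exact (prim_zero' _).trans hA.symm) (fun x hx => hasDerivAt_prim_emb A hx)
  exact ⟨⟨c, Ioo_subset_Icc_self hc⟩, (ex_of_mem A (Ioo_subset_Icc_self hc)).symm.trans h⟩

/-! ### Restrictions, shifts and difference quotients in x (`σ h` is 1 - h) -/

/-- The restriction of a function to `(0,y)`, extended by zero. -/
def indFun (y : unitInterval) (F : ℝ → ℝ) : ℝ → ℝ := (Ioo (0 : ℝ) y).indicator F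

theorem memLp_indFun (y : unitInterval) (F : L2) : MemLp (indFun y F) 2 leb :=
  (Lp.memLp F).indicator measurableSet_Ioo

theorem norm_indFun_le (y : unitInterval) (F : L2) : ‖(memLp_indFun y F).toLp‖ ≤ ‖F‖ := by
  refine Lp.norm_le_norm_of_ae_le ?_
  filter_upwards [(memLp_indFun y F).coeFn_toLp] with x h1
  rw [h1]
  exact norm_indicator_le_norm_self _ _

/-- Multiplication by the indicator function of `(0,y)`. -/
def ind (y : unitInterval) : L2 →L[ℝ] L2 :=
  LinearMap.mkContinuous
    { toFun := fun F => (memLp_indFun y F).toLp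
      map_add' := fun F G => by
        refine Lp.ext ?_
        filter_upwards [(memLp_indFun y (F + G)).coeFn_toLp, (memLp_indFun y F).coeFn_toLp,
          (memLp_indFun y G).coeFn_toLp, Lp.coeFn_add F G,
          Lp.coeFn_add (memLp_indFun y F).toLp (memLp_indFun y G).toLp] with x h1 h2 h3 h4 h5
        rw [h1, h5, Pi.add_apply, h2, h3, indFun, indFun, indFun]
        by_cases hx : x ∈ Ioo (0 : ℝ) y
        · simp only [indicator_of_mem hx]
          exact h4
        · simp only [indicator_of_notMem hx, add_zero]
      map_smul' := fun c F => by
        refine Lp.ext ?_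
        filter_upwards [(memLp_indFun y (c • F)).coeFn_toLp, (memLp_indFun y F).coeFn_toLp,
          Lp.coeFn_smul c F, Lp.coeFn_smul c (memLp_indFun y F).toLp] with x h1 h2 h4 h5
        rw [h1, RingHom.id_apply, h5, Pi.smul_apply, h2, indFun, indFun]
        by_cases hx : x ∈ Ioo (0 : ℝ) y
        · simp only [indicator_of_mem hx]
          exact h4
        · simp only [indicator_of_notMem hx, smul_zero] } 1
    (fun F => by
      change ‖(memLp_indFun y F).toLp‖ ≤ _
      rw [one_mul]
      exact norm_indFun_le y F)

theorem coeFn_ind (y : unitInterval) (F : L2) :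
    ⇑(ind y F) =ᵐ[leb] (Ioo (0 : ℝ) y).indicator F :=
  (memLp_indFun y F).coeFn_toLp

theorem norm_ind_le (y : unitInterval) (F : L2) : ‖ind y F‖ ≤ ‖F‖ := by
  refine Lp.norm_le_norm_of_ae_le ?_
  filter_upwards [coeFn_ind y F] with x h1
  rw [h1]
  exact norm_indicator_le_norm_self _ _

theorem ind_csmul (y : unitInterval) (a : CI) (F : L2) : ind y (a • F) = a • ind y F := by
  refine Lp.ext ?_
  filter_upwards [coeFn_ind y (a • F), coeFn_csmul a F, coeFn_csmul a (ind y F), coeFn_ind y F]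
    with x h1 h2 h3 h4
  rw [h1, h3, h4]
  by_cases hx : x ∈ Ioo (0 : ℝ) y <;> simp [hx, h2]

theorem ind_ind (y : unitInterval) (F : L2) : ind y (ind y F) = ind y F := by
  refine Lp.ext ?_
  filter_upwards [coeFn_ind y (ind y F), coeFn_ind y F] with x h1 h2
  rw [h1, h2]
  by_cases hx : x ∈ Ioo (0 : ℝ) y <;> simp [hx, h2]

theorem inner_ind (y : unitInterval) (F G : L2) : inner ℝ (ind y F) G = primMul F G y := by
  rw [inner_eq, primMul_apply, intervalIntegral.integral_of_le y.2.1,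
    ← restrict_Ioo_eq_restrict_Ioc]
  have h1 : (fun x => ind y F x * G x) =ᵐ[leb] (Ioo (0 : ℝ) y).indicator (fun x => F x * G x) := by
    filter_upwards [coeFn_ind y F] with x h
    rw [h]
    by_cases hx : x ∈ Ioo (0 : ℝ) y <;> simp [hx]
  rw [integral_congr_ae h1, setIntegral_indicator measurableSet_Ioo,
    inter_eq_right.2 (Ioo_subset_Ioo_right y.2.2)]

theorem inner_ind_comm (y : unitInterval) (F G : L2) :
    inner ℝ (ind y F) G = inner ℝ F (ind y G) := by
  rw [inner_ind, real_inner_comm, inner_ind, primMul_comm]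

theorem measurePreserving_shift (h : unitInterval) :
    MeasurePreserving (fun x : ℝ => x + h) (volume.restrict (Ioo (0 : ℝ) (σ h)))
      (volume.restrict (Ioo (h : ℝ) 1)) := by
  have := (measurePreserving_add_right volume (h : ℝ)).restrict_preimage
    (measurableSet_Ioo (a := (h : ℝ)) (b := 1))
  simpa using this

theorem ae_shift (h : unitInterval) {p : ℝ → Prop} (hp : ∀ᵐ x ∂leb, p x) :
    ∀ᵐ x ∂leb, x ∈ Ioo (0 : ℝ) (σ h) → p (x + h) := by
  have h1 : ∀ᵐ x ∂(volume.restrict (Ioo (h : ℝ) 1)), p x :=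
    ae_mono (Measure.restrict_mono (Ioo_subset_Ioo_left h.2.1) le_rfl) hp
  have h2 := (measurePreserving_shift h).quasiMeasurePreserving.ae h1
  rw [ae_restrict_iff' measurableSet_Ioo] at h2
  exact ae_restrict_of_ae h2

/-- The function `x ↦ F (x + h)` on `(0,1-h)`, extended by zero. -/
def shfFun (h : unitInterval) (F : ℝ → ℝ) : ℝ → ℝ :=
  (Ioo (0 : ℝ) (σ h)).indicator fun x => F (x + h)

theorem leb_restrict (y : unitInterval) :
    leb.restrict (Ioo (0 : ℝ) y) = volume.restrict (Ioo (0 : ℝ) y) := by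
  rw [leb, Measure.restrict_restrict measurableSet_Ioo,
    inter_eq_left.2 (Ioo_subset_Ioo_right y.2.2)]

theorem eLpNorm_shfFun_le (h : unitInterval) (F : L2) :
    eLpNorm (shfFun h F) 2 leb ≤ eLpNorm F 2 leb := by
  have hF : AEStronglyMeasurable F (volume.restrict (Ioo (h : ℝ) 1)) :=
    (Lp.aestronglyMeasurable F).mono_measure
      (Measure.restrict_mono (Ioo_subset_Ioo_left h.2.1) le_rfl)
  rw [shfFun, eLpNorm_indicator_eq_eLpNorm_restrict measurableSet_Ioo, leb_restrict]
  have := eLpNorm_comp_measurePreserving (p := 2) hF (measurePreserving_shift h)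
  refine (le_of_eq this).trans ?_
  exact eLpNorm_mono_measure _ (Measure.restrict_mono (Ioo_subset_Ioo_left h.2.1) le_rfl)

theorem memLp_shfFun (h : unitInterval) (F : L2) : MemLp (shfFun h F) 2 leb := by
  refine ⟨?_, (eLpNorm_shfFun_le h F).trans_lt (Lp.memLp F).2⟩
  have hF : AEStronglyMeasurable F (volume.restrict (Ioo (h : ℝ) 1)) :=
    (Lp.aestronglyMeasurable F).mono_measure
      (Measure.restrict_mono (Ioo_subset_Ioo_left h.2.1) le_rfl)
  rw [shfFun, aestronglyMeasurable_indicator_iff measurableSet_Ioo, leb_restrict]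
  exact hF.comp_measurePreserving (measurePreserving_shift h)

/-- The shift by `h` on `(0,1-h)`, extended by zero. -/
def shf (h : unitInterval) : L2 →L[ℝ] L2 :=
  LinearMap.mkContinuous
    { toFun := fun F => (memLp_shfFun h F).toLp
      map_add' := fun F G => by
        refine Lp.ext ?_
        filter_upwards [(memLp_shfFun h (F + G)).coeFn_toLp, (memLp_shfFun h F).coeFn_toLp,
          (memLp_shfFun h G).coeFn_toLp, ae_shift h (Lp.coeFn_add F G),
          Lp.coeFn_add (memLp_shfFun h F).toLp (memLp_shfFun h G).toLp] with x h1 h2 h3 h4 h5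
        rw [h1, h5, Pi.add_apply, h2, h3, shfFun, shfFun, shfFun]
        by_cases hx : x ∈ Ioo (0 : ℝ) (σ h)
        · have := h4 hx
          simp only [indicator_of_mem hx]
          exact this
        · simp only [indicator_of_notMem hx, add_zero]
      map_smul' := fun c F => by
        refine Lp.ext ?_
        filter_upwards [(memLp_shfFun h (c • F)).coeFn_toLp, (memLp_shfFun h F).coeFn_toLp,
          ae_shift h (Lp.coeFn_smul c F),
          Lp.coeFn_smul c (memLp_shfFun h F).toLp] with x h1 h2 h4 h5
        rw [h1, RingHom.id_apply, h5, Pi.smul_apply, h2, shfFun, shfFun]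
        by_cases hx : x ∈ Ioo (0 : ℝ) (σ h)
        · have := h4 hx
          simp only [indicator_of_mem hx]
          exact this
        · simp only [indicator_of_notMem hx, smul_zero] } 1
    (fun F => by
      change ‖(memLp_shfFun h F).toLp‖ ≤ _
      rw [one_mul, Lp.norm_toLp, Lp.norm_def]
      exact ENNReal.toReal_mono (Lp.memLp F).2.ne (eLpNorm_shfFun_le h F))

theorem coeFn_shf (h : unitInterval) (F : L2) : ⇑(shf h F) =ᵐ[leb] shfFun h F :=
  (memLp_shfFun h F).coeFn_toLp

theorem norm_shf_le (h : unitInterval) (F : L2) : ‖shf h F‖ ≤ ‖F‖ := by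
  change ‖(memLp_shfFun h F).toLp‖ ≤ _
  rw [Lp.norm_toLp, Lp.norm_def]
  exact ENNReal.toReal_mono (Lp.memLp F).2.ne (eLpNorm_shfFun_le h F)

/-- The shift by `h` on continuous functions, with the constant extension. -/
def shC (h : unitInterval) (a : CI) : CI := ⟨fun x => ex a (x + h), by fun_prop⟩

@[simp] theorem shC_apply (h : unitInterval) (a : CI) (x : unitInterval) :
    shC h a x = ex a (x + h) := rfl

theorem ex_shC (h : unitInterval) (a : CI) {x : ℝ} (hx : x ∈ Icc (0 : ℝ) 1) :
    ex (shC h a) x = ex a (x + h) := by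
  rw [ex_of_mem _ hx]; rfl

theorem shC_emb (h : unitInterval) (a : CI) : ind (σ h) (emb (shC h a)) = shf h (emb a) := by
  refine Lp.ext ?_
  filter_upwards [coeFn_ind (σ h) (emb (shC h a)), coeFn_emb (shC h a), coeFn_shf h (emb a),
    ae_shift h (coeFn_emb a), ae_restrict_mem measurableSet_Ioo] with x h1 h2 h3 h4 h5
  rw [h1, h3, shfFun]
  by_cases hx : x ∈ Ioo (0 : ℝ) (σ h)
  · simp only [indicator_of_mem hx]
    rw [h2, h4 hx, ex_shC h a (Ioo_subset_Icc_self h5)]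
  · simp only [indicator_of_notMem hx]

theorem shf_csmul (h : unitInterval) (a : CI) (F : L2) : shf h (a • F) = shC h a • shf h F := by
  refine Lp.ext ?_
  filter_upwards [coeFn_shf h (a • F), coeFn_csmul (shC h a) (shf h F), coeFn_shf h F,
    ae_shift h (coeFn_csmul a F), ae_restrict_mem measurableSet_Ioo] with x h1 h2 h3 h4 h5
  rw [h1, h2, h3, shfFun, shfFun]
  by_cases hx : x ∈ Ioo (0 : ℝ) (σ h)
  · simp only [indicator_of_mem hx]
    rw [h4 hx, ex_shC h a (Ioo_subset_Icc_self h5)]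
  · simp only [indicator_of_notMem hx, mul_zero]

/-- The difference quotient in space on `(0,1-h)`, extended by zero. -/
def dq (h : unitInterval) : L2 →L[ℝ] L2 := (h : ℝ)⁻¹ • (shf h - ind (σ h))

theorem dq_apply (h : unitInterval) (F : L2) :
    dq h F = (h : ℝ)⁻¹ • (shf h F - ind (σ h) F) := rfl

/-- The difference quotient in space of a continuous function. -/
def dqC (h : unitInterval) (a : CI) : CI := (h : ℝ)⁻¹ • (shC h a - a)

theorem dq_emb (h : unitInterval) (a : CI) : dq h (emb a) = ind (σ h) (emb (dqC h a)) := by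
  rw [dq_apply, ← shC_emb, dqC, map_smul, map_smul, map_sub, map_sub]

theorem shC_one (h : unitInterval) : shC h 1 = 1 := rfl

theorem one2_eq : one2 = emb 1 := by rw [emb_apply, one_smul]

theorem dq_one2 (h : unitInterval) : dq h one2 = 0 := by
  rw [one2_eq, dq_emb, dqC, shC_one]; simp

theorem dq_meanFree (h : unitInterval) (F : L2) : dq h (meanFree F) = dq h F := by
  rw [meanFree_apply, map_sub, map_smul, dq_one2]; simp

theorem dq_csmul (h : unitInterval) (a : CI) (F : L2) :
    dq h (a • F) = a • dq h F + dqC h a • shf h F := by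
  rw [dq_apply, dq_apply, shf_csmul, ind_csmul, dqC]
  simp only [smul_assoc, sub_smul, smul_sub, smul_comm a ((h : ℝ)⁻¹)]
  abel

/-- Extending a primitive by its final value past x = 1 amounts to extending its derivative by zero.
So the conventions of `shC` and `shf` match, and the identity also holds where x + h > 1. -/
theorem shC_prim (h : unitInterval) (F : L2) :
    shC h (prim F) = cst (prim F h) + prim (shf h F) := by
  ext x
  rw [shC_apply, ContinuousMap.add_apply, cst_apply]
  have key : ∀ y ∈ Icc (0 : ℝ) (σ h), ∫ z in (0 : ℝ)..y, shf h F z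
      = ∫ z in (h : ℝ)..(y + h), F z := by
    intro y hy
    have hy1 : y ∈ Icc (0 : ℝ) 1 := ⟨hy.1, hy.2.trans (σ h).2.2⟩
    have e1 : ∫ z in (0 : ℝ)..y, shf h F z = ∫ z in (0 : ℝ)..y, F (z + h) := by
      rw [primMul_congr (coeFn_shf h F) hy1, intervalIntegral.integral_of_le hy.1,
        intervalIntegral.integral_of_le hy.1, ← restrict_Ioo_eq_restrict_Ioc]
      refine setIntegral_congr_fun measurableSet_Ioo fun z hz => ?_
      have hz' : z ∈ Ioo (0 : ℝ) (σ h) := ⟨hz.1, hz.2.trans_le hy.2⟩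
      simp only [shfFun, indicator_of_mem hz']
    rw [e1, intervalIntegral.integral_comp_add_right, zero_add]
  have hint : ∀ y ∈ Icc (0 : ℝ) 1, ∀ z ∈ Icc (0 : ℝ) 1, IntervalIntegrable F volume y z :=
    fun y hy z hz => intervalIntegrable_of_leb (integrable_coe F) hy hz
  by_cases hx : (x : ℝ) + h ≤ 1
  · have hx' : (x : ℝ) + h ∈ Icc (0 : ℝ) 1 := ⟨add_nonneg x.2.1 h.2.1, hx⟩
    rw [ex_of_mem _ hx', prim_apply, prim_apply, prim_apply, key x ⟨x.2.1, by
      rw [coe_symm_eq]; linarith⟩]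
    exact (intervalIntegral.integral_add_adjacent_intervals (hint _ (by simp) _ h.2)
      (hint _ h.2 _ hx')).symm
  · push Not at hx
    have e0 : ex (prim F) (x + h) = prim F 1 := by
      exact IccExtend_of_right_le _ _ hx.le
    have e1 : ∫ z in (0 : ℝ)..x, shf h F z = ∫ z in (0 : ℝ)..(σ h), shf h F z := by
      have hsx : ((σ h : unitInterval) : ℝ) ≤ x := by rw [coe_symm_eq]; linarith
      have hi : ∀ y ∈ Icc (0 : ℝ) 1, ∀ z ∈ Icc (0 : ℝ) 1,
          IntervalIntegrable (shf h F) volume y z :=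
        fun y hy z hz => intervalIntegrable_of_leb (integrable_coe _) hy hz
      rw [← intervalIntegral.integral_add_adjacent_intervals (hi 0 (by simp) (σ h) (σ h).2)
        (hi (σ h) (σ h).2 x x.2), add_eq_left, intervalIntegral.integral_of_le hsx,
        ← restrict_Ioo_eq_restrict_Ioc]
      have : shf h F =ᵐ[volume.restrict (Ioo ((σ h : unitInterval) : ℝ) x)] fun _ => 0 := by
        filter_upwards [ae_mono (Measure.restrict_mono (Ioo_subset_Ioo (σ h).2.1 x.2.2) le_rfl)
          (coeFn_shf h F), ae_restrict_mem measurableSet_Ioo] with z h1 h2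
        rw [h1, shfFun, indicator_of_notMem]
        exact fun h3 => absurd h3.2 (not_lt.2 h2.1.le)
      rw [integral_congr_ae this]; simp
    rw [e0, prim_apply, prim_apply, prim_apply, e1, key _ ⟨(σ h).2.1, le_rfl⟩, coe_symm_eq,
      sub_add_cancel]
    exact (intervalIntegral.integral_add_adjacent_intervals (hint _ (by simp) _ h.2)
      (hint _ h.2 _ (by simp))).symm

theorem dqC_prim (h : unitInterval) (F : L2) :
    dqC h (prim F) = cst ((h : ℝ)⁻¹ * prim F h) + prim ((h : ℝ)⁻¹ • (shf h F - F)) := by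
  rw [dqC, shC_prim, map_smul, map_sub]
  ext x
  simp only [ContinuousMap.smul_apply, ContinuousMap.sub_apply, ContinuousMap.add_apply,
    cst_apply, smul_eq_mul]
  ring

theorem ex_prim_sub (F G : L2) {x y : ℝ} (hx : x ∈ Icc (0 : ℝ) 1) (hy : y ∈ Icc (0 : ℝ) 1) :
    ex (primMul F G) y - ex (primMul F G) x = ∫ z in x..y, F z * G z := by
  rw [ex_of_mem _ hx, ex_of_mem _ hy, primMul_apply, primMul_apply]
  exact intervalIntegral.integral_interval_sub_left
    (intervalIntegrable_of_leb (integrable_mul F G) (by simp) hy)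
    (intervalIntegrable_of_leb (integrable_mul F G) (by simp) hx)

theorem primMul_self_mono (F : L2) {x y : ℝ} (hx : x ∈ Icc (0 : ℝ) 1) (hy : y ∈ Icc (0 : ℝ) 1)
    (hxy : x ≤ y) : ex (primMul F F) x ≤ ex (primMul F F) y := by
  rw [← sub_nonneg, ex_prim_sub F F hx hy]
  exact intervalIntegral.integral_nonneg hxy fun z _ => mul_self_nonneg _

theorem norm_sq_eq_primMul (F : L2) : ‖F‖ ^ 2 = primMul F F 1 := by
  rw [primMul_one, real_inner_self_eq_norm_sq]

theorem prim_one2 (x : unitInterval) : prim one2 x = x := by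
  rw [prim_apply, primMul_congr coeFn_one2 x.2]; simp

/-- Jensen's inequality on [x, x+h]: with c the mean of F there, the integral of (F - c)² is
nonnegative. -/
theorem sq_prim_sub_le (F : L2) {x h : ℝ} (hh : 0 < h) (hx : x ∈ Icc (0 : ℝ) 1)
    (hy : x + h ∈ Icc (0 : ℝ) 1) :
    (h⁻¹ * (ex (prim F) (x + h) - ex (prim F) x)) ^ 2 ≤
      h⁻¹ * (ex (primMul F F) (x + h) - ex (primMul F F) x) := by
  set c := h⁻¹ * (ex (prim F) (x + h) - ex (prim F) x) with hc
  have h1 := primMul_self_mono (F - c • one2) hx hy (by linarith)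
  have e : primMul (F - c • one2) (F - c • one2) =
      primMul F F - (2 * c) • prim F + (c * c) • prim one2 := by
    have := primMul_comm F one2
    simp only [map_sub, map_smul, sub_apply, smul_apply,
      this]
    simp only [prim]
    module
  rw [e] at h1
  simp only [ex_add, ex_sub, ex_smul] at h1
  have e1 : ex (prim one2) x = x := by rw [ex_of_mem _ hx, prim_one2]
  have e2 : ex (prim one2) (x + h) = x + h := by rw [ex_of_mem _ hy, prim_one2]
  rw [e1, e2] at h1
  have hd : ex (prim F) (x + h) - ex (prim F) x = h * c := by rw [hc]; field_simp
  have h2 : h * c ^ 2 ≤ ex (primMul F F) (x + h) - ex (primMul F F) x := by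
    have := congrArg (fun z => 2 * c * z) hd
    beta_reduce at this
    nlinarith
  calc c ^ 2 = h⁻¹ * (h * c ^ 2) := by field_simp
    _ ≤ _ := by gcongr

/-- Jensen's inequality is integrated over (0, 1-h). With A(x) = ∫₀ˣ F², the integral of A(x+h) -
A(x) telescopes to two end pieces; the one at 0 is dropped and the one at 1 is at most h‖F‖². The
constant 1, uniform in h, is what permits passing to the limit on compact sets. -/
theorem norm_dq_emb_prim_le {h : unitInterval} (hh : 0 < (h : ℝ)) (F : L2) :
    ‖dq h (emb (prim F))‖ ≤ ‖F‖ := by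
  set A : ℝ → ℝ := ex (primMul F F) with hA
  have hAc : Continuous A := continuous_ex _
  have hsub : ((σ h : unitInterval) : ℝ) = 1 - h := coe_symm_eq h
  have h1 : ‖dq h (emb (prim F))‖ ^ 2 ≤ ∫ x in Ioo (0 : ℝ) (σ h), (h : ℝ)⁻¹ * (A (x + h) - A x) := by
    rw [← real_inner_self_eq_norm_sq, dq_emb, inner_ind_comm, ind_ind, inner_eq]
    have e : (fun x => emb (dqC h (prim F)) x * ind (σ h) (emb (dqC h (prim F))) x) =ᵐ[leb]
        (Ioo (0 : ℝ) (σ h)).indicator fun x => ex (dqC h (prim F)) x ^ 2 := by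
      filter_upwards [coeFn_emb (dqC h (prim F)), coeFn_ind (σ h) (emb (dqC h (prim F)))]
        with x h1 h2
      rw [h2]
      by_cases hx : x ∈ Ioo (0 : ℝ) (σ h)
      · simp only [indicator_of_mem hx, h1]; ring
      · simp only [indicator_of_notMem hx, mul_zero]
    rw [integral_congr_ae e, setIntegral_indicator measurableSet_Ioo,
      inter_eq_right.2 (Ioo_subset_Ioo_right (σ h).2.2)]
    refine setIntegral_mono_on ?_ ?_ measurableSet_Ioo ?_
    · exact (((continuous_ex _).pow 2).integrableOn_Icc).mono_set Ioo_subset_Icc_self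
    · exact ((by fun_prop : Continuous fun x => (h : ℝ)⁻¹ * (A (x + h) - A x)).integrableOn_Icc).mono_set
        Ioo_subset_Icc_self
    · intro x hx
      have hx1 : x ∈ Icc (0 : ℝ) 1 := ⟨hx.1.le, hx.2.le.trans (σ h).2.2⟩
      have hx2 : x + h ∈ Icc (0 : ℝ) 1 :=
        ⟨add_nonneg hx.1.le h.2.1, by have := hx.2; rw [hsub] at this; linarith⟩
      rw [dqC, ex_smul, ex_sub, ex_shC h _ hx1]
      exact sq_prim_sub_le F hh hx1 hx2
  have h2 : ∫ x in Ioo (0 : ℝ) (σ h), (h : ℝ)⁻¹ * (A (x + h) - A x) ≤ ‖F‖ ^ 2 := by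
    have hi : ∀ a b : ℝ, IntervalIntegrable A volume a b := fun a b => hAc.intervalIntegrable a b
    rw [restrict_Ioo_eq_restrict_Ioc, ← intervalIntegral.integral_of_le (σ h).2.1,
      intervalIntegral.integral_const_mul, intervalIntegral.integral_sub
        ((by fun_prop : Continuous fun x => A (x + h)).intervalIntegrable _ _) (hi _ _),
      intervalIntegral.integral_comp_add_right, zero_add, hsub, sub_add_cancel]
    have e1 : (∫ x in (h : ℝ)..1, A x) - ∫ x in (0 : ℝ)..(1 - h), A x
        = (∫ x in (1 - h : ℝ)..1, A x) - ∫ x in (0 : ℝ)..h, A x := by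
      have := intervalIntegral.integral_add_adjacent_intervals (hi 0 h) (hi h 1)
      have := intervalIntegral.integral_add_adjacent_intervals (hi 0 (1 - h)) (hi (1 - h) 1)
      linarith
    have e2 : ∫ x in (1 - h : ℝ)..1, A x ≤ ∫ x in (1 - h : ℝ)..1, ‖F‖ ^ 2 := by
      refine intervalIntegral.integral_mono_on (by linarith) (hi _ _) (by simp) fun x hx => ?_
      have hx0 : x ∈ Icc (0 : ℝ) 1 := ⟨by linarith [hx.1, h.2.2], hx.2⟩
      refine (primMul_self_mono F hx0 (by simp : (1 : ℝ) ∈ Icc (0 : ℝ) 1) hx.2).trans ?_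
      rw [norm_sq_eq_primMul, ex_of_mem _ (by simp : (1 : ℝ) ∈ Icc (0 : ℝ) 1)]
      exact le_rfl
    have e3 : 0 ≤ ∫ x in (0 : ℝ)..h, A x := by
      refine intervalIntegral.integral_nonneg h.2.1 fun x hx => ?_
      have hx0 : x ∈ Icc (0 : ℝ) 1 := ⟨hx.1, hx.2.trans h.2.2⟩
      have := primMul_self_mono F (by simp : (0 : ℝ) ∈ Icc (0 : ℝ) 1) hx0 hx.1
      rw [ex_of_mem _ (by simp : (0 : ℝ) ∈ Icc (0 : ℝ) 1)] at this
      exact (primMul_zero' F F).symm.le.trans this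
    rw [e1]
    simp only [intervalIntegral.integral_const, smul_eq_mul, sub_sub_cancel] at e2
    calc (h : ℝ)⁻¹ * ((∫ x in (1 - h : ℝ)..1, A x) - ∫ x in (0 : ℝ)..h, A x)
        ≤ (h : ℝ)⁻¹ * (h * ‖F‖ ^ 2) := by gcongr; linarith
      _ = ‖F‖ ^ 2 := by field_simp
  exact (sq_le_sq₀ (norm_nonneg _) (norm_nonneg _)).1 (h1.trans h2)

/-! ### Limits of difference quotients as the step tends to zero -/

theorem continuous_shC (a : CI) : Continuous fun h : unitInterval => shC h a :=
  (ContinuousMap.curry ⟨fun p : unitInterval × unitInterval => ex a (p.2 + p.1), by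
    fun_prop⟩).continuous

theorem shC_zero (a : CI) : shC 0 a = a := by
  ext x
  rw [shC_apply, ← ex_coe]; simp

theorem tendsto_shC (a : CI) : Tendsto (fun h : unitInterval => shC h a) (𝓝 0) (𝓝 a) := by
  have := (continuous_shC a).tendsto 0
  rwa [shC_zero] at this

theorem tendsto_ind (F : L2) : Tendsto (fun h : unitInterval => ind (σ h) F) (𝓝 0) (𝓝 F) := by
  rw [tendsto_iff_norm_sub_tendsto_zero]
  have h1 : ∀ h : unitInterval, ‖ind (σ h) F - F‖ = Real.sqrt (‖F‖ ^ 2 - primMul F F (σ h)) := by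
    intro h
    rw [← Real.sqrt_sq (norm_nonneg (ind (σ h) F - F))]
    congr 1
    have e : ‖ind (σ h) F‖ ^ 2 = primMul F F (σ h) := by
      rw [← real_inner_self_eq_norm_sq, inner_ind_comm, ind_ind, real_inner_comm, inner_ind]
    rw [norm_sub_sq_real, inner_ind, e]; ring
  simp_rw [h1]
  have h2 : Continuous fun h : unitInterval => Real.sqrt (‖F‖ ^ 2 - primMul F F (σ h)) := by
    fun_prop
  have := h2.tendsto 0
  rw [symm_zero, ← norm_sq_eq_primMul, sub_self, Real.sqrt_zero] at this
  exact this

/-- Uniformly bounded operators which converge strongly on a dense set converge strongly. -/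
theorem tendsto_of_dense {l : Filter unitInterval} (A : unitInterval → L2 →L[ℝ] L2) (C : ℝ)
    (hA : ∀ᶠ h in l, ∀ F, ‖A h F‖ ≤ C * ‖F‖)
    (hd : ∀ a : CI, Tendsto (fun h => A h (emb a)) l (𝓝 0)) (F : L2) :
    Tendsto (fun h => A h F) l (𝓝 0) := by
  rw [Metric.tendsto_nhds]
  intro η hη
  obtain ⟨a, ha⟩ := dense_emb.exists_dist_lt F (show 0 < η / (2 * (|C| + 1)) by positivity)
  have h1 := (Metric.tendsto_nhds.1 (hd a)) (η / 2) (by positivity)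
  filter_upwards [hA, h1] with h h2 h3
  rw [dist_zero_right] at h3 ⊢
  have h4 : ‖A h (F - emb a)‖ ≤ (|C| + 1) * ‖F - emb a‖ := by
    refine (h2 _).trans ?_
    gcongr
    linarith [le_abs_self C]
  rw [dist_eq_norm, lt_div_iff₀ (by positivity)] at ha
  have h5 : A h F = A h (F - emb a) + A h (emb a) := by rw [← map_add, sub_add_cancel]
  rw [h5]
  refine (norm_add_le _ _).trans_lt ?_
  linarith

/-- Strong convergence of uniformly bounded operators is uniform on compact sets. -/
theorem eventually_forall_compact {l : Filter unitInterval} (A : unitInterval → L2 →L[ℝ] L2)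
    (C : ℝ) (hA : ∀ᶠ h in l, ∀ F, ‖A h F‖ ≤ C * ‖F‖)
    (hd : ∀ F, Tendsto (fun h => A h F) l (𝓝 0)) {K : Set L2} (hK : IsCompact K) {η : ℝ}
    (hη : 0 < η) : ∀ᶠ h in l, ∀ F ∈ K, ‖A h F‖ ≤ η := by
  obtain ⟨t, htf, ht⟩ := Metric.totallyBounded_iff.1 hK.totallyBounded (η / (2 * (|C| + 1)))
    (by positivity)
  have h1 : ∀ᶠ h in l, ∀ G ∈ t, ‖A h G‖ < η / 2 := by
    rw [eventually_all_finite htf]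
    intro G _
    simpa using (Metric.tendsto_nhds.1 (hd G)) (η / 2) (by positivity)
  filter_upwards [hA, h1] with h h2 h3 F hF
  obtain ⟨G, hG, hFG⟩ := mem_iUnion₂.1 (ht hF)
  rw [Metric.mem_ball, dist_eq_norm, lt_div_iff₀ (by positivity)] at hFG
  have h4 : ‖A h (F - G)‖ ≤ (|C| + 1) * ‖F - G‖ := by
    refine (h2 _).trans ?_
    gcongr
    linarith [le_abs_self C]
  have h5 : A h F = A h (F - G) + A h G := by rw [← map_add, sub_add_cancel]
  rw [h5]
  refine (norm_add_le _ _).trans ?_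
  have := h3 G hG
  linarith

theorem norm_shf_sub_ind_le (h : unitInterval) (F : L2) : ‖(shf h - ind (σ h)) F‖ ≤ 2 * ‖F‖ := by
  rw [sub_apply]
  refine (norm_sub_le _ _).trans ?_
  have := norm_shf_le h F
  have := norm_ind_le (σ h) F
  linarith

theorem tendsto_shf_sub_ind (F : L2) :
    Tendsto (fun h => (shf h - ind (σ h)) F) (𝓝 0) (𝓝 0) := by
  refine tendsto_of_dense _ 2 (Eventually.of_forall fun h F => norm_shf_sub_ind_le h F) ?_ F
  intro a
  have h1 : Tendsto (fun h : unitInterval => ‖shC h a - a‖) (𝓝 0) (𝓝 0) :=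
    tendsto_iff_norm_sub_tendsto_zero.1 (tendsto_shC a)
  refine squeeze_zero_norm (fun h => ?_) h1
  rw [sub_apply, ← shC_emb, ← map_sub, ← map_sub]
  exact (norm_ind_le _ _).trans (norm_emb_le _)

theorem mem_Icc_of_mem_shift {h : unitInterval} {x : ℝ} (hx : x ∈ Ioo (0 : ℝ) (σ h)) :
    x ∈ Icc (0 : ℝ) 1 ∧ x + h ∈ Icc (0 : ℝ) 1 := by
  refine ⟨⟨hx.1.le, hx.2.le.trans (σ h).2.2⟩, add_nonneg hx.1.le h.2.1, ?_⟩
  have := hx.2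
  rw [coe_symm_eq] at this
  linarith

theorem ex_dqC {h : unitInterval} (a : CI) {x : ℝ} (hx : x ∈ Ioo (0 : ℝ) (σ h)) :
    ex (dqC h a) x = (h : ℝ)⁻¹ * (ex a (x + h) - ex a x) := by
  rw [dqC, ex_smul, ex_sub, ex_shC h _ (mem_Icc_of_mem_shift hx).1]

theorem ex_prim_sub_ex_prim (F : L2) {x y : ℝ} (hx : x ∈ Icc (0 : ℝ) 1) (hy : y ∈ Icc (0 : ℝ) 1) :
    ex (prim F) y - ex (prim F) x = ∫ z in x..y, F z := by
  rw [ex_of_mem _ hx, ex_of_mem _ hy, prim_apply, prim_apply]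
  exact intervalIntegral.integral_interval_sub_left
    (intervalIntegrable_of_leb (integrable_coe F) (by simp) hy)
    (intervalIntegrable_of_leb (integrable_coe F) (by simp) hx)

theorem integral_congr_leb {f g : ℝ → ℝ} (h : f =ᵐ[leb] g) {x y : ℝ}
    (hx : x ∈ Icc (0 : ℝ) 1) (hy : y ∈ Icc (0 : ℝ) 1) :
    ∫ z in x..y, f z = ∫ z in x..y, g z := by
  refine intervalIntegral.integral_congr_ae ?_
  have : ∀ᵐ z ∂(volume.restrict (Ioc (0 : ℝ) 1)), f z = g z := by
    rw [← restrict_Ioo_eq_restrict_Ioc]; exact h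
  rw [ae_restrict_iff' measurableSet_Ioc] at this
  filter_upwards [this] with z hz hz'
  exact hz ⟨(le_min hx.1 hy.1).trans_lt hz'.1, hz'.2.trans (max_le hx.2 hy.2)⟩

theorem abs_dqC_prim_emb_sub_le {h : unitInterval} (hh : 0 < (h : ℝ)) (a : CI) {η : ℝ}
    (hη : ∀ z ≤ h, ‖shC z a - a‖ ≤ η) {x : ℝ} (hx : x ∈ Ioo (0 : ℝ) (σ h)) :
    |ex (dqC h (prim (emb a)) - a) x| ≤ η := by
  obtain ⟨hx1, hx2⟩ := mem_Icc_of_mem_shift hx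
  rw [ex_sub, ex_dqC _ hx, ex_prim_sub_ex_prim _ hx1 hx2, integral_congr_leb (coeFn_emb a) hx1 hx2]
  have e2 : (h : ℝ)⁻¹ * (∫ z in x..(x + h), ex a z) - ex a x
      = (h : ℝ)⁻¹ * ∫ z in x..(x + h), (ex a z - ex a x) := by
    rw [intervalIntegral.integral_sub ((continuous_ex a).intervalIntegrable _ _) (by simp)]
    simp only [intervalIntegral.integral_const, smul_eq_mul, add_sub_cancel_left]
    field_simp
  have e3 : ‖∫ z in x..(x + h), (ex a z - ex a x)‖ ≤ η * |x + h - x| := by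
    refine intervalIntegral.norm_integral_le_of_norm_le_const fun z hz => ?_
    rw [uIoc_of_le (by linarith [h.2.1])] at hz
    have hz1 : z - x ∈ Icc (0 : ℝ) 1 := ⟨by linarith [hz.1], by linarith [hz.2, h.2.2]⟩
    have := (abs_ex_le (shC ⟨z - x, hz1⟩ a - a) x).trans (hη ⟨z - x, hz1⟩ (by
      change z - x ≤ h
      linarith [hz.2]))
    rw [ex_sub, ex_shC _ _ hx1] at this
    simpa using this
  rw [e2, abs_mul, abs_inv, abs_of_pos hh, ← Real.norm_eq_abs (∫ z in x..(x + h), _)]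
  rw [add_sub_cancel_left, abs_of_pos hh] at e3
  calc (h : ℝ)⁻¹ * ‖∫ z in x..(x + h), (ex a z - ex a x)‖ ≤ (h : ℝ)⁻¹ * (η * h) := by gcongr
    _ = η := by field_simp

theorem norm_dq_sub_ind_emb_le {h : unitInterval} (hh : 0 < (h : ℝ)) (a : CI) {η : ℝ}
    (hη : ∀ z ≤ h, ‖shC z a - a‖ ≤ η) :
    ‖dq h (emb (prim (emb a))) - ind (σ h) (emb a)‖ ≤ η := by
  have hη0 : 0 ≤ η := (norm_nonneg _).trans (hη 0 h.2.1)
  have h1 : ‖dq h (emb (prim (emb a))) - ind (σ h) (emb a)‖ ≤ η * ‖one2‖ := by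
    refine Lp.norm_le_mul_norm_of_ae_le_mul ?_
    rw [dq_emb, ← map_sub, ← map_sub]
    filter_upwards [coeFn_ind (σ h) (emb (dqC h (prim (emb a)) - a)),
      coeFn_emb (dqC h (prim (emb a)) - a), coeFn_one2] with x h1 h2 h3
    rw [h1, h3, norm_one, mul_one]
    by_cases hx : x ∈ Ioo (0 : ℝ) (σ h)
    · rw [indicator_of_mem hx, h2]
      exact abs_dqC_prim_emb_sub_le hh a hη hx
    · rw [indicator_of_notMem hx, norm_zero]; exact hη0
  rwa [norm_one2, mul_one] at h1

/-- Positive steps tending to zero. -/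
abbrev zeroR : Filter unitInterval := 𝓝[≠] 0

theorem eventually_pos_zeroR : ∀ᶠ h : unitInterval in zeroR, 0 < (h : ℝ) := by
  filter_upwards [self_mem_nhdsWithin] with h hh
  exact lt_of_le_of_ne h.2.1 fun e => hh (Subtype.ext e.symm)

/-- `dq h ∘ emb ∘ prim - id`. -/
def dqErr (h : unitInterval) : L2 →L[ℝ] L2 :=
  (dq h).comp (emb.comp prim) - ContinuousLinearMap.id ℝ L2

theorem dqErr_apply (h : unitInterval) (F : L2) : dqErr h F = dq h (emb (prim F)) - F := rfl

theorem eventually_norm_dqErr_le : ∀ᶠ h in zeroR, ∀ F, ‖dqErr h F‖ ≤ 2 * ‖F‖ := by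
  filter_upwards [eventually_pos_zeroR] with h hh F
  rw [dqErr_apply]
  refine (norm_sub_le _ _).trans ?_
  have := norm_dq_emb_prim_le hh F
  linarith

/-- For continuous a the difference quotient of its primitive differs from a on (0, 1-h) by at most
the modulus of continuity of a, and the missing strip (1-h, 1) is handled by `tendsto_ind`. General
F follow by density and the uniform bound. -/
theorem tendsto_dqErr (F : L2) : Tendsto (fun h => dqErr h F) zeroR (𝓝 0) := by
  refine tendsto_of_dense _ 2 eventually_norm_dqErr_le ?_ F
  intro a
  have h1 : Tendsto (fun h => dq h (emb (prim (emb a))) - ind (σ h) (emb a)) zeroR (𝓝 0) := by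
    rw [Metric.tendsto_nhds]
    intro η hη
    have h2 := Metric.tendsto_nhds.1 (tendsto_shC a) (η / 2) (by positivity)
    obtain ⟨δ, hδ, h3⟩ := Metric.eventually_nhds_iff.1 h2
    have h4 : ∀ᶠ h : unitInterval in zeroR, dist h 0 < δ :=
      nhdsWithin_le_nhds (Metric.ball_mem_nhds _ hδ)
    filter_upwards [h4, eventually_pos_zeroR] with h h5 h6
    rw [dist_zero_right]
    refine lt_of_le_of_lt (norm_dq_sub_ind_emb_le h6 a (η := η / 2) fun z hz => ?_) (by linarith)
    rw [← dist_eq_norm]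
    refine (h3 (lt_of_le_of_lt ?_ h5)).le
    rw [Subtype.dist_eq, Subtype.dist_eq, Real.dist_eq, Real.dist_eq]
    simp only [Icc.coe_zero, sub_zero]
    rw [abs_of_nonneg z.2.1, abs_of_nonneg h.2.1]
    exact hz
  have h2 : Tendsto (fun h => ind (σ h) (emb a) - emb a) zeroR (𝓝 0) := by
    have := ((tendsto_ind (emb a)).sub_const (emb a)).mono_left
      (nhdsWithin_le_nhds (s := {0}ᶜ))
    rwa [sub_self] at this
  have := h1.add h2
  simpa [dqErr_apply] using this

theorem neBot_zeroR : NeBot zeroR := by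
  rw [← mem_closure_iff_nhdsWithin_neBot]
  have h1 : Tendsto (fun n : ℕ => (⟨1 / ((n : ℝ) + 1), by
      refine ⟨by positivity, ?_⟩
      rw [div_le_one (by positivity)]
      linarith [n.cast_nonneg (α := ℝ)]⟩ : unitInterval)) atTop (𝓝 0) := by
    rw [tendsto_subtype_rng]
    exact tendsto_one_div_add_atTop_nhds_zero_nat
  refine mem_closure_of_tendsto h1 (Eventually.of_forall fun n => ?_)
  intro h
  have h2 := congrArg Subtype.val h
  have h3 : (0 : ℝ) < 1 / ((n : ℝ) + 1) := by positivity
  exact h3.ne' h2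

/-! ### Splitting into a bounded part and a small L² part -/

/-- A square integrable function which is at distance at most `e` from a function bounded
by `Y`. -/
def SplitBound (F : L2) (Y e : ℝ) : Prop :=
  ∃ G : L2, (∀ᵐ x ∂leb, |G x| ≤ Y) ∧ ‖F - G‖ ≤ e

theorem SplitBound.nonneg_left {F : L2} {Y e : ℝ} (h : SplitBound F Y e) : 0 ≤ Y := by
  obtain ⟨G, hG, -⟩ := h
  have : NeBot (ae leb) := by
    rw [ae_neBot]
    intro h0
    have := congrArg (fun μ : Measure ℝ => μ univ) h0
    simp [leb] at this
  obtain ⟨x, hx⟩ := hG.exists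
  exact (abs_nonneg _).trans hx

theorem SplitBound.nonneg_right {F : L2} {Y e : ℝ} (h : SplitBound F Y e) : 0 ≤ e := by
  obtain ⟨G, -, hG⟩ := h
  exact (norm_nonneg _).trans hG

theorem norm_csmul_le_of_ae_bound {G : L2} {Y : ℝ} (hG : ∀ᵐ x ∂leb, |G x| ≤ Y) (y : unitInterval)
    (A : CI) : ‖ind y (A • G)‖ ≤ Y * ‖ind y (emb A)‖ := by
  refine Lp.norm_le_mul_norm_of_ae_le_mul ?_
  filter_upwards [hG, coeFn_ind y (A • G), coeFn_csmul A G, coeFn_ind y (emb A), coeFn_emb A]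
    with x h1 h2 h3 h4 h5
  rw [h2, h4]
  by_cases hx : x ∈ Ioo (0 : ℝ) y
  · rw [indicator_of_mem hx, indicator_of_mem hx, h3, h5, norm_mul, mul_comm]
    exact mul_le_mul_of_nonneg_right h1 (norm_nonneg _)
  · rw [indicator_of_notMem hx, indicator_of_notMem hx]; simp

/-- The bounded part is charged to the L² norm of A, the remainder only to its sup norm. For
difference quotients the sup norm is O(1/h), so a remainder of size e costs e/h. -/
theorem SplitBound.norm_ind_csmul_le {F : L2} {Y e : ℝ} (h : SplitBound F Y e) (y : unitInterval)
    (A : CI) : ‖ind y (A • F)‖ ≤ Y * ‖ind y (emb A)‖ + e * ‖A‖ := by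
  obtain ⟨G, hG, hFG⟩ := h
  have e1 : ind y (A • F) = ind y (A • G) + ind y (A • (F - G)) := by
    rw [← map_add, ← smul_add, add_sub_cancel]
  rw [e1]
  refine (norm_add_le _ _).trans (add_le_add (norm_csmul_le_of_ae_bound hG y A) ?_)
  refine (norm_ind_le _ _).trans ((norm_csmul_le _ _).trans ?_)
  rw [mul_comm]
  gcongr

theorem norm_ind_one2 (y : unitInterval) : ‖ind y one2‖ = Real.sqrt y := by
  rw [← Real.sqrt_sq (norm_nonneg (ind y one2))]
  congr 1
  rw [← real_inner_self_eq_norm_sq, inner_ind_comm, ind_ind, real_inner_comm, inner_ind]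
  exact prim_one2 y

theorem SplitBound.norm_ind_le {F : L2} {Y e : ℝ} (h : SplitBound F Y e) (y : unitInterval) :
    ‖ind y F‖ ≤ Y * Real.sqrt y + e := by
  have := h.norm_ind_csmul_le y 1
  rwa [one_smul, ← one2_eq, norm_ind_one2, norm_one, mul_one] at this

/-- The primitive of the bounded part is Y-Lipschitz, so its quotient is at most Y pointwise. The
quotient of the primitive of the remainder is at most 2e/h in sup norm. -/
theorem SplitBound.norm_dqC_prim_csmul_shf_le {F : L2} {Y e : ℝ} (hF : SplitBound F Y e)
    {h : unitInterval} (hh : 0 < (h : ℝ)) (N : L2) :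
    ‖dqC h (prim F) • shf h N‖ ≤ (Y + 2 * e / h) * ‖N‖ := by
  have hY := hF.nonneg_left
  obtain ⟨G, hG, hFG⟩ := hF
  have e1 : dqC h (prim F) • shf h N = dqC h (prim G) • shf h N + dqC h (prim (F - G)) • shf h N := by
    rw [← add_smul]
    congr 1
    simp only [dqC, ← smul_add]
    congr 1
    ext x
    simp
    ring
  have h1 : ‖dqC h (prim G) • shf h N‖ ≤ Y * ‖shf h N‖ := by
    refine Lp.norm_le_mul_norm_of_ae_le_mul ?_
    filter_upwards [coeFn_csmul (dqC h (prim G)) (shf h N), coeFn_shf h N] with x h1 h2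
    rw [h1, norm_mul]
    by_cases hx : x ∈ Ioo (0 : ℝ) (σ h)
    · refine mul_le_mul_of_nonneg_right ?_ (norm_nonneg _)
      obtain ⟨hx1, hx2⟩ := mem_Icc_of_mem_shift hx
      rw [ex_dqC _ hx, ex_prim_sub_ex_prim _ hx1 hx2, norm_mul, norm_inv, Real.norm_of_nonneg hh.le]
      have e3 : ‖∫ z in x..(x + h), G z‖ ≤ Y * |x + h - x| := by
        refine intervalIntegral.norm_integral_le_of_norm_le_const_ae ?_
        have : ∀ᵐ z ∂(volume.restrict (Ioc (0 : ℝ) 1)), |G z| ≤ Y := by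
          rw [← restrict_Ioo_eq_restrict_Ioc]; exact hG
        rw [ae_restrict_iff' measurableSet_Ioc] at this
        filter_upwards [this] with z hz hz'
        rw [uIoc_of_le (by linarith)] at hz'
        exact hz ⟨hx1.1.trans_lt hz'.1, hz'.2.trans hx2.2⟩
      rw [add_sub_cancel_left, abs_of_pos hh] at e3
      calc (h : ℝ)⁻¹ * ‖∫ z in x..(x + h), G z‖ ≤ (h : ℝ)⁻¹ * (Y * h) := by gcongr
        _ = Y := by field_simp
    · have : shf h N x = 0 := by rw [h2, shfFun, indicator_of_notMem hx]
      rw [this]; simp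
  have h2 : ‖dqC h (prim (F - G))‖ ≤ 2 * e / h := by
    rw [dqC, norm_smul, norm_inv, Real.norm_of_nonneg hh.le]
    have h3 : ‖shC h (prim (F - G)) - prim (F - G)‖ ≤ 2 * e := by
      rw [ContinuousMap.norm_le _ (by linarith [(norm_nonneg _).trans hFG])]
      intro x
      rw [ContinuousMap.sub_apply, shC_apply]
      refine (norm_sub_le _ _).trans ?_
      have h4 := (abs_ex_le (prim (F - G)) (x + h)).trans ((norm_prim_le _).trans hFG)
      have h5 := ((prim (F - G)).norm_coe_le_norm x).trans ((norm_prim_le _).trans hFG)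
      rw [Real.norm_eq_abs (ex _ _)]
      linarith
    rw [inv_mul_eq_div]
    gcongr
  rw [e1]
  refine (norm_add_le _ _).trans ?_
  rw [add_mul]
  refine add_le_add (h1.trans ?_) ((norm_csmul_le _ _).trans ?_)
  · gcongr; exact norm_shf_le _ _
  · exact mul_le_mul h2 (norm_shf_le _ _) (norm_nonneg _) ((norm_nonneg _).trans h2)

theorem norm_dqC_sub_csmul_shf_le {h : unitInterval} (hh : 0 < (h : ℝ)) (a : CI) {η : ℝ}
    (hη : ∀ z ≤ h, ‖shC z a - a‖ ≤ η) (N : L2) :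
    ‖(dqC h (prim (emb a)) - a) • shf h N‖ ≤ η * ‖N‖ := by
  have hη0 : 0 ≤ η := (norm_nonneg _).trans (hη 0 h.2.1)
  have h1 : ‖(dqC h (prim (emb a)) - a) • shf h N‖ ≤ η * ‖shf h N‖ := by
    refine Lp.norm_le_mul_norm_of_ae_le_mul ?_
    filter_upwards [coeFn_csmul (dqC h (prim (emb a)) - a) (shf h N), coeFn_shf h N] with x h1 h2
    rw [h1, norm_mul]
    by_cases hx : x ∈ Ioo (0 : ℝ) (σ h)
    · exact mul_le_mul_of_nonneg_right (abs_dqC_prim_emb_sub_le hh a hη hx) (norm_nonneg _)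
    · have : shf h N x = 0 := by rw [h2, shfFun, indicator_of_notMem hx]
      rw [this]; simp
  exact h1.trans (by gcongr; exact norm_shf_le _ _)

theorem ind_shf (h : unitInterval) (F : L2) : ind (σ h) (shf h F) = shf h F := by
  refine Lp.ext ?_
  filter_upwards [coeFn_ind (σ h) (shf h F), coeFn_shf h F] with x h1 h2
  rw [h1]
  by_cases hx : x ∈ Ioo (0 : ℝ) (σ h)
  · rw [indicator_of_mem hx]
  · rw [indicator_of_notMem hx, h2, shfFun, indicator_of_notMem hx]

theorem dq_eq_ind (h : unitInterval) (F : L2) :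
    dq h F = ind (σ h) ((h : ℝ)⁻¹ • (shf h F - F)) := by
  rw [map_smul, map_sub, ind_shf, dq_apply]

theorem ind_dq (h : unitInterval) (F : L2) : ind (σ h) (dq h F) = dq h F := by
  rw [dq_eq_ind, ind_ind]

theorem norm_dqC_prim_le {h : unitInterval} (hh : 0 < (h : ℝ)) (N : L2) :
    ‖dqC h (prim N)‖ ≤ 2 * ‖N‖ / h := by
  rw [dqC, norm_smul, norm_inv, Real.norm_of_nonneg hh.le, inv_mul_eq_div]
  gcongr
  rw [ContinuousMap.norm_le _ (by positivity)]
  intro x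
  rw [ContinuousMap.sub_apply, shC_apply]
  refine (norm_sub_le _ _).trans ?_
  have h4 := (abs_ex_le (prim N) (x + h)).trans (norm_prim_le _)
  have h5 := ((prim N).norm_coe_le_norm x).trans (norm_prim_le _)
  rw [Real.norm_eq_abs (ex _ _)]
  linarith

/-! ### Energy estimates in space for the effective flux -/

/-- Energy identity for the transport operator applied to a difference quotient. -/
theorem inner_transport (b₀ : ℝ) (β : L2) (h : unitInterval) (N : L2) :
    inner ℝ ((cst b₀ + prim β) • dq h (emb (prim N))) (dq h N) =
      1 / 2 * ((cst b₀ + prim β) (σ h) * dqC h (prim N) (σ h) ^ 2)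
      - 1 / 2 * (b₀ * ((h : ℝ)⁻¹ * prim N h) ^ 2)
      - 1 / 2 * inner ℝ (dq h (emb (prim N))) (dqC h (prim N) • β) := by
  set S := dqC h (prim N) with hS
  set s₀ := (h : ℝ)⁻¹ * prim N h
  set τ := (h : ℝ)⁻¹ • (shf h N - N) with hτ
  have hS' : S = cst s₀ + prim τ := dqC_prim h N
  set B := cst b₀ + prim β with hB
  -- With S the quotient and τ its derivative, S² and then BS² are written as primitives and
  -- evaluated at 1 - h: the integrated form of BSS_x = ½(BS²)_x - ½B_xS².
  have h1 := mul_prim s₀ s₀ τ τ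
  rw [← hS'] at h1
  have h2 := mul_prim b₀ (s₀ * s₀) β (S • τ + S • τ)
  rw [← h1, ← hB] at h2
  have h3 := congrArg (fun a : CI => a (σ h)) h2
  simp only [ContinuousMap.mul_apply, ContinuousMap.add_apply, cst_apply, smul_add, map_add] at h3
  have e1 : inner ℝ (B • dq h (emb (prim N))) (dq h N) = prim (B • S • τ) (σ h) := by
    rw [dq_emb, dq_eq_ind h N, ← hS, ← hτ, ← inner_ind_comm, ind_csmul, ind_ind, ← ind_csmul,
      inner_ind, ← emb_mul, primMul_emb_left, mul_smul]
  have e2 : inner ℝ (dq h (emb (prim N))) (S • β) = prim ((S * S) • β) (σ h) := by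
    rw [dq_emb, ← hS, inner_ind, primMul_emb_left, mul_smul]
  rw [e1, e2]
  linarith

theorem shC_cst (h : unitInterval) (c : ℝ) : shC h (cst c) = cst c := rfl

theorem dqC_add (h : unitInterval) (a b : CI) : dqC h (a + b) = dqC h a + dqC h b := by
  ext x
  simp [dqC]
  ring

theorem dqC_cst (h : unitInterval) (c : ℝ) : dqC h (cst c) = 0 := by
  rw [dqC, shC_cst]; simp

theorem abs_inner_csmul_le (a : CI) (F G : L2) : |inner ℝ (a • F) G| ≤ ‖a‖ * ‖F‖ * ‖G‖ :=
  (abs_real_inner_le_norm _ _).trans (by gcongr; exact norm_csmul_le _ _)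

/-- The transport term in the energy estimate for a difference quotient. -/
theorem transport_energy_le {C Y e m η u₀ : ℝ} {û ûx u : CI} {w : L2}
    (hû : û = cst u₀ + prim (emb ûx)) (hu : u = û + prim w) {h : unitInterval} (hh : 0 < (h : ℝ))
    (hpos : 0 ≤ (û * u) (σ h)) (hC1 : ‖û‖ ≤ C) (hC2 : ‖ûx‖ ≤ C) (hw : SplitBound w Y e)
    (hm : ‖w‖ ≤ m) (hη : ∀ z ≤ h, ‖shC z ûx - ûx‖ ≤ η) (N : L2) :
    -inner ℝ (û • dq h (emb (prim N))) (dq h (u • N)) ≤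
      1 / 2 * (C * ((h : ℝ)⁻¹ * prim N h)) ^ 2
      + C * ‖N‖ * (C * ‖dq h (emb (prim N)) - shf h N‖ + η * ‖N‖)
      + C * (2 * Y + m + 3 * e / h) * ‖N‖ ^ 2 := by
  have hC0 : 0 ≤ C := (norm_nonneg _).trans hC1
  have hY := hw.nonneg_left
  have he := hw.nonneg_right
  set S := dqC h (prim N) with hS
  set Sd := dq h (emb (prim N)) with hSd
  set v := prim w with hv
  have hSdN : ‖Sd‖ ≤ ‖N‖ := norm_dq_emb_prim_le hh N
  have hu' : u = cst u₀ + prim (emb ûx + w) := by rw [hu, hû, map_add, add_assoc]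
  -- The identity is used for B = ûu, whose derivative is β = 2ûû_x + vû_x + ûw.
  have hB := mul_prim u₀ u₀ (emb ûx) (emb ûx + w)
  rw [← hû, ← hu'] at hB
  set β := û • (emb ûx + w) + u • emb ûx with hβ
  have h1 := inner_transport (u₀ * u₀) β h N
  rw [← hB, ← hSd, ← hS] at h1
  have hSd' : Sd = ind (σ h) (emb S) := dq_emb _ _
  have h2 : inner ℝ Sd (S • β) = 2 * inner ℝ (û • Sd) (ûx • Sd) + inner ℝ Sd ((v * ûx) • Sd)
      + inner ℝ Sd (û • ind (σ h) (S • w)) := by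
    have e1 : ind (σ h) (S • β) = (û * ûx) • Sd + (û * ûx) • Sd + (v * ûx) • Sd
        + û • ind (σ h) (S • w) := by
      rw [hSd', hβ, hu]
      simp only [smul_add, map_add, ind_csmul, emb_apply, smul_smul]
      have e3 : S * (û * ûx) = û * ûx * S := by ring
      have e4 : S * (v * ûx) = v * ûx * S := by ring
      have e5 : S * û = û * S := by ring
      rw [e3, e5, add_mul, mul_add, add_smul, e3, e4]
      abel
    have e2 : inner ℝ Sd (S • β) = inner ℝ Sd (ind (σ h) (S • β)) := by
      rw [← inner_ind_comm, ind_dq]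
    rw [e2, e1, inner_add_right, inner_add_right, inner_add_right, csmul_inner, smul_smul]
    ring
  have h3 : inner ℝ (û • Sd) (dq h (u • N)) = inner ℝ ((û * u) • Sd) (dq h N)
      + inner ℝ (û • Sd) (ûx • shf h N)
      + inner ℝ (û • Sd) ((dqC h (prim (emb ûx)) - ûx) • shf h N)
      + inner ℝ (û • Sd) (dqC h v • shf h N) := by
    have e1 : dqC h u = dqC h (prim (emb ûx)) + dqC h v := by
      rw [hu, hû, dqC_add, dqC_add, dqC_cst, zero_add]
    rw [dq_csmul, e1, inner_add_right, mul_comm û u, mul_smul, csmul_inner u, add_smul,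
      inner_add_right, sub_smul, inner_sub_right]
    ring
  -- The two terms in ûû_x, one from β and one from the discrete Leibniz rule for uN, cancel as h →
  -- 0. This is the purpose of the weight û: ûN(ûN)_x is an exact derivative.
  have h4 : inner ℝ (û • Sd) (ûx • Sd) - inner ℝ (û • Sd) (ûx • shf h N)
      ≤ C * ‖N‖ * (C * ‖Sd - shf h N‖) := by
    rw [← inner_sub_right, ← smul_sub]
    refine (le_abs_self _).trans ((abs_inner_csmul_le _ _ _).trans ?_)
    gcongr
    exact (norm_csmul_le _ _).trans (by gcongr)
  have h5 : -inner ℝ (û • Sd) ((dqC h (prim (emb ûx)) - ûx) • shf h N) ≤ C * ‖N‖ * (η * ‖N‖) := by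
    refine (neg_le_abs _).trans ((abs_inner_csmul_le _ _ _).trans ?_)
    gcongr
    exact norm_dqC_sub_csmul_shf_le hh ûx hη N
  have h6 : -inner ℝ (û • Sd) (dqC h v • shf h N) ≤ C * ‖N‖ * ((Y + 2 * e / h) * ‖N‖) := by
    refine (neg_le_abs _).trans ((abs_inner_csmul_le _ _ _).trans ?_)
    gcongr
    exact hw.norm_dqC_prim_csmul_shf_le hh N
  have h7 : inner ℝ Sd ((v * ûx) • Sd) ≤ m * C * ‖N‖ * ‖N‖ := by
    rw [← csmul_inner]
    refine (le_abs_self _).trans ((abs_inner_csmul_le _ _ _).trans ?_)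
    have : ‖v * ûx‖ ≤ m * C := (norm_mul_le _ _).trans
      (mul_le_mul ((norm_prim_le _).trans hm) hC2 (norm_nonneg _) ((norm_nonneg _).trans hm))
    have h0 := (norm_nonneg _).trans this
    gcongr
  have h8 : inner ℝ Sd (û • ind (σ h) (S • w)) ≤ C * ‖N‖ * ((Y + 2 * e / h) * ‖N‖) := by
    rw [← csmul_inner]
    refine (le_abs_self _).trans ((abs_inner_csmul_le _ _ _).trans ?_)
    gcongr
    refine (hw.norm_ind_csmul_le _ _).trans ?_
    rw [← hSd', add_mul]
    have := norm_dqC_prim_le hh N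
    have h9 : e * ‖S‖ ≤ e * (2 * ‖N‖ / h) := by gcongr
    calc Y * ‖Sd‖ + e * ‖S‖ ≤ Y * ‖N‖ + e * (2 * ‖N‖ / h) := by gcongr
      _ = _ := by ring
  have h10 : u₀ * u₀ * ((h : ℝ)⁻¹ * prim N h) ^ 2 ≤ (C * ((h : ℝ)⁻¹ * prim N h)) ^ 2 := by
    rw [mul_pow C]
    refine mul_le_mul_of_nonneg_right ?_ (sq_nonneg _)
    have : |u₀| ≤ C := by
      have := û.norm_coe_le_norm 0
      rw [hû] at this
      simp only [ContinuousMap.add_apply, cst_apply, prim_zero', add_zero, Real.norm_eq_abs] at this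
      rw [hû] at hC1
      exact this.trans hC1
    nlinarith [abs_nonneg u₀, sq_abs u₀]
  -- The outflow boundary term has the good sign and is discarded.
  have h11 : 0 ≤ (û * u) (σ h) * S (σ h) ^ 2 := mul_nonneg hpos (sq_nonneg _)
  have hz : e / h * 3 = 3 * e / h := by ring
  have hz2 : 2 * e / h = 2 * (e / h) := by ring
  rw [hz2] at h6 h8
  rw [h3, h1, h2, ← hz]
  have hmC : 0 ≤ m * C * ‖N‖ * ‖N‖ := by
    have := (norm_nonneg _).trans hm
    positivity
  have hYC : 0 ≤ C * Y * ‖N‖ * ‖N‖ := by positivity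
  linarith

theorem abs_prim_le (φ : L2) {y x : unitInterval} (hx : x ≤ y) :
    |prim φ x| ≤ Real.sqrt y * ‖φ‖ := by
  refine abs_le_of_sq_le_sq ?_ (by positivity)
  rw [mul_pow, Real.sq_sqrt y.2.1]
  rcases eq_or_lt_of_le x.2.1 with h | h
  · have : x = 0 := Subtype.ext h.symm
    rw [this, prim_zero']
    have := mul_nonneg y.2.1 (sq_nonneg ‖φ‖)
    simpa using this
  · have h1 := sq_prim_sub_le φ h (x := 0) (by simp) (by simp)
    rw [zero_add, ex_coe, ex_coe, ex_of_mem _ (by simp : (0 : ℝ) ∈ Icc (0 : ℝ) 1),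
      ex_of_mem _ (by simp : (0 : ℝ) ∈ Icc (0 : ℝ) 1)] at h1
    have e1 : prim φ ⟨0, by simp⟩ = 0 := prim_zero' φ
    have e2 : primMul φ φ ⟨0, by simp⟩ = 0 := primMul_zero' φ φ
    rw [e1, e2, sub_zero, sub_zero, mul_pow] at h1
    have h2 : primMul φ φ x ≤ ‖φ‖ ^ 2 := by
      have := (le_abs_self _).trans (((primMul φ φ).norm_coe_le_norm x).trans (norm_primMul_le φ φ))
      rwa [← pow_two] at this
    have h3 : (prim φ x) ^ 2 ≤ x * primMul φ φ x := by
      have := mul_le_mul_of_nonneg_left h1 (sq_nonneg (x : ℝ))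
      have e3 : (x : ℝ) ^ 2 * (((x : ℝ)⁻¹) ^ 2 * (prim φ x) ^ 2) = (prim φ x) ^ 2 := by field_simp
      have e4 : (x : ℝ) ^ 2 * ((x : ℝ)⁻¹ * primMul φ φ x) = x * primMul φ φ x := by field_simp
      rwa [e3, e4] at this
    exact h3.trans (mul_le_mul hx h2
      (by nlinarith [sq_nonneg (prim φ x)]) y.2.1)

/-- One factor √h is the pointwise bound of a primitive that vanishes at 0, the other the square
root of the length of the interval. The full factor h compensates the later division by h². -/
theorem norm_ind_emb_prim_le (h : unitInterval) (φ : L2) :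
    ‖ind h (emb (prim φ))‖ ≤ h * ‖φ‖ := by
  have h1 : ‖ind h (emb (prim φ))‖ ≤ (Real.sqrt h * ‖φ‖) * ‖ind h one2‖ := by
    refine Lp.norm_le_mul_norm_of_ae_le_mul ?_
    filter_upwards [coeFn_ind h (emb (prim φ)), coeFn_emb (prim φ), coeFn_ind h one2, coeFn_one2]
      with x h1 h2 h3 h4
    rw [h1, h3]
    by_cases hx : x ∈ Ioo (0 : ℝ) h
    · rw [indicator_of_mem hx, indicator_of_mem hx, h2, h4, norm_one, mul_one,
        ex_of_mem _ ⟨hx.1.le, hx.2.le.trans h.2.2⟩]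
      exact abs_prim_le φ hx.2.le
    · rw [indicator_of_notMem hx, indicator_of_notMem hx]; simp
  rw [norm_ind_one2] at h1
  calc _ ≤ _ := h1
    _ = (Real.sqrt h * Real.sqrt h) * ‖φ‖ := by ring
    _ = h * ‖φ‖ := by rw [Real.mul_self_sqrt h.2.1]

/-- A weight which decreases from `2` to `1` on `(0,h)`. -/
def wgt (h : unitInterval) : CI := cst 2 - (h : ℝ)⁻¹ • prim one2

theorem ex_wgt (h : unitInterval) {x : ℝ} (hx : x ∈ Icc (0 : ℝ) 1) :
    ex (wgt h) x = 2 - (h : ℝ)⁻¹ * x := by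
  rw [wgt, ex_sub, ex_smul, ex_cst, ex_of_mem _ hx, prim_one2]

theorem wgt_mem {h : unitInterval} {x : ℝ} (hx : x ∈ Ioo (0 : ℝ) h) :
    1 ≤ ex (wgt h) x ∧ ex (wgt h) x ≤ 2 := by
  have hx0 : x ∈ Icc (0 : ℝ) 1 := ⟨hx.1.le, hx.2.le.trans h.2.2⟩
  have hh : 0 < (h : ℝ) := hx.1.trans hx.2
  have h1 : (h : ℝ)⁻¹ * x ≤ 1 := by
    rw [inv_mul_le_iff₀ hh]; linarith [hx.2]
  have h2 : 0 ≤ (h : ℝ)⁻¹ * x := mul_nonneg (inv_nonneg.2 hh.le) hx.1.le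
  rw [ex_wgt h hx0]
  constructor <;> linarith

theorem norm_ind_wgt_le (h : unitInterval) (F : L2) : ‖ind h (wgt h • F)‖ ≤ 2 * ‖ind h F‖ := by
  refine Lp.norm_le_mul_norm_of_ae_le_mul ?_
  filter_upwards [coeFn_ind h (wgt h • F), coeFn_csmul (wgt h) F, coeFn_ind h F] with x h1 h2 h3
  rw [h1, h3]
  by_cases hx : x ∈ Ioo (0 : ℝ) h
  · rw [indicator_of_mem hx, indicator_of_mem hx, h2, norm_mul]
    have := wgt_mem hx
    gcongr
    rw [Real.norm_of_nonneg (by linarith)]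
    exact this.2
  · rw [indicator_of_notMem hx, indicator_of_notMem hx]; simp

/-- The boundary layer energy estimate. -/
theorem trace_energy_le {c C Y Y' e e' u₀ : ℝ} {ûx u b v : CI} {wb w φ : L2}
    (hu : u = cst u₀ + prim (emb ûx + wb)) {h : unitInterval} (hh : 0 < (h : ℝ))
    (hc : ∀ x, c ≤ u x) (hC2 : ‖ûx‖ ≤ C) (hb : ‖b‖ ≤ C)
    (hwb : SplitBound wb Y' e') (hw : SplitBound w Y e) :
    inner ℝ (ind h (wgt h • emb (prim φ))) (-(u • φ + w + emb (b * v))) ≤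
      -(c / 2) * (prim φ h) ^ 2 - c / (2 * h) * ‖ind h (emb (prim φ))‖ ^ 2
      + C * ‖ind h (emb (prim φ))‖ ^ 2
      + ‖ind h (emb (prim φ))‖ * (Y' * ‖ind h (emb (prim φ))‖ + e' * ‖φ‖)
      + 2 * ‖ind h (emb (prim φ))‖ * (Y * Real.sqrt h + e)
      + 2 * ‖ind h (emb (prim φ))‖ * (Real.sqrt h * (C * ‖v‖)) := by
  set f := prim φ with hf
  set If := ind h (emb f) with hIf
  set a := wgt h with ha
  have hC0 : 0 ≤ C := (norm_nonneg _).trans hb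
  have ha' : a = cst 2 + prim (-((h : ℝ)⁻¹ • one2)) := by
    rw [ha, wgt, map_neg, map_smul, sub_eq_add_neg]
  have hA := mul_prim 2 u₀ (-((h : ℝ)⁻¹ • one2)) (emb ûx + wb)
  rw [← ha', ← hu] at hA
  set β := a • (emb ûx + wb) + u • -((h : ℝ)⁻¹ • one2) with hβ
  have hff := prim_mul_prim φ φ
  rw [← hf] at hff
  have h0 : cst 0 = 0 := by simp [cst]
  have hAff := mul_prim (2 * u₀) 0 β (f • φ + f • φ)
  rw [h0, zero_add, ← hff, ← hA, mul_zero, h0, zero_add] at hAff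
  have h1 := congrArg (fun g : CI => g h) hAff
  have hah : a h = 1 := by
    rw [ha, wgt]
    simp only [ContinuousMap.sub_apply, ContinuousMap.smul_apply, cst_apply, prim_one2, smul_eq_mul]
    field_simp
    norm_num
  simp only [ContinuousMap.mul_apply, map_add, ContinuousMap.add_apply, hah, one_mul,
    smul_add] at h1
  have e1 : inner ℝ (ind h (a • emb f)) (u • φ) = prim ((a * u) • f • φ) h := by
    rw [inner_ind, ← emb_mul, primMul_emb_left]
    congr 2
    simp only [smul_smul]
    congr 1
    ring
  -- The slope -1/h of the weight produces -(1/2h)∫uf² on (0,h), the negative term that pays for the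
  -- lower-order terms of the layer.
  have e2 : prim ((f * f) • β) h = inner ℝ If (a • (ûx • If)) + inner ℝ If (a • (f • wb))
      - (h : ℝ)⁻¹ * inner ℝ (u • If) If := by
    have e3 : inner ℝ If (f • β) = prim ((f * f) • β) h := by
      rw [hIf, inner_ind, primMul_emb_left, smul_smul]
    have e4 : f • β = a • (ûx • emb f) + a • (f • wb) - (h : ℝ)⁻¹ • (u • emb f) := by
      rw [hβ]
      simp only [emb_apply]
      module
    have e5 : ∀ G : L2, inner ℝ If G = inner ℝ If (ind h G) := by
      intro G
      rw [← inner_ind_comm, hIf, ind_ind]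
    rw [← e3, e4, inner_sub_right, inner_add_right, inner_smul_right]
    rw [e5 (a • ûx • emb f), ind_csmul, ind_csmul, e5 (u • emb f), ind_csmul, ← hIf, csmul_inner]
  have h2 : inner ℝ If (a • (ûx • If)) ≤ 2 * C * ‖If‖ ^ 2 := by
    have e5 : inner ℝ If (a • (ûx • If)) = inner ℝ If (ind h (a • (ûx • If))) := by
      rw [← inner_ind_comm, hIf, ind_ind]
    rw [e5]
    refine (real_inner_le_norm _ _).trans ?_
    have h3 : ‖ind h (a • (ûx • If))‖ ≤ 2 * (C * ‖If‖) := by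
      refine (norm_ind_wgt_le h _).trans ?_
      gcongr
      refine (norm_ind_le _ _).trans ((norm_csmul_le _ _).trans ?_)
      gcongr
    calc _ ≤ ‖If‖ * (2 * (C * ‖If‖)) := by gcongr
      _ = _ := by ring
  have h3 : inner ℝ If (a • (f • wb)) ≤ 2 * (‖If‖ * (Y' * ‖If‖ + e' * ‖φ‖)) := by
    have e5 : inner ℝ If (a • (f • wb)) = inner ℝ If (ind h (a • (f • wb))) := by
      rw [← inner_ind_comm, hIf, ind_ind]
    rw [e5]
    refine (real_inner_le_norm _ _).trans ?_
    have h3 : ‖ind h (a • (f • wb))‖ ≤ 2 * (Y' * ‖If‖ + e' * ‖φ‖) := by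
      refine (norm_ind_wgt_le h _).trans ?_
      gcongr
      refine (hwb.norm_ind_csmul_le h f).trans ?_
      have := hwb.nonneg_right
      gcongr
      exact norm_prim_le φ
    calc _ ≤ ‖If‖ * (2 * (Y' * ‖If‖ + e' * ‖φ‖)) := by gcongr
      _ = _ := by ring
  have h4 : c * ‖If‖ ^ 2 ≤ inner ℝ (u • If) If := by
    rw [← real_inner_self_eq_norm_sq, inner_eq, inner_eq, ← MeasureTheory.integral_const_mul]
    refine integral_mono_ae ((integrable_mul If If).const_mul c) (integrable_mul _ _) ?_
    filter_upwards [coeFn_csmul u If, ae_restrict_mem measurableSet_Ioo] with x h5 h6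
    rw [h5, mul_assoc]
    refine mul_le_mul_of_nonneg_right ?_ (mul_self_nonneg _)
    rw [ex_of_mem _ (Ioo_subset_Icc_self h6)]
    exact hc _
  have h5 : -inner ℝ (ind h (a • emb f)) w ≤ 2 * ‖If‖ * (Y * Real.sqrt h + e) := by
    have e5 : inner ℝ (ind h (a • emb f)) w = inner ℝ (ind h (a • emb f)) (ind h w) := by
      rw [← inner_ind_comm, ind_ind]
    rw [e5]
    refine (neg_le_abs _).trans ((abs_real_inner_le_norm _ _).trans ?_)
    exact mul_le_mul (norm_ind_wgt_le h _) (hw.norm_ind_le h) (norm_nonneg _) (by positivity)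
  have h6 : -inner ℝ (ind h (a • emb f)) (emb (b * v)) ≤
      2 * ‖If‖ * (Real.sqrt h * (C * ‖v‖)) := by
    have e5 : inner ℝ (ind h (a • emb f)) (emb (b * v))
        = inner ℝ (ind h (a • emb f)) (ind h (emb (b * v))) := by
      rw [← inner_ind_comm, ind_ind]
    rw [e5]
    refine (neg_le_abs _).trans ((abs_real_inner_le_norm _ _).trans ?_)
    refine mul_le_mul (norm_ind_wgt_le h _) ?_ (norm_nonneg _) (by positivity)
    rw [emb_apply, ind_csmul]
    refine (norm_csmul_le _ _).trans ?_
    rw [norm_ind_one2, mul_comm]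
    gcongr
    exact (norm_mul_le _ _).trans (by gcongr)
  have h7 : c * (prim φ h) ^ 2 ≤ u h * (f h * f h) := by
    rw [← hf, ← pow_two]
    exact mul_le_mul_of_nonneg_right (hc h) (sq_nonneg _)
  have h8 : c / h * ‖If‖ ^ 2 ≤ (h : ℝ)⁻¹ * inner ℝ (u • If) If := by
    calc c / h * ‖If‖ ^ 2 = (h : ℝ)⁻¹ * (c * ‖If‖ ^ 2) := by ring
      _ ≤ _ := by gcongr
  have h9 : c / (2 * h) * ‖If‖ ^ 2 = 1 / 2 * (c / h * ‖If‖ ^ 2) := by ring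
  rw [inner_neg_right, inner_add_right, inner_add_right, e1, h9]
  rw [e2] at h1
  rw [← hf] at h7
  linarith

/-- After division by h² the boundary term is -(c/2)(f(h)/h)², a substitute for the trace φ(0)²,
while the source w enters through its pointwise bound Y. This is the rigorous form of φ(0) =
-w(0)/u(0). Young's inequality spends parts of the term p²/h, and p ≤ h‖φ‖ handles what is left. -/
theorem trace_energy_scaled_le {c C Y Y' e e' u₀ : ℝ} {ûx u b v : CI} {wb w φ : L2}
    (hc0 : 0 < c) (hu : u = cst u₀ + prim (emb ûx + wb)) {h : unitInterval} (hh : 0 < (h : ℝ))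
    (hhc : 8 * C * h ≤ c)
    (hc : ∀ x, c ≤ u x) (hC2 : ‖ûx‖ ≤ C) (hb : ‖b‖ ≤ C)
    (hwb : SplitBound wb Y' e') (hw : SplitBound w Y e) :
    ((h : ℝ) ^ 2)⁻¹ * inner ℝ (ind h (wgt h • emb (prim φ))) (-(u • φ + w + emb (b * v))) ≤
      -(c / 2) * (prim φ h / h) ^ 2 + Y' * ‖φ‖ ^ 2 + 8 / c * (Y ^ 2 + C ^ 2 * ‖v‖ ^ 2)
      + (e' / h * ‖φ‖ ^ 2 + 2 * e / h * ‖φ‖) := by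
  have h1 := trace_energy_le (φ := φ) (v := v) hu hh hc hC2 hb hwb hw
  have hp := norm_ind_emb_prim_le h φ
  set p := ‖ind h (emb (prim φ))‖ with hp'
  set X := inner ℝ (ind h (wgt h • emb (prim φ))) (-(u • φ + w + emb (b * v))) with hX
  have hp0 : 0 ≤ p := norm_nonneg _
  have hY' := hwb.nonneg_left
  have he' := hwb.nonneg_right
  have he := hw.nonneg_right
  set H : ℝ := (h : ℝ) with hH
  set s := Real.sqrt H with hs
  have hs2 : s ^ 2 = H := Real.sq_sqrt hh.le
  have hs0 : 0 < s := Real.sqrt_pos.2 hh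
  have hF := norm_nonneg φ
  -- the small multiples of `p ^ 2 / h`
  have a1 : 2 * p * (Y * s) ≤ c / (8 * H) * p ^ 2 + H ^ 2 * (8 / c * Y ^ 2) := by
    have : c / (8 * H) * p ^ 2 + H ^ 2 * (8 / c * Y ^ 2) - 2 * p * (Y * s)
        = (c / (8 * H)) * (p - 8 * H * s * Y / c) ^ 2 := by
      rw [← hs2]; field_simp; ring
    have : 0 ≤ (c / (8 * H)) * (p - 8 * H * s * Y / c) ^ 2 := by positivity
    linarith
  have a2 : 2 * p * (s * (C * ‖v‖)) ≤ c / (8 * H) * p ^ 2 + H ^ 2 * (8 / c * (C ^ 2 * ‖v‖ ^ 2)) := by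
    have : c / (8 * H) * p ^ 2 + H ^ 2 * (8 / c * (C ^ 2 * ‖v‖ ^ 2)) - 2 * p * (s * (C * ‖v‖))
        = (c / (8 * H)) * (p - 8 * H * s * (C * ‖v‖) / c) ^ 2 := by
      rw [← hs2]; field_simp; ring
    have : 0 ≤ (c / (8 * H)) * (p - 8 * H * s * (C * ‖v‖) / c) ^ 2 := by positivity
    linarith
  have a3 : C * p ^ 2 ≤ c / (8 * H) * p ^ 2 := by
    refine mul_le_mul_of_nonneg_right ?_ (sq_nonneg _)
    rw [le_div_iff₀ (by positivity)]
    linarith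
  have a4 : c / (2 * H) * p ^ 2 = 4 * (c / (8 * H) * p ^ 2) := by field_simp; ring
  have a5 : 0 ≤ c / (8 * H) * p ^ 2 := by positivity
  have a6 : p * (Y' * p + e' * ‖φ‖) ≤ H ^ 2 * (Y' * ‖φ‖ ^ 2 + e' / H * ‖φ‖ ^ 2) := by
    have : H ^ 2 * (Y' * ‖φ‖ ^ 2 + e' / H * ‖φ‖ ^ 2)
        = (H * ‖φ‖) * (Y' * (H * ‖φ‖) + e' * ‖φ‖) := by field_simp
    rw [this]
    gcongr
  have a7 : 2 * p * e ≤ H ^ 2 * (2 * e / H * ‖φ‖) := by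
    have : H ^ 2 * (2 * e / H * ‖φ‖) = 2 * (H * ‖φ‖) * e := by field_simp
    rw [this]
    gcongr
  have a8 : c / 2 * (prim φ h) ^ 2 = H ^ 2 * (c / 2 * (prim φ h / H) ^ 2) := by field_simp
  have h2 : X ≤ H ^ 2 * (-(c / 2) * (prim φ h / h) ^ 2 + Y' * ‖φ‖ ^ 2
      + 8 / c * (Y ^ 2 + C ^ 2 * ‖v‖ ^ 2) + (e' / h * ‖φ‖ ^ 2 + 2 * e / h * ‖φ‖)) := by
    rw [← hH]
    linarith
  rw [inv_mul_le_iff₀ (by positivity)]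
  exact h2

theorem abs_prim_emb_le (a : CI) (x : unitInterval) : |prim (emb a) x| ≤ x * ‖a‖ := by
  have h : ‖∫ z in (0 : ℝ)..x, ex a z‖ ≤ ‖a‖ * |(x : ℝ) - 0| :=
    intervalIntegral.norm_integral_le_of_norm_le_const fun z _ => abs_ex_le a z
  rw [prim_apply, primMul_congr (coeFn_emb a) x.2, ← Real.norm_eq_abs]
  rwa [sub_zero, abs_of_nonneg x.2.1, mul_comm] at h

theorem le_csmul_inner_self {c : ℝ} {a : CI} (h : ∀ x, c ≤ a x) (F : L2) :
    c * ‖F‖ ^ 2 ≤ inner ℝ (a • F) F := by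
  rw [← real_inner_self_eq_norm_sq, inner_eq, inner_eq, ← MeasureTheory.integral_const_mul]
  refine integral_mono_ae ((integrable_mul F F).const_mul c) (integrable_mul _ _) ?_
  filter_upwards [coeFn_csmul a F, ae_restrict_mem measurableSet_Ioo] with x h5 h6
  rw [h5, mul_assoc]
  refine mul_le_mul_of_nonneg_right ?_ (mul_self_nonneg _)
  rw [ex_of_mem _ (Ioo_subset_Icc_self h6)]
  exact h _

/-- The damping term in the energy estimate for a difference quotient. -/
theorem damping_energy_le {c C : ℝ} {û κ : CI} (hc : 0 < c) (hû : ∀ x, c ≤ û x)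
    (hκ : ∀ x, c ≤ κ x) (hC1 : ‖û‖ ≤ C) (hC2 : ‖κ‖ ≤ C) {h : unitInterval} (hh : 0 < (h : ℝ))
    (N G : L2) :
    -inner ℝ (û • dq h (emb (prim N))) (dq h (emb (prim (κ • N + G)))) ≤
      -(c ^ 2) * ‖N‖ ^ 2 + C * ‖N‖ * (C * ‖dqErr h N‖ + ‖dqErr h (κ • N)‖) + C * ‖N‖ * ‖G‖ := by
  have hC0 : 0 ≤ C := (norm_nonneg _).trans hC1
  set Sd := dq h (emb (prim N)) with hSd
  have hSdN : ‖Sd‖ ≤ ‖N‖ := norm_dq_emb_prim_le hh N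
  have e1 : dq h (emb (prim (κ • N + G))) = κ • N + dqErr h (κ • N) + dq h (emb (prim G)) := by
    rw [map_add, map_add, map_add, dqErr_apply]; abel
  have e2 : inner ℝ (û • Sd) (κ • N) = inner ℝ ((û * κ) • N) N + inner ℝ (û • dqErr h N) (κ • N) := by
    rw [dqErr_apply, ← hSd, smul_sub, inner_sub_left, mul_comm, mul_smul, csmul_inner κ]
    ring
  have h1 : c ^ 2 * ‖N‖ ^ 2 ≤ inner ℝ ((û * κ) • N) N := by
    refine le_csmul_inner_self (fun x => ?_) N
    rw [pow_two]
    exact mul_le_mul (hû x) (hκ x) hc.le (hc.le.trans (hû x))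
  have h2 : -inner ℝ (û • dqErr h N) (κ • N) ≤ C * ‖dqErr h N‖ * (C * ‖N‖) := by
    refine (neg_le_abs _).trans ((abs_inner_csmul_le _ _ _).trans ?_)
    gcongr
    exact (norm_csmul_le _ _).trans (by gcongr)
  have h3 : -inner ℝ (û • Sd) (dqErr h (κ • N)) ≤ C * ‖N‖ * ‖dqErr h (κ • N)‖ := by
    refine (neg_le_abs _).trans ((abs_inner_csmul_le _ _ _).trans ?_)
    gcongr
  have h4 : -inner ℝ (û • Sd) (dq h (emb (prim G))) ≤ C * ‖N‖ * ‖G‖ := by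
    refine (neg_le_abs _).trans ((abs_inner_csmul_le _ _ _).trans ?_)
    gcongr
    exact norm_dq_emb_prim_le hh G
  rw [e1, inner_add_right, inner_add_right, e2]
  linarith

/-- The trace at the inflow boundary of the difference quotient of `∫ ρ v + ν φ`. -/
theorem sq_trace_le {C ν : ℝ} {ρ v : CI} (hρ : ‖ρ‖ ≤ C) {h : unitInterval} (hh : 0 < (h : ℝ))
    (φ : L2) :
    ((h : ℝ)⁻¹ * prim (ρ • emb v + ν • φ) h) ^ 2 ≤
      2 * (C * ‖v‖) ^ 2 + 2 * ν ^ 2 * (prim φ h / h) ^ 2 := by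
  have e : (h : ℝ)⁻¹ * prim (ρ • emb v + ν • φ) h
      = (h : ℝ)⁻¹ * prim (emb (ρ * v)) h + ν * (prim φ h / h) := by
    rw [map_add, ← emb_mul, map_smul, ContinuousMap.add_apply, ContinuousMap.smul_apply,
      smul_eq_mul]
    ring
  have h1 : ((h : ℝ)⁻¹ * prim (emb (ρ * v)) h) ^ 2 ≤ (C * ‖v‖) ^ 2 := by
    have hC0 : 0 ≤ C := (norm_nonneg _).trans hρ
    rw [← sq_abs]
    gcongr
    rw [abs_mul, abs_of_pos (inv_pos.2 hh), inv_mul_le_iff₀ hh]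
    refine (abs_prim_emb_le _ _).trans ?_
    gcongr
    exact (norm_mul_le _ _).trans (by gcongr)
  rw [e]
  nlinarith [sq_nonneg ((h : ℝ)⁻¹ * prim (emb (ρ * v)) h - ν * (prim φ h / h))]

/-- The error in the energy estimate for difference quotients with step `h`. -/
def spaceErr (C : ℝ) (h : unitInterval) (η : ℝ) (κ : CI) (N : L2) : ℝ :=
  C * ‖dq h (emb (prim N)) - shf h N‖ + η * ‖N‖ + C * ‖dqErr h N‖ + ‖dqErr h (κ • N)‖

set_option maxHeartbeats 1000000 in
/-- The spatial part of the energy estimate for the effective flux `ρ v + ν φ`. -/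
theorem space_energy_le {c C ν Y Y' e e' m η u₀ : ℝ} {û ûx u b v κ ρ : CI} {wb w φ G N : L2}
    (hc0 : 0 < c) (hν : 0 < ν) (hN : N = ρ • emb v + ν • φ) (hv : v = prim w)
    (hû : û = cst u₀ + prim (emb ûx)) (hu : u = û + prim wb)
    {h : unitInterval} (hh : 0 < (h : ℝ)) (hhc : 8 * C * h ≤ c)
    (hcû : ∀ x, c ≤ û x) (hcu : ∀ x, c ≤ u x) (hcκ : ∀ x, c ≤ κ x)
    (hC1 : ‖û‖ ≤ C) (hC2 : ‖ûx‖ ≤ C) (hb : ‖b‖ ≤ C) (hκ : ‖κ‖ ≤ C) (hρ : ‖ρ‖ ≤ C)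
    (hG : ‖G‖ ≤ C * (‖emb (prim φ)‖ + ‖w‖))
    (hwb : SplitBound wb Y' e') (hw : SplitBound w Y e) (hm : ‖wb‖ ≤ m)
    (hmc : C * m ≤ c ^ 2 / 4) (hη : ∀ z ≤ h, ‖shC z ûx - ûx‖ ≤ η) :
    -inner ℝ (û • dq h (emb (prim N))) (dq h (u • N + emb (prim (κ • N + G))))
      + 2 * C ^ 2 * ν ^ 2 / c * (((h : ℝ) ^ 2)⁻¹ *
        inner ℝ (ind h (wgt h • emb (prim φ))) (-(u • φ + w + emb (b * v)))) ≤
      -(c ^ 2 / 4) * ‖N‖ ^ 2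
      + (C ^ 4 + 4 * C ^ 4 / c ^ 2 + 2 * C ^ 2 * ν ^ 2 / c * (8 / c * (1 + C ^ 2)))
        * (‖w‖ ^ 2 + ‖emb (prim φ)‖ ^ 2 + Y ^ 2)
      + (2 * C + 2 * C ^ 2 * ν ^ 2 / c) * (Y' * (‖N‖ ^ 2 + ‖φ‖ ^ 2))
      + (C * ‖N‖ * spaceErr C h η κ N + 3 * C * e' / h * ‖N‖ ^ 2
        + 2 * C ^ 2 * ν ^ 2 / c * (e' / h * ‖φ‖ ^ 2 + 2 * e / h * ‖φ‖)) := by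
  have hC0 : 0 ≤ C := (norm_nonneg _).trans hC1
  have hY' := hwb.nonneg_left
  have he' := hwb.nonneg_right
  have he := hw.nonneg_right
  have hpos : 0 ≤ (û * u) (σ h) :=
    mul_nonneg (hc0.le.trans (hcû _)) (hc0.le.trans (hcu _))
  have hu' : u = cst u₀ + prim (emb ûx + wb) := by rw [hu, hû, map_add, add_assoc]
  have h1 := transport_energy_le hû hu hh hpos hC1 hC2 hwb hm hη N
  have h2 := damping_energy_le hc0 hcû hcκ hC1 hκ hh N G
  have h3 := trace_energy_scaled_le (φ := φ) (v := v) hc0 hu' hh hhc hcu hC2 hb hwb hw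
  have h4 := sq_trace_le (ν := ν) (v := v) hρ hh φ
  rw [← hN] at h4
  have hvw : ‖v‖ ≤ ‖w‖ := hv ▸ norm_prim_le w
  -- Chosen so that Λ(c/2)t² = C²ν²t², which is exactly the t² part of the inflow loss ½(Cs)².
  set Λ := 2 * C ^ 2 * ν ^ 2 / c with hΛ
  have hΛ0 : 0 ≤ Λ := by positivity
  have h5 := mul_le_mul_of_nonneg_left h3 hΛ0
  set s := (h : ℝ)⁻¹ * prim N h
  set t := prim φ h / (h : ℝ)
  have h6 : 1 / 2 * (C * s) ^ 2 ≤ C ^ 4 * ‖w‖ ^ 2 + Λ * (c / 2 * t ^ 2) := by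
    have e1 : Λ * (c / 2 * t ^ 2) = C ^ 2 * (ν ^ 2 * t ^ 2) := by rw [hΛ]; field_simp
    have e2 : 1 / 2 * (C * s) ^ 2 ≤ C ^ 2 * (1 / 2 * (2 * (C * ‖v‖) ^ 2 + 2 * ν ^ 2 * t ^ 2)) := by
      calc _ = C ^ 2 * (1 / 2 * s ^ 2) := by ring
        _ ≤ _ := by gcongr
    have e3 : C ^ 4 * ‖v‖ ^ 2 ≤ C ^ 4 * ‖w‖ ^ 2 := by gcongr
    rw [e1]
    linarith
  -- Of the damping -c²‖N‖², half is spent here and a quarter in `h8` on the smallness assumption Cm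
  -- ≤ c²/4. A quarter remains.
  have h7 : C * ‖N‖ * ‖G‖ ≤ c ^ 2 / 2 * ‖N‖ ^ 2 + 4 * C ^ 4 / c ^ 2 * (‖w‖ ^ 2 + ‖emb (prim φ)‖ ^ 2) := by
    set q := ‖emb (prim φ)‖ + ‖w‖ with hq
    have e1 : C * ‖N‖ * ‖G‖ ≤ C * ‖N‖ * (C * q) := by gcongr
    have e2 : C * ‖N‖ * (C * q) ≤ c ^ 2 / 2 * ‖N‖ ^ 2 + C ^ 4 / (2 * c ^ 2) * q ^ 2 := by
      have : c ^ 2 / 2 * ‖N‖ ^ 2 + C ^ 4 / (2 * c ^ 2) * q ^ 2 - C * ‖N‖ * (C * q)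
          = 1 / 2 * (c * ‖N‖ - C ^ 2 / c * q) ^ 2 := by field_simp; ring
      have h' := sq_nonneg (c * ‖N‖ - C ^ 2 / c * q)
      linarith
    have e3 : q ^ 2 ≤ 2 * (‖w‖ ^ 2 + ‖emb (prim φ)‖ ^ 2) := by
      rw [hq]; nlinarith [sq_nonneg (‖emb (prim φ)‖ - ‖w‖)]
    have e4 : C ^ 4 / (2 * c ^ 2) * q ^ 2 ≤ C ^ 4 / (2 * c ^ 2) * (2 * (‖w‖ ^ 2 + ‖emb (prim φ)‖ ^ 2)) := by
      gcongr
    have e5 : C ^ 4 / (2 * c ^ 2) * (2 * (‖w‖ ^ 2 + ‖emb (prim φ)‖ ^ 2))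
        ≤ 4 * C ^ 4 / c ^ 2 * (‖w‖ ^ 2 + ‖emb (prim φ)‖ ^ 2) := by
      rw [← mul_assoc]
      gcongr
      have : C ^ 4 / (2 * c ^ 2) * 2 = C ^ 4 / c ^ 2 := by field_simp
      rw [this]
      gcongr
      have := pow_nonneg hC0 4
      linarith
    linarith
  have h8 : C * (2 * Y' + m + 3 * e' / h) * ‖N‖ ^ 2
      ≤ 2 * C * (Y' * ‖N‖ ^ 2) + c ^ 2 / 4 * ‖N‖ ^ 2 + 3 * C * e' / h * ‖N‖ ^ 2 := by
    have := mul_le_mul_of_nonneg_right hmc (sq_nonneg ‖N‖)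
    have e1 : C * (2 * Y' + m + 3 * e' / h) * ‖N‖ ^ 2
      = 2 * C * (Y' * ‖N‖ ^ 2) + C * m * ‖N‖ ^ 2 + 3 * C * e' / h * ‖N‖ ^ 2 := by ring
    linarith
  have h9 : Λ * (8 / c * (Y ^ 2 + C ^ 2 * ‖v‖ ^ 2)) ≤
      Λ * (8 / c * (1 + C ^ 2)) * (‖w‖ ^ 2 + ‖emb (prim φ)‖ ^ 2 + Y ^ 2) := by
    have e1 : Λ * (8 / c * (1 + C ^ 2)) * (‖w‖ ^ 2 + ‖emb (prim φ)‖ ^ 2 + Y ^ 2)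
      = Λ * (8 / c * ((1 + C ^ 2) * (‖w‖ ^ 2 + ‖emb (prim φ)‖ ^ 2 + Y ^ 2))) := by ring
    rw [e1]
    gcongr
    have : ‖v‖ ^ 2 ≤ ‖w‖ ^ 2 := by gcongr
    have p1 := mul_le_mul_of_nonneg_left this (sq_nonneg C)
    have p2 : 0 ≤ C ^ 2 * Y ^ 2 := by positivity
    have p3 : 0 ≤ (1 + C ^ 2) * ‖emb (prim φ)‖ ^ 2 := by positivity
    have p4 := sq_nonneg ‖w‖
    linarith
  have h10 : 0 ≤ C ^ 4 * (‖emb (prim φ)‖ ^ 2 + Y ^ 2) := by positivity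
  have h11 : 0 ≤ 4 * C ^ 4 / c ^ 2 * Y ^ 2 := by positivity
  have h12 : 0 ≤ 2 * C * (Y' * ‖φ‖ ^ 2) := by positivity
  have h13 : 0 ≤ Λ * (Y' * ‖N‖ ^ 2) := by positivity
  rw [map_add, inner_add_right, neg_add, spaceErr]
  linarith

/-! ### Time averages and differentiation of products with a merely continuous factor -/

/-- Time average over `[t, t + k]`. -/
def avg (k : ℝ) (F : ℝ → L2) (t : ℝ) : L2 := k⁻¹ • ∫ s in t..t + k, F s

theorem hasDerivAt_avg {F : ℝ → L2} (hF : Continuous F) (k t : ℝ) :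
    HasDerivAt (avg k F) (k⁻¹ • (F (t + k) - F t)) t := by
  have e : avg k F = fun t => k⁻¹ • ((∫ s in (0 : ℝ)..t + k, F s) - ∫ s in (0 : ℝ)..t, F s) := by
    funext t
    rw [avg, integral_interval_sub_left (hF.intervalIntegrable _ _) (hF.intervalIntegrable _ _)]
  rw [e]
  have h1 := (hF.integral_hasStrictDerivAt 0 t).hasDerivAt
  have h2 := ((hF.integral_hasStrictDerivAt 0 (t + k)).hasDerivAt).comp_add_const t k
  exact (h2.sub h1).const_smul (k⁻¹ : ℝ)

theorem map_avg (A : L2 →L[ℝ] L2) {F : ℝ → L2} (hF : Continuous F) (k t : ℝ) :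
    A (avg k F t) = avg k (fun s => A (F s)) t := by
  rw [avg, avg, map_smul, A.intervalIntegral_comp_comm (hF.intervalIntegrable _ _)]

theorem norm_avg_sub_le {F : ℝ → L2} (hF : Continuous F) {k t η : ℝ} (hk : 0 < k)
    (h : ∀ s ∈ Icc t (t + k), ‖F s - F t‖ ≤ η) : ‖avg k F t - F t‖ ≤ η := by
  have e : avg k F t - F t = k⁻¹ • ∫ s in t..t + k, (F s - F t) := by
    rw [intervalIntegral.integral_sub (hF.intervalIntegrable _ _) (by simp),
      intervalIntegral.integral_const, smul_sub, avg, smul_smul]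
    simp [hk.ne']
  rw [e, norm_smul, norm_inv, Real.norm_of_nonneg hk.le, inv_mul_le_iff₀ hk]
  refine (intervalIntegral.norm_integral_le_of_norm_le_const (C := η) fun s hs => ?_).trans ?_
  · rw [uIoc_of_le (by linarith)] at hs
    exact h s ⟨hs.1.le, hs.2⟩
  · rw [add_sub_cancel_left, abs_of_pos hk, mul_comm]

theorem eventually_avg_sub_le {F : ℝ → L2} (hF : Continuous F) (T : ℝ) {η : ℝ} (hη : 0 < η) :
    ∃ k₀ > 0, ∀ k, 0 < k → k < k₀ → ∀ t ∈ Icc (0 : ℝ) T, ‖avg k F t - F t‖ ≤ η := by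
  have hu := (isCompact_Icc (a := (0 : ℝ)) (b := T + 1)).uniformContinuousOn_of_continuous
    hF.continuousOn
  obtain ⟨δ, hδ, h⟩ := Metric.uniformContinuousOn_iff.1 hu η hη
  refine ⟨min δ 1, by positivity, fun k hk hk' t ht => norm_avg_sub_le hF hk fun s hs => ?_⟩
  have h1 := hk'.trans_le (min_le_left _ _)
  have h2 := hk'.trans_le (min_le_right _ _)
  have := h s ⟨by linarith [ht.1, hs.1], by linarith [ht.2, hs.2]⟩ t
    ⟨ht.1, by linarith [ht.2]⟩ (by
      rw [Real.dist_eq, abs_of_nonneg (by linarith [hs.1])]; linarith [hs.2])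
  rw [dist_eq_norm] at this
  exact this.le

/-- The first factor vanishes at t, so the second only has to be continuous there. This replaces the
product rule for factors with no time derivative. -/
theorem hasDerivWithinAt_inner_sub {s : Set ℝ} {t : ℝ} {a b : ℝ → L2} {a' : L2}
    (ha : HasDerivWithinAt a a' s t) (hb : ContinuousWithinAt b s t) :
    HasDerivWithinAt (fun z => inner ℝ (a z - a t) (b z)) (inner ℝ a' (b t)) s t := by
  rw [hasDerivWithinAt_iff_tendsto_slope] at ha ⊢
  have h := ha.inner (𝕜 := ℝ) (hb.mono (sdiff_subset : s \ {t} ⊆ s))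
  refine h.congr fun z => ?_
  simp [slope, real_inner_smul_left]

theorem hasDerivWithinAt_half_quadratic {s : Set ℝ} {t : ℝ} (A : L2 → L2)
    {a : ℝ → L2} {a' : L2} (hA : HasDerivWithinAt (fun z => A (a z)) (A a') s t)
    (hs : ∀ F G, inner ℝ (A F) G = inner ℝ F (A G)) (ha : HasDerivWithinAt a a' s t) :
    HasDerivWithinAt (fun z => 1 / 2 * inner ℝ (A (a z)) (a z)) (inner ℝ (A (a t)) a') s t := by
  have h := (hA.inner ℝ ha).const_mul (1 / 2 : ℝ)
  refine h.congr_deriv ?_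
  rw [hs a' (a t), real_inner_comm (A (a t)) a']
  ring

/-! ### The linear system, its kinetic energy and its effective flux -/

/-- The linear system satisfied both by the perturbation (with the logarithm of the density as
unknown) and by its time derivative. Here `φ` and `w` are the space derivatives of the
unknowns. -/
structure LinSys (ν c C T u₀ : ℝ) (ûx : CI) (φ w wb j g G : ℝ → L2) (ρ κ b : ℝ → CI) : Prop where
  hν : 0 < ν
  hc : 0 < c
  cont_φ : Continuous φ
  cont_w : Continuous w
  cont_g : Continuous g
  cont_ρ : Continuous ρ
  cont_κ : Continuous κ
  prim_w : ∀ t, prim (w t) 1 = 0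
  transport : ∀ t ∈ Icc 0 T, HasDerivWithinAt (fun s => emb (prim (φ s)))
    (-((cst u₀ + prim (emb ûx) + prim (wb t)) • φ t + w t + emb (b t * prim (w t)))) (Icc 0 T) t
  flux : ∀ t ∈ Icc 0 T, HasDerivWithinAt
    (fun s => meanFree (emb (prim (ρ s • emb (prim (w s))))))
    (meanFree (ν • w t - emb (prim (g t)))) (Icc 0 T) t
  density : ∀ t ∈ Icc 0 T, HasDerivWithinAt (fun s => emb (ρ s)) (-j t) (Icc 0 T) t
  -- With N = ρv + νφ, this relation turns the sum of `flux` and ν times `transport` into (∫N)_t +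
  -- uN + ∫(κN + G) = 0 modulo constants.
  rel : ∀ t, prim (g t) + ν • (b t * prim (w t)) =
    (cst u₀ + prim (emb ûx) + prim (wb t)) * (ρ t * prim (w t))
      + prim (κ t • (ρ t • emb (prim (w t)) + ν • φ t) + G t)
  le_û : ∀ x, c ≤ (cst u₀ + prim (emb ûx)) x
  le_u : ∀ t x, c ≤ (cst u₀ + prim (emb ûx) + prim (wb t)) x
  le_ρ : ∀ t x, c ≤ ρ t x
  le_κ : ∀ t x, c ≤ κ t x
  û_le : ‖cst u₀ + prim (emb ûx)‖ ≤ C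
  ûx_le : ‖ûx‖ ≤ C
  ρ_le : ∀ t, ‖ρ t‖ ≤ C
  κ_le : ∀ t, ‖κ t‖ ≤ C
  b_le : ∀ t, ‖b t‖ ≤ C
  j_le : ∀ t, ‖j t‖ ≤ C
  g_le : ∀ t, ‖g t‖ ≤ C * (‖φ t‖ + ‖w t‖)
  G_le : ∀ t, ‖G t‖ ≤ C * (‖emb (prim (φ t))‖ + ‖w t‖)

namespace LinSys

variable {ν c C T u₀ : ℝ} {ûx : CI} {φ w wb j g G : ℝ → L2} {ρ κ b : ℝ → CI}

theorem C_nonneg (hs : LinSys ν c C T u₀ ûx φ w wb j g G ρ κ b) : 0 ≤ C :=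
  (norm_nonneg _).trans hs.ûx_le

/-- Since w has mean zero, testing z with v sees the primitive of z only modulo constants, which is
the form in which the momentum equation is available. -/
theorem inner_momentum (hs : LinSys ν c C T u₀ ûx φ w wb j g G ρ κ b) (z : L2) (t : ℝ) :
    inner ℝ z (emb (prim (w t))) = -inner ℝ (meanFree (emb (prim z))) (w t) := by
  rw [inner_meanFree _ _ (hs.prim_w t), inner_emb_prim_of_eq_zero _ _ (hs.prim_w t), neg_neg]

/-- Conservation law for the kinetic energy. -/
theorem hasDerivWithinAt_kinetic (hs : LinSys ν c C T u₀ ûx φ w wb j g G ρ κ b) {t : ℝ}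
    (ht : t ∈ Icc 0 T) :
    HasDerivWithinAt (fun s => inner ℝ (ρ s • emb (prim (w s))) (emb (prim (w s))))
      (-(2 * ν) * ‖w t‖ ^ 2 - 2 * inner ℝ (g t) (emb (prim (w t)))
        + inner ℝ (j t) (emb (prim (w t) * prim (w t)))) (Icc 0 T) t := by
  set B : ℝ → L2 := fun s => meanFree (emb (prim (ρ s • emb (prim (w s))))) with hB
  -- The increment of ⟨ρv, v⟩ is arranged so that the quantities with a time derivative, the
  -- integrated momentum and the density, appear as increments paired with factors that are only
  -- continuous.
  have key : ∀ z, inner ℝ (ρ z • emb (prim (w z))) (emb (prim (w z)))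
      = inner ℝ (ρ t • emb (prim (w t))) (emb (prim (w t)))
        + (-inner ℝ (B z - B t) (w z + w t)
          - inner ℝ (emb (ρ z) - emb (ρ t)) (emb (prim (w z) * prim (w t)))) := by
    intro z
    have e1 := hs.inner_momentum (ρ z • emb (prim (w z))) z
    have e2 := hs.inner_momentum (ρ z • emb (prim (w z))) t
    have e3 := hs.inner_momentum (ρ t • emb (prim (w t))) z
    have e4 := hs.inner_momentum (ρ t • emb (prim (w t))) t
    have e5 : ∀ (a c d : CI), inner ℝ (emb a) (emb (c * d)) = inner ℝ (a • emb c) (emb d) := by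
      intro a c d
      rw [← emb_mul, emb_mul c d, ← csmul_inner, ← emb_mul, mul_comm]
    have e6 : inner ℝ (ρ t • emb (prim (w z))) (emb (prim (w t)))
        = inner ℝ (ρ t • emb (prim (w t))) (emb (prim (w z))) := by
      rw [csmul_inner, real_inner_comm]
    simp only [inner_sub_left, inner_add_right, e5, hB]
    rw [e6]
    linarith
  have h1 := hasDerivWithinAt_inner_sub (hs.flux t ht)
    (b := fun z => w z + w t) ((hs.cont_w.add continuous_const).continuousWithinAt)
  have hcv : Continuous fun z => emb (prim (w z) * prim (w t)) :=
    emb.continuous.comp ((prim.continuous.comp hs.cont_w).mul continuous_const)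
  have h2 := hasDerivWithinAt_inner_sub (hs.density t ht) hcv.continuousWithinAt
  have h3 := (h1.neg.sub h2).const_add (inner ℝ (ρ t • emb (prim (w t))) (emb (prim (w t))))
  refine (h3.congr_deriv ?_).congr (fun z _ => key z) (key t)
  have e1 : inner ℝ (emb (prim (g t))) (w t) = -inner ℝ (g t) (emb (prim (w t))) :=
    inner_emb_prim_of_eq_zero _ _ (hs.prim_w t)
  rw [← two_smul ℝ (w t), inner_smul_right, inner_meanFree _ _ (hs.prim_w t), inner_sub_left,
    real_inner_smul_left, e1, real_inner_self_eq_norm_sq, inner_neg_left]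
  ring

theorem kinetic_deriv_le (hs : LinSys ν c C T u₀ ûx φ w wb j g G ρ κ b) (t : ℝ) :
    -(2 * ν) * ‖w t‖ ^ 2 - 2 * inner ℝ (g t) (emb (prim (w t)))
        + inner ℝ (j t) (emb (prim (w t) * prim (w t))) ≤
      -(2 * ν) * ‖w t‖ ^ 2 + 2 * C * (‖φ t‖ + ‖w t‖) * ‖emb (prim (w t))‖
        + C * ‖w t‖ * ‖emb (prim (w t))‖ := by
  have hC := hs.C_nonneg
  have h1 : -inner ℝ (g t) (emb (prim (w t))) ≤ C * (‖φ t‖ + ‖w t‖) * ‖emb (prim (w t))‖ := by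
    refine (neg_le_abs _).trans ((abs_real_inner_le_norm _ _).trans ?_)
    gcongr
    exact hs.g_le t
  have h2 : inner ℝ (j t) (emb (prim (w t) * prim (w t))) ≤ C * ‖w t‖ * ‖emb (prim (w t))‖ := by
    refine (real_inner_le_norm _ _).trans ?_
    rw [emb_mul, mul_assoc]
    gcongr
    · exact hs.j_le t
    · exact (norm_csmul_le _ _).trans (by gcongr; exact norm_prim_le _)
  linarith

/-- The effective flux. -/
theorem hasDerivWithinAt_dq (hs : LinSys ν c C T u₀ ûx φ w wb j g G ρ κ b) (h : unitInterval)
    {t : ℝ} (ht : t ∈ Icc 0 T) :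
    HasDerivWithinAt (fun s => dq h (emb (prim (ρ s • emb (prim (w s)) + ν • φ s))))
      (-dq h ((cst u₀ + prim (emb ûx) + prim (wb t)) • (ρ t • emb (prim (w t)) + ν • φ t)
        + emb (prim (κ t • (ρ t • emb (prim (w t)) + ν • φ t) + G t)))) (Icc 0 T) t := by
  have h1 := ((dq h).hasFDerivAt.comp_hasDerivWithinAt t (hs.flux t ht))
  have h2 := ((dq h).hasFDerivAt.comp_hasDerivWithinAt t (hs.transport t ht)).const_smul ν
  have h3 := h1.add h2
  refine (h3.congr_deriv ?_).congr (fun z _ => ?_) ?_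
  -- Difference quotients annihilate constants, so the mean-free projection disappears. The term νw
  -- of `flux` cancels the one in ν times `transport`.
  · rw [dq_meanFree, ← map_smul, ← map_add, ← map_neg]
    have h4 : emb (prim (g t)) + ν • emb (b t * prim (w t)) =
      (cst u₀ + prim (emb ûx) + prim (wb t)) • ρ t • emb (prim (w t))
        + emb (prim (κ t • (ρ t • emb (prim (w t)) + ν • φ t) + G t)) := by
      have h6 := congrArg emb (hs.rel t)
      rw [map_add, map_add, emb_mul, emb_mul, map_smul] at h6
      exact h6
    congr 1
    have h5 : emb (prim (κ t • (ρ t • emb (prim (w t)) + ν • φ t) + G t))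
      = emb (prim (g t)) + ν • emb (b t * prim (w t))
        - (cst u₀ + prim (emb ûx) + prim (wb t)) • ρ t • emb (prim (w t)) := by
      rw [h4]; abel
    rw [h5]
    module
  · simp only [Function.comp_apply, Pi.add_apply, Pi.smul_apply]
    rw [dq_meanFree, map_add prim, map_add, map_add, map_smul prim, map_smul emb, map_smul (dq h)]
  · simp only [Function.comp_apply, Pi.add_apply, Pi.smul_apply]
    rw [dq_meanFree, map_add prim, map_add, map_add, map_smul prim, map_smul emb, map_smul (dq h)]

end LinSys

/-! ### Viscous stress and the averaged velocity gradient -/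

/-- Time difference quotient. -/
def tdq (k : ℝ) (F : ℝ → L2) (t : ℝ) : L2 := k⁻¹ • (F (t + k) - F t)

namespace LinSys

variable {ν c C T u₀ : ℝ} {ûx : CI} {φ w wb j g G : ℝ → L2} {ρ κ b : ℝ → CI}

/-- The time-averaged derivative of the viscous stress. -/
def stress (k : ℝ) (w g : ℝ → L2) (ρ : ℝ → CI) (t : ℝ) : L2 :=
  avg k g t + tdq k (fun s => ρ s • emb (prim (w s))) t

theorem meanFree_w (hs : LinSys ν c C T u₀ ûx φ w wb j g G ρ κ b) (t : ℝ) :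
    meanFree (w t) = w t := by
  rw [meanFree_apply, hs.prim_w t, zero_smul, sub_zero]

/-- The momentum equation integrated over [t, t+k]. Although w is only square integrable in x, its
time average is, up to a constant, the primitive of the L² function `stress`, hence an H¹ function
of x. -/
theorem smul_avg_eq (hs : LinSys ν c C T u₀ ûx φ w wb j g G ρ κ b) {t k : ℝ} (hk : 0 < k)
    (h0 : 0 ≤ t) (hT : t + k ≤ T) :
    ν • avg k w t = meanFree (emb (prim (stress k w g ρ t))) := by
  set L : L2 →L[ℝ] L2 := meanFree.comp (emb.comp prim) with hL
  have hLa : ∀ F, L F = meanFree (emb (prim F)) := fun F => rfl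
  have hmem : ∀ s ∈ Icc t (t + k), s ∈ Icc 0 T := fun s hs => ⟨h0.trans hs.1, hs.2.trans hT⟩
  have hder : ∀ s, meanFree (ν • w s - emb (prim (g s))) = ν • w s - L (g s) := by
    intro s
    rw [map_sub, map_smul, hs.meanFree_w, hLa]
  have hint : ∫ s in t..t + k, (ν • w s - L (g s))
      = L (ρ (t + k) • emb (prim (w (t + k)))) - L (ρ t • emb (prim (w t))) := by
    have hle : t ≤ t + k := by linarith
    refine integral_eq_sub_of_hasDerivAt_of_le hle (f := fun s => L (ρ s • emb (prim (w s))))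
      (fun s h => ((hs.flux s (hmem s h)).continuousWithinAt).mono fun z hz => hmem z hz)
      (fun s h => ?_) ?_
    · rw [← hder]
      exact (hs.flux s (hmem s (Ioo_subset_Icc_self h))).hasDerivAt
        (Icc_mem_nhds (h0.trans_lt h.1) (h.2.trans_le hT))
    · exact ((hs.cont_w.const_smul ν).sub (L.continuous.comp hs.cont_g)).intervalIntegrable _ _
  have hsub : ∫ s in t..t + k, (ν • w s - L (g s))
      = ν • (∫ s in t..t + k, w s) - ∫ s in t..t + k, L (g s) := by
    rw [← intervalIntegral.integral_smul]
    exact intervalIntegral.integral_sub ((hs.cont_w.const_smul ν).intervalIntegrable _ _)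
      ((L.continuous.comp hs.cont_g).intervalIntegrable _ _)
  have h1 : ν • avg k w t - L (avg k g t) = L (tdq k (fun s => ρ s • emb (prim (w s))) t) := by
    rw [map_avg L hs.cont_g, tdq, map_smul, map_sub, ← hint, avg, avg, hsub]
    module
  rw [stress, ← hLa, map_add, ← h1]
  abel

theorem prim_avg (hs : LinSys ν c C T u₀ ûx φ w wb j g G ρ κ b) (k t : ℝ) :
    prim (avg k w t) 1 = 0 := by
  have h1 : meanFree (avg k w t) = avg k w t := by
    rw [map_avg _ hs.cont_w, avg, avg]
    simp only [hs.meanFree_w]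
  rw [meanFree_apply, sub_eq_self, smul_eq_zero] at h1
  refine h1.resolve_right fun h => ?_
  have := norm_one2
  rw [h, norm_zero] at this
  exact zero_ne_one this

theorem norm_sub_density_le (hs : LinSys ν c C T u₀ ûx φ w wb j g G ρ κ b) {t k : ℝ} (hk : 0 < k)
    (h0 : 0 ≤ t) (hT : t + k ≤ T) : ‖emb (ρ (t + k)) - emb (ρ t)‖ ≤ C * k := by
  have := (convex_Icc (0 : ℝ) T).norm_image_sub_le_of_norm_hasDerivWithin_le
    (f := fun s => emb (ρ s)) (C := C) (fun s h => hs.density s h)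
    (fun s _ => by rw [norm_neg]; exact hs.j_le s) (x := t) (y := t + k)
    ⟨h0, by linarith⟩ ⟨by linarith, hT⟩
  rwa [add_sub_cancel_left, Real.norm_of_nonneg hk.le] at this

theorem tdq_momentum (k : ℝ) (w : ℝ → L2) (ρ : ℝ → CI) (t : ℝ) :
    tdq k (fun s => ρ s • emb (prim (w s))) t
      = ρ (t + k) • tdq k (fun s => emb (prim (w s))) t
        + k⁻¹ • prim (w t) • (emb (ρ (t + k)) - emb (ρ t)) := by
  have h1 : ∀ a b : CI, a • emb b = b • emb a := fun a b => by
    rw [← emb_mul, ← emb_mul, mul_comm]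
  have h2 : ∀ (a : CI) (r : ℝ) (F : L2), a • r • F = r • a • F := fun a r F => by
    module
  rw [tdq, tdq, smul_sub (prim (w t)), h1 (prim (w t)), h1 (prim (w t)), h2, smul_sub (ρ (t + k))]
  module

theorem norm_tdq_density_le (hs : LinSys ν c C T u₀ ûx φ w wb j g G ρ κ b) {t k : ℝ} (hk : 0 < k)
    (h0 : 0 ≤ t) (hT : t + k ≤ T) :
    ‖k⁻¹ • prim (w t) • (emb (ρ (t + k)) - emb (ρ t))‖ ≤ C * ‖w t‖ := by
  rw [norm_smul, norm_inv, Real.norm_of_nonneg hk.le, inv_mul_le_iff₀ hk]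
  refine (norm_csmul_le _ _).trans ?_
  have := mul_le_mul (norm_prim_le (w t)) (hs.norm_sub_density_le hk h0 hT) (norm_nonneg _)
    (norm_nonneg _)
  linarith

theorem norm_stress_le (hs : LinSys ν c C T u₀ ûx φ w wb j g G ρ κ b) {t k : ℝ} (hk : 0 < k)
    (h0 : 0 ≤ t) (hT : t + k ≤ T) :
    ‖stress k w g ρ t‖ ≤ ‖avg k g t‖ + C * ‖tdq k (fun s => emb (prim (w s))) t‖ + C * ‖w t‖ := by
  rw [stress, tdq_momentum, ← add_assoc]
  refine (norm_add₃_le).trans ?_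
  gcongr
  · exact (norm_csmul_le _ _).trans (by gcongr; exact hs.ρ_le _)
  · exact hs.norm_tdq_density_le hk h0 hT

/-- The average is differentiable in time even though w is only continuous. Its derivative is a time
quotient of w, and an integration by parts moves the x-derivative from that quotient onto the
averaged w, leaving the stress against the time quotient of v. -/
theorem hasDerivAt_half_sq_avg (hs : LinSys ν c C T u₀ ûx φ w wb j g G ρ κ b) {t k : ℝ}
    (hk : 0 < k) (h0 : 0 ≤ t) (hT : t + k ≤ T) :
    HasDerivAt (fun s => ν / 2 * ‖avg k w s‖ ^ 2)
      (-inner ℝ (stress k w g ρ t) (tdq k (fun s => emb (prim (w s))) t)) t := by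
  have h1 := ((hasDerivAt_avg hs.cont_w k t).norm_sq).const_mul (ν / 2)
  refine h1.congr_deriv ?_
  have h2 : prim (k⁻¹ • (w (t + k) - w t)) 1 = 0 := by
    rw [map_smul, map_sub, ContinuousMap.smul_apply, ContinuousMap.sub_apply, hs.prim_w, hs.prim_w]
    simp
  have h3 : emb (prim (k⁻¹ • (w (t + k) - w t))) = tdq k (fun s => emb (prim (w s))) t := by
    rw [tdq, map_smul, map_smul, map_sub, map_sub]
  have h4 : ν * inner ℝ (avg k w t) (k⁻¹ • (w (t + k) - w t))
      = -inner ℝ (stress k w g ρ t) (tdq k (fun s => emb (prim (w s))) t) := by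
    rw [← real_inner_smul_left, hs.smul_avg_eq hk h0 hT, inner_meanFree _ _ h2,
      inner_emb_prim_of_eq_zero _ _ h2, h3]
  rw [← h4]
  ring

/-- The stress contains ρ(t+k) times the time quotient of v, which gives the dissipation; the
increment of ρ contributes only C‖w‖. -/
theorem avg_deriv_le (hs : LinSys ν c C T u₀ ûx φ w wb j g G ρ κ b) {t k : ℝ}
    (hk : 0 < k) (h0 : 0 ≤ t) (hT : t + k ≤ T) :
    -inner ℝ (stress k w g ρ t) (tdq k (fun s => emb (prim (w s))) t) ≤
      -c * ‖tdq k (fun s => emb (prim (w s))) t‖ ^ 2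
      + (‖avg k g t‖ + C * ‖w t‖) * ‖tdq k (fun s => emb (prim (w s))) t‖ := by
  set d := tdq k (fun s => emb (prim (w s))) t with hd
  have e : stress k w g ρ t
      = ρ (t + k) • d + (avg k g t + k⁻¹ • prim (w t) • (emb (ρ (t + k)) - emb (ρ t))) := by
    rw [stress, tdq_momentum]; abel
  rw [e, inner_add_left]
  have h1 := le_csmul_inner_self (hs.le_ρ (t + k)) d
  have h2 := neg_le_abs
    (inner ℝ (avg k g t + k⁻¹ • prim (w t) • (emb (ρ (t + k)) - emb (ρ t))) d)
  have h3 := abs_real_inner_le_norm (avg k g t + k⁻¹ • prim (w t) • (emb (ρ (t + k)) - emb (ρ t))) d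
  have h4 := (norm_add_le (avg k g t) (k⁻¹ • prim (w t) • (emb (ρ (t + k)) - emb (ρ t)))).trans
    (add_le_add_right (hs.norm_tdq_density_le hk h0 hT) _)
  have h5 := mul_le_mul_of_nonneg_right h4 (norm_nonneg d)
  linarith

/-- ν times the averaged w is a mean-free continuous function A, so A vanishes somewhere and
interpolation bounds sup|A|² by the norms of A and of its derivative, the stress. The small part of
w is the averaging error. -/
theorem splitBound_w (hs : LinSys ν c C T u₀ ûx φ w wb j g G ρ κ b) {t k : ℝ}
    (hk : 0 < k) (h0 : 0 ≤ t) (hT : t + k ≤ T) :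
    ∃ Y, SplitBound (w t) Y ‖avg k w t - w t‖ ∧
      Y ^ 2 ≤ 4 / ν * (‖avg k w t‖ * ‖stress k w g ρ t‖) := by
  have hν := hs.hν
  set ζ := stress k w g ρ t
  set A : CI := cst (-(prim (emb (prim ζ)) 1)) + prim ζ with hA
  have h1 : emb A = ν • avg k w t := by
    rw [hs.smul_avg_eq hk h0 hT, meanFree_apply, hA, map_add, emb_apply (cst _), cst_csmul,
      neg_smul]
    abel
  have h2 : prim (emb A) 1 = 0 := by
    rw [h1, map_smul, ContinuousMap.smul_apply, hs.prim_avg, smul_zero]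
  obtain ⟨x₀, hx₀⟩ := exists_zero_of_mean_zero A h2
  have h3 := norm_sq_le_of_zero _ _ x₀ hx₀
  rw [← hA, h1, norm_smul, Real.norm_of_nonneg hν.le] at h3
  refine ⟨ν⁻¹ * ‖A‖, ⟨avg k w t, ?_, (norm_sub_rev _ _).le⟩, ?_⟩
  · have h4 : avg k w t = ν⁻¹ • emb A := by rw [h1, smul_smul, inv_mul_cancel₀ hν.ne', one_smul]
    rw [h4]
    filter_upwards [Lp.coeFn_smul ν⁻¹ (emb A), coeFn_emb A] with x hx hx'
    rw [hx, Pi.smul_apply, hx', smul_eq_mul, abs_mul, abs_of_pos (inv_pos.2 hν)]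
    gcongr
    exact abs_ex_le _ _
  · rw [mul_pow]
    calc ν⁻¹ ^ 2 * ‖A‖ ^ 2 ≤ ν⁻¹ ^ 2 * (4 * (ν * ‖avg k w t‖ * ‖ζ‖)) := by gcongr
      _ = _ := by field_simp

end LinSys

/-! ### Absorption of error terms -/

/-- Absorption of the error terms in the sum of the three energy estimates. -/
theorem exists_absorption {a K : ℝ} (ha : 0 < a) (hK : 1 ≤ K) :
    ∃ l₁ > 0, ∃ l₀ > 0, ∃ ε > 0, ∃ c₁ > 0, ∃ M > 0, ∀ p o n d f v Y η X₀ X₁ X₂ : ℝ,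
      0 ≤ p → 0 ≤ o → 0 ≤ d → 0 ≤ v → 0 ≤ η →
      X₂ ≤ -a * n ^ 2 + K * (o ^ 2 + f ^ 2 + Y ^ 2) + K * (ε * (Y ^ 2 + n ^ 2 + p ^ 2)) + η →
      X₁ ≤ -a * d ^ 2 + K * (p ^ 2 + o ^ 2) + η →
      X₀ ≤ -a * o ^ 2 + K * (v ^ 2 + v * p) + η →
      Y ^ 2 ≤ K * (o * (p + o + d)) + η →
      p ^ 2 ≤ K * (n ^ 2 + o ^ 2) →
      X₂ + l₁ * X₁ + l₀ * X₀ ≤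
        -c₁ * (p ^ 2 + o ^ 2 + n ^ 2 + d ^ 2) + M * (f ^ 2 + v ^ 2) + M * η := by
  have hK0 : 0 < K := by linarith
  -- In use p, o, n, d are the norms of φ, w, N and the time quotient of v, f and v those of the
  -- primitives of φ and w, and Y bounds w pointwise. The constant l₁ is small enough for l₁Kp² to
  -- be absorbed through p² ≤ K(n² + o²). Then l₀ is large enough to dominate Bo², where B collects
  -- every coefficient of o², including the one of order 1/l₁ from Young's inequality for od.
  set l₁ := a / (8 * K ^ 2) with hl₁
  have hl₁0 : 0 < l₁ := by positivity
  set B := K + K ^ 2 + 2 * K ^ 2 + 8 * K ^ 5 / a + a + 2 * K ^ 4 / (l₁ * a) + l₁ * K with hB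
  have hB0 : 0 < B := by positivity
  set l₀ := (B + 1) / a with hl₀
  have hl₀0 : 0 < l₀ := by positivity
  set ε := min 1 (a / (4 * K * (1 + K))) with hε
  have hε0 : 0 < ε := by positivity
  set m := min (3 * a / 8) 1 with hm
  have hm0 : 0 < m := by positivity
  set c₁ := min (min (m / 2) (m / (2 * K))) (l₁ * a / 2) with hc₁
  have hc₁0 : 0 < c₁ := by positivity
  set M := K + 1 + 2 * K + l₁ + l₀ + l₀ * K + 2 * l₀ ^ 2 * K ^ 3 / a with hM
  refine ⟨l₁, hl₁0, l₀, hl₀0, ε, hε0, c₁, hc₁0, M, by positivity, ?_⟩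
  intro p o n d f v Y η X₀ X₁ X₂ hp ho hd hv hη h2 h1 h0 hY hpn
  have e1 : K * (ε * (Y ^ 2 + n ^ 2 + p ^ 2)) ≤ K * Y ^ 2 + a / 4 * n ^ 2 + K ^ 2 * o ^ 2 := by
    have g1 : ε * Y ^ 2 ≤ 1 * Y ^ 2 := by gcongr; exact min_le_left _ _
    have g2 : ε * (K * o ^ 2) ≤ 1 * (K * o ^ 2) := by gcongr; exact min_le_left _ _
    have g3 : ε * ((1 + K) * n ^ 2) ≤ a / (4 * K * (1 + K)) * ((1 + K) * n ^ 2) := by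
      gcongr; exact min_le_right _ _
    have g4 : K * (a / (4 * K * (1 + K)) * ((1 + K) * n ^ 2)) = a / 4 * n ^ 2 := by
      field_simp
    have g5 : ε * p ^ 2 ≤ ε * (K * (n ^ 2 + o ^ 2)) := by gcongr
    calc K * (ε * (Y ^ 2 + n ^ 2 + p ^ 2))
        ≤ K * (1 * Y ^ 2 + a / (4 * K * (1 + K)) * ((1 + K) * n ^ 2) + 1 * (K * o ^ 2)) := by
          gcongr; linarith
      _ = K * Y ^ 2 + K * (a / (4 * K * (1 + K)) * ((1 + K) * n ^ 2)) + K ^ 2 * o ^ 2 := by ring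
      _ = _ := by rw [g4]
  have e2 : 2 * K ^ 2 * (o * p) ≤ a / 8 * (n ^ 2 + o ^ 2) + 8 * K ^ 5 / a * o ^ 2 := by
    have g1 : a / (8 * K) * p ^ 2 + 8 * K ^ 5 / a * o ^ 2 - 2 * K ^ 2 * (o * p)
        = a / (8 * K) * (p - 8 * K ^ 3 / a * o) ^ 2 := by field_simp; ring
    have g2 : 0 ≤ a / (8 * K) * (p - 8 * K ^ 3 / a * o) ^ 2 := by positivity
    have g3 : a / (8 * K) * p ^ 2 ≤ a / (8 * K) * (K * (n ^ 2 + o ^ 2)) := by gcongr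
    have g4 : a / (8 * K) * (K * (n ^ 2 + o ^ 2)) = a / 8 * (n ^ 2 + o ^ 2) := by field_simp
    linarith
  have e3 : 2 * K ^ 2 * (o * d) ≤ l₁ * a / 2 * d ^ 2 + 2 * K ^ 4 / (l₁ * a) * o ^ 2 := by
    have g1 : l₁ * a / 2 * d ^ 2 + 2 * K ^ 4 / (l₁ * a) * o ^ 2 - 2 * K ^ 2 * (o * d)
        = l₁ * a / 2 * (d - 2 * K ^ 2 / (l₁ * a) * o) ^ 2 := by field_simp; ring
    have g2 : 0 ≤ l₁ * a / 2 * (d - 2 * K ^ 2 / (l₁ * a) * o) ^ 2 := by positivity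
    linarith
  have e4 : l₁ * (K * p ^ 2) ≤ a / 8 * (n ^ 2 + o ^ 2) := by
    calc l₁ * (K * p ^ 2) ≤ l₁ * (K * (K * (n ^ 2 + o ^ 2))) := by gcongr
      _ = _ := by rw [hl₁]; field_simp
  have e5 : l₀ * (K * (v * p)) ≤ a / 8 * (n ^ 2 + o ^ 2) + 2 * l₀ ^ 2 * K ^ 3 / a * v ^ 2 := by
    have g1 : a / (8 * K) * p ^ 2 + 2 * l₀ ^ 2 * K ^ 3 / a * v ^ 2 - l₀ * (K * (v * p))
        = a / (8 * K) * (p - 4 * l₀ * K ^ 2 / a * v) ^ 2 := by field_simp; ring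
    have g2 : 0 ≤ a / (8 * K) * (p - 4 * l₀ * K ^ 2 / a * v) ^ 2 := by positivity
    have g3 : a / (8 * K) * p ^ 2 ≤ a / (8 * K) * (K * (n ^ 2 + o ^ 2)) := by gcongr
    have g4 : a / (8 * K) * (K * (n ^ 2 + o ^ 2)) = a / 8 * (n ^ 2 + o ^ 2) := by field_simp
    linarith
  have e6 : 2 * K * Y ^ 2 ≤ 2 * K ^ 2 * (o * p) + 2 * K ^ 2 * o ^ 2 + 2 * K ^ 2 * (o * d)
      + 2 * K * η := by
    have := mul_le_mul_of_nonneg_left hY (by positivity : 0 ≤ 2 * K)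
    linarith
  have e7 : l₀ * a = B + 1 := by rw [hl₀]; field_simp
  have h1' := mul_le_mul_of_nonneg_left h1 hl₁0.le
  have h0' := mul_le_mul_of_nonneg_left h0 hl₀0.le
  have e8 : l₀ * (-a * o ^ 2) = -(B + 1) * o ^ 2 := by rw [← e7]; ring
  have hmain : X₂ + l₁ * X₁ + l₀ * X₀ ≤ -(3 * a / 8) * n ^ 2 - o ^ 2 - l₁ * a / 2 * d ^ 2
      + (K + l₀ * K + 2 * l₀ ^ 2 * K ^ 3 / a) * (f ^ 2 + v ^ 2) + (1 + 2 * K + l₁ + l₀) * η := by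
    have k1 : 0 ≤ (l₀ * K + 2 * l₀ ^ 2 * K ^ 3 / a) * f ^ 2 := by positivity
    have k2 : 0 ≤ K * v ^ 2 := by positivity
    have k3 : B * o ^ 2 = K * o ^ 2 + K ^ 2 * o ^ 2 + 2 * K ^ 2 * o ^ 2 + 8 * K ^ 5 / a * o ^ 2
      + a * o ^ 2 + 2 * K ^ 4 / (l₁ * a) * o ^ 2 + l₁ * K * o ^ 2 := by rw [hB]; ring
    have k4 : 0 ≤ a * o ^ 2 := by positivity
    have k5 : 0 ≤ a * n ^ 2 := by positivity
    linarith
  have f1 : c₁ * n ^ 2 ≤ m / 2 * n ^ 2 := by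
    gcongr; exact (min_le_left _ _).trans (min_le_left _ _)
  have f2 : c₁ * o ^ 2 ≤ m / 2 * o ^ 2 := by
    gcongr; exact (min_le_left _ _).trans (min_le_left _ _)
  have f3 : c₁ * p ^ 2 ≤ m / 2 * (n ^ 2 + o ^ 2) := by
    calc c₁ * p ^ 2 ≤ m / (2 * K) * (K * (n ^ 2 + o ^ 2)) := by
          gcongr; exact (min_le_left _ _).trans (min_le_right _ _)
      _ = _ := by field_simp
  have f4 : c₁ * d ^ 2 ≤ l₁ * a / 2 * d ^ 2 := by
    gcongr; exact min_le_right _ _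
  have f5 : m * n ^ 2 ≤ 3 * a / 8 * n ^ 2 := by gcongr; exact min_le_left _ _
  have f6 : m * o ^ 2 ≤ 1 * o ^ 2 := by gcongr; exact min_le_right _ _
  have f7 : (K + l₀ * K + 2 * l₀ ^ 2 * K ^ 3 / a) * (f ^ 2 + v ^ 2) ≤ M * (f ^ 2 + v ^ 2) := by
    gcongr; rw [hM]; linarith
  have f8 : (1 + 2 * K + l₁ + l₀) * η ≤ M * η := by
    have : 0 ≤ K + l₀ * K + 2 * l₀ ^ 2 * K ^ 3 / a := by positivity
    gcongr; rw [hM]; linarith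
  linarith

theorem ae_abs_le_norm_le {F : L2} {Y : ℝ} (hY : 0 ≤ Y) (h : ∀ᵐ x ∂leb, |F x| ≤ Y) : ‖F‖ ≤ Y := by
  have h1 := Lp.norm_le_of_ae_bound (p := 2) hY (f := F) h
  simpa [measureUnivNNReal] using h1

-- The reduction to `exists_absorption` replaces o by O = o + η, which also bounds the norm of the
-- averaged w. With ek ≤ ηh all other errors are at most a constant times A²η, A being a bound for
-- the norms.
set_option maxHeartbeats 2000000 in
theorem exists_absorption_of_errors {ν c C : ℝ} (hν : 0 < ν) (hc : 0 < c) (hC : 0 ≤ C) :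
    ∃ l₁ > 0, ∃ l₀ > 0, ∃ ε > 0, ∃ c₁ > 0, ∃ M > 0,
      ∀ p o n d f v Y Y' e' ek gk wk ζ Er h A η X₀ X₁ X₂ : ℝ,
      0 ≤ p → 0 ≤ o → 0 ≤ n → 0 ≤ d → 0 ≤ f → 0 ≤ v → 0 ≤ ζ → 0 ≤ e' → 0 ≤ η → η ≤ 1 →
      1 ≤ A → 0 < h → h ≤ 1 → p ≤ A → n ≤ A → o ≤ A →
      e' ≤ ek → ek ≤ η * h → wk ≤ o + ek → gk ≤ C * (p + o) + η → Er ≤ η →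
      ζ ≤ gk + C * d + C * o → Y ^ 2 ≤ 4 / ν * (wk * ζ) →
      Y' * (n ^ 2 + p ^ 2) ≤ (C + ν + 1) * (ε * (Y ^ 2 + n ^ 2 + p ^ 2)) →
      p ^ 2 ≤ 2 / ν ^ 2 * (1 + C ^ 2) * (n ^ 2 + o ^ 2) →
      X₂ ≤ -(c ^ 2 / 4) * n ^ 2
        + (C ^ 4 + 4 * C ^ 4 / c ^ 2 + 2 * C ^ 2 * ν ^ 2 / c * (8 / c * (1 + C ^ 2)))
          * (o ^ 2 + f ^ 2 + Y ^ 2)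
        + (2 * C + 2 * C ^ 2 * ν ^ 2 / c) * (Y' * (n ^ 2 + p ^ 2))
        + (C * n * Er + 3 * C * e' / h * n ^ 2
          + 2 * C ^ 2 * ν ^ 2 / c * (e' / h * p ^ 2 + 2 * ek / h * p)) →
      X₁ ≤ -c * d ^ 2 + (gk + C * o) * d →
      X₀ ≤ -(2 * ν) * o ^ 2 + 2 * C * (p + o) * v + C * o * v →
      X₂ + l₁ * X₁ + l₀ * X₀ ≤
        -c₁ * (p ^ 2 + o ^ 2 + n ^ 2 + d ^ 2) + M * (f ^ 2 + v ^ 2) + M * (A ^ 2 * η) := by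
  set Λ := 2 * C ^ 2 * ν ^ 2 / c with hΛ
  have hΛ0 : 0 ≤ Λ := by positivity
  set a := min (min (c ^ 2 / 4) (c / 2)) ν with ha
  have ha0 : 0 < a := by positivity
  set K₂ := C ^ 4 + 4 * C ^ 4 / c ^ 2 + Λ * (8 / c * (1 + C ^ 2)) with hK₂
  have hK₂0 : 0 ≤ K₂ := by positivity
  set Kε := (2 * C + Λ) * (C + ν + 1) with hKε
  have hKε0 : 0 ≤ Kε := by positivity
  set KY := 4 / ν * (2 * C) with hKY
  have hKY0 : 0 ≤ KY := by positivity
  set Kp := 2 / ν ^ 2 * (1 + C ^ 2) with hKp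
  have hKp0 : 0 ≤ Kp := by positivity
  set K := 1 + K₂ + Kε + 8 * C ^ 2 / c + 2 * C + 9 * C ^ 2 / (4 * ν) + KY + Kp with hK
  have t1 : 0 ≤ 8 * C ^ 2 / c := by positivity
  have t2 : 0 ≤ 9 * C ^ 2 / (4 * ν) := by positivity
  obtain ⟨l₁, hl₁, l₀, hl₀, ε, hε, c₁, hc₁, M, hM, habs⟩ :=
    exists_absorption (a := a) (K := K) ha0 (by rw [hK]; linarith)
  set Kη := 4 * C + 3 * Λ + 1 / c + 3 * a + 8 / ν with hKη
  have t3 : 0 ≤ 1 / c := by positivity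
  have t4 : 0 ≤ 8 / ν := by positivity
  have hKη0 : 0 < Kη := by rw [hKη]; linarith
  refine ⟨l₁, hl₁, l₀, hl₀, ε, hε, c₁, hc₁, M + M * Kη, by positivity, ?_⟩
  intro p o n d f v Y Y' e' ek gk wk ζ Er h A η X₀ X₁ X₂ hp0 ho0 hn0 hd0 hf0 hv0 hζ0 he' hη0 hη1
    hA hh hh1 hφA hNA hwA hee hew hwk hgk hsp hζ hYY hY' hpn hX2 hX1 hX0
  have hA2 : 1 ≤ A ^ 2 := one_le_pow₀ hA
  have hAA : A ≤ A ^ 2 := le_self_pow₀ hA two_ne_zero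
  have hη2 : η ^ 2 ≤ η := pow_le_of_le_one hη0 hη1 two_ne_zero
  have heη : ek ≤ η := hew.trans (mul_le_of_le_one_right hη0 hh1)
  have ha1 : a ≤ c ^ 2 / 4 := (min_le_left _ _).trans (min_le_left _ _)
  have ha2 : a ≤ c / 2 := (min_le_left _ _).trans (min_le_right _ _)
  have ha3 : a ≤ ν := min_le_right _ _
  set O := o + η with hO
  have hO0 : 0 ≤ O := by positivity
  have hoO : o ^ 2 ≤ O ^ 2 := by gcongr; linarith
  have hAη : η ≤ A ^ 2 * η := le_mul_of_one_le_left hη0 hA2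
  have hKA : ∀ x : ℝ, 0 ≤ x → x ≤ Kη → x * (A ^ 2 * η) ≤ Kη * (A ^ 2 * η) := fun x _ hx => by
    gcongr
  have hwn : wk ≤ O := by linarith
  have hgn' : gk ≤ C * (p + o) + η := by linarith
  have r2 : X₂ ≤
      -a * n ^ 2 + K * (O ^ 2 + f ^ 2 + Y ^ 2) + K * (ε * (Y ^ 2 + n ^ 2 + p ^ 2))
        + Kη * (A ^ 2 * η) := by
    have q1 : -(c ^ 2 / 4) * n ^ 2 ≤ -a * n ^ 2 := by
      have := mul_le_mul_of_nonneg_right ha1 (sq_nonneg n); linarith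
    have q2 : K₂ * (o ^ 2 + f ^ 2 + Y ^ 2) ≤ K * (O ^ 2 + f ^ 2 + Y ^ 2) := by
      gcongr
      rw [hK]; linarith
    have q3 : (2 * C + Λ) * (Y' * (n ^ 2 + p ^ 2)) ≤ K * (ε * (Y ^ 2 + n ^ 2 + p ^ 2)) := by
      calc _ ≤ (2 * C + Λ) * ((C + ν + 1) * (ε * (Y ^ 2 + n ^ 2 + p ^ 2))) := by gcongr
        _ = Kε * (ε * (Y ^ 2 + n ^ 2 + p ^ 2)) := by rw [hKε]; ring
        _ ≤ _ := by gcongr; rw [hK]; linarith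
    have he'h : e' / h ≤ η := by
      rw [div_le_iff₀ hh]; exact hee.trans hew
    have heh : ek / h ≤ η := by
      rw [div_le_iff₀ hh]; exact hew
    have hnA : n ^ 2 ≤ A ^ 2 := by gcongr
    have hpA : p ^ 2 ≤ A ^ 2 := by gcongr
    have he'0 : 0 ≤ e' / h := div_nonneg he' hh.le
    have q4 : C * n * Er ≤ C * (A ^ 2 * η) := by
      calc C * n * Er ≤ C * n * η := by gcongr
        _ = C * (n * η) := by ring
        _ ≤ _ := by gcongr; linarith
    have q5 : 3 * C * e' / h * n ^ 2 ≤ 3 * C * (A ^ 2 * η) := by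
      calc 3 * C * e' / h * n ^ 2 = 3 * C * (n ^ 2 * (e' / h)) := by ring
        _ ≤ _ := by gcongr
    have q6 : Λ * (e' / h * p ^ 2 + 2 * ek / h * p) ≤ 3 * Λ * (A ^ 2 * η) := by
      have q7 : e' / h * p ^ 2 ≤ A ^ 2 * η := by
        rw [mul_comm]; gcongr
      have q8 : 2 * ek / h * p ≤ 2 * (A ^ 2 * η) := by
        calc _ = 2 * (p * (ek / h)) := by ring
          _ ≤ _ := by
            have := div_nonneg (he'.trans hee) hh.le
            gcongr
            linarith
      calc _ ≤ Λ * (A ^ 2 * η + 2 * (A ^ 2 * η)) := by gcongr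
        _ = _ := by ring
    have q9 : (4 * C + 3 * Λ) * (A ^ 2 * η) ≤ Kη * (A ^ 2 * η) :=
      hKA _ (by positivity) (by rw [hKη]; linarith)
    refine hX2.trans ?_
    linarith
  have r1 : X₁ ≤
      -a * d ^ 2 + K * (p ^ 2 + O ^ 2) + Kη * (A ^ 2 * η) := by
    have q1 : (gk + C * o) * d ≤ (2 * C * (p + o) + η) * d := by
      have : 0 ≤ C * p := by positivity
      exact mul_le_mul_of_nonneg_right (by linarith) hd0
    have q2 : (2 * C * (p + o) + η) * d ≤
        c / 2 * d ^ 2 + 1 / (2 * c) * (2 * C * (p + o) + η) ^ 2 := by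
      have : c / 2 * d ^ 2 + 1 / (2 * c) * (2 * C * (p + o) + η) ^ 2 - (2 * C * (p + o) + η) * d
        = c / 2 * (d - (2 * C * (p + o) + η) / c) ^ 2 := by field_simp; ring
      have q : 0 ≤ c / 2 * (d - (2 * C * (p + o) + η) / c) ^ 2 := by positivity
      linarith
    have q3 : (2 * C * (p + o) + η) ^ 2 ≤ 16 * C ^ 2 * (p ^ 2 + o ^ 2) + 2 * η := by
      have k1 := sq_nonneg (2 * C * (p + o) - η)
      have k2 : 0 ≤ C ^ 2 * (p - o) ^ 2 := by positivity
      linarith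
    have q4 : 1 / (2 * c) * (2 * C * (p + o) + η) ^ 2 ≤ 8 * C ^ 2 / c * (p ^ 2 + o ^ 2) + 1 / c * η := by
      calc _ ≤ 1 / (2 * c) * (16 * C ^ 2 * (p ^ 2 + o ^ 2) + 2 * η) := by gcongr
        _ = _ := by field_simp; ring
    have q5 : 8 * C ^ 2 / c * (p ^ 2 + o ^ 2) ≤ K * (p ^ 2 + O ^ 2) := by
      gcongr
      rw [hK]; linarith
    have q6 : 1 / c * η ≤ Kη * (A ^ 2 * η) := by
      calc _ ≤ 1 / c * (A ^ 2 * η) := by gcongr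
        _ ≤ _ := hKA _ t3 (by rw [hKη]; linarith)
    have q7 : a * d ^ 2 ≤ c / 2 * d ^ 2 := by gcongr
    linarith
  have r0 : X₀ ≤
      -a * O ^ 2 + K * (v ^ 2 + v * p) + Kη * (A ^ 2 * η) := by
    have q1 : 3 * C * o * v ≤ ν * o ^ 2 + 9 * C ^ 2 / (4 * ν) * v ^ 2 := by
      have : ν * o ^ 2 + 9 * C ^ 2 / (4 * ν) * v ^ 2 - 3 * C * o * v
        = ν * (o - 3 * C / (2 * ν) * v) ^ 2 := by field_simp; ring
      have q : 0 ≤ ν * (o - 3 * C / (2 * ν) * v) ^ 2 := by positivity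
      linarith
    have q2 : 9 * C ^ 2 / (4 * ν) * v ^ 2 ≤ K * v ^ 2 := by
      gcongr
      rw [hK]; linarith
    have q3 : 2 * C * (v * p) ≤ K * (v * p) := by
      gcongr
      rw [hK]; linarith
    have q4 : a * O ^ 2 ≤ ν * o ^ 2 + 3 * a * (A ^ 2 * η) := by
      have k1 : a * o ^ 2 ≤ ν * o ^ 2 := by gcongr
      have k2 : o * η ≤ A ^ 2 * η := by gcongr; linarith
      have k3 : a * (2 * (o * η) + η ^ 2) ≤ a * (3 * (A ^ 2 * η)) := by gcongr; linarith
      rw [hO]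
      linarith
    have q5 : 3 * a * (A ^ 2 * η) ≤ Kη * (A ^ 2 * η) :=
      hKA _ (by positivity) (by rw [hKη]; linarith)
    refine hX0.trans ?_
    linarith
  have rY : Y ^ 2 ≤ K * (O * (p + O + d)) + Kη * (A ^ 2 * η) := by
    have q1 : ζ ≤ 2 * C * (p + O + d) + η := by
      have k1 : 0 ≤ C * p := by positivity
      have k2 : 0 ≤ C * d := by positivity
      have k3 : 0 ≤ C * η := by positivity
      have k4 : C * O = C * o + C * η := by rw [hO]; ring
      linarith
    have q2 : wk * ζ ≤ O * (2 * C * (p + O + d) + η) := mul_le_mul hwn q1 hζ0 hO0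
    have q3 : O * η ≤ 2 * (A ^ 2 * η) := by
      have k2 : o * η ≤ A ^ 2 * η := by gcongr; linarith
      rw [hO]
      linarith
    have q4 : KY * (O * (p + O + d)) ≤ K * (O * (p + O + d)) := by
      gcongr
      rw [hK]; linarith
    have q5 : 8 / ν * (A ^ 2 * η) ≤ Kη * (A ^ 2 * η) := hKA _ t4 (by rw [hKη]; linarith)
    calc Y ^ 2 ≤ 4 / ν * (wk * ζ) := hYY
      _ ≤ 4 / ν * (O * (2 * C * (p + O + d) + η)) := by gcongr
      _ = KY * (O * (p + O + d)) + 4 / ν * (O * η) := by rw [hKY]; ring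
      _ ≤ KY * (O * (p + O + d)) + 4 / ν * (2 * (A ^ 2 * η)) := by gcongr
      _ = KY * (O * (p + O + d)) + 8 / ν * (A ^ 2 * η) := by ring
      _ ≤ _ := add_le_add q4 q5
  have rp : p ^ 2 ≤ K * (n ^ 2 + O ^ 2) := by
    refine hpn.trans ?_
    gcongr
    rw [hK]; linarith
  have key := habs p O n d f v Y (Kη * (A ^ 2 * η)) _ _ _ hp0 hO0 hd0 hv0 (by positivity)
    r2 r1 r0 rY rp
  refine key.trans ?_
  have z1 : c₁ * o ^ 2 ≤ c₁ * O ^ 2 := by gcongr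
  have z2 : 0 ≤ M * Kη * (f ^ 2 + v ^ 2) := by positivity
  have z3 : 0 ≤ M * (A ^ 2 * η) := by positivity
  linarith

/-! ### Dissipation for the linear system -/

namespace LinSys

/-- Smallness of the perturbation: either `‖φ‖, ‖w‖ ≤ ε` and `w` is itself the perturbation of the
velocity gradient, or the latter is uniformly bounded by `ε`. -/
def Small (ε T : ℝ) (φ w wb : ℝ → L2) : Prop :=
  (∀ t ∈ Icc 0 T, wb t = w t ∧ ‖φ t‖ ≤ ε ∧ ‖w t‖ ≤ ε) ∨
    (0 ≤ ε ∧ ∀ t ∈ Icc 0 T, ∀ᵐ x ∂leb, |wb t x| ≤ ε)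

theorem Small.norm_le {ε T : ℝ} {φ w wb : ℝ → L2} (h : Small ε T φ w wb) {t : ℝ}
    (ht : t ∈ Icc 0 T) : ‖wb t‖ ≤ ε := by
  rcases h with h | h
  · rw [(h t ht).1]; exact (h t ht).2.2
  · exact ae_abs_le_norm_le h.1 (h.2 t ht)

theorem Small.mono {ε ε' T : ℝ} {φ w wb : ℝ → L2} (h : Small ε T φ w wb) (hε : ε ≤ ε') :
    Small ε' T φ w wb := by
  rcases h with h | h
  · exact Or.inl fun t ht => ⟨(h t ht).1, (h t ht).2.1.trans hε, (h t ht).2.2.trans hε⟩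
  · exact Or.inr ⟨h.1.trans hε, fun t ht => (h.2 t ht).mono fun x hx => hx.trans hε⟩

variable {ν c C T u₀ : ℝ} {ûx : CI} {φ w wb j g G : ℝ → L2} {ρ κ b : ℝ → CI}

/-- The space derivative of the effective flux. -/
def eff (ν : ℝ) (φ w : ℝ → L2) (ρ : ℝ → CI) (t : ℝ) : L2 := ρ t • emb (prim (w t)) + ν • φ t

theorem norm_momentum_le (hs : LinSys ν c C T u₀ ûx φ w wb j g G ρ κ b) (t : ℝ) :
    ‖ρ t • emb (prim (w t))‖ ≤ C * ‖w t‖ :=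
  (norm_csmul_le _ _).trans
    (mul_le_mul (hs.ρ_le t) ((norm_emb_le _).trans (norm_prim_le _)) (norm_nonneg _) hs.C_nonneg)

theorem norm_eff_le (hs : LinSys ν c C T u₀ ûx φ w wb j g G ρ κ b) (t : ℝ) :
    ‖eff ν φ w ρ t‖ ≤ C * ‖w t‖ + ν * ‖φ t‖ := by
  refine (norm_add_le _ _).trans (add_le_add (hs.norm_momentum_le t) ?_)
  rw [norm_smul, Real.norm_of_nonneg hs.hν.le]

theorem norm_φ_le (hs : LinSys ν c C T u₀ ûx φ w wb j g G ρ κ b) (t : ℝ) :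
    ν * ‖φ t‖ ≤ ‖eff ν φ w ρ t‖ + C * ‖w t‖ := by
  have h1 : ν • φ t = eff ν φ w ρ t - ρ t • emb (prim (w t)) := by rw [eff]; abel
  have h2 := norm_sub_le (eff ν φ w ρ t) (ρ t • emb (prim (w t)))
  rw [← h1, norm_smul, Real.norm_of_nonneg hs.hν.le] at h2
  linarith [hs.norm_momentum_le t]

theorem sq_norm_φ_le (hs : LinSys ν c C T u₀ ûx φ w wb j g G ρ κ b) (t : ℝ) :
    ‖φ t‖ ^ 2 ≤ 2 / ν ^ 2 * (1 + C ^ 2) * (‖eff ν φ w ρ t‖ ^ 2 + ‖w t‖ ^ 2) := by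
  have hν := hs.hν
  have h1 := hs.norm_φ_le t
  have hC := hs.C_nonneg
  have h2 : (ν * ‖φ t‖) ^ 2 ≤ (‖eff ν φ w ρ t‖ + C * ‖w t‖) ^ 2 := by gcongr
  have h3 : (‖eff ν φ w ρ t‖ + C * ‖w t‖) ^ 2
      ≤ 2 * (1 + C ^ 2) * (‖eff ν φ w ρ t‖ ^ 2 + ‖w t‖ ^ 2) := by
    have k1 := sq_nonneg (‖eff ν φ w ρ t‖ - C * ‖w t‖)
    have k2 : 0 ≤ C ^ 2 * ‖eff ν φ w ρ t‖ ^ 2 := by positivity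
    have k3 : 0 ≤ ‖w t‖ ^ 2 := by positivity
    linarith
  have h4 := h2.trans h3
  rw [mul_pow, ← le_div_iff₀' (by positivity)] at h4
  refine h4.trans_eq ?_
  field_simp

/-- The right-hand side of the energy identity for the difference quotient with step `h` of the
effective flux, together with the weighted energy near the inflow boundary. -/
def spaceDiss (ν c C u₀ : ℝ) (ûx : CI) (φ w wb G : ℝ → L2) (ρ κ b : ℝ → CI) (h : unitInterval)
    (t : ℝ) : ℝ :=
  -inner ℝ ((cst u₀ + prim (emb ûx)) • dq h (emb (prim (eff ν φ w ρ t))))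
      (dq h ((cst u₀ + prim (emb ûx) + prim (wb t)) • eff ν φ w ρ t
        + emb (prim (κ t • eff ν φ w ρ t + G t))))
    + 2 * C ^ 2 * ν ^ 2 / c * (((h : ℝ) ^ 2)⁻¹ * inner ℝ (ind h (wgt h • emb (prim (φ t))))
      (-((cst u₀ + prim (emb ûx) + prim (wb t)) • φ t + w t + emb (b t * prim (w t)))))

/-- The cubic term Y'(‖N‖² + ‖φ‖²) gains a factor ε in two ways. If wb = w, one factor ‖N‖ or ‖φ‖ is
O(ε) and Young's inequality treats the rest. If |wb| ≤ ε pointwise, then Y' = ε and there is no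
remainder. -/
theorem exists_splitBound {ε : ℝ} (hs : LinSys ν c C T u₀ ûx φ w wb j g G ρ κ b)
    (hsm : Small ε T φ w wb) {t k : ℝ} (hk : 0 < k) (h0 : 0 ≤ t) (hT : t + k ≤ T) :
    ∃ Y Y' e', SplitBound (w t) Y ‖avg k w t - w t‖ ∧ SplitBound (wb t) Y' e' ∧
      e' ≤ ‖avg k w t - w t‖ ∧
      Y ^ 2 ≤ 4 / ν * (‖avg k w t‖ * ‖stress k w g ρ t‖) ∧
      Y' * (‖eff ν φ w ρ t‖ ^ 2 + ‖φ t‖ ^ 2) ≤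
        (C + ν + 1) * (ε * (Y ^ 2 + ‖eff ν φ w ρ t‖ ^ 2 + ‖φ t‖ ^ 2)) := by
  obtain ⟨Y, h1, h2⟩ := hs.splitBound_w hk h0 hT
  have ht : t ∈ Icc 0 T := ⟨h0, by linarith⟩
  have hν := hs.hν
  have hC := hs.C_nonneg
  have hY := h1.nonneg_left
  have hn := norm_nonneg (eff ν φ w ρ t)
  have hp := norm_nonneg (φ t)
  rcases hsm with hsm | hsm
  · obtain ⟨e1, e2, e3⟩ := hsm t ht
    have hε : 0 ≤ ε := hp.trans e2
    refine ⟨Y, Y, _, h1, e1 ▸ h1, le_rfl, h2, ?_⟩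
    have e4 : ‖eff ν φ w ρ t‖ ≤ (C + ν + 1) * ε := by
      have := hs.norm_eff_le t
      have k1 := mul_le_mul_of_nonneg_left e3 hC
      have k2 := mul_le_mul_of_nonneg_left e2 hν.le
      linarith
    have e5 : ‖φ t‖ ≤ (C + ν + 1) * ε := by
      have : 0 ≤ (C + ν) * ε := by positivity
      linarith
    have e6 : Y * ‖eff ν φ w ρ t‖ ^ 2 ≤
        (C + ν + 1) * ε * (1 / 2 * (Y ^ 2 + ‖eff ν φ w ρ t‖ ^ 2)) := by
      calc Y * ‖eff ν φ w ρ t‖ ^ 2 = ‖eff ν φ w ρ t‖ * (Y * ‖eff ν φ w ρ t‖) := by ring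
        _ ≤ _ := mul_le_mul e4 (by linarith [sq_nonneg (Y - ‖eff ν φ w ρ t‖)])
          (mul_nonneg hY hn) (by positivity)
    have e7 : Y * ‖φ t‖ ^ 2 ≤ (C + ν + 1) * ε * (1 / 2 * (Y ^ 2 + ‖φ t‖ ^ 2)) := by
      calc Y * ‖φ t‖ ^ 2 = ‖φ t‖ * (Y * ‖φ t‖) := by ring
        _ ≤ _ := mul_le_mul e5 (by linarith [sq_nonneg (Y - ‖φ t‖)])
          (mul_nonneg hY hp) (by positivity)
    have e8 : 0 ≤ (C + ν + 1) * ε * (‖eff ν φ w ρ t‖ ^ 2 + ‖φ t‖ ^ 2) := by positivity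
    linarith
  · refine ⟨Y, ε, 0, h1, ⟨wb t, hsm.2 t ht, by simp⟩, norm_nonneg _, h2, ?_⟩
    have hε := hsm.1
    have e1 : 0 ≤ (C + ν) * (ε * (Y ^ 2 + ‖eff ν φ w ρ t‖ ^ 2 + ‖φ t‖ ^ 2)) := by positivity
    have e2 : 0 ≤ ε * Y ^ 2 := by positivity
    linarith

/-- The dissipation of the energy functional. -/
theorem exists_dissipation {ν c C : ℝ} (hν : 0 < ν) (hc : 0 < c) (hC : 0 ≤ C) :
    ∃ l₁ > 0, ∃ l₀ > 0, ∃ ε > 0, ∃ c₁ > 0, ∃ M > 0,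
      ∀ (T u₀ : ℝ) (ûx : CI) (φ w wb j g G : ℝ → L2) (ρ κ b : ℝ → CI),
      LinSys ν c C T u₀ ûx φ w wb j g G ρ κ b → Small ε T φ w wb →
      ∀ (A η s k t : ℝ) (h : unitInterval), 1 ≤ A → η ≤ 1 → 0 < (h : ℝ) → 8 * C * h ≤ c →
      0 < k → 0 ≤ t → t + k ≤ T → ‖φ t‖ ≤ A → ‖w t‖ ≤ A → ‖eff ν φ w ρ t‖ ≤ A →
      ‖avg k w t - w t‖ ≤ η * h → ‖avg k g t - g t‖ ≤ η →
      (∀ z ≤ h, ‖shC z ûx - ûx‖ ≤ s) → spaceErr C h s (κ t) (eff ν φ w ρ t) ≤ η →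
      spaceDiss ν c C u₀ ûx φ w wb G ρ κ b h t
        + l₁ * (-inner ℝ (stress k w g ρ t) (tdq k (fun s => emb (prim (w s))) t))
        + l₀ * (-(2 * ν) * ‖w t‖ ^ 2 - 2 * inner ℝ (g t) (emb (prim (w t)))
          + inner ℝ (j t) (emb (prim (w t) * prim (w t)))) ≤
      -c₁ * (‖φ t‖ ^ 2 + ‖w t‖ ^ 2 + ‖eff ν φ w ρ t‖ ^ 2
          + ‖tdq k (fun s => emb (prim (w s))) t‖ ^ 2)
        + M * (‖emb (prim (φ t))‖ ^ 2 + ‖emb (prim (w t))‖ ^ 2) + M * (A ^ 2 * η) := by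
  obtain ⟨l₁, hl₁, l₀, hl₀, ε, hε, c₁, hc₁, M, hM, habs⟩ := exists_absorption_of_errors hν hc hC
  -- The second entry of the minimum gives C‖wb‖ ≤ c²/4, the smallness required by
  -- `space_energy_le`.
  refine ⟨l₁, hl₁, l₀, hl₀, min ε (c ^ 2 / (4 * (C + 1))), by positivity, c₁, hc₁, M, hM, ?_⟩
  intro T u₀ ûx φ w wb j g G ρ κ b hs hsm A η s k t h hA hη1 hh hhc hk h0 hT hφA hwA hNA hew heg hsx
    hsp
  have ht : t ∈ Icc 0 T := ⟨h0, by linarith⟩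
  obtain ⟨Y, Y', e', hsw, hswb, hee, hYY, hY'⟩ :=
    hs.exists_splitBound (hsm.mono (min_le_left _ _)) hk h0 hT
  have hwbn := (hsm.norm_le ht).trans (min_le_right ε (c ^ 2 / (4 * (C + 1))))
  have hCm : C * (c ^ 2 / (4 * (C + 1))) ≤ c ^ 2 / 4 := by
    calc C * (c ^ 2 / (4 * (C + 1))) ≤ (C + 1) * (c ^ 2 / (4 * (C + 1))) := by gcongr; linarith
      _ = _ := by field_simp
  have hX2 := space_energy_le (ν := ν) (N := eff ν φ w ρ t) (v := prim (w t)) (φ := φ t)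
    (G := G t) (b := b t) hc hν rfl rfl rfl rfl hh hhc hs.le_û (hs.le_u t) (hs.le_κ t)
    hs.û_le hs.ûx_le (hs.b_le t) (hs.κ_le t) (hs.ρ_le t) (hs.G_le t) hswb hsw hwbn hCm hsx
  have hwn := norm_add_le (avg k w t - w t) (w t)
  rw [sub_add_cancel] at hwn
  have hgn := norm_add_le (avg k g t - g t) (g t)
  rw [sub_add_cancel] at hgn
  exact habs _ _ _ _ _ _ Y Y' e' _ _ _ _ _ h A η _ _ _ (norm_nonneg _) (norm_nonneg _)
    (norm_nonneg _) (norm_nonneg _) (norm_nonneg _) (norm_nonneg _)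
    (norm_nonneg (stress k w g ρ t)) hswb.nonneg_right ((norm_nonneg _).trans heg) hη1 hA hh h.2.2
    hφA hNA hwA hee hew (by linarith) (by linarith [hs.g_le t]) hsp (hs.norm_stress_le hk h0 hT)
    hYY hY' (hs.sq_norm_φ_le t) hX2 (hs.avg_deriv_le hk h0 hT) (hs.kinetic_deriv_le t)

end LinSys

/-! ### Gronwall's argument and the energy functional -/

theorem exp_mul_add_integral_le {y y' D S : ℝ → ℝ} {θ a M η t : ℝ} (ht : 0 ≤ t)
    (hy : ContinuousOn y (Icc 0 t)) (hy' : ∀ s ∈ Ioo 0 t, HasDerivAt y (y' s) s)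
    (hD : Continuous D) (hS : Continuous S)
    (hb : ∀ s ∈ Ioo 0 t, y' s + θ * y s ≤ -a * D s + M * S s + η) :
    Real.exp (θ * t) * y t + a * (∫ s in (0 : ℝ)..t, Real.exp (θ * s) * D s) ≤
      y 0 + M * (∫ s in (0 : ℝ)..t, Real.exp (θ * s) * S s)
        + η * ∫ s in (0 : ℝ)..t, Real.exp (θ * s) := by
  have he : Continuous fun s => Real.exp (θ * s) := by fun_prop
  have h1 : ∀ s, HasDerivAt (fun s => Real.exp (θ * s)) (θ * Real.exp (θ * s)) s := by
    intro s
    have := ((hasDerivAt_id s).const_mul θ).exp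
    simpa [mul_comm] using this
  -- The derivative of exp(θs)y(s) is integrated, and the dissipation is kept on the left instead of
  -- being discarded: part (ii) needs its time integral.
  have key := intervalIntegral.sub_le_integral_of_hasDeriv_right_of_le ht
    (g := fun s => Real.exp (θ * s) * y s)
    (g' := fun s => θ * Real.exp (θ * s) * y s + Real.exp (θ * s) * y' s)
    (φ := fun s => -a * (Real.exp (θ * s) * D s) + M * (Real.exp (θ * s) * S s)
      + η * Real.exp (θ * s))
    (he.continuousOn.mul hy) (fun s hs => ((h1 s).mul (hy' s hs)).hasDerivWithinAt)
    (Continuous.integrableOn_Icc (by fun_prop)) (fun s hs => by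
      have := mul_le_mul_of_nonneg_left (hb s hs) (Real.exp_pos (θ * s)).le
      linarith)
  rw [intervalIntegral.integral_add (Continuous.intervalIntegrable (by fun_prop) _ _)
    (Continuous.intervalIntegrable (by fun_prop) _ _),
    intervalIntegral.integral_add (Continuous.intervalIntegrable (by fun_prop) _ _)
    (Continuous.intervalIntegrable (by fun_prop) _ _), intervalIntegral.integral_const_mul,
    intervalIntegral.integral_const_mul, intervalIntegral.integral_const_mul] at key
  simp only [mul_zero, Real.exp_zero, one_mul] at key
  linarith

theorem inner_ind_wgt_comm (h : unitInterval) (F G : L2) :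
    inner ℝ (ind h (wgt h • F)) G = inner ℝ F (ind h (wgt h • G)) := by
  rw [inner_ind_comm, csmul_inner, ind_csmul]

theorem inner_ind_wgt_nonneg {h : unitInterval} (F : L2) :
    0 ≤ inner ℝ (ind h (wgt h • F)) F := by
  rw [inner_eq]
  refine integral_nonneg_of_ae ?_
  filter_upwards [coeFn_ind h (wgt h • F), coeFn_csmul (wgt h) F] with x h1 h2
  rw [h1]
  by_cases hx : x ∈ Ioo (0 : ℝ) h
  · rw [indicator_of_mem hx, h2, mul_assoc]
    exact mul_nonneg (by linarith [(wgt_mem hx).1]) (mul_self_nonneg _)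
  · rw [indicator_of_notMem hx]; simp

theorem inner_ind_wgt_le (h : unitInterval) (φ : L2) :
    inner ℝ (ind h (wgt h • emb (prim φ))) (emb (prim φ)) ≤ 2 * ((h : ℝ) * ‖φ‖) ^ 2 := by
  rw [← ind_ind, inner_ind_comm]
  refine (real_inner_le_norm _ _).trans ?_
  have h1 := norm_ind_wgt_le h (emb (prim φ))
  have h2 := norm_ind_emb_prim_le h φ
  have h3 : 0 ≤ (h : ℝ) * ‖φ‖ := (norm_nonneg _).trans h2
  calc _ ≤ (2 * (h * ‖φ‖)) * (h * ‖φ‖) :=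
        mul_le_mul (by linarith) h2 (norm_nonneg _) (by linarith)
    _ = _ := by ring

namespace LinSys

variable {ν c C T u₀ : ℝ} {ûx : CI} {φ w wb j g G : ℝ → L2} {ρ κ b : ℝ → CI}

/-- The energy functional. -/
def energy (ν c C u₀ : ℝ) (ûx : CI) (φ w : ℝ → L2) (ρ : ℝ → CI) (l₁ l₀ : ℝ) (h : unitInterval)
    (k t : ℝ) : ℝ :=
  1 / 2 * inner ℝ ((cst u₀ + prim (emb ûx)) • dq h (emb (prim (eff ν φ w ρ t))))
      (dq h (emb (prim (eff ν φ w ρ t))))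
    + 2 * C ^ 2 * ν ^ 2 / c * (((h : ℝ) ^ 2)⁻¹ *
      (1 / 2 * inner ℝ (ind h (wgt h • emb (prim (φ t)))) (emb (prim (φ t)))))
    + l₁ * (ν / 2 * ‖avg k w t‖ ^ 2)
    + l₀ * inner ℝ (ρ t • emb (prim (w t))) (emb (prim (w t)))

theorem hasDerivWithinAt_energy (hs : LinSys ν c C T u₀ ûx φ w wb j g G ρ κ b) (l₁ l₀ : ℝ)
    (h : unitInterval) {t k : ℝ} (hk : 0 < k) (h0 : 0 ≤ t) (hT : t + k ≤ T) :
    HasDerivWithinAt (energy ν c C u₀ ûx φ w ρ l₁ l₀ h k)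
      (spaceDiss ν c C u₀ ûx φ w wb G ρ κ b h t
        + l₁ * (-inner ℝ (stress k w g ρ t) (tdq k (fun s => emb (prim (w s))) t))
        + l₀ * (-(2 * ν) * ‖w t‖ ^ 2 - 2 * inner ℝ (g t) (emb (prim (w t)))
          + inner ℝ (j t) (emb (prim (w t) * prim (w t))))) (Icc 0 T) t := by
  have ht : t ∈ Icc 0 T := ⟨h0, by linarith⟩
  have h1 := hs.hasDerivWithinAt_dq h ht
  have h1' := hasDerivWithinAt_half_quadratic (fun F => (cst u₀ + prim (emb ûx)) • F)
    (h1.const_smul (cst u₀ + prim (emb ûx))) (fun F G => csmul_inner _ _ _) h1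
  have h2 := hs.transport t ht
  have h2' := hasDerivWithinAt_half_quadratic (fun F => ind h (wgt h • F))
    ((ind h).hasFDerivAt.comp_hasDerivWithinAt t (h2.const_smul (wgt h)))
    (inner_ind_wgt_comm h) h2
  have h3 := ((hs.hasDerivAt_half_sq_avg hk h0 hT).hasDerivWithinAt (s := Icc 0 T)).const_mul l₁
  have h4 := (hs.hasDerivWithinAt_kinetic ht).const_mul l₀
  have h5 := ((h1'.add ((h2'.const_mul ((h : ℝ) ^ 2)⁻¹).const_mul (2 * C ^ 2 * ν ^ 2 / c))).add
    h3).add h4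
  refine h5.congr_deriv ?_
  rw [spaceDiss, inner_neg_right]
  rfl

/-- The factor 1/h² of the boundary-layer energy is harmless, since the primitive of φ has norm at
most h‖φ‖ on (0,h). The bound is therefore uniform in h. -/
theorem energy_le (hs : LinSys ν c C T u₀ ûx φ w wb j g G ρ κ b) {l₁ l₀ : ℝ} (hl₁ : 0 ≤ l₁)
    (hl₀ : 0 ≤ l₀) {h : unitInterval} (hh : 0 < (h : ℝ)) {t k η : ℝ} (hη : η ≤ 1)
    (hw : ‖avg k w t - w t‖ ≤ η) :
    energy ν c C u₀ ûx φ w ρ l₁ l₀ h k t ≤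
      (C + 2 * C ^ 2 * ν ^ 2 / c + l₁ * ν + l₀ * C) *
        (‖φ t‖ ^ 2 + ‖w t‖ ^ 2 + ‖eff ν φ w ρ t‖ ^ 2 + η) := by
  have hC := hs.C_nonneg
  have hν := hs.hν
  have hc := hs.hc
  have hη0 : 0 ≤ η := (norm_nonneg _).trans hw
  have e1 : inner ℝ ((cst u₀ + prim (emb ûx)) • dq h (emb (prim (eff ν φ w ρ t))))
      (dq h (emb (prim (eff ν φ w ρ t)))) ≤ C * ‖eff ν φ w ρ t‖ ^ 2 := by
    refine (le_abs_self _).trans ((abs_inner_csmul_le _ _ _).trans ?_)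
    rw [mul_assoc, ← pow_two]
    gcongr
    · exact hs.û_le
    · exact norm_dq_emb_prim_le hh _
  have e2 : ((h : ℝ) ^ 2)⁻¹ *
      (1 / 2 * inner ℝ (ind h (wgt h • emb (prim (φ t)))) (emb (prim (φ t)))) ≤ ‖φ t‖ ^ 2 := by
    rw [inv_mul_le_iff₀ (by positivity)]
    linarith [inner_ind_wgt_le h (φ t)]
  have e3 : ‖avg k w t‖ ^ 2 ≤ 2 * (‖w t‖ ^ 2 + η) := by
    have k1 := norm_add_le (avg k w t - w t) (w t)
    rw [sub_add_cancel] at k1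
    have k2 : ‖avg k w t‖ ^ 2 ≤ (η + ‖w t‖) ^ 2 := by gcongr; linarith
    have k3 := sq_nonneg (η - ‖w t‖)
    have k4 : η ^ 2 ≤ η := pow_le_of_le_one hη0 hη two_ne_zero
    linarith
  have e4 : inner ℝ (ρ t • emb (prim (w t))) (emb (prim (w t))) ≤ C * ‖w t‖ ^ 2 := by
    refine (real_inner_le_norm _ _).trans ?_
    rw [pow_two, ← mul_assoc]
    gcongr
    · exact hs.norm_momentum_le t
    · exact (norm_emb_le _).trans (norm_prim_le _)
  have f2 : 0 ≤ 2 * C ^ 2 * ν ^ 2 / c := by positivity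
  have g2 := mul_le_mul_of_nonneg_left e2 f2
  have g3 := mul_le_mul_of_nonneg_left e3 (by positivity : 0 ≤ l₁ * (ν / 2))
  have g4 := mul_le_mul_of_nonneg_left e4 hl₀
  have a1 : 0 ≤ C * (‖φ t‖ ^ 2 + ‖w t‖ ^ 2 + 1 / 2 * ‖eff ν φ w ρ t‖ ^ 2 + η) := by positivity
  have a2 : 0 ≤ 2 * C ^ 2 * ν ^ 2 / c * (‖w t‖ ^ 2 + ‖eff ν φ w ρ t‖ ^ 2 + η) := by positivity
  have a3 : 0 ≤ l₁ * ν * (‖φ t‖ ^ 2 + ‖eff ν φ w ρ t‖ ^ 2) := by positivity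
  have a4 : 0 ≤ l₀ * C * (‖φ t‖ ^ 2 + ‖eff ν φ w ρ t‖ ^ 2 + η) := by positivity
  rw [energy]
  linarith

/-- The quotient energy controls N up to `dqErr`, and the averaged energy controls w up to the
averaging error. Then φ is recovered from νφ = N - ρv. -/
theorem le_energy (hs : LinSys ν c C T u₀ ûx φ w wb j g G ρ κ b) {l₁ l₀ : ℝ} (hl₁ : 0 < l₁)
    (hl₀ : 0 ≤ l₀) {h : unitInterval} {t k η : ℝ} (hη : η ≤ 1)
    (hw : ‖avg k w t - w t‖ ≤ η) (hN : ‖dqErr h (eff ν φ w ρ t)‖ ≤ η) :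
    ‖φ t‖ ^ 2 + ‖w t‖ ^ 2 ≤ (1 + 2 / ν ^ 2 * (1 + C ^ 2)) *
      ((4 / c + 4 / (l₁ * ν)) * energy ν c C u₀ ûx φ w ρ l₁ l₀ h k t + 4 * η) := by
  have hC := hs.C_nonneg
  have hν := hs.hν
  have hc := hs.hc
  have hη0 : 0 ≤ η := (norm_nonneg _).trans hw
  have hη2 : η ^ 2 ≤ η := pow_le_of_le_one hη0 hη two_ne_zero
  set S := dq h (emb (prim (eff ν φ w ρ t))) with hS
  set E := energy ν c C u₀ ûx φ w ρ l₁ l₀ h k t with hE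
  have e1 := le_csmul_inner_self hs.le_û S
  have e2 := inner_ind_wgt_nonneg (h := h) (emb (prim (φ t)))
  have e4 := le_csmul_inner_self (hs.le_ρ t) (emb (prim (w t)))
  have hE1 : c / 2 * ‖S‖ ^ 2 + l₁ * ν / 2 * ‖avg k w t‖ ^ 2 ≤ E := by
    have a2 : 0 ≤ 2 * C ^ 2 * ν ^ 2 / c * (((h : ℝ) ^ 2)⁻¹ *
      (1 / 2 * inner ℝ (ind h (wgt h • emb (prim (φ t)))) (emb (prim (φ t))))) := by positivity
    have a4 : 0 ≤ l₀ * inner ℝ (ρ t • emb (prim (w t))) (emb (prim (w t))) :=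
      mul_nonneg hl₀ (le_trans (by positivity) e4)
    rw [hE, energy, ← hS]
    linarith
  have hE2 : ‖S‖ ^ 2 ≤ 2 / c * E := by
    have : 0 ≤ l₁ * ν / 2 * ‖avg k w t‖ ^ 2 := by positivity
    rw [div_mul_eq_mul_div, le_div_iff₀ hc]
    linarith
  have hE3 : ‖avg k w t‖ ^ 2 ≤ 2 / (l₁ * ν) * E := by
    have : 0 ≤ c / 2 * ‖S‖ ^ 2 := by positivity
    rw [div_mul_eq_mul_div, le_div_iff₀ (by positivity)]
    linarith
  have hw2 : ‖w t‖ ^ 2 ≤ 2 * ‖avg k w t‖ ^ 2 + 2 * η := by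
    have k1 := norm_sub_le (avg k w t) (avg k w t - w t)
    rw [sub_sub_cancel] at k1
    have k2 : ‖w t‖ ^ 2 ≤ (‖avg k w t‖ + η) ^ 2 := by gcongr; linarith
    have k3 := sq_nonneg (‖avg k w t‖ - η)
    linarith
  have hn2 : ‖eff ν φ w ρ t‖ ^ 2 ≤ 2 * ‖S‖ ^ 2 + 2 * η := by
    have k1 := norm_sub_le S (dqErr h (eff ν φ w ρ t))
    rw [dqErr_apply, ← hS, sub_sub_cancel] at k1
    rw [dqErr_apply, ← hS] at hN
    have k2 : ‖eff ν φ w ρ t‖ ^ 2 ≤ (‖S‖ + η) ^ 2 := by gcongr; linarith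
    have k3 := sq_nonneg (‖S‖ - η)
    linarith
  have hp := hs.sq_norm_φ_le t
  set Kp := 2 / ν ^ 2 * (1 + C ^ 2)
  have hKp : 0 ≤ Kp := by positivity
  have h5 : ‖φ t‖ ^ 2 + ‖w t‖ ^ 2 ≤ (1 + Kp) * (‖eff ν φ w ρ t‖ ^ 2 + ‖w t‖ ^ 2) := by
    have := sq_nonneg ‖eff ν φ w ρ t‖
    linarith
  refine h5.trans (mul_le_mul_of_nonneg_left ?_ (by positivity))
  have e5 : 4 / c * E = 2 * (2 / c * E) := by ring
  have e6 : 4 / (l₁ * ν) * E = 2 * (2 / (l₁ * ν) * E) := by ring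
  linarith

end LinSys

/-! ### Choice of the steps and the a priori estimate -/

theorem exists_space_step {C c T η : ℝ} (hc : 0 < c) (hη : 0 < η) (ûx : CI)
    {N : ℝ → L2} {κ : ℝ → CI} (hN : Continuous N) (hκ : Continuous κ) :
    ∃ (h : unitInterval) (s : ℝ), 0 < (h : ℝ) ∧ 8 * C * h ≤ c ∧
      (∀ z ≤ h, ‖shC z ûx - ûx‖ ≤ s) ∧ ∀ t ∈ Icc 0 T, ‖dqErr h (N t)‖ ≤ η ∧
        spaceErr C h s (κ t) (N t) ≤ η := by
  -- The curves N and κN have compact range over [0,T], and strong convergence of uniformly bounded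
  -- operators is uniform on compact sets. So one step h serves all times.
  have hK1 := (isCompact_Icc (a := (0 : ℝ)) (b := T)).image hN
  have hK2 := (isCompact_Icc (a := (0 : ℝ)) (b := T)).image (hκ.smul hN)
  obtain ⟨A, hA⟩ := hK1.isBounded.exists_norm_le
  set s := η / (4 * |C| + |A| + 2) with hs
  have hs0 : 0 < s := by positivity
  have hz : zeroR ≤ 𝓝 0 := nhdsWithin_le_nhds
  have ev1 := eventually_forall_compact (l := zeroR) dqErr 2
    eventually_norm_dqErr_le tendsto_dqErr hK1 hs0
  have ev2 := eventually_forall_compact (l := zeroR) dqErr 2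
    eventually_norm_dqErr_le tendsto_dqErr hK2 hs0
  have ev3 := eventually_forall_compact (l := zeroR) (fun h => shf h - ind (σ h)) 2
    (Eventually.of_forall fun h F => norm_shf_sub_ind_le h F)
    (fun F => (tendsto_shf_sub_ind F).mono_left hz) hK1 hs0
  have ev4 := eventually_forall_compact (l := zeroR)
    (fun h => ContinuousLinearMap.id ℝ L2 - ind (σ h)) 2
    (Eventually.of_forall fun h F => by
      have := norm_sub_le F (ind (σ h) F)
      have := norm_ind_le (σ h) F
      simp only [sub_apply, ContinuousLinearMap.id_apply]
      linarith)
    (fun F => by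
      have := (tendsto_const_nhds (x := F)).sub (tendsto_ind F)
      rw [sub_self] at this
      exact this.mono_left hz) hK1 hs0
  have ev5 : ∀ᶠ h : unitInterval in zeroR, ∀ z ≤ h, ‖shC z ûx - ûx‖ ≤ s := by
    refine Eventually.filter_mono hz ?_
    have h1 := (tendsto_shC ûx).eventually (Metric.closedBall_mem_nhds ûx hs0)
    obtain ⟨r, hr, h2⟩ := Metric.eventually_nhds_iff.1 h1
    refine Metric.eventually_nhds_iff.2 ⟨r, hr, fun h hh z hzh => ?_⟩
    have h3 : dist z 0 < r := by
      refine lt_of_le_of_lt ?_ hh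
      rw [Subtype.dist_eq, Subtype.dist_eq, Real.dist_eq, Real.dist_eq]
      simp only [Icc.coe_zero, sub_zero]
      rw [abs_of_nonneg z.2.1, abs_of_nonneg h.2.1]
      exact hzh
    have := h2 h3
    rwa [dist_eq_norm] at this
  have ev6 : ∀ᶠ h : unitInterval in zeroR, 8 * C * h ≤ c := by
    refine Eventually.filter_mono hz ?_
    have h1 : Continuous fun h : unitInterval => 8 * C * (h : ℝ) := by fun_prop
    have h2 := (h1.tendsto 0).eventually_le_const (u := c) (by simpa using hc)
    exact h2
  have := neBot_zeroR
  obtain ⟨h, e0, e1, e2, e3, e4, e5, e6⟩ := (eventually_pos_zeroR.and (ev1.and (ev2.and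
    (ev3.and (ev4.and (ev5.and ev6)))))).exists
  have hC1 : s * (4 * |C| + |A| + 2) = η := by rw [hs]; field_simp
  refine ⟨h, s, e0, e6, e5, fun t ht => ?_⟩
  have m1 := mem_image_of_mem N ht
  have k1 := e1 _ m1
  have k2 := e2 _ (mem_image_of_mem (fun t => κ t • N t) ht)
  have k3 := e3 _ m1
  have k4 := e4 _ m1
  have k5 := hA _ m1
  have hC0 := abs_nonneg C
  have hA0 := abs_nonneg A
  constructor
  · refine k1.trans ?_
    rw [← hC1]
    exact le_mul_of_one_le_right hs0.le (by linarith)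
  · have k6 : ‖dq h (emb (prim (N t))) - shf h (N t)‖ ≤ 3 * s := by
      have e : dq h (emb (prim (N t))) - shf h (N t) = dqErr h (N t)
        + (ContinuousLinearMap.id ℝ L2 - ind (σ h)) (N t) - (shf h - ind (σ h)) (N t) := by
        simp only [dqErr_apply, sub_apply, ContinuousLinearMap.id_apply]
        abel
      rw [e]
      refine (norm_sub_le _ _).trans ?_
      have := norm_add_le (dqErr h (N t)) ((ContinuousLinearMap.id ℝ L2 - ind (σ h)) (N t))
      linarith
    have k7 : C * ‖dq h (emb (prim (N t))) - shf h (N t)‖ ≤ |C| * (3 * s) := by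
      calc _ ≤ |C| * ‖dq h (emb (prim (N t))) - shf h (N t)‖ := by gcongr; exact le_abs_self C
        _ ≤ _ := by gcongr
    have k8 : C * ‖dqErr h (N t)‖ ≤ |C| * s := by
      calc _ ≤ |C| * ‖dqErr h (N t)‖ := by gcongr; exact le_abs_self C
        _ ≤ _ := by gcongr
    have k9 : s * ‖N t‖ ≤ s * |A| := by gcongr; exact k5.trans (le_abs_self A)
    rw [spaceErr, ← hC1]
    linarith

/-- The a priori estimate for the linear system. -/
theorem exists_energy_estimate {ν c C : ℝ} (hν : 0 < ν) (hc : 0 < c) (hC : 0 ≤ C) :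
    ∃ ε > 0, ∃ θ > 0, ∃ K > 0,
      ∀ (T u₀ : ℝ) (ûx : CI) (φ w wb j g G : ℝ → L2) (ρ κ b : ℝ → CI),
      LinSys ν c C T u₀ ûx φ w wb j g G ρ κ b → LinSys.Small ε T φ w wb →
      ∀ t, 0 ≤ t → t < T → ∀ η > 0, ∃ k₀ > 0, ∀ k, 0 < k → k < k₀ →
        Real.exp (θ * t) * (‖φ t‖ ^ 2 + ‖w t‖ ^ 2)
          + (∫ s in (0 : ℝ)..t, Real.exp (θ * s) * (‖φ s‖ ^ 2 + ‖w s‖ ^ 2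
            + ‖tdq k (fun s => emb (prim (w s))) s‖ ^ 2)) ≤
        K * ((‖φ 0‖ ^ 2 + ‖w 0‖ ^ 2) + ∫ s in (0 : ℝ)..t, Real.exp (θ * s) *
          (‖emb (prim (φ s))‖ ^ 2 + ‖emb (prim (w s))‖ ^ 2)) + η := by
  obtain ⟨l₁, hl₁, l₀, hl₀, ε, hε, c₁, hc₁, M, hM, hdiss⟩ := LinSys.exists_dissipation hν hc hC
  set M₂ := C + 2 * C ^ 2 * ν ^ 2 / c + l₁ * ν + l₀ * C with hM₂
  have hM₂0 : 0 < M₂ := by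
    have : 0 < l₁ * ν := by positivity
    have : 0 ≤ C + 2 * C ^ 2 * ν ^ 2 / c + l₀ * C := by positivity
    linarith
  -- So θM₂ = c₁/2: half of the dissipation pays for the exponential weight.
  set θ := c₁ / (2 * M₂) with hθ
  have hθ0 : 0 < θ := by positivity
  set Kp := 1 + 2 / ν ^ 2 * (1 + C ^ 2) with hKp
  have hKp0 : 0 < Kp := by positivity
  set Kl := 4 / c + 4 / (l₁ * ν) with hKl
  have hKl0 : 0 < Kl := by positivity
  set Kn := 1 + 2 * (C + ν) ^ 2 with hKn
  have hKn0 : 0 < Kn := by positivity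
  set Q := Kp * Kl + 2 / c₁ with hQ
  have hQ0 : 0 < Q := by positivity
  refine ⟨ε, hε, θ, hθ0, Q * (M₂ * Kn + M), by positivity, ?_⟩
  intro T u₀ ûx φ w wb j g G ρ κ b hs hsm t ht htT η₀ hη₀
  have hNc : Continuous (LinSys.eff ν φ w ρ) :=
    (hs.cont_ρ.smul (emb.continuous.comp (prim.continuous.comp hs.cont_w))).add
      (hs.cont_φ.const_smul ν)
  obtain ⟨A₁, hA₁⟩ := (isCompact_Icc (a := 0) (b := T)).exists_bound_of_continuousOn
    hs.cont_φ.continuousOn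
  obtain ⟨A₂, hA₂⟩ := (isCompact_Icc (a := 0) (b := T)).exists_bound_of_continuousOn
    hs.cont_w.continuousOn
  obtain ⟨A₃, hA₃⟩ := (isCompact_Icc (a := 0) (b := T)).exists_bound_of_continuousOn
    hNc.continuousOn
  set A := max 1 (max A₁ (max A₂ A₃)) with hA
  have hA1 : 1 ≤ A := le_max_left _ _
  have hA2 : A₁ ≤ A := (le_max_left _ _).trans (le_max_right _ _)
  have hA3 : A₂ ≤ A := (le_max_left _ _).trans ((le_max_right _ _).trans (le_max_right _ _))
  have hA4 : A₃ ≤ A := (le_max_right _ _).trans ((le_max_right _ _).trans (le_max_right _ _))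
  set X₀ := ∫ s in (0 : ℝ)..t, Real.exp (θ * s) with hI
  have hI0 : 0 ≤ X₀ := integral_nonneg ht fun s _ => (Real.exp_pos _).le
  -- Z collects the coefficients of η in the final bound. It depends on the solution and on t but
  -- not on h or k, so η can be fixed before the steps.
  set Z := Q * (M₂ + (M * A ^ 2 + c₁) * X₀) + Real.exp (θ * t) * (Kp * 4) with hZ
  have hZ0 : 0 < Z := by positivity
  set η := min 1 (η₀ / Z) with hη
  have hη0 : 0 < η := by positivity
  have hη1 : η ≤ 1 := min_le_left _ _
  have hηZ : Z * η ≤ η₀ := by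
    calc Z * η ≤ Z * (η₀ / Z) := by gcongr; exact min_le_right _ _
      _ = η₀ := by field_simp
  obtain ⟨h, s, hh, hhc, hsx, hsp⟩ := exists_space_step (C := C) (T := T) hc hη0 ûx hNc hs.cont_κ
  -- The threshold ηh is available because h is already fixed; it makes the errors e/h at most η.
  obtain ⟨k₁, hk₁, hkw⟩ := eventually_avg_sub_le hs.cont_w T (mul_pos hη0 hh)
  obtain ⟨k₂, hk₂, hkg⟩ := eventually_avg_sub_le hs.cont_g T hη0
  -- The bound T - t keeps the averages, which look ahead by k, inside [0,T].
  refine ⟨min (T - t) (min k₁ k₂), by have := sub_pos.2 htT; positivity, fun k hk hkk => ?_⟩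
  have hkT : k < T - t := hkk.trans_le (min_le_left _ _)
  have hkw' := hkw k hk (hkk.trans_le ((min_le_right _ _).trans (min_le_left _ _)))
  have hkg' := hkg k hk (hkk.trans_le ((min_le_right _ _).trans (min_le_right _ _)))
  have hmem : ∀ z ∈ Icc 0 t, z ∈ Icc 0 T := fun z hz => ⟨hz.1, hz.2.trans htT.le⟩
  have hηh : η * h ≤ η := mul_le_of_le_one_right hη0.le h.2.2
  set v : ℝ → L2 := fun s => emb (prim (w s)) with hv
  have hvc : Continuous v := emb.continuous.comp (prim.continuous.comp hs.cont_w)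
  have hdc : Continuous (tdq k v) :=
    ((hvc.comp (continuous_id.add continuous_const)).sub hvc).const_smul (k⁻¹ : ℝ)
  set D : ℝ → ℝ := fun s => ‖φ s‖ ^ 2 + ‖w s‖ ^ 2 + ‖tdq k v s‖ ^ 2 with hD
  have hDc : Continuous D :=
    ((hs.cont_φ.norm.pow 2).add (hs.cont_w.norm.pow 2)).add (hdc.norm.pow 2)
  set S : ℝ → ℝ := fun s => ‖emb (prim (φ s))‖ ^ 2 + ‖v s‖ ^ 2 with hS
  have hSc : Continuous S :=
    ((emb.continuous.comp (prim.continuous.comp hs.cont_φ)).norm.pow 2).add (hvc.norm.pow 2)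
  set E := LinSys.energy ν c C u₀ ûx φ w ρ l₁ l₀ h k with hE
  have hder := fun z (hz : z ∈ Icc 0 t) => hs.hasDerivWithinAt_energy l₁ l₀ h hk hz.1
    (by linarith [hz.2] : z + k ≤ T)
  have hup := fun z (hz : z ∈ Icc 0 t) => hs.energy_le hl₁.le hl₀.le hh hη1
    ((hkw' z (hmem z hz)).trans hηh)
  have hgr := exp_mul_add_integral_le (θ := θ) (a := c₁ / 2) (M := M) (η := (M * A ^ 2 + c₁) * η)
    (D := D) (S := S) ht
    (fun z hz => ((hder z hz).continuousWithinAt).mono fun x hx => hmem x hx)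
    (fun z hz => (hder z (Ioo_subset_Icc_self hz)).hasDerivAt
      (Icc_mem_nhds hz.1 (hz.2.trans htT))) hDc hSc (fun z hz => by
      have hz' := Ioo_subset_Icc_self hz
      have hzT := hmem z hz'
      have m1 := hdiss T u₀ ûx φ w wb j g G ρ κ b hs hsm A η s k z h hA1 hη1 hh hhc hk hz'.1
        (by linarith [hz'.2]) ((hA₁ z hzT).trans hA2) ((hA₂ z hzT).trans hA3)
        ((hA₃ z hzT).trans hA4) (hkw' z hzT) (hkg' z hzT) hsx (hsp z hzT).2
      have m2 := mul_le_mul_of_nonneg_left (hup z hz') hθ0.le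
      have m3 : θ * (M₂ * (‖φ z‖ ^ 2 + ‖w z‖ ^ 2 + ‖LinSys.eff ν φ w ρ z‖ ^ 2 + η))
        = c₁ / 2 * (‖φ z‖ ^ 2 + ‖w z‖ ^ 2 + ‖LinSys.eff ν φ w ρ z‖ ^ 2 + η) := by
        rw [hθ]; field_simp
      rw [← hM₂, m3] at m2
      have m4 : 0 ≤ c₁ / 2 * (‖LinSys.eff ν φ w ρ z‖ ^ 2 + ‖tdq k v z‖ ^ 2 + η) := by positivity
      have m5 : 0 ≤ c₁ / 2 * ‖LinSys.eff ν φ w ρ z‖ ^ 2 := by positivity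
      have m6 : 0 ≤ c₁ * η := by positivity
      simp only [hD, hS]
      have m7 : 0 ≤ c₁ / 2 * ‖tdq k v z‖ ^ 2 := by positivity
      linarith)
  have ht0 : (0 : ℝ) ∈ Icc 0 t := ⟨le_rfl, ht⟩
  have htt : t ∈ Icc 0 t := ⟨ht, le_rfl⟩
  have hE0 : E 0 ≤ M₂ * (Kn * (‖φ 0‖ ^ 2 + ‖w 0‖ ^ 2) + η) := by
    refine (hup 0 ht0).trans ?_
    rw [← hM₂]
    have n1 := hs.norm_eff_le 0
    have n2 : ‖LinSys.eff ν φ w ρ 0‖ ^ 2 ≤ ((C + ν) * (‖φ 0‖ + ‖w 0‖)) ^ 2 := by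
      gcongr
      have : 0 ≤ C * ‖φ 0‖ + ν * ‖w 0‖ := by positivity
      linarith
    have n3 : (‖φ 0‖ + ‖w 0‖) ^ 2 ≤ 2 * (‖φ 0‖ ^ 2 + ‖w 0‖ ^ 2) := by
      linarith [sq_nonneg (‖φ 0‖ - ‖w 0‖)]
    have n4 := mul_le_mul_of_nonneg_left n3 (sq_nonneg (C + ν))
    refine mul_le_mul_of_nonneg_left ?_ hM₂0.le
    rw [hKn]
    linarith
  have hlow := hs.le_energy hl₁ hl₀.le hη1 ((hkw' t (hmem t htt)).trans hηh)
    (hsp t (hmem t htt)).1 (k := k) (h := h)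
  rw [← hKp, ← hKl] at hlow
  set ID := ∫ s in (0 : ℝ)..t, Real.exp (θ * s) * D s with hID
  set IS := ∫ s in (0 : ℝ)..t, Real.exp (θ * s) * S s with hIS
  have hID0 : 0 ≤ ID := integral_nonneg ht fun s _ => by positivity
  have hIS0 : 0 ≤ IS := integral_nonneg ht fun s _ => by positivity
  set R := M₂ * (Kn * (‖φ 0‖ ^ 2 + ‖w 0‖ ^ 2) + η) + M * IS + (M * A ^ 2 + c₁) * η * X₀ with hR
  have hR1 : Real.exp (θ * t) * E t + c₁ / 2 * ID ≤ R := by linarith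
  have hX := Real.exp_pos (θ * t)
  -- the energy is bounded below by a small quantity
  have hlow' := mul_le_mul_of_nonneg_left hlow hX.le
  have hED : c₁ / 2 * ID ≤ R - Real.exp (θ * t) * E t := by linarith
  have hEpos : 0 ≤ E t := by
    rw [hE, LinSys.energy]
    have a1 := le_csmul_inner_self hs.le_û (dq h (emb (prim (LinSys.eff ν φ w ρ t))))
    have a1' : 0 ≤ c * ‖dq h (emb (prim (LinSys.eff ν φ w ρ t)))‖ ^ 2 := by positivity
    have a2 := inner_ind_wgt_nonneg (h := h) (emb (prim (φ t)))
    have a4 := le_csmul_inner_self (hs.le_ρ t) (emb (prim (w t)))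
    have a4' : 0 ≤ c * ‖emb (prim (w t))‖ ^ 2 := by positivity
    have a5 := a1'.trans a1
    have a6 := a4'.trans a4
    positivity
  have hXE : 0 ≤ Real.exp (θ * t) * E t := by positivity
  have f1 : ID ≤ 2 / c₁ * R := by
    rw [div_mul_eq_mul_div, le_div_iff₀ hc₁]
    linarith
  have f2 : Real.exp (θ * t) * (Kp * (Kl * E t)) ≤ Kp * Kl * R := by
    have : Real.exp (θ * t) * E t ≤ R := by
      have : 0 ≤ c₁ / 2 * ID := by positivity
      linarith
    calc _ = Kp * Kl * (Real.exp (θ * t) * E t) := by ring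
      _ ≤ _ := by gcongr
  have f3 : Real.exp (θ * t) * (‖φ t‖ ^ 2 + ‖w t‖ ^ 2) + ID ≤
      Q * R + Real.exp (θ * t) * (Kp * 4) * η := by
    rw [hQ]
    linarith
  have f4 : Q * R + Real.exp (θ * t) * (Kp * 4) * η
      = Q * (M₂ * Kn * (‖φ 0‖ ^ 2 + ‖w 0‖ ^ 2) + M * IS) + Z * η := by
    rw [hR, hZ]; ring
  have f5 : Q * (M₂ * Kn * (‖φ 0‖ ^ 2 + ‖w 0‖ ^ 2) + M * IS)
      ≤ Q * (M₂ * Kn + M) * ((‖φ 0‖ ^ 2 + ‖w 0‖ ^ 2) + IS) := by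
    rw [mul_assoc Q]
    refine mul_le_mul_of_nonneg_left ?_ hQ0.le
    have g1 : 0 ≤ M * (‖φ 0‖ ^ 2 + ‖w 0‖ ^ 2) := by positivity
    have g2 : 0 ≤ M₂ * Kn * IS := by positivity
    linarith
  rw [f4] at f3
  linarith

/-! ### Calculus of H¹ functions -/

/-- `a` is the continuous representative of an element of `H¹(0,1)` with weak derivative `a'`. -/
def IsH1 (a : CI) (a' : L2) : Prop := a = cst (a 0) + prim a'

theorem isH1_cst_add_prim (c : ℝ) (F : L2) : IsH1 (cst c + prim F) F := by
  simp [IsH1]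

theorem isH1_prim (F : L2) : IsH1 (prim F) F := by
  have h := isH1_cst_add_prim 0 F
  have h0 : cst 0 = 0 := by simp [cst]
  rwa [h0, zero_add] at h

theorem isH1_cst (c : ℝ) : IsH1 (cst c) 0 := by
  simp [IsH1]

namespace IsH1

variable {a b : CI} {a' b' : L2}

theorem add (ha : IsH1 a a') (hb : IsH1 b b') : IsH1 (a + b) (a' + b') := by
  rw [ha, hb]
  have e : cst (a 0) + prim a' + (cst (b 0) + prim b') = cst (a 0 + b 0) + prim (a' + b') := by
    rw [map_add, cst_eq, cst_eq, cst_eq, add_smul]; abel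
  rw [e]
  exact isH1_cst_add_prim _ _

theorem smul (ha : IsH1 a a') (r : ℝ) : IsH1 (r • a) (r • a') := by
  rw [ha]
  have e : r • (cst (a 0) + prim a') = cst (r * a 0) + prim (r • a') := by
    rw [map_smul, cst_eq, cst_eq, smul_add, smul_smul]
  rw [e]
  exact isH1_cst_add_prim _ _

theorem neg (ha : IsH1 a a') : IsH1 (-a) (-a') := by
  simpa using ha.smul (-1)

theorem sub (ha : IsH1 a a') (hb : IsH1 b b') : IsH1 (a - b) (a' - b') := by
  simpa [sub_eq_add_neg] using ha.add hb.neg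

theorem mul (ha : IsH1 a a') (hb : IsH1 b b') : IsH1 (a * b) (a • b' + b • a') := by
  have h := mul_prim (a 0) (b 0) a' b'
  rw [← ha, ← hb] at h
  rw [h]
  exact isH1_cst_add_prim _ _

theorem comp {Φ Φ' : ℝ → ℝ} {Ψ Ψ' : C(ℝ, ℝ)} {m M : ℝ} (ha : IsH1 a a')
    (hΦ : ∀ y ∈ Icc m M, HasDerivAt Φ (Φ' y) y) (hΨ : EqOn Ψ Φ (Icc m M))
    (hΨ' : EqOn Ψ' Φ' (Icc m M)) (hm : ∀ x, a x ∈ Icc m M) :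
    IsH1 (Ψ.comp a) (Ψ'.comp a • a') := by
  have h := chain_prim (Φ := Φ) (Φ' := Φ') (m := m) (M := M) hΦ
    (Ψ'.continuous.continuousOn.congr hΨ'.symm) (a 0) a' (by rwa [← ha]) (Ψ.comp a)
    (Ψ'.comp a) (fun x => by rw [← ha]; exact hΨ (hm x)) (fun x => by rw [← ha]; exact hΨ' (hm x))
  rw [h]
  exact isH1_cst_add_prim _ _

theorem congr_deriv {a'' : L2} (ha : IsH1 a a') (h : a' = a'') : IsH1 a a'' := h ▸ ha

theorem prim_eq (ha : IsH1 a a') (h0 : a 0 = 0) : prim a' = a := by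
  rw [IsH1, h0] at ha
  have : cst 0 = 0 := by simp [cst]
  rw [ha, this, zero_add]

theorem unique (h₁ : IsH1 a a') (h₂ : IsH1 a b') : a' = b' := by
  refine prim_injective ?_
  rw [IsH1] at h₁ h₂
  have := h₁.symm.trans h₂
  exact add_left_cancel this

/-- This is integration by parts for a∫FG, where the product FG is only integrable. Density is
therefore used in F alone; for continuous F it is the product rule. -/
theorem mul_primMul (ha : IsH1 a a') (F G : L2) :
    a * primMul F G = primMul (a • F) G + primMul a' (emb (primMul F G)) := by
  refine isClosed_property (e := emb) (p := fun F => a * primMul F G = primMul (a • F) G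
    + primMul a' (emb (primMul F G))) dense_emb ?_ ?_ F
  · exact isClosed_eq (by fun_prop) (by fun_prop)
  · intro f
    have h1 : primMul (emb f) G = prim (f • G) := primMul_emb_left _ _
    have h2 : primMul (a • emb f) G = prim (a • f • G) := by
      rw [← emb_mul, primMul_emb_left, mul_smul]
    rw [h1, h2, primMul_emb, ← map_add]
    exact ((ha.mul (isH1_prim (f • G))).prim_eq (by simp)).symm

end IsH1

/-! ### Test functions and weak formulations -/

/-- The restriction to `[0,1]` of a function. -/
def ofOn (f : ℝ → ℝ) (hf : ContinuousOn f (Icc 0 1)) : CI :=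
  ⟨fun x => f x, hf.comp_continuous continuous_subtype_val fun x => x.2⟩

theorem ofOn_apply {f : ℝ → ℝ} (hf : ContinuousOn f (Icc 0 1)) (x : unitInterval) :
    ofOn f hf x = f x := rfl

theorem ex_ofOn {f : ℝ → ℝ} (hf : ContinuousOn f (Icc 0 1)) {x : ℝ} (hx : x ∈ Icc (0 : ℝ) 1) :
    ex (ofOn f hf) x = f x := ex_of_mem _ hx

theorem coeFn_emb_ofOn {f : ℝ → ℝ} (hf : ContinuousOn f (Icc 0 1)) : emb (ofOn f hf) =ᵐ[leb] f := by
  filter_upwards [coeFn_emb (ofOn f hf), ae_restrict_mem measurableSet_Ioo] with x h1 h2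
  rw [h1, ex_ofOn hf (Ioo_subset_Icc_self h2)]

theorem inner_emb_ofOn {f : ℝ → ℝ} (hf : ContinuousOn f (Icc 0 1)) (F : L2) :
    inner ℝ F (emb (ofOn f hf)) = ∫ x in Ioo (0 : ℝ) 1, F x * f x := by
  rw [inner_eq]
  refine integral_congr_ae ?_
  filter_upwards [coeFn_emb_ofOn hf] with x h1
  rw [h1]

theorem isH1_ofOn {f f' : ℝ → ℝ} (hf : ContinuousOn f (Icc 0 1)) (hf' : ContinuousOn f' (Icc 0 1))
    (h : ∀ x ∈ Ioo (0 : ℝ) 1, HasDerivAt f (f' x) x) : IsH1 (ofOn f hf) (emb (ofOn f' hf')) := by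
  refine eq_prim_of_hasDerivAt _ _ fun x hx => ?_
  rw [ex_ofOn hf' (Ioo_subset_Icc_self hx)]
  refine (h x hx).congr_of_eventuallyEq ?_
  filter_upwards [isOpen_Ioo.mem_nhds hx] with y hy
  exact ex_ofOn hf (Ioo_subset_Icc_self hy)

namespace IsTest

variable {ψ : ℝ → ℝ}

theorem eq_zero (h : IsTest ψ) {x : ℝ} (hx : x ∉ Ioo (0 : ℝ) 1) : ψ x = 0 :=
  image_eq_zero_of_notMem_tsupport fun hx' => hx (h.supp hx')

theorem continuous_deriv (h : IsTest ψ) : Continuous (deriv ψ) :=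
  h.smooth.continuous_deriv (by simp)

/-- A test function as a continuous function on `[0,1]`. -/
def toCI (h : IsTest ψ) : CI := ofOn ψ h.smooth.continuous.continuousOn

/-- The derivative of a test function as a continuous function on `[0,1]`. -/
def derivCI (h : IsTest ψ) : CI := ofOn (deriv ψ) h.continuous_deriv.continuousOn

theorem isH1 (h : IsTest ψ) : IsH1 h.toCI (emb h.derivCI) :=
  isH1_ofOn _ _ fun x _ => ((h.smooth.differentiable (by simp)) x).hasDerivAt

theorem toCI_zero (h : IsTest ψ) : h.toCI 0 = 0 := h.eq_zero (by simp)

theorem toCI_one (h : IsTest ψ) : h.toCI 1 = 0 := h.eq_zero (by simp)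

theorem prim_derivCI (h : IsTest ψ) : prim (emb h.derivCI) = h.toCI := h.isH1.prim_eq h.toCI_zero

theorem prim_derivCI_one (h : IsTest ψ) : prim (emb h.derivCI) 1 = 0 := by
  rw [h.prim_derivCI, h.toCI_one]

theorem inner_toCI (h : IsTest ψ) (F : L2) :
    inner ℝ F (emb h.toCI) = ∫ x in Ioo (0 : ℝ) 1, F x * ψ x := inner_emb_ofOn _ _

theorem inner_derivCI (h : IsTest ψ) (F : L2) :
    inner ℝ F (emb h.derivCI) = ∫ x in Ioo (0 : ℝ) 1, F x * deriv ψ x := inner_emb_ofOn _ _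

theorem inner_emb_prim (h : IsTest ψ) (F : L2) :
    inner ℝ (emb (prim F)) (emb h.derivCI) = -inner ℝ F (emb h.toCI) := by
  rw [inner_emb_prim_of_eq_zero _ _ h.prim_derivCI_one, h.prim_derivCI]

end IsTest

theorem eq_zero_of_forall_isTest (F : L2)
    (h : ∀ ψ : ℝ → ℝ, IsTest ψ → ∫ x in Ioo (0 : ℝ) 1, F x * ψ x = 0) : F = 0 := by
  have hF := integrable_coe F
  have h1 := isOpen_Ioo.ae_eq_zero_of_integral_contDiff_smul_eq_zero (μ := leb)
    (f := F) (U := Ioo (0 : ℝ) 1) (hF.locallyIntegrable.locallyIntegrableOn _) (by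
      intro g hg1 hg2 hg3
      refine Eq.trans (integral_congr_ae (Eventually.of_forall fun x => ?_)) (h g ⟨hg1, hg2, hg3⟩)
      simp [mul_comm])
  refine Lp.ext ?_
  filter_upwards [h1, ae_restrict_mem measurableSet_Ioo, Lp.coeFn_zero ℝ 2 leb] with x h2 h3 h4
  rw [h2 h3, h4]; rfl

/-- The support of η lies in some [a,b] inside (0,1). Its primitive vanishes to the left of a, and
to the right of b because the integral of η is zero. -/
theorem isTest_of_deriv {η : ℝ → ℝ} (hη : IsTest η) (h0 : ∫ x in (0 : ℝ)..1, η x = 0) :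
    IsTest (fun x => ∫ y in (0 : ℝ)..x, η y) ∧ deriv (fun x => ∫ y in (0 : ℝ)..x, η y) = η := by
  have hc := hη.smooth.continuous
  have hd : ∀ x, HasDerivAt (fun x => ∫ y in (0 : ℝ)..x, η y) (η x) x := fun x =>
    (hc.integral_hasStrictDerivAt 0 x).hasDerivAt
  have hderiv : deriv (fun x => ∫ y in (0 : ℝ)..x, η y) = η := funext fun x => (hd x).deriv
  obtain ⟨a, b, ha, hb, hab⟩ : ∃ a b : ℝ, 0 < a ∧ b < 1 ∧ tsupport η ⊆ Icc a b := by
    rcases (tsupport η).eq_empty_or_nonempty with he | hne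
    · exact ⟨1 / 2, 1 / 2, by norm_num, by norm_num, by simp [he]⟩
    · have hK : IsCompact (tsupport η) := hη.compact
      exact ⟨sInf (tsupport η), sSup (tsupport η), (hη.supp (hK.sInf_mem hne)).1,
        (hη.supp (hK.sSup_mem hne)).2, fun x hx =>
          ⟨csInf_le hK.bddBelow hx, le_csSup hK.bddAbove hx⟩⟩
  have hz : ∀ x, x ∉ Icc a b → η x = 0 := fun x hx =>
    image_eq_zero_of_notMem_tsupport fun hx' => hx (hab hx')
  have hsupp : ∀ x, x ∉ Icc a b → ∫ y in (0 : ℝ)..x, η y = 0 := by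
    intro x hx
    rw [mem_Icc, not_and_or, not_le, not_le] at hx
    rcases hx with hx | hx
    · rw [intervalIntegral.integral_congr (g := fun _ => (0 : ℝ)) fun y hy => hz y ?_]
      · simp
      · rw [mem_uIcc] at hy
        rw [mem_Icc]
        rintro ⟨h1, h2⟩
        rcases hy with hy | hy <;> linarith [hy.1, hy.2]
    · have : ∫ y in (1 : ℝ)..x, η y = 0 := by
        rw [intervalIntegral.integral_congr (g := fun _ => (0 : ℝ)) fun y hy => hz y ?_]
        · simp
        · rw [mem_uIcc] at hy
          rw [mem_Icc]
          rintro ⟨h1, h2⟩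
          rcases hy with hy | hy <;> linarith [hy.1, hy.2]
      rw [← intervalIntegral.integral_add_adjacent_intervals (hc.intervalIntegrable 0 1)
        (hc.intervalIntegrable 1 x), h0, this, add_zero]
  have hts : tsupport (fun x => ∫ y in (0 : ℝ)..x, η y) ⊆ Icc a b :=
    closure_minimal (fun x hx => by
      by_contra h
      exact hx (hsupp x h)) isClosed_Icc
  refine ⟨⟨?_, ?_, ?_⟩, hderiv⟩
  · rw [contDiff_infty_iff_deriv, hderiv]
    exact ⟨fun x => (hd x).differentiableAt, hη.smooth⟩
  · exact isCompact_Icc.of_isClosed_subset (isClosed_tsupport _) hts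
  · exact hts.trans fun x hx => ⟨ha.trans_le hx.1, hx.2.trans_lt hb⟩

theorem exists_isTest_integral_eq_one : ∃ χ : ℝ → ℝ, IsTest χ ∧ ∫ x in (0 : ℝ)..1, χ x = 1 := by
  let f : ContDiffBump (1 / 2 : ℝ) := ⟨1 / 8, 1 / 4, by norm_num, by norm_num⟩
  have hs : tsupport (f.normed volume) ⊆ Ioo 0 1 := by
    rw [f.tsupport_normed_eq, Real.closedBall_eq_Icc]
    intro x hx
    have h1 : (1 / 2 : ℝ) - 1 / 4 ≤ x := hx.1
    have h2 : x ≤ (1 / 2 : ℝ) + 1 / 4 := hx.2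
    constructor <;> linarith
  refine ⟨f.normed volume, ⟨f.contDiff_normed, f.hasCompactSupport_normed, hs⟩, ?_⟩
  rw [intervalIntegral.integral_of_le zero_le_one]
  refine Eq.trans (setIntegral_eq_integral_of_forall_compl_eq_zero fun x hx => ?_)
    (f.integral_normed (μ := volume))
  exact image_eq_zero_of_notMem_tsupport fun h => hx (Ioo_subset_Ioc_self (hs h))

/-- The du Bois-Reymond lemma. Subtracting from a test function η a multiple of a fixed χ of
integral one gives the derivative of a test function, so F is orthogonal to every η up to its
pairing with constants. -/
theorem meanFree_eq_zero_of_forall_isTest (F : L2)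
    (h : ∀ ψ : ℝ → ℝ, IsTest ψ → ∫ x in Ioo (0 : ℝ) 1, F x * deriv ψ x = 0) : meanFree F = 0 := by
  obtain ⟨χ, hχ, hχ1⟩ := exists_isTest_integral_eq_one
  set k := ∫ x in Ioo (0 : ℝ) 1, F x * χ x with hk
  have hF : F - k • one2 = 0 := by
    refine eq_zero_of_forall_isTest _ fun η hη => ?_
    set c := ∫ x in (0 : ℝ)..1, η x with hc
    have ht : IsTest (fun x => η x - c * χ x) :=
      ⟨hη.smooth.sub (contDiff_const.mul hχ.smooth),
        hη.compact.sub (hχ.compact.mul_left),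
        (tsupport_sub η (fun x => c * χ x)).trans
          (union_subset hη.supp ((tsupport_mul_subset_right).trans hχ.supp))⟩
    have h0 : ∫ x in (0 : ℝ)..1, (η x - c * χ x) = 0 := by
      have hi : IntervalIntegrable (fun x => c * χ x) volume 0 1 :=
        (continuous_const.mul hχ.smooth.continuous).intervalIntegrable _ _
      rw [intervalIntegral.integral_sub (hη.smooth.continuous.intervalIntegrable _ _) hi,
        intervalIntegral.integral_const_mul, hχ1, ← hc]
      ring
    obtain ⟨h1, h2⟩ := isTest_of_deriv ht h0
    have h3 := h _ h1
    rw [h2] at h3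
    have e1 : ∫ x in Ioo (0 : ℝ) 1, F x * η x = c * k := by
      have i1 : Integrable (fun x => F x * η x) leb := (Lp.memLp F).integrable_mul hη.memLp
      have i2 : Integrable (fun x => F x * χ x) leb := (Lp.memLp F).integrable_mul hχ.memLp
      have : (fun x => F x * (η x - c * χ x)) = fun x => F x * η x - c * (F x * χ x) := by
        funext x; ring
      rw [this, integral_sub i1 (i2.const_mul c), MeasureTheory.integral_const_mul] at h3
      linarith
    have e2 : inner ℝ one2 (emb hη.toCI) = c := by
      rw [hη.inner_toCI, hc, intervalIntegral.integral_of_le zero_le_one,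
        integral_Ioc_eq_integral_Ioo]
      refine integral_congr_ae ?_
      filter_upwards [coeFn_one2] with x hx
      rw [hx, one_mul]
    rw [← hη.inner_toCI, inner_sub_left, real_inner_smul_left, e2, hη.inner_toCI, e1]
    ring
  rw [sub_eq_zero] at hF
  rw [hF, meanFree_apply, map_smul, ContinuousMap.smul_apply, prim_one2]
  simp

/-- The curves X and X(0) + ∫d have equal pairings with S, their difference having derivative zero.
So A maps them to the same curve, and the second is strongly differentiable because d is continuous.
-/
theorem hasDerivWithinAt_of_weak {T : ℝ} (A : L2 →L[ℝ] L2) (S : Set L2)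
    (hA : ∀ F, (∀ e ∈ S, inner ℝ F e = 0) → A F = 0) {X d : ℝ → L2} (hd : Continuous d)
    (h : ∀ e ∈ S, ∀ t ∈ Icc 0 T, HasDerivWithinAt (fun s => inner ℝ (X s) e) (inner ℝ (d t) e)
      (Icc 0 T) t) {t : ℝ} (ht : t ∈ Icc 0 T) :
    HasDerivWithinAt (fun s => A (X s)) (A (d t)) (Icc 0 T) t := by
  have hder : ∀ t, HasDerivAt (fun t => ∫ s in (0 : ℝ)..t, d s) (d t) t := fun t =>
    (hd.integral_hasStrictDerivAt 0 t).hasDerivAt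
  have key : ∀ t ∈ Icc 0 T, A (X t) = A (X 0 + ∫ s in (0 : ℝ)..t, d s) := by
    intro t ht
    rw [← sub_eq_zero, ← map_sub]
    refine hA _ fun e he => ?_
    have hc := (convex_Icc (0 : ℝ) T).norm_image_sub_le_of_norm_hasDerivWithin_le
      (f := fun t => inner ℝ (X t) e - inner ℝ (∫ s in (0 : ℝ)..t, d s) e) (C := 0)
      (fun s hs => (h e he s hs).sub
        (((hder s).inner ℝ (hasDerivAt_const s e)).hasDerivWithinAt)) (fun s _ => by simp)
      (x := 0) (y := t) ⟨le_rfl, ht.1.trans ht.2⟩ ht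
    rw [zero_mul, norm_le_zero_iff, intervalIntegral.integral_same, inner_zero_left, sub_zero] at hc
    rw [inner_sub_left, inner_add_left]
    linarith
  have h1 := (A.hasFDerivAt.comp_hasDerivWithinAt t
    (((hder t).const_add (X 0)).hasDerivWithinAt (s := Icc 0 T)))
  exact h1.congr key (key t ht)

theorem hasDerivWithinAt_of_weak_zero {T : ℝ} {X d : ℝ → L2} (hd : Continuous d)
    (h : ∀ ψ : ℝ → ℝ, ∀ hψ : IsTest ψ, ∀ t ∈ Icc 0 T, HasDerivWithinAt
      (fun s => inner ℝ (X s) (emb hψ.toCI)) (inner ℝ (d t) (emb hψ.toCI)) (Icc 0 T) t)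
    {t : ℝ} (ht : t ∈ Icc 0 T) : HasDerivWithinAt X (d t) (Icc 0 T) t :=
  hasDerivWithinAt_of_weak (ContinuousLinearMap.id ℝ L2)
    {e | ∃ ψ : ℝ → ℝ, ∃ hψ : IsTest ψ, e = emb hψ.toCI}
    (fun F hF => eq_zero_of_forall_isTest F fun ψ hψ => by
      rw [← hψ.inner_toCI]; exact hF _ ⟨ψ, hψ, rfl⟩) hd
    (by rintro e ⟨ψ, hψ, rfl⟩ t ht; exact h ψ hψ t ht) ht

/-- A time derivative that lies only in H⁻¹ becomes an L² function after one primitive in x, at the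
price of working modulo constants. -/
theorem hasDerivWithinAt_of_weak_one {T : ℝ} {X B : ℝ → L2} (hB : Continuous B)
    (h : ∀ ψ : ℝ → ℝ, ∀ hψ : IsTest ψ, ∀ t ∈ Icc 0 T, HasDerivWithinAt
      (fun s => inner ℝ (X s) (emb hψ.toCI)) (inner ℝ (B t) (emb hψ.derivCI)) (Icc 0 T) t)
    {t : ℝ} (ht : t ∈ Icc 0 T) :
    HasDerivWithinAt (fun s => meanFree (emb (prim (X s)))) (-meanFree (B t)) (Icc 0 T) t := by
  rw [← map_neg]
  refine hasDerivWithinAt_of_weak meanFree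
    {e | ∃ ψ : ℝ → ℝ, ∃ hψ : IsTest ψ, e = emb hψ.derivCI}
    (fun F hF => meanFree_eq_zero_of_forall_isTest F fun ψ hψ => by
      rw [← hψ.inner_derivCI]; exact hF _ ⟨ψ, hψ, rfl⟩) (d := fun t => -B t) hB.neg ?_ ht
  rintro e ⟨ψ, hψ, rfl⟩ t ht
  simp only [hψ.inner_emb_prim, inner_neg_left]
  exact (h ψ hψ t ht).neg

/-- The difference f - ∫g has weak derivative zero, hence is constant. -/
theorem IsWeakDeriv.exists_eq {f g : L2} (h : IsWeakDeriv f g) :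
    ∃ a : CI, IsH1 a g ∧ f = emb a := by
  have h1 : meanFree (f - emb (prim g)) = 0 := by
    refine meanFree_eq_zero_of_forall_isTest _ fun ψ hψ => ?_
    rw [← hψ.inner_derivCI, inner_sub_left, hψ.inner_emb_prim, hψ.inner_derivCI, h ψ hψ,
      hψ.inner_toCI]
    ring
  rw [meanFree_apply, sub_eq_zero] at h1
  refine ⟨_, isH1_cst_add_prim (prim (f - emb (prim g)) 1) g, ?_⟩
  rw [map_add, emb_apply (cst _), cst_csmul, ← h1]
  abel

theorem VanishesAt.apply_eq_zero {f : H 1} {a : CI} {x : unitInterval} (h : VanishesAt f x)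
    (ha : D 0 f = emb a) : a x = 0 := by
  obtain ⟨g, hg, hfg, hx⟩ := h
  have h1 : ex a =ᵐ[volume.restrict (Icc (0 : ℝ) 1)] g := by
    rw [← restrict_Ioo_eq_restrict_Icc]
    rw [ha] at hfg
    exact (coeFn_emb a).symm.trans hfg
  have h2 := Measure.eqOn_Icc_of_ae_eq volume zero_ne_one h1 (continuous_ex a).continuousOn hg x.2
  rw [ex_coe] at h2
  rw [h2, hx]

/-! ### Time derivatives of nonlinear functions of a curve -/

theorem norm_emb_le_of_abs_le {a b : CI} {K : ℝ} (h : ∀ x, |a x| ≤ K * |b x|) :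
    ‖emb a‖ ≤ K * ‖emb b‖ := by
  refine Lp.norm_le_mul_norm_of_ae_le_mul ?_
  filter_upwards [coeFn_emb a, coeFn_emb b] with x h1 h2
  rw [h1, h2, Real.norm_eq_abs, Real.norm_eq_abs]
  exact h _

theorem abs_sub_le_of_hasDerivAt {Φ Φ' : ℝ → ℝ} {m M K : ℝ}
    (h1 : ∀ y ∈ Icc m M, HasDerivAt Φ (Φ' y) y) (hK : ∀ y ∈ Icc m M, |Φ' y| ≤ K)
    {y z : ℝ} (hy : y ∈ Icc m M) (hz : z ∈ Icc m M) : |Φ z - Φ y| ≤ K * |z - y| :=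
  (convex_Icc m M).norm_image_sub_le_of_norm_hasDerivWithin_le
    (fun x hx => (h1 x hx).hasDerivWithinAt) (fun x hx => hK x hx) hy hz

theorem abs_taylor_le {Φ Φ' Φ'' : ℝ → ℝ} {m M K : ℝ}
    (h1 : ∀ y ∈ Icc m M, HasDerivAt Φ (Φ' y) y) (h2 : ∀ y ∈ Icc m M, HasDerivAt Φ' (Φ'' y) y)
    (hK : ∀ y ∈ Icc m M, |Φ'' y| ≤ K) {y z : ℝ} (hy : y ∈ Icc m M) (hz : z ∈ Icc m M) :
    |Φ z - Φ y - Φ' y * (z - y)| ≤ K * |z - y| * |z - y| := by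
  have hK0 : 0 ≤ K := (abs_nonneg _).trans (hK y hy)
  have hsub : uIcc y z ⊆ Icc m M := uIcc_subset_Icc hy hz
  have h := (convex_uIcc y z).norm_image_sub_le_of_norm_hasDerivWithin_le
    (f := fun x => Φ x - Φ' y * x) (f' := fun x => Φ' x - Φ' y) (C := K * |z - y|)
    (fun x hx => ((h1 x (hsub hx)).sub (by
      simpa using (hasDerivAt_id x).const_mul (Φ' y))).hasDerivWithinAt)
    (fun x hx => (abs_sub_le_of_hasDerivAt h2 hK hy (hsub hx)).trans
      (mul_le_mul_of_nonneg_left (abs_sub_left_of_mem_uIcc hx) hK0))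
    left_mem_uIcc right_mem_uIcc
  rw [Real.norm_eq_abs, Real.norm_eq_abs] at h
  convert h using 2
  ring

/-- A continuous function `Ψ` on `ℝ` that has on `[m, M]` a Lipschitz derivative, extended to the
continuous function `Ψ'`. -/
structure Smooth1 (m M : ℝ) (Ψ Ψ' : C(ℝ, ℝ)) : Prop where
  exists_quad : ∃ K, 0 ≤ K ∧ ∀ y ∈ Icc m M, ∀ z ∈ Icc m M,
    |Ψ z - Ψ y - Ψ' y * (z - y)| ≤ K * |z - y| * |z - y|
  isH1_comp : ∀ a a', (∀ x, a x ∈ Icc m M) → IsH1 a a' → IsH1 (Ψ.comp a) (Ψ'.comp a • a')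

theorem smooth1_of_hasDerivAt {Φ Φ' Φ'' : ℝ → ℝ} {Ψ Ψ' : C(ℝ, ℝ)} {m M : ℝ}
    (h1 : ∀ y ∈ Icc m M, HasDerivAt Φ (Φ' y) y) (h2 : ∀ y ∈ Icc m M, HasDerivAt Φ' (Φ'' y) y)
    (hc : ContinuousOn Φ'' (Icc m M)) (hΨ : EqOn Ψ Φ (Icc m M)) (hΨ' : EqOn Ψ' Φ' (Icc m M)) :
    Smooth1 m M Ψ Ψ' where
  exists_quad := by
    obtain ⟨K, hK⟩ := isCompact_Icc.exists_bound_of_continuousOn hc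
    refine ⟨|K|, abs_nonneg K, fun y hy z hz => ?_⟩
    rw [hΨ hz, hΨ hy, hΨ' hy]
    exact abs_taylor_le h1 h2 (fun x hx => (hK x hx).trans (le_abs_self K)) hy hz
  isH1_comp := fun a a' ha h => h.comp h1 hΨ hΨ' ha

section Chain

variable {s : Set ℝ} {t : ℝ} {a : ℝ → CI} {m M : ℝ} {Ψ Ψ' : C(ℝ, ℝ)}

/-- The curve is differentiable only in L² but continuous in sup norm. The quadratic Taylor
remainder is bounded by the product of the sup-norm increment, which tends to zero, and the L²
increment, which is O(|z - t|). -/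
theorem hasDerivWithinAt_emb_comp {d : L2} (ha : HasDerivWithinAt (fun z => emb (a z)) d s t)
    (hc : ContinuousWithinAt a s t) (hr : ∀ z x, a z x ∈ Icc m M) (hΨ : Smooth1 m M Ψ Ψ') :
    HasDerivWithinAt (fun z => emb (Ψ.comp (a z))) (Ψ'.comp (a t) • d) s t := by
  obtain ⟨K, hK0, hK⟩ := hΨ.exists_quad
  set R : ℝ → L2 := fun z => emb (Ψ.comp (a z)) - emb (Ψ.comp (a t))
    - Ψ'.comp (a t) • (emb (a z) - emb (a t)) with hR
  have hRle : ∀ z, ‖R z‖ ≤ (K * ‖a z - a t‖) * ‖emb (a z) - emb (a t)‖ := by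
    intro z
    have e : R z = emb (Ψ.comp (a z) - Ψ.comp (a t) - Ψ'.comp (a t) * (a z - a t)) := by
      rw [hR, map_sub, map_sub, emb_mul, map_sub]
    rw [e, ← map_sub]
    refine norm_emb_le_of_abs_le fun x => (hK _ (hr t x) _ (hr z x)).trans ?_
    have h1 : |(a z - a t) x| ≤ ‖a z - a t‖ := (a z - a t).norm_coe_le_norm x
    have h2 : a z x - a t x = (a z - a t) x := rfl
    rw [h2]
    gcongr
  have hR0 : HasDerivWithinAt R 0 s t := by
    rw [hasDerivWithinAt_iff_isLittleO]
    have e : R t = 0 := by simp [hR]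
    simp only [e, smul_zero, sub_zero]
    have o1 : (fun z => K * ‖a z - a t‖) =o[𝓝[s] t] (fun _ => (1 : ℝ)) := by
      rw [Asymptotics.isLittleO_one_iff]
      have h3 : Tendsto (fun z => a z - a t) (𝓝[s] t) (𝓝 0) := by
        have := hc.tendsto.sub_const (a t)
        rwa [sub_self] at this
      simpa using h3.norm.const_mul K
    have o2 := o1.mul_isBigO (ha.hasFDerivWithinAt.isBigO_sub.norm_left)
    simp only [one_mul] at o2
    exact (Asymptotics.isBigO_of_le _ fun z => (hRle z).trans (le_abs_self _)).trans_isLittleO o2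
  have h1 := ((hR0.add (((ha.sub_const (emb (a t))).const_smul (Ψ'.comp (a t))))).const_add
    (emb (Ψ.comp (a t))))
  refine (h1.congr_deriv (zero_add _)).congr (fun z _ => ?_) ?_ <;> simp [hR]

theorem hasDerivWithinAt_comp {d : CI} (ha : HasDerivWithinAt a d s t)
    (hr : ∀ z x, a z x ∈ Icc m M) (hΨ : Smooth1 m M Ψ Ψ') :
    HasDerivWithinAt (fun z => Ψ.comp (a z)) (Ψ'.comp (a t) * d) s t := by
  obtain ⟨K, hK0, hK⟩ := hΨ.exists_quad
  set R : ℝ → CI := fun z => Ψ.comp (a z) - Ψ.comp (a t) - Ψ'.comp (a t) * (a z - a t) with hR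
  have hRle : ∀ z, ‖R z‖ ≤ (K * ‖a z - a t‖) * ‖a z - a t‖ := by
    intro z
    rw [ContinuousMap.norm_le _ (by positivity)]
    refine fun x => (hK _ (hr t x) _ (hr z x)).trans ?_
    have h1 : |(a z - a t) x| ≤ ‖a z - a t‖ := (a z - a t).norm_coe_le_norm x
    have h2 : a z x - a t x = (a z - a t) x := rfl
    rw [h2]
    gcongr
  have hR0 : HasDerivWithinAt R 0 s t := by
    rw [hasDerivWithinAt_iff_isLittleO]
    have e : R t = 0 := by simp [hR]
    simp only [e, smul_zero, sub_zero]
    have o1 : (fun z => K * ‖a z - a t‖) =o[𝓝[s] t] (fun _ => (1 : ℝ)) := by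
      rw [Asymptotics.isLittleO_one_iff]
      have h3 : Tendsto (fun z => a z - a t) (𝓝[s] t) (𝓝 0) := by
        have := ha.continuousWithinAt.tendsto.sub_const (a t)
        rwa [sub_self] at this
      simpa using h3.norm.const_mul K
    have o2 := o1.mul_isBigO (ha.hasFDerivWithinAt.isBigO_sub.norm_left)
    simp only [one_mul] at o2
    exact (Asymptotics.isBigO_of_le _ fun z => (hRle z).trans (le_abs_self _)).trans_isLittleO o2
  have h1 := ((hR0.add (((ha.sub_const (a t)).const_mul (Ψ'.comp (a t))))).const_add
    (Ψ.comp (a t)))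
  refine (h1.congr_deriv (zero_add _)).congr (fun z _ => ?_) ?_ <;> simp [hR]

end Chain

theorem hasDerivWithinAt_csmul_sub {s : Set ℝ} {t : ℝ} {a : ℝ → CI} {F : ℝ → L2} {F' : L2}
    (ha : ContinuousWithinAt a s t) (hF : HasDerivWithinAt F F' s t) :
    HasDerivWithinAt (fun z => a z • (F z - F t)) (a t • F') s t := by
  rw [hasDerivWithinAt_iff_tendsto_slope] at hF ⊢
  have h := Filter.Tendsto.smul (ha.mono (sdiff_subset : s \ {t} ⊆ s)) hF
  refine h.congr fun z => ?_
  simp only [slope, vsub_eq_sub, sub_self, smul_zero, sub_zero]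
  module

theorem hasDerivWithinAt_primMul_sub {s : Set ℝ} {t : ℝ} {G F : ℝ → L2} {F' : L2}
    (hG : ContinuousWithinAt G s t) (hF : HasDerivWithinAt F F' s t) :
    HasDerivWithinAt (fun z => primMul (G z) (F z - F t)) (primMul (G t) F') s t := by
  rw [hasDerivWithinAt_iff_tendsto_slope] at hF ⊢
  have h := (primMul.continuous₂.tendsto (G t, F')).comp
    (Tendsto.prodMk_nhds (hG.mono (sdiff_subset : s \ {t} ⊆ s)) hF)
  refine h.congr fun z => ?_
  simp [slope]

/-! ### Multiplying the integrated momentum equation by an H¹ factor -/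

/-- Integration by parts in `(z F)` for a factor `z ∈ H¹`, modulo constants. -/
def byParts (z : CI) (z' F : L2) : L2 := meanFree (z • F - emb (primMul z' F))

theorem meanFree_one2 : meanFree one2 = 0 := by
  rw [meanFree_apply, prim_one2]
  simp

/-- Formally `byParts z z' F` is a primitive of zF_x. It does not see constants in F, so it acts on
quantities known only modulo constants. -/
theorem byParts_smul_one2 {z : CI} {z' : L2} (hz : IsH1 z z') (k : ℝ) :
    byParts z z' (k • one2) = 0 := by
  have h1 : z • k • one2 - emb (primMul z' (k • one2)) = (k * z 0) • one2 := by
    have h2 : emb z - emb (prim z') = (z 0) • one2 := by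
      have h := congrArg emb hz
      rw [map_add, emb_apply (cst _), cst_csmul] at h
      rw [h, add_sub_cancel_right]
    have h3 : primMul z' (k • one2) = k • prim z' := by
      rw [map_smul, one2_eq, primMul_emb, one_smul]
    rw [h3, map_smul, mul_smul, ← h2, emb_apply z]
    module
  rw [byParts, h1, map_smul, meanFree_one2, smul_zero]

theorem byParts_sub (z : CI) (z' F G : L2) :
    byParts z z' (F - G) = byParts z z' F - byParts z z' G := by
  rw [byParts, byParts, byParts, ← map_sub]
  congr 1
  rw [map_sub, map_sub]
  module

theorem byParts_sub_left (z y : CI) (z' y' F : L2) :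
    byParts (z - y) (z' - y') F = byParts z z' F - byParts y y' F := by
  rw [byParts, byParts, byParts, ← map_sub]
  congr 1
  rw [map_sub, sub_apply, map_sub]
  module

theorem byParts_meanFree {z : CI} {z' : L2} (hz : IsH1 z z') (F : L2) :
    byParts z z' (meanFree F) = byParts z z' F := by
  rw [meanFree_apply, byParts_sub, byParts_smul_one2 hz, sub_zero]

theorem byParts_emb_prim {z : CI} {z' : L2} (hz : IsH1 z z') (X : L2) :
    byParts z z' (emb (prim X)) = meanFree (emb (prim (z • X))) := by
  have h := (hz.mul (isH1_prim X)).prim_eq (by simp)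
  rw [byParts]
  congr 1
  rw [← emb_mul, ← h, ← map_sub, map_add, primMul_emb, add_sub_cancel_right]

/-- The rule (zx)_t = zx_t + z_tx when x_t exists only after one primitive. The increment splits
into `byParts` of the increment of the primitive of x and a term with the increment of z; in this
form z' needs no time derivative, only continuity. -/
theorem hasDerivWithinAt_byParts {s : Set ℝ} {t : ℝ} {z x : ℝ → CI} {z' : ℝ → L2} {B ζ : L2}
    (hz : ∀ t, IsH1 (z t) (z' t)) (hzc : ContinuousWithinAt z s t)
    (hzc' : ContinuousWithinAt z' s t)
    (hE : HasDerivWithinAt (fun t => meanFree (emb (prim (emb (x t))))) (-meanFree B) s t)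
    (hζ : HasDerivWithinAt (fun t => emb (z t)) ζ s t) :
    HasDerivWithinAt (fun t => meanFree (emb (prim (z t • emb (x t)))))
      (-byParts (z t) (z' t) B + meanFree (emb (prim (x t • ζ)))) s t := by
  set E : ℝ → L2 := fun t => meanFree (emb (prim (emb (x t)))) with hEdef
  have e1 : ∀ r, meanFree (emb (prim (z r • emb (x r)))) =
      meanFree (emb (prim (z t • emb (x t)))) + byParts (z r) (z' r) (E r - E t)
        + meanFree (emb (prim (x t • (emb (z r) - emb (z t))))) := by
    intro r
    have k1 : ∀ q, byParts (z q) (z' q) (E q) = meanFree (emb (prim (z q • emb (x q)))) := fun q => by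
      rw [hEdef, byParts_meanFree (hz q), byParts_emb_prim (hz q)]
    have k2 : byParts (z r - z t) (z' r - z' t) (E t)
        = meanFree (emb (prim (x t • (emb (z r) - emb (z t))))) := by
      rw [hEdef, byParts_meanFree ((hz r).sub (hz t)), byParts_emb_prim ((hz r).sub (hz t)),
        ← emb_mul, ← map_sub, ← emb_mul, mul_comm]
    rw [← k2, ← k1, ← k1, byParts_sub, byParts_sub_left]
    abel
  have h1 : HasDerivWithinAt (fun r => byParts (z r) (z' r) (E r - E t))
      (byParts (z t) (z' t) (-meanFree B)) s t := by
    have a1 := hasDerivWithinAt_csmul_sub hzc hE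
    have a2 := emb.hasFDerivAt.comp_hasDerivWithinAt t (hasDerivWithinAt_primMul_sub hzc' hE)
    exact meanFree.hasFDerivAt.comp_hasDerivWithinAt t (a1.sub a2)
  have h2 : HasDerivWithinAt (fun r => meanFree (emb (prim (x t • (emb (z r) - emb (z t))))))
      (meanFree (emb (prim (x t • ζ)))) s t :=
    (meanFree.comp (emb.comp prim)).hasFDerivAt.comp_hasDerivWithinAt t
      ((hζ.sub_const (emb (z t))).const_smul (x t))
  have h3 : byParts (z t) (z' t) (-meanFree B) = -byParts (z t) (z' t) B := by
    have := byParts_sub (z t) (z' t) 0 (meanFree B)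
    have h0 : byParts (z t) (z' t) 0 = 0 := by simp [byParts]
    rw [h0, zero_sub, zero_sub, byParts_meanFree (hz t)] at this
    exact this
  rw [← h3]
  exact ((h1.const_add (meanFree (emb (prim (z t • emb (x t)))))).add h2).congr
    (fun r _ => e1 r) (e1 t)

/-- The momentum flux in terms of the momentum divided by the density. -/
theorem byParts_flux {z y : CI} {z' y' : L2} (hz : IsH1 z z') (hy : IsH1 y y') (hzy : z * y = 1)
    (ν : ℝ) (w k : L2) :
    byParts z z' (-(ν • y • w) + emb (ν • primMul w y' + prim (y • k)))
      = -meanFree (ν • w - emb (prim k)) := by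
  -- Since zy = 1, the terms carrying the derivative of the factor cancel below, and the pure
  -- viscous flux remains.
  have hd : z • y' + y • z' = 0 := by
    have h1 := hz.mul hy
    rw [hzy] at h1
    have h2 : IsH1 (1 : CI) 0 := by
      have h3 : cst 1 = 1 := by rw [cst_eq, one_smul]
      have := isH1_cst 1
      rwa [h3] at this
    exact h1.unique h2
  have e1 : z • y • w = w := by rw [smul_smul, hzy, one_smul]
  have e2 : z * primMul w y' - primMul z' (emb (primMul w y')) = primMul (z • w) y' := by
    rw [hz.mul_primMul, add_sub_cancel_right]
  have e3 : z * prim (y • k) - primMul z' (emb (prim (y • k))) = prim k := by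
    have h := (hz.mul (isH1_prim (y • k))).prim_eq (by simp)
    rw [← h, smul_smul, hzy, one_smul, map_add, primMul_emb, add_sub_cancel_right]
  have e4 : primMul (z • w) y' + primMul z' (y • w) = 0 := by
    rw [primMul_csmul_left, primMul_comm z', primMul_csmul_left, ← map_add, hd, map_zero]
  rw [byParts, ← map_neg]
  congr 1
  have e5 : z • (-(ν • y • w) + emb (ν • primMul w y' + prim (y • k)))
      = -(ν • w) + emb (ν • (z * primMul w y') + z * prim (y • k)) := by
    have : z • ν • y • w = ν • w := by
      rw [smul_comm z ν (y • w), e1]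
    rw [smul_add, smul_neg, this, ← emb_mul, mul_add, mul_smul_comm]
  have e6 : primMul z' (-(ν • y • w) + emb (ν • primMul w y' + prim (y • k)))
      = -(ν • primMul z' (y • w)) + (ν • primMul z' (emb (primMul w y'))
        + primMul z' (emb (prim (y • k)))) := by
    rw [map_add, map_neg, map_smul (primMul z') ν (y • w), map_add emb,
      map_smul emb ν (primMul w y'), map_add, map_smul (primMul z') ν (emb (primMul w y'))]
  have e7 : ν • (z * primMul w y') + z * prim (y • k)
      - (-(ν • primMul z' (y • w)) + (ν • primMul z' (emb (primMul w y'))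
        + primMul z' (emb (prim (y • k))))) = prim k := by
    have : ν • (z * primMul w y') + z * prim (y • k)
      - (-(ν • primMul z' (y • w)) + (ν • primMul z' (emb (primMul w y'))
        + primMul z' (emb (prim (y • k))))) =
      ν • ((z * primMul w y' - primMul z' (emb (primMul w y'))) + primMul z' (y • w))
        + (z * prim (y • k) - primMul z' (emb (prim (y • k)))) := by module
    rw [this, e2, e3, e4, smul_zero, zero_add]
  rw [e5, e6, add_sub_assoc, ← map_sub, e7]
  abel

theorem norm_csmul_le_of_le {a : CI} {F : L2} {K X : ℝ} (ha : ‖a‖ ≤ K) (hF : ‖F‖ ≤ X) :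
    ‖a • F‖ ≤ K * X :=
  (norm_csmul_le a F).trans (mul_le_mul ha hF (norm_nonneg _) ((norm_nonneg _).trans ha))

theorem norm_mul_le_of_le' {a b : CI} {K L : ℝ} (ha : ‖a‖ ≤ K) (hb : ‖b‖ ≤ L) : ‖a * b‖ ≤ K * L :=
  (norm_mul_le a b).trans (mul_le_mul ha hb (norm_nonneg _) ((norm_nonneg _).trans ha))

theorem exists_comp_bound (Ψ : C(ℝ, ℝ)) (m M : ℝ) :
    ∃ K, ∀ a : CI, (∀ x, a x ∈ Icc m M) → ‖Ψ.comp a‖ ≤ K := by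
  obtain ⟨K, hK⟩ := (isCompact_Icc (a := m) (b := M)).exists_bound_of_continuousOn
    Ψ.continuous.continuousOn
  exact ⟨|K|, fun a ha => (ContinuousMap.norm_le _ (abs_nonneg K)).2 fun x =>
    (hK _ (ha x)).trans (le_abs_self K)⟩

theorem Smooth1.exists_lipschitz {m M : ℝ} {Ψ Ψ' : C(ℝ, ℝ)} (h : Smooth1 m M Ψ Ψ') :
    ∃ L, ∀ y ∈ Icc m M, ∀ z ∈ Icc m M, |Ψ z - Ψ y| ≤ L * |z - y| := by
  obtain ⟨K, hK0, hK⟩ := h.exists_quad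
  obtain ⟨L, hL⟩ := (isCompact_Icc (a := m) (b := M)).exists_bound_of_continuousOn
    Ψ'.continuous.continuousOn
  refine ⟨K * (M - m) + L, fun y hy z hz => ?_⟩
  have h1 := hK y hy z hz
  have h2 : |z - y| ≤ M - m := abs_sub_le_iff.2 ⟨by linarith [hz.2, hy.1], by linarith [hz.1, hy.2]⟩
  have h3 : |Ψ z - Ψ y| ≤ |Ψ z - Ψ y - Ψ' y * (z - y)| + |Ψ' y * (z - y)| := by
    have := abs_add_le (Ψ z - Ψ y - Ψ' y * (z - y)) (Ψ' y * (z - y))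
    rwa [sub_add_cancel] at this
  rw [abs_mul] at h3
  have h4 : |Ψ' y| * |z - y| ≤ L * |z - y| := by gcongr; exact hL y hy
  have h5 : K * |z - y| * |z - y| ≤ K * (M - m) * |z - y| := by gcongr
  linarith

/-! ### The steady solution and the quantities built from it -/

/-- A steady solution, together with continuous extensions of the nonlinearities `log y`, `1 / y`,
`P' y` and of the derivatives of `P'`. -/
structure Background (ν : ℝ) where
  m : ℝ
  M : ℝ
  δ : ℝ
  ρ₀ : ℝ
  u₀ : ℝ
  ρx : CI
  ρxx : CI
  ux : CI
  uxx : CI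
  lg : C(ℝ, ℝ)
  iv : C(ℝ, ℝ)
  q1 : C(ℝ, ℝ)
  q2 : C(ℝ, ℝ)
  q3 : C(ℝ, ℝ)
  hν : 0 < ν
  hm : 0 < m
  hδ : 0 < δ
  ρ_mem : ∀ x, m + δ ≤ (cst ρ₀ + prim (emb ρx)) x ∧ (cst ρ₀ + prim (emb ρx)) x ≤ M - δ
  u_mem : ∀ x, m + δ ≤ (cst u₀ + prim (emb ux)) x ∧ (cst u₀ + prim (emb ux)) x ≤ M - δ
  isH1_ρx : IsH1 ρx (emb ρxx)
  isH1_ux : IsH1 ux (emb uxx)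
  mass : (cst ρ₀ + prim (emb ρx)) * ux + (cst u₀ + prim (emb ux)) * ρx = 0
  smooth_lg : Smooth1 m M lg iv
  smooth_iv : Smooth1 m M iv (-(iv * iv))
  smooth_q1 : Smooth1 m M q1 q2
  smooth_q2 : Smooth1 m M q2 q3
  iv_mul : ∀ y ∈ Icc m M, iv y * y = 1
  q1_pos : ∀ y ∈ Icc m M, 0 < q1 y
  lg_sub_le : ∀ y ∈ Icc m M, ∀ z ∈ Icc m M, |lg z - lg y| ≤ m⁻¹ * |z - y|
  le_lg_sub : ∀ y ∈ Icc m M, ∀ z ∈ Icc m M, |z - y| ≤ M * |lg z - lg y|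

namespace Background

variable {ν : ℝ} (B : Background ν)

/-- The steady density. -/
def ρ : CI := cst B.ρ₀ + prim (emb B.ρx)
/-- The steady velocity. -/
def u : CI := cst B.u₀ + prim (emb B.ux)
/-- The density, in terms of the space derivative of its perturbation. -/
def dens (F : L2) : CI := B.ρ + prim F
/-- The velocity, in terms of the space derivative of its perturbation. -/
def vel (W : L2) : CI := B.u + prim W
/-- The space derivative of the density. -/
def densx (F : L2) : L2 := emb B.ρx + F
/-- The space derivative of the velocity. -/
def velx (W : L2) : L2 := emb B.ux + W
/-- The space derivative of the momentum. -/
def momx (F W : L2) : L2 := B.dens F • B.velx W + B.vel W • B.densx F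
/-- The ratio of the steady density and the density. -/
def ratio (F : L2) : CI := B.ρ * B.iv.comp (B.dens F)
/-- The space derivative of `ratio`. -/
def ratiox (F : L2) : L2 :=
  B.ρ • (-(B.iv * B.iv)).comp (B.dens F) • B.densx F + B.iv.comp (B.dens F) • emb B.ρx
/-- The logarithmic derivative of the steady density. -/
def b : CI := B.iv.comp B.ρ * B.ρx
/-- The space derivative of the perturbation of the logarithm of the density. -/
def logx (F : L2) : L2 := B.iv.comp (B.dens F) • B.densx F - emb B.b
/-- The lower order terms in the momentum equation. -/
def force (F W : L2) : L2 :=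
  B.q1.comp (B.dens F) • B.densx F - emb (B.q1.comp B.ρ * B.ρx)
    + emb (B.ux * (B.dens F * prim W + B.u * prim F))

theorem isH1_ρ : IsH1 B.ρ (emb B.ρx) := isH1_cst_add_prim _ _
theorem isH1_u : IsH1 B.u (emb B.ux) := isH1_cst_add_prim _ _
theorem isH1_dens (F : L2) : IsH1 (B.dens F) (B.densx F) := B.isH1_ρ.add (isH1_prim F)
theorem isH1_vel (W : L2) : IsH1 (B.vel W) (B.velx W) := B.isH1_u.add (isH1_prim W)

theorem mem_of_norm_le {F : L2} (hF : ‖F‖ ≤ B.δ) {a : CI} {x : unitInterval}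
    (ha : B.m + B.δ ≤ a x ∧ a x ≤ B.M - B.δ) : (a + prim F) x ∈ Icc B.m B.M := by
  have h1 : |prim F x| ≤ B.δ :=
    ((prim F).norm_coe_le_norm x).trans ((norm_prim_le F).trans hF)
  rw [abs_le] at h1
  rw [ContinuousMap.add_apply]
  constructor <;> linarith

theorem dens_mem {F : L2} (hF : ‖F‖ ≤ B.δ) (x : unitInterval) : B.dens F x ∈ Icc B.m B.M :=
  B.mem_of_norm_le hF (B.ρ_mem x)
theorem vel_mem {W : L2} (hW : ‖W‖ ≤ B.δ) (x : unitInterval) : B.vel W x ∈ Icc B.m B.M :=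
  B.mem_of_norm_le hW (B.u_mem x)
theorem ρ_mem' (x : unitInterval) : B.ρ x ∈ Icc B.m B.M :=
  ⟨by have := (B.ρ_mem x).1; have := B.hδ; rw [ρ]; linarith,
    by have := (B.ρ_mem x).2; have := B.hδ; rw [ρ]; linarith⟩
theorem u_mem' (x : unitInterval) : B.u x ∈ Icc B.m B.M :=
  ⟨by have := (B.u_mem x).1; have := B.hδ; rw [u]; linarith,
    by have := (B.u_mem x).2; have := B.hδ; rw [u]; linarith⟩

theorem hM : 0 < B.M := B.hm.trans_le ((B.ρ_mem' 0).1.trans (B.ρ_mem' 0).2)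

theorem iv_comp_mul {a : CI} (ha : ∀ x, a x ∈ Icc B.m B.M) : B.iv.comp a * a = 1 := by
  ext x
  exact B.iv_mul _ (ha x)

theorem mul_iv_comp {a : CI} (ha : ∀ x, a x ∈ Icc B.m B.M) : a * B.iv.comp a = 1 := by
  rw [mul_comm, B.iv_comp_mul ha]

theorem norm_le_of_mem {a : CI} (ha : ∀ x, a x ∈ Icc B.m B.M) : ‖a‖ ≤ B.M := by
  rw [ContinuousMap.norm_le _ B.hM.le]
  intro x
  rw [Real.norm_of_nonneg (B.hm.le.trans (ha x).1)]
  exact (ha x).2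

@[simp] theorem dens_apply_zero (F : L2) : B.dens F 0 = B.ρ 0 := by simp [dens]

theorem mass' : B.ρ * B.ux + B.u * B.ρx = 0 := B.mass

theorem u_mul_b : B.u * B.b = -B.ux := by
  have h1 := B.mul_iv_comp B.ρ_mem'
  have h2 := B.mass'
  rw [b]
  linear_combination B.iv.comp B.ρ * h2 - B.ux * h1

theorem ρ_mul_b : B.ρ * B.b = B.ρx := by
  have h1 := B.mul_iv_comp B.ρ_mem'
  rw [b]
  linear_combination B.ρx * h1

theorem isH1_b : IsH1 B.b (emb (B.iv.comp B.ρ * B.ρxx + B.ρx * ((-(B.iv * B.iv)).comp B.ρ * B.ρx))) :=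
  ((B.smooth_iv.isH1_comp _ _ B.ρ_mem' B.isH1_ρ).mul B.isH1_ρx).congr_deriv (by
    rw [map_add, emb_mul, emb_mul, emb_mul])

/-- The derivative of the logarithmic derivative of the steady density. -/
def bx : CI := B.iv.comp B.ρ * B.ρxx + B.ρx * ((-(B.iv * B.iv)).comp B.ρ * B.ρx)

theorem isH1_b' : IsH1 B.b (emb B.bx) := B.isH1_b

theorem isH1_ratio {F : L2} (hF : ‖F‖ ≤ B.δ) : IsH1 (B.ratio F) (B.ratiox F) :=
  B.isH1_ρ.mul (B.smooth_iv.isH1_comp _ _ (B.dens_mem hF) (B.isH1_dens F))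

theorem prim_momx (F W : L2) : prim (B.momx F W) = B.dens F * B.vel W - B.ρ * B.u := by
  have h1 := (B.isH1_dens F).mul (B.isH1_vel W)
  have h2 := B.isH1_ρ.mul B.isH1_u
  have h3 : B.ρ • emb B.ux + B.u • emb B.ρx = 0 := by
    rw [← emb_mul, ← emb_mul, ← map_add, B.mass', map_zero]
  have h4 := (h1.sub h2).prim_eq (by simp [dens, vel])
  rw [← h4, h3, sub_zero]
  rfl

theorem prim_logx {F : L2} (hF : ‖F‖ ≤ B.δ) :
    prim (B.logx F) = B.lg.comp (B.dens F) - B.lg.comp B.ρ := by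
  have h1 := B.smooth_lg.isH1_comp _ _ (B.dens_mem hF) (B.isH1_dens F)
  have h2 := B.smooth_lg.isH1_comp _ _ B.ρ_mem' B.isH1_ρ
  have h3 := (h1.sub h2).prim_eq (by simp [dens])
  rw [← h3, logx, b, emb_mul]

theorem continuous_dens : Continuous B.dens := continuous_const.add prim.continuous
theorem continuous_vel : Continuous B.vel := continuous_const.add prim.continuous
theorem continuous_densx : Continuous B.densx := continuous_const.add continuous_id
theorem continuous_velx : Continuous B.velx := continuous_const.add continuous_id

theorem continuous_comp_dens (Ψ : C(ℝ, ℝ)) : Continuous fun F => Ψ.comp (B.dens F) :=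
  (ContinuousMap.continuous_postcomp Ψ).comp B.continuous_dens

theorem continuous_logx : Continuous B.logx :=
  ((B.continuous_comp_dens _).smul B.continuous_densx).sub continuous_const

theorem continuous_ratio : Continuous B.ratio := continuous_const.mul (B.continuous_comp_dens _)

theorem continuous_ratiox : Continuous B.ratiox :=
  ((((B.continuous_comp_dens _).smul B.continuous_densx)).const_smul B.ρ).add
    ((B.continuous_comp_dens _).smul continuous_const)

theorem continuous_momx {r w : ℝ → L2} (hr : Continuous r) (hw : Continuous w) :
    Continuous fun t => B.momx (r t) (w t) :=
  ((B.continuous_dens.comp hr).smul (B.continuous_velx.comp hw)).add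
    ((B.continuous_vel.comp hw).smul (B.continuous_densx.comp hr))

theorem continuous_force {r w : ℝ → L2} (hr : Continuous r) (hw : Continuous w) :
    Continuous fun t => B.force (r t) (w t) :=
  ((((B.continuous_comp_dens _).comp hr).smul (B.continuous_densx.comp hr)).sub
    continuous_const).add (emb.continuous.comp (continuous_const.mul
      (((B.continuous_dens.comp hr).mul (prim.continuous.comp hw)).add
        (continuous_const.mul (prim.continuous.comp hr)))))

/-! ### The perturbation equations for the space derivatives -/

/-- The perturbation equations in terms of the space derivatives `r, w` of the perturbation of
the density and of the velocity. -/
structure Pert (T : ℝ) (r w : ℝ → L2) : Prop where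
  cont_r : Continuous r
  cont_w : Continuous w
  prim_w : ∀ t, prim (w t) 1 = 0
  r_le : ∀ t, ‖r t‖ ≤ B.δ
  w_le : ∀ t, ‖w t‖ ≤ B.δ
  mass : ∀ ψ : ℝ → ℝ, ∀ hψ : IsTest ψ, ∀ t ∈ Icc 0 T,
    HasDerivWithinAt (fun s => inner ℝ (emb (prim (r s))) (emb hψ.toCI))
      (inner ℝ (emb (B.dens (r t) * B.vel (w t) - B.ρ * B.u)) (emb hψ.derivCI)) (Icc 0 T) t
  momentum : ∀ ψ : ℝ → ℝ, ∀ hψ : IsTest ψ, ∀ t ∈ Icc 0 T,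
    HasDerivWithinAt (fun s => inner ℝ (emb (B.ρ * prim (w s))) (emb hψ.toCI))
      (-(ν * inner ℝ (w t) (B.ratio (r t) • emb hψ.derivCI + hψ.toCI • B.ratiox (r t)))
        - inner ℝ (B.ratio (r t) • ((B.dens (r t) * B.vel (w t)) • w t + B.force (r t) (w t)))
          (emb hψ.toCI)) (Icc 0 T) t

namespace Pert

variable {B} {T : ℝ} {r w : ℝ → L2}

theorem hasDerivWithinAt_dens (h : B.Pert T r w) {t : ℝ} (ht : t ∈ Icc 0 T) :
    HasDerivWithinAt (fun s => emb (B.dens (r s))) (-B.momx (r t) (w t)) (Icc 0 T) t := by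
  have h1 : HasDerivWithinAt (fun s => emb (prim (r s))) (-B.momx (r t) (w t)) (Icc 0 T) t := by
    refine hasDerivWithinAt_of_weak_zero (d := fun t => -B.momx (r t) (w t))
      (B.continuous_momx h.cont_r h.cont_w).neg (fun ψ hψ s hs => ?_) ht
    have h2 := h.mass ψ hψ s hs
    rw [← B.prim_momx, hψ.inner_emb_prim] at h2
    rwa [inner_neg_left]
  simp only [dens, map_add]
  exact h1.const_add _

/-- The product Wz' is only integrable, so it enters the momentum flux through its primitive, which
is continuous, and ψ is replaced by its derivative. -/
theorem inner_csmul_isTest {z' : L2} {ψ : ℝ → ℝ} (hψ : IsTest ψ) (W : L2) :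
    inner ℝ W (hψ.toCI • z') = -inner ℝ (emb (primMul W z')) (emb hψ.derivCI) := by
  have h1 := congrArg (fun a : CI => a 1) (hψ.isH1.mul_primMul W z')
  simp only [ContinuousMap.mul_apply, ContinuousMap.add_apply, hψ.toCI_one, zero_mul,
    primMul_one] at h1
  rw [csmul_inner, real_inner_comm (emb (primMul W z'))] at h1
  linarith

/-- The momentum flux. -/
theorem hasDerivWithinAt_flux (h : B.Pert T r w) {t : ℝ} (ht : t ∈ Icc 0 T) :
    HasDerivWithinAt (fun s => meanFree (emb (prim (B.dens (r s) • emb (prim (w s))))))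
      (meanFree (ν • w t - emb (prim ((B.dens (r t) * B.vel (w t)) • w t
        + prim (w t) • B.momx (r t) (w t) + B.force (r t) (w t))))) (Icc 0 T) t := by
  set k : ℝ → L2 := fun t => (B.dens (r t) * B.vel (w t)) • w t + B.force (r t) (w t) with hk
  have hkc : Continuous k :=
    (((B.continuous_dens.comp h.cont_r).mul (B.continuous_vel.comp h.cont_w)).smul h.cont_w).add
      (B.continuous_force h.cont_r h.cont_w)
  set y : ℝ → CI := fun t => B.ratio (r t) with hy
  set y' : ℝ → L2 := fun t => B.ratiox (r t) with hy'
  have hyc : Continuous y := B.continuous_ratio.comp h.cont_r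
  have hyc' : Continuous y' := B.continuous_ratiox.comp h.cont_r
  have hyH : ∀ t, IsH1 (y t) (y' t) := fun t => B.isH1_ratio (h.r_le t)
  set b : ℝ → L2 := fun t => -(ν • y t • w t)
    + emb (ν • primMul (w t) (y' t) + prim (y t • k t)) with hb
  have hbc : Continuous b := by
    refine ((hyc.smul h.cont_w).const_smul ν).neg.add (emb.continuous.comp ?_)
    refine Continuous.add (Continuous.const_smul ?_ ν) (prim.continuous.comp (hyc.smul hkc))
    exact primMul.continuous₂.comp (h.cont_w.prodMk hyc')
  -- The given equation governs ρ̂v and has the factor y = ρ̂/ρ on its right-hand side. Multiplying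
  -- by z = ρ/ρ̂ through `byParts` removes y and gives an equation for ρv, the extra term coming
  -- from z_t and the mass equation.
  have hE : HasDerivWithinAt (fun t => meanFree (emb (prim (emb (B.ρ * prim (w t))))))
      (-meanFree (b t)) (Icc 0 T) t := by
    refine hasDerivWithinAt_of_weak_one hbc (fun ψ hψ s hs => ?_) ht
    refine (h.momentum ψ hψ s hs).congr_deriv ?_
    have e1 : inner ℝ (w s) (y s • emb hψ.derivCI) = inner ℝ (y s • w s) (emb hψ.derivCI) := by
      rw [csmul_inner]
    have e2 := inner_csmul_isTest (z' := y' s) hψ (w s)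
    have e3 := hψ.inner_emb_prim (y s • k s)
    rw [hb, inner_add_right, e1, e2]
    simp only [map_add, inner_add_left, inner_neg_left, real_inner_smul_left, map_smul emb ν,
      hk, hy, hy'] at e3 ⊢
    rw [e3]
    simp only [smul_add, inner_add_left]
    ring
  -- the density divided by the steady density
  set ivρ := B.iv.comp B.ρ with hivρ
  set z : ℝ → CI := fun t => ivρ * B.dens (r t) with hz
  set z' : ℝ → L2 := fun t => ivρ • B.densx (r t)
    + B.dens (r t) • (-(B.iv * B.iv)).comp B.ρ • emb B.ρx with hz'
  have hzH : ∀ t, IsH1 (z t) (z' t) := fun t =>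
    (B.smooth_iv.isH1_comp _ _ B.ρ_mem' B.isH1_ρ).mul (B.isH1_dens (r t))
  have hzc : Continuous z := continuous_const.mul (B.continuous_dens.comp h.cont_r)
  have hzc' : Continuous z' := ((B.continuous_densx.comp h.cont_r).const_smul ivρ).add
    ((B.continuous_dens.comp h.cont_r).smul continuous_const)
  have hζ : HasDerivWithinAt (fun t => emb (z t)) (ivρ • (-B.momx (r t) (w t))) (Icc 0 T) t := by
    simp only [hz, emb_mul]
    exact (h.hasDerivWithinAt_dens ht).const_smul ivρ
  have hiv := B.iv_comp_mul B.ρ_mem'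
  have hmain := hasDerivWithinAt_byParts hzH hzc.continuousWithinAt hzc'.continuousWithinAt hE hζ
  have hzy : z t * y t = 1 := by
    have h2 := B.mul_iv_comp (B.dens_mem (h.r_le t))
    change ivρ * B.dens (r t) * (B.ρ * B.iv.comp (B.dens (r t))) = 1
    linear_combination (B.dens (r t) * B.iv.comp (B.dens (r t))) * hiv + h2
  have hzx : ∀ s, z s • emb (B.ρ * prim (w s)) = B.dens (r s) • emb (prim (w s)) := by
    intro s
    rw [← emb_mul, ← emb_mul]
    congr 1
    rw [hz]
    linear_combination (B.dens (r s) * prim (w s)) * hiv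
  have hxζ : (B.ρ * prim (w t)) • ivρ • (-B.momx (r t) (w t)) = -(prim (w t) • B.momx (r t) (w t)) := by
    rw [smul_smul, smul_neg]
    congr 2
    linear_combination (prim (w t)) * hiv
  simp only [hzx] at hmain
  refine hmain.congr_deriv ?_
  rw [hb, byParts_flux (hzH t) (hyH t) hzy, hxζ, neg_neg, ← map_add]
  congr 1
  simp only [hk, map_add, map_neg]
  abel

end Pert

end Background

theorem LinSys.mono {ν c C c' C' T u₀ : ℝ} {ûx : CI} {φ w wb j g G : ℝ → L2} {ρ κ b : ℝ → CI}
    (h : LinSys ν c C T u₀ ûx φ w wb j g G ρ κ b) (hc' : 0 < c') (hc : c' ≤ c) (hC : C ≤ C') :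
    LinSys ν c' C' T u₀ ûx φ w wb j g G ρ κ b :=
  { h with
    hc := hc'
    le_û := fun x => hc.trans (h.le_û x)
    le_u := fun t x => hc.trans (h.le_u t x)
    le_ρ := fun t x => hc.trans (h.le_ρ t x)
    le_κ := fun t x => hc.trans (h.le_κ t x)
    û_le := h.û_le.trans hC
    ûx_le := h.ûx_le.trans hC
    ρ_le := fun t => (h.ρ_le t).trans hC
    κ_le := fun t => (h.κ_le t).trans hC
    b_le := fun t => (h.b_le t).trans hC
    j_le := fun t => (h.j_le t).trans hC
    g_le := fun t => (h.g_le t).trans (by gcongr)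
    G_le := fun t => (h.G_le t).trans (by gcongr) }

/-! ### Bounds on the coefficients and reduction to the linear system -/

namespace Background

variable {ν : ℝ} (B : Background ν)

/-- All the quantities attached to the steady solution are bounded by `K`. -/
structure Bd (K : ℝ) : Prop where
  one_le : 1 ≤ K
  M_le : B.M ≤ K
  inv_m_le : B.m⁻¹ ≤ K
  δ_le : B.δ ≤ K
  ν_le : ν ≤ K
  inv_ν_le : ν⁻¹ ≤ K
  ρx_le : ‖B.ρx‖ ≤ K
  ux_le : ‖B.ux‖ ≤ K
  ρxx_le : ‖B.ρxx‖ ≤ K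
  uxx_le : ‖B.uxx‖ ≤ K
  b_le : ‖B.b‖ ≤ K
  bx_le : ‖B.bx‖ ≤ K
  iv_le : ∀ a : CI, (∀ x, a x ∈ Icc B.m B.M) → ‖B.iv.comp a‖ ≤ K
  q1_le : ∀ a : CI, (∀ x, a x ∈ Icc B.m B.M) → ‖B.q1.comp a‖ ≤ K
  q2_le : ∀ a : CI, (∀ x, a x ∈ Icc B.m B.M) → ‖B.q2.comp a‖ ≤ K
  iv_lip : ∀ y ∈ Icc B.m B.M, ∀ z ∈ Icc B.m B.M, |B.iv z - B.iv y| ≤ K * |z - y|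
  q1_lip : ∀ y ∈ Icc B.m B.M, ∀ z ∈ Icc B.m B.M, |B.q1 z - B.q1 y| ≤ K * |z - y|
  q2_lip : ∀ y ∈ Icc B.m B.M, ∀ z ∈ Icc B.m B.M, |B.q2 z - B.q2 y| ≤ K * |z - y|

theorem exists_bd : ∃ K, B.Bd K := by
  obtain ⟨k1, h1⟩ := exists_comp_bound B.iv B.m B.M
  obtain ⟨k2, h2⟩ := exists_comp_bound B.q1 B.m B.M
  obtain ⟨k3, h3⟩ := exists_comp_bound B.q2 B.m B.M
  obtain ⟨k5, h5⟩ := B.smooth_iv.exists_lipschitz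
  obtain ⟨k6, h6⟩ := B.smooth_q1.exists_lipschitz
  obtain ⟨k7, h7⟩ := B.smooth_q2.exists_lipschitz
  obtain ⟨S, hle⟩ := (List.finite_toSet [1, B.M, B.m⁻¹, B.δ, ν, ν⁻¹, ‖B.ρx‖, ‖B.ux‖, ‖B.ρxx‖,
    ‖B.uxx‖, ‖B.b‖, ‖B.bx‖, k1, k2, k3, k5, k6, k7]).bddAbove
  simp only [mem_upperBounds, mem_ofPred_eq, List.forall_mem_cons, List.not_mem_nil,
    IsEmpty.forall_iff, implies_true, and_true] at hle
  obtain ⟨a1, a2, a3, a4, a5, a6, a7, a8, a9, a10, a11, a12, a13, a14, a15, a17, a18, a19⟩ := hle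
  exact ⟨S, a1, a2, a3, a4, a5, a6, a7, a8, a9, a10, a11, a12,
    fun a ha => (h1 a ha).trans a13, fun a ha => (h2 a ha).trans a14,
    fun a ha => (h3 a ha).trans a15,
    fun y hy z hz => (h5 y hy z hz).trans (by gcongr),
    fun y hy z hz => (h6 y hy z hz).trans (by gcongr),
    fun y hy z hz => (h7 y hy z hz).trans (by gcongr)⟩

namespace Bd

variable {B} {K : ℝ}

theorem pos (hK : B.Bd K) : 0 < K := zero_lt_one.trans_le hK.one_le

theorem le_pow (hK : B.Bd K) {n : ℕ} (hn : n ≠ 0) : K ≤ K ^ n := le_self_pow₀ hK.one_le hn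

theorem mem_le (hK : B.Bd K) {a : CI} (ha : ∀ x, a x ∈ Icc B.m B.M) : ‖a‖ ≤ K :=
  (B.norm_le_of_mem ha).trans hK.M_le

theorem norm_comp_sub_le {Ψ : C(ℝ, ℝ)}
    (hΨ : ∀ y ∈ Icc B.m B.M, ∀ z ∈ Icc B.m B.M, |Ψ z - Ψ y| ≤ K * |z - y|) (hK0 : 0 ≤ K)
    {F : L2} (hF : ‖F‖ ≤ B.δ) : ‖Ψ.comp (B.dens F) - Ψ.comp B.ρ‖ ≤ K * ‖prim F‖ := by
  rw [ContinuousMap.norm_le _ (by positivity)]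
  intro x
  refine (hΨ _ (B.ρ_mem' x) _ (B.dens_mem hF x)).trans ?_
  gcongr
  have : B.dens F x - B.ρ x = prim F x := by simp [dens]
  rw [this]
  exact (prim F).norm_coe_le_norm x

theorem norm_densx_le (hK : B.Bd K) {F : L2} (hF : ‖F‖ ≤ B.δ) : ‖B.densx F‖ ≤ 2 * K := by
  have h1 := (norm_emb_le B.ρx).trans hK.ρx_le
  have h2 := norm_add_le (emb B.ρx) F
  have h3 := hK.δ_le
  rw [densx]; linarith

theorem norm_velx_le (hK : B.Bd K) {F : L2} (hF : ‖F‖ ≤ B.δ) : ‖B.velx F‖ ≤ 2 * K := by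
  have h1 := (norm_emb_le B.ux).trans hK.ux_le
  have h2 := norm_add_le (emb B.ux) F
  have h3 := hK.δ_le
  rw [velx]; linarith

theorem norm_momx_le (hK : B.Bd K) {F W : L2} (hF : ‖F‖ ≤ B.δ) (hW : ‖W‖ ≤ B.δ) :
    ‖B.momx F W‖ ≤ 4 * K ^ 2 := by
  have h1 := norm_csmul_le_of_le (hK.mem_le (B.dens_mem hF)) (hK.norm_velx_le hW)
  have h2 := norm_csmul_le_of_le (hK.mem_le (B.vel_mem hW)) (hK.norm_densx_le hF)
  refine (norm_add_le _ _).trans ?_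
  linarith

theorem norm_emb_prim_le (hK : B.Bd K) {F : L2} (hF : ‖F‖ ≤ B.δ) :
    ‖emb (prim F)‖ ≤ K * ‖emb (prim (B.logx F))‖ := by
  refine norm_emb_le_of_abs_le fun x => ?_
  have h := B.le_lg_sub _ (B.ρ_mem' x) _ (B.dens_mem hF x)
  have e1 : B.dens F x - B.ρ x = prim F x := by simp [dens]
  rw [B.prim_logx hF, ← e1]
  exact h.trans (mul_le_mul_of_nonneg_right hK.M_le (abs_nonneg _))

theorem norm_emb_prim_logx_le (hK : B.Bd K) {F : L2} (hF : ‖F‖ ≤ B.δ) :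
    ‖emb (prim (B.logx F))‖ ≤ K * ‖emb (prim F)‖ := by
  refine norm_emb_le_of_abs_le fun x => ?_
  have h := B.lg_sub_le _ (B.ρ_mem' x) _ (B.dens_mem hF x)
  have e1 : B.dens F x - B.ρ x = prim F x := by simp [dens]
  rw [B.prim_logx hF, ← e1]
  refine h.trans ?_
  have := hK.inv_m_le
  gcongr

theorem norm_logx_le (hK : B.Bd K) {F : L2} (hF : ‖F‖ ≤ B.δ) : ‖B.logx F‖ ≤ 2 * K ^ 2 * ‖F‖ := by
  have e : B.logx F = B.iv.comp (B.dens F) • F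
      + (B.iv.comp (B.dens F) - B.iv.comp B.ρ) • emb B.ρx := by
    rw [logx, densx, b, emb_mul]; module
  have h1 := norm_csmul_le_of_le (hK.iv_le _ (B.dens_mem hF)) (le_refl ‖F‖)
  have h2 := norm_csmul_le_of_le (norm_comp_sub_le hK.iv_lip hK.pos.le hF)
    ((norm_emb_le B.ρx).trans hK.ρx_le)
  have h3 : K * ‖prim F‖ * K ≤ K ^ 2 * ‖F‖ := by
    calc K * ‖prim F‖ * K = K ^ 2 * ‖prim F‖ := by ring
      _ ≤ _ := by gcongr; exact norm_prim_le F
  have h4 : K * ‖F‖ ≤ K ^ 2 * ‖F‖ := by gcongr; exact hK.le_pow two_ne_zero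
  rw [e]
  refine (norm_add_le _ _).trans ?_
  linarith

/-- The identity r_x = ρ(log(ρ/ρ̂))_x + (ρ̂_x/ρ̂)r inverts the passage to the logarithm; its last
term is controlled because the logarithm is bi-Lipschitz on [m,M]. -/
theorem norm_le_logx (hK : B.Bd K) {F : L2} (hF : ‖F‖ ≤ B.δ) : ‖F‖ ≤ 2 * K ^ 2 * ‖B.logx F‖ := by
  have e : F = B.dens F • B.logx F + B.b • emb (prim F) := by
    have h1 : B.dens F • B.iv.comp (B.dens F) • B.densx F = B.densx F := by
      rw [smul_smul, B.mul_iv_comp (B.dens_mem hF), one_smul]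
    have h2 : B.dens F • emb B.b = emb B.ρx + B.b • emb (prim F) := by
      rw [← B.ρ_mul_b, ← emb_mul, ← emb_mul, ← map_add, dens]
      congr 1; ring
    rw [logx, smul_sub, h1, h2, densx]; abel
  have h1 := norm_csmul_le_of_le (hK.mem_le (B.dens_mem hF)) (le_refl ‖B.logx F‖)
  have h2 := norm_csmul_le_of_le hK.b_le ((hK.norm_emb_prim_le hF).trans
    (mul_le_mul_of_nonneg_left ((norm_emb_le _).trans (norm_prim_le _)) hK.pos.le))
  have h4 : K * ‖B.logx F‖ ≤ K ^ 2 * ‖B.logx F‖ := by gcongr; exact hK.le_pow two_ne_zero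
  have h5 : ‖F‖ ≤ K * ‖B.logx F‖ + K * (K * ‖B.logx F‖) := by
    conv_lhs => rw [e]
    exact (norm_add_le _ _).trans (add_le_add h1 h2)
  linarith

/-- The part of the force without derivatives of the unknowns. -/
theorem force_eq {F : L2} (hF : ‖F‖ ≤ B.δ) (W : L2) :
    B.force F W = (B.q1.comp (B.dens F) * B.dens F) • B.logx F
      + emb ((B.q1.comp (B.dens F) * B.dens F - B.q1.comp B.ρ * B.ρ) * B.b)
      + B.ux • (B.dens F • emb (prim W) + B.u • emb (prim F)) := by
  have h1 : B.q1.comp (B.dens F) • B.densx F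
      = (B.q1.comp (B.dens F) * B.dens F) • (B.logx F + emb B.b) := by
    rw [logx, sub_add_cancel, mul_smul, smul_smul (B.dens F), B.mul_iv_comp (B.dens_mem hF),
      one_smul]
  have h2 : B.q1.comp B.ρ * B.ρx = B.q1.comp B.ρ * B.ρ * B.b := by
    rw [mul_assoc, B.ρ_mul_b]
  rw [force, h1, h2, sub_mul, map_sub, emb_mul B.ux, map_add, emb_mul (B.dens F), emb_mul B.u,
    smul_add, emb_mul (B.q1.comp (B.dens F) * B.dens F)]
  abel

theorem norm_low_le (hK : B.Bd K) {F : L2} (hF : ‖F‖ ≤ B.δ) :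
    ‖emb ((B.q1.comp (B.dens F) * B.dens F - B.q1.comp B.ρ * B.ρ) * B.b)‖
      ≤ 2 * K ^ 4 * ‖emb (prim (B.logx F))‖ := by
  have hK0 := hK.pos
  have h1 : ‖emb ((B.q1.comp (B.dens F) * B.dens F - B.q1.comp B.ρ * B.ρ) * B.b)‖
      ≤ 2 * K ^ 3 * ‖emb (prim F)‖ := by
    refine norm_emb_le_of_abs_le fun x => ?_
    have e1 : B.dens F x - B.ρ x = prim F x := by simp [dens]
    have a1 := hK.q1_lip _ (B.ρ_mem' x) _ (B.dens_mem hF x)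
    have a2 : |B.q1 (B.dens F x)| ≤ K :=
      ((B.q1.comp (B.dens F)).norm_coe_le_norm x).trans (hK.q1_le _ (B.dens_mem hF))
    have a3 : |B.ρ x| ≤ K := (B.ρ.norm_coe_le_norm x).trans (hK.mem_le B.ρ_mem')
    have a4 : |B.b x| ≤ K := (B.b.norm_coe_le_norm x).trans hK.b_le
    rw [e1] at a1
    have e2 : ((B.q1.comp (B.dens F) * B.dens F - B.q1.comp B.ρ * B.ρ) * B.b) x
        = (B.q1 (B.dens F x) * prim F x + (B.q1 (B.dens F x) - B.q1 (B.ρ x)) * B.ρ x) * B.b x := by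
      rw [← e1]
      simp only [ContinuousMap.mul_apply, ContinuousMap.sub_apply, ContinuousMap.comp_apply]
      ring
    rw [e2, abs_mul]
    have a5 : |B.q1 (B.dens F x) * prim F x + (B.q1 (B.dens F x) - B.q1 (B.ρ x)) * B.ρ x|
        ≤ 2 * K ^ 2 * |prim F x| := by
      refine (abs_add_le _ _).trans ?_
      rw [abs_mul, abs_mul]
      have b1 : |B.q1 (B.dens F x)| * |prim F x| ≤ K ^ 2 * |prim F x| := by
        gcongr; exact a2.trans (hK.le_pow two_ne_zero)
      have b2 : |B.q1 (B.dens F x) - B.q1 (B.ρ x)| * |B.ρ x| ≤ K * |prim F x| * K := by gcongr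
      linarith
    calc _ ≤ (2 * K ^ 2 * |prim F x|) * K := by gcongr
      _ = _ := by ring
  refine h1.trans ?_
  have := hK.norm_emb_prim_le hF
  calc 2 * K ^ 3 * ‖emb (prim F)‖ ≤ 2 * K ^ 3 * (K * ‖emb (prim (B.logx F))‖) := by gcongr
    _ = _ := by ring

end Bd

/-- The damping coefficient. -/
def damp (ν : ℝ) (B : Background ν) (F : L2) : CI := ν⁻¹ • (B.q1.comp (B.dens F) * B.dens F)

/-- A lower bound for the coefficients. -/
theorem exists_lower : ∃ c > 0, c ≤ B.m ∧ ∀ F : L2, ‖F‖ ≤ B.δ → ∀ x, c ≤ damp ν B F x := by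
  have hne : (Icc B.m B.M).Nonempty := ⟨_, B.ρ_mem' 0⟩
  obtain ⟨y, hy, hmin⟩ := isCompact_Icc.exists_isMinOn hne B.q1.continuous.continuousOn
  have hpos := B.q1_pos y hy
  have hν := B.hν
  have hm := B.hm
  refine ⟨min B.m (ν⁻¹ * (B.q1 y * B.m)), by positivity, min_le_left _ _, fun F hF x =>
    (min_le_right _ _).trans ?_⟩
  have h1 : B.q1 y ≤ B.q1 (B.dens F x) := hmin (B.dens_mem hF x)
  have h2 := (B.dens_mem hF x).1
  have h3 : 0 ≤ B.q1 (B.dens F x) := hpos.le.trans h1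
  change _ ≤ ν⁻¹ * (B.q1 (B.dens F x) * B.dens F x)
  gcongr

theorem Bd.damp_le {B : Background ν} {K : ℝ} (hK : B.Bd K) {F : L2} (hF : ‖F‖ ≤ B.δ) :
    ‖damp ν B F‖ ≤ K ^ 3 := by
  have hK0 := hK.pos
  have h1 := norm_mul_le_of_le' (hK.q1_le _ (B.dens_mem hF)) (hK.mem_le (B.dens_mem hF))
  have hν := B.hν
  rw [damp, norm_smul, Real.norm_of_nonneg (by positivity)]
  calc _ ≤ K * (K * K) := by gcongr; exact hK.inv_ν_le
    _ = _ := by ring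

/-- The remainder in the damping relation. -/
def rem (ν : ℝ) (B : Background ν) (F W : L2) : L2 :=
  B.force F W + ν • (B.b • W + prim W • emb B.bx)
    - damp ν B F • (B.dens F • emb (prim W) + ν • B.logx F)

/-- By definition of the damping coefficient, the damping of the νφ part of N is exactly the
pressure term ρP'(ρ)φ of the force. After this cancellation the remainder contains only the
primitive of φ, v and w, which is why it counts as lower order. -/
theorem Bd.norm_force_rem_le {B : Background ν} {K : ℝ} (hK : B.Bd K) {F W : L2}
    (hF : ‖F‖ ≤ B.δ) :
    ‖B.force F W‖ ≤ 4 * K ^ 4 * (‖B.logx F‖ + ‖W‖) ∧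
    ‖rem ν B F W‖ ≤ 5 * K ^ 4 * (‖emb (prim (B.logx F))‖ + ‖W‖) := by
  have hK0 := hK.pos
  have hK1 := hK.one_le
  have hν := B.hν
  have hd := hK.mem_le (B.dens_mem hF)
  have hu := hK.mem_le B.u_mem'
  have hW : ‖emb (prim W)‖ ≤ ‖W‖ := (norm_emb_le _).trans (norm_prim_le _)
  have hf : ‖emb (prim (B.logx F))‖ ≤ ‖B.logx F‖ := (norm_emb_le _).trans (norm_prim_le _)
  set f := ‖emb (prim (B.logx F))‖
  set L := ‖B.logx F‖ with hL
  have p1 : K ^ 2 ≤ K ^ 4 := pow_le_pow_right₀ hK1 (by norm_num)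
  have p2 : K ^ 3 ≤ K ^ 4 := pow_le_pow_right₀ hK1 (by norm_num)
  have f0 : 0 ≤ f := norm_nonneg _
  have L0 : 0 ≤ L := norm_nonneg _
  have w0 : 0 ≤ ‖W‖ := norm_nonneg _
  have h1 := hK.norm_low_le hF
  have h2 : ‖B.ux • (B.dens F • emb (prim W) + B.u • emb (prim F))‖ ≤ K ^ 4 * (f + ‖W‖) := by
    have a1 := norm_csmul_le_of_le hd hW
    have a2 := norm_csmul_le_of_le hu (hK.norm_emb_prim_le hF)
    have a3 := norm_csmul_le_of_le hK.ux_le ((norm_add_le _ _).trans (add_le_add a1 a2))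
    refine a3.trans ?_
    have b1 : K ^ 2 * ‖W‖ ≤ K ^ 4 * ‖W‖ := by gcongr
    have b2 : K ^ 3 * f ≤ K ^ 4 * f := by gcongr
    linarith
  have h3 : ‖(B.q1.comp (B.dens F) * B.dens F) • B.logx F‖ ≤ K ^ 4 * L := by
    have a1 := norm_csmul_le_of_le (norm_mul_le_of_le' (hK.q1_le _ (B.dens_mem hF)) hd) (le_refl L)
    have b1 : K ^ 2 * L ≤ K ^ 4 * L := by gcongr
    linarith
  constructor
  · rw [Bd.force_eq hF]
    refine norm_add₃_le.trans ?_
    have b1 : K ^ 4 * f ≤ K ^ 4 * L := by gcongr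
    have b2 : 0 ≤ K ^ 4 * ‖W‖ := by positivity
    linarith
  · have e : rem ν B F W =
        emb ((B.q1.comp (B.dens F) * B.dens F - B.q1.comp B.ρ * B.ρ) * B.b)
        + B.ux • (B.dens F • emb (prim W) + B.u • emb (prim F))
        + ν • (B.b • W + prim W • emb B.bx) - damp ν B F • B.dens F • emb (prim W) := by
      have : damp ν B F • ν • B.logx F = (B.q1.comp (B.dens F) * B.dens F) • B.logx F := by
        rw [damp, smul_assoc, smul_comm _ ν, smul_smul ν⁻¹ ν, inv_mul_cancel₀ hν.ne', one_smul]
      rw [rem, Bd.force_eq hF, smul_add (damp ν B F), this]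
      abel
    have h4 : ‖ν • (B.b • W + prim W • emb B.bx)‖ ≤ 2 * (K ^ 4 * ‖W‖) := by
      have a1 := norm_csmul_le_of_le hK.b_le (le_refl ‖W‖)
      have a2 := norm_csmul_le_of_le (norm_prim_le W) ((norm_emb_le B.bx).trans hK.bx_le)
      have a3 := (norm_add_le _ _).trans (add_le_add a1 a2)
      rw [norm_smul, Real.norm_of_nonneg hν.le]
      calc _ ≤ K * (K * ‖W‖ + ‖W‖ * K) := by gcongr; exact hK.ν_le
        _ = 2 * (K ^ 2 * ‖W‖) := by ring
        _ ≤ _ := by gcongr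
    have h5 := norm_csmul_le_of_le (hK.damp_le hF) (norm_csmul_le_of_le hd hW)
    rw [e]
    refine (norm_sub_le _ _).trans ((add_le_add (norm_add₃_le) le_rfl).trans ?_)
    have b2 : 0 ≤ K ^ 4 * f := by positivity
    have b3 : 0 ≤ K ^ 4 * ‖W‖ := by positivity
    linarith

/-- The logarithm is the right unknown: (log ρ)_t + u(log ρ)_x + u_x = 0 has precisely w as the
highest-order source, which is what the viscous term can cancel. Subtracting the steady equation
produces the term bv, since ûb = -û_x. -/
theorem exists_linSys {K c : ℝ} (hK : B.Bd K) (hc : 0 < c) (hcm : c ≤ B.m)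
    (hcd : ∀ F : L2, ‖F‖ ≤ B.δ → ∀ x, c ≤ damp ν B F x) {T : ℝ} {r w : ℝ → L2}
    (h : B.Pert T r w) :
    LinSys ν c (9 * K ^ 4) T B.u₀ B.ux (fun t => B.logx (r t)) w w
      (fun t => B.momx (r t) (w t))
      (fun t => (B.dens (r t) * B.vel (w t)) • w t + prim (w t) • B.momx (r t) (w t)
        + B.force (r t) (w t))
      (fun t => rem ν B (r t) (w t)) (fun t => B.dens (r t)) (fun t => damp ν B (r t))
      (fun _ => B.b) := by
  have hK0 := hK.pos
  have hK1 := hK.one_le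
  have p1 : K ≤ K ^ 4 := hK.le_pow (by norm_num)
  have p2 : K ^ 2 ≤ K ^ 4 := pow_le_pow_right₀ hK1 (by norm_num)
  have p3 : K ^ 3 ≤ K ^ 4 := pow_le_pow_right₀ hK1 (by norm_num)
  have q4 : 0 ≤ K ^ 4 := by positivity
  exact
  { hν := B.hν
    hc := hc
    cont_φ := B.continuous_logx.comp h.cont_r
    cont_w := h.cont_w
    cont_g := ((((B.continuous_dens.comp h.cont_r).mul (B.continuous_vel.comp h.cont_w)).smul
      h.cont_w).add ((prim.continuous.comp h.cont_w).smul
        (B.continuous_momx h.cont_r h.cont_w))).add (B.continuous_force h.cont_r h.cont_w)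
    cont_ρ := B.continuous_dens.comp h.cont_r
    cont_κ := (((B.continuous_comp_dens _).comp h.cont_r).mul
      (B.continuous_dens.comp h.cont_r)).const_smul (ν⁻¹ : ℝ)
    prim_w := h.prim_w
    transport := fun t ht => by
      have h1 := hasDerivWithinAt_emb_comp (h.hasDerivWithinAt_dens ht)
        (B.continuous_dens.comp h.cont_r).continuousWithinAt (fun s => B.dens_mem (h.r_le s))
        B.smooth_lg
      have h2 := h1.sub_const (emb (B.lg.comp B.ρ))
      simp only [B.prim_logx (h.r_le _), map_sub]
      refine h2.congr_deriv ?_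
      have e1 := B.iv_comp_mul (B.dens_mem (h.r_le t))
      have e2 : B.vel (w t) • emb B.b = -emb B.ux + emb (B.b * prim (w t)) := by
        rw [← emb_mul, ← map_neg, ← map_add, vel, ← B.u_mul_b]
        congr 1; ring
      have e3 : B.vel (w t) • B.logx (r t) = B.iv.comp (B.dens (r t)) • B.vel (w t) • B.densx (r t)
          - (-emb B.ux + emb (B.b * prim (w t))) := by
        rw [← e2, logx, smul_sub, smul_comm]
      have e4 : B.iv.comp (B.dens (r t)) • B.dens (r t) • B.velx (w t) = emb B.ux + w t := by
        rw [smul_smul, e1, one_smul, velx]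
      change _ = -(B.vel (w t) • B.logx (r t) + w t + emb (B.b * prim (w t)))
      rw [e3, momx, smul_neg, smul_add, e4]
      abel
    flux := fun t ht => h.hasDerivWithinAt_flux ht
    density := fun t ht => h.hasDerivWithinAt_dens ht
    rel := fun t => by
      have e1 := ((B.isH1_dens (r t)).mul (B.isH1_vel (w t))).mul (isH1_prim (w t))
      have e2 := e1.prim_eq (by simp)
      have e3 := (B.isH1_b'.mul (isH1_prim (w t))).prim_eq (by simp)
      change _ = B.vel (w t) * (B.dens (r t) * prim (w t)) + _
      rw [rem, add_sub_cancel, map_add, map_add prim (B.force _ _), map_smul, e3]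
      -- The first two terms of g are the x-derivative of the convective flux ρuv.
      have e4 : prim ((B.dens (r t) * B.vel (w t)) • w t + prim (w t) • B.momx (r t) (w t))
          = B.vel (w t) * (B.dens (r t) * prim (w t)) := by
        rw [momx, e2]; ring
      rw [e4]
      abel
    le_û := fun x => hcm.trans (B.u_mem' x).1
    le_u := fun t x => hcm.trans (B.vel_mem (h.w_le t) x).1
    le_ρ := fun t x => hcm.trans (B.dens_mem (h.r_le t) x).1
    le_κ := fun t x => hcd _ (h.r_le t) x
    û_le := (hK.mem_le B.u_mem').trans (by linarith)
    ûx_le := hK.ux_le.trans (by linarith)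
    ρ_le := fun t => (hK.mem_le (B.dens_mem (h.r_le t))).trans (by linarith)
    κ_le := fun t => (hK.damp_le (h.r_le t)).trans (by linarith)
    b_le := fun t => hK.b_le.trans (by linarith)
    j_le := fun t => (hK.norm_momx_le (h.r_le t) (h.w_le t)).trans (by linarith)
    g_le := fun t => by
      have a1 := norm_csmul_le_of_le (norm_mul_le_of_le' (hK.mem_le (B.dens_mem (h.r_le t)))
        (hK.mem_le (B.vel_mem (h.w_le t)))) (le_refl ‖w t‖)
      have a2 := norm_csmul_le_of_le (norm_prim_le (w t)) (hK.norm_momx_le (h.r_le t) (h.w_le t))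
      have a3 := (hK.norm_force_rem_le (W := w t) (h.r_le t)).1
      refine norm_add₃_le.trans ((add_le_add (add_le_add a1 a2) a3).trans ?_)
      have b1 : K ^ 2 * ‖w t‖ ≤ K ^ 4 * ‖w t‖ := by gcongr
      have b2 : 0 ≤ K ^ 4 * ‖B.logx (r t)‖ := by positivity
      linarith
    G_le := fun t => (hK.norm_force_rem_le (h.r_le t)).2.trans (by gcongr; norm_num) }

end Background

/-! ### Background data of a steady solution -/

theorem exists_continuousMap_eqOn {f : ℝ → ℝ} {m M : ℝ} (hmM : m ≤ M)
    (hf : ContinuousOn f (Icc m M)) : ∃ Ψ : C(ℝ, ℝ), EqOn Ψ f (Icc m M) := by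
  refine ⟨⟨fun y => f (max m (min M y)), hf.comp_continuous (by fun_prop) fun y =>
    ⟨le_max_left _ _, max_le hmM (min_le_left _ _)⟩⟩, fun y hy => ?_⟩
  simp [min_eq_right hy.2, max_eq_right hy.1]

theorem ofOn_eq_cst_add_prim {f f' : ℝ → ℝ} (hf : ContinuousOn f (Icc 0 1))
    (hf' : ContinuousOn f' (Icc 0 1)) (h : ∀ x ∈ Ioo (0 : ℝ) 1, HasDerivAt f (f' x) x)
    (x : unitInterval) : (cst (f 0) + prim (emb (ofOn f' hf'))) x = f x := by
  have h1 := isH1_ofOn hf hf' h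
  rw [IsH1] at h1
  have h2 := congrArg (fun a : CI => a x) h1
  exact h2.symm

/-- The functions defining a background are those of the steady solution `(ρh, uh)`. -/
structure Background.Rep {ν : ℝ} (B : Background ν) (P ρh uh : ℝ → ℝ) : Prop where
  ρ_eq : ∀ x : unitInterval, B.ρ x = ρh x
  u_eq : ∀ x : unitInterval, B.u x = uh x
  ρx_eq : ∀ x : unitInterval, (x : ℝ) ∈ Ioo (0 : ℝ) 1 → B.ρx x = deriv ρh x
  ux_eq : ∀ x : unitInterval, (x : ℝ) ∈ Ioo (0 : ℝ) 1 → B.ux x = deriv uh x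
  q1_eq : EqOn B.q1 (deriv P) (Icc B.m B.M)
  q2_eq : EqOn B.q2 (deriv (deriv P)) (Icc B.m B.M)

/-- Conservation of mass makes ρ̂û the constant ρ₀u₀ > 0. So û is positive, and ρ̂ = ρ₀u₀/û inherits
two derivatives from û, one more than is assumed of it. -/
theorem IsSteady.exists_rep {ν : ℝ} (hν : 0 < ν) {P : ℝ → ℝ} (hP : ContDiffOn ℝ ∞ P (Ioi 0))
    (hP' : ∀ y : ℝ, 0 < y → 0 < deriv P y) {ρ₀ u₀ u₁ : ℝ} (hρ₀ : 0 < ρ₀) (hu₀ : 0 < u₀)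
    {ρh uh : ℝ → ℝ} (h : IsSteady ν P ρ₀ u₀ u₁ ρh uh) :
    ∃ B : Background ν, B.Rep P ρh uh := by
  have hU : UniqueDiffOn ℝ (Icc (0 : ℝ) 1) := uniqueDiffOn_Icc_zero_one
  have hIcc : ∀ x ∈ Ioo (0 : ℝ) 1, Icc (0 : ℝ) 1 ∈ 𝓝 x := fun x hx => Icc_mem_nhds hx.1 hx.2
  have hderiv : ∀ {f : ℝ → ℝ}, DifferentiableOn ℝ f (Icc 0 1) → ∀ x ∈ Ioo (0 : ℝ) 1,
      HasDerivAt f (derivWithin f (Icc 0 1) x) x := fun hf x hx =>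
    ((hf x (Ioo_subset_Icc_self hx)).hasDerivWithinAt).hasDerivAt (hIcc x hx)
  set u' := derivWithin uh (Icc 0 1) with hu'
  set u'' := derivWithin u' (Icc 0 1) with hu''
  have hu'C : ContDiffOn ℝ 1 u' (Icc 0 1) := h.contDiff_u.derivWithin hU (by norm_num)
  have cu := h.contDiff_u.continuousOn
  have cu' := hu'C.continuousOn
  have cu'' : ContinuousOn u'' (Icc 0 1) := hu'C.continuousOn_derivWithin hU le_rfl
  have cρ := h.contDiff_ρ.continuousOn
  have du : ∀ x ∈ Ioo (0 : ℝ) 1, HasDerivAt uh (u' x) x :=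
    hderiv (h.contDiff_u.differentiableOn (by norm_num))
  have du' : ∀ x ∈ Ioo (0 : ℝ) 1, HasDerivAt u' (u'' x) x :=
    hderiv (hu'C.differentiableOn (by norm_num))
  have dρ := hderiv (h.contDiff_ρ.differentiableOn (by norm_num))
  have hconst : ∀ x ∈ Icc (0 : ℝ) 1, ρh x * uh x = ρ₀ * u₀ := by
    intro x hx
    have h1 := ofOn_eq_cst_add_prim (f := fun y => ρh y * uh y) (cρ.mul cu)
      (f' := fun _ : ℝ => (0 : ℝ)) continuousOn_const (fun y hy => by
        have h2 := ((dρ y hy).mul (du y hy)).differentiableAt.hasDerivAt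
        have h3 := h.mass y hy
        change HasDerivAt (fun y => ρh y * uh y) (deriv (fun y => ρh y * uh y) y) y at h2
        rwa [h3] at h2) ⟨x, hx⟩
    have h4 : ofOn (fun _ : ℝ => (0 : ℝ)) continuousOn_const = 0 := by
      ext y; rfl
    rw [h4, map_zero, map_zero, add_zero] at h1
    simp only [h.bc_ρ, h.bc_u_left] at h1
    rw [← h1]
    simp [cst]
  have hupos : ∀ x ∈ Icc (0 : ℝ) 1, 0 < uh x := fun x hx => by
    have h1 := hconst x hx
    have h2 : 0 < ρh x * uh x := by rw [h1]; positivity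
    exact (pos_iff_pos_of_mul_pos h2).1 (h.pos x hx)
  have hρeq : ∀ x ∈ Icc (0 : ℝ) 1, ρh x = ρ₀ * u₀ / uh x := fun x hx => by
    rw [eq_div_iff (hupos x hx).ne', hconst x hx]
  set p' : ℝ → ℝ := fun x => -(ρ₀ * u₀ * u' x / uh x ^ 2) with hp'
  set p'' : ℝ → ℝ := fun x => -((ρ₀ * u₀ * u'' x * uh x ^ 2
    - ρ₀ * u₀ * u' x * (2 * uh x * u' x)) / (uh x ^ 2) ^ 2) with hp''
  have hne : ∀ x ∈ Icc (0 : ℝ) 1, uh x ^ 2 ≠ 0 := fun x hx => (pow_pos (hupos x hx) 2).ne'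
  have cp' : ContinuousOn p' (Icc 0 1) :=
    ((continuousOn_const.mul cu').div (cu.pow 2) hne).neg
  have cp'' : ContinuousOn p'' (Icc 0 1) := by
    refine ContinuousOn.neg (ContinuousOn.div ?_ ((cu.pow 2).pow 2) fun x hx => pow_ne_zero 2 (hne x hx))
    exact ((continuousOn_const.mul cu'').mul (cu.pow 2)).sub
      ((continuousOn_const.mul cu').mul ((continuousOn_const.mul cu).mul cu'))
  have dp : ∀ x ∈ Ioo (0 : ℝ) 1, HasDerivAt ρh (p' x) x := fun x hx => by
    have h1 := ((hasDerivAt_const x (ρ₀ * u₀)).div (du x hx)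
      (hupos x (Ioo_subset_Icc_self hx)).ne').congr_of_eventuallyEq
      (f₁ := ρh) (by filter_upwards [hIcc x hx] with y hy using hρeq y hy)
    refine h1.congr_deriv ?_
    rw [hp']; ring
  have dp' : ∀ x ∈ Ioo (0 : ℝ) 1, HasDerivAt p' (p'' x) x := fun x hx => by
    have h1 := (((du' x hx).const_mul (ρ₀ * u₀)).div ((du x hx).pow 2)
      (hne x (Ioo_subset_Icc_self hx))).neg
    refine h1.congr_deriv ?_
    rw [hp'']; simp
  -- the range of the density and of the velocity
  obtain ⟨x1, hx1, m1⟩ := isCompact_Icc.exists_isMinOn (nonempty_Icc.2 zero_le_one) cu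
  obtain ⟨x2, hx2, m2⟩ := isCompact_Icc.exists_isMinOn (nonempty_Icc.2 zero_le_one) cρ
  obtain ⟨x3, hx3, m3⟩ := isCompact_Icc.exists_isMaxOn (nonempty_Icc.2 zero_le_one) cu
  obtain ⟨x4, hx4, m4⟩ := isCompact_Icc.exists_isMaxOn (nonempty_Icc.2 zero_le_one) cρ
  set a := min (uh x1) (ρh x2) with ha
  set b := max (uh x3) (ρh x4) with hb
  have ha0 : 0 < a := lt_min (hupos x1 hx1) (h.pos x2 hx2)
  have hu_mem : ∀ x ∈ Icc (0 : ℝ) 1, a ≤ uh x ∧ uh x ≤ b := fun x hx =>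
    ⟨(min_le_left _ _).trans (m1 hx), le_trans (m3 hx) (le_max_left _ _)⟩
  have hρ_mem : ∀ x ∈ Icc (0 : ℝ) 1, a ≤ ρh x ∧ ρh x ≤ b := fun x hx =>
    ⟨(min_le_right _ _).trans (m2 hx), le_trans (m4 hx) (le_max_right _ _)⟩
  have hab : a ≤ b := (hu_mem 0 (by simp)).1.trans (hu_mem 0 (by simp)).2
  -- The margin a/2 is the δ of the background: perturbations of sup norm at most δ keep density and
  -- velocity in [m,M], away from zero.
  set m := a / 2 with hm
  set M := b + a / 2 with hM
  have hm0 : 0 < m := by positivity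
  have hmM : m ≤ M := by rw [hm, hM]; linarith
  have hpos : ∀ y ∈ Icc m M, 0 < y := fun y hy => hm0.trans_le hy.1
  have hsub : Icc m M ⊆ Ioi 0 := fun y hy => hpos y hy
  -- the derivatives of the pressure
  have hP1 : ContDiffOn ℝ ∞ (deriv P) (Ioi 0) := hP.deriv_of_isOpen isOpen_Ioi (by simp)
  have hP2 : ContDiffOn ℝ ∞ (deriv (deriv P)) (Ioi 0) := hP1.deriv_of_isOpen isOpen_Ioi (by simp)
  have hP3 : ContDiffOn ℝ ∞ (deriv (deriv (deriv P))) (Ioi 0) :=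
    hP2.deriv_of_isOpen isOpen_Ioi (by simp)
  have hP4 : ContDiffOn ℝ ∞ (deriv (deriv (deriv (deriv P)))) (Ioi 0) :=
    hP3.deriv_of_isOpen isOpen_Ioi (by simp)
  have hdP : ∀ {Q : ℝ → ℝ}, ContDiffOn ℝ ∞ Q (Ioi 0) → ∀ y ∈ Icc m M, HasDerivAt Q (deriv Q y) y :=
    fun hQ y hy => ((hQ.contDiffAt (Ioi_mem_nhds (hpos y hy))).differentiableAt
      (by simp)).hasDerivAt
  have clog : ContinuousOn Real.log (Icc m M) := fun y hy =>
    (Real.continuousAt_log (hpos y hy).ne').continuousWithinAt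
  have cinv : ContinuousOn (fun y : ℝ => y⁻¹) (Icc m M) := fun y hy =>
    (continuousAt_inv₀ (hpos y hy).ne').continuousWithinAt
  obtain ⟨lg, hlg⟩ := exists_continuousMap_eqOn hmM clog
  obtain ⟨iv, hiv⟩ := exists_continuousMap_eqOn hmM cinv
  obtain ⟨q1, hq1⟩ := exists_continuousMap_eqOn hmM (hP1.continuousOn.mono hsub)
  obtain ⟨q2, hq2⟩ := exists_continuousMap_eqOn hmM (hP2.continuousOn.mono hsub)
  obtain ⟨q3, hq3⟩ := exists_continuousMap_eqOn hmM (hP3.continuousOn.mono hsub)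
  have dlog : ∀ y ∈ Icc m M, HasDerivAt Real.log y⁻¹ y := fun y hy =>
    Real.hasDerivAt_log (hpos y hy).ne'
  have dinv : ∀ y ∈ Icc m M, HasDerivAt (fun y : ℝ => y⁻¹) (-(y ^ 2)⁻¹) y := fun y hy =>
    hasDerivAt_inv (hpos y hy).ne'
  have hρe : ∀ x : unitInterval, (cst ρ₀ + prim (emb (ofOn p' cp'))) x = ρh x := fun x => by
    have := ofOn_eq_cst_add_prim cρ cp' dp x
    rwa [h.bc_ρ] at this
  have hue : ∀ x : unitInterval, (cst u₀ + prim (emb (ofOn u' cu'))) x = uh x := fun x => by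
    have := ofOn_eq_cst_add_prim cu cu' du x
    rwa [h.bc_u_left] at this
  let B : Background ν :=
  { m := m
    M := M
    δ := a / 2
    ρ₀ := ρ₀
    u₀ := u₀
    ρx := ofOn p' cp'
    ρxx := ofOn p'' cp''
    ux := ofOn u' cu'
    uxx := ofOn u'' cu''
    lg := lg
    iv := iv
    q1 := q1
    q2 := q2
    q3 := q3
    hν := hν
    hm := hm0
    hδ := by positivity
    ρ_mem := fun x => by
      rw [hρe x]
      have := hρ_mem x x.2
      rw [hm, hM]
      constructor <;> linarith
    u_mem := fun x => by
      rw [hue x]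
      have := hu_mem x x.2
      rw [hm, hM]
      constructor <;> linarith
    isH1_ρx := isH1_ofOn cp' cp'' dp'
    isH1_ux := isH1_ofOn cu' cu'' du'
    mass := by
      ext x
      have h1 := hρe x
      have h2 := hue x
      simp only [ContinuousMap.add_apply, ContinuousMap.mul_apply, ContinuousMap.zero_apply] at h1 h2 ⊢
      rw [h1, h2, ofOn_apply, ofOn_apply, hρeq x x.2, hp']
      have := (hupos x x.2).ne'
      field_simp
      ring
    smooth_lg := smooth1_of_hasDerivAt dlog dinv
      (fun y hy => (((continuousAt_id.pow 2).inv₀ (pow_ne_zero 2 (hpos y hy).ne')).neg).continuousWithinAt)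
      hlg hiv
    smooth_iv := smooth1_of_hasDerivAt (Φ'' := fun y => 2 * y / (y ^ 2) ^ 2) dinv
      (fun y hy => by
        have h1 := ((hasDerivAt_pow 2 y).inv (pow_ne_zero 2 (hpos y hy).ne')).neg
        refine h1.congr_deriv ?_
        simp [neg_div])
      (ContinuousOn.div (by fun_prop) (by fun_prop) fun y hy =>
        pow_ne_zero 2 (pow_ne_zero 2 (hpos y hy).ne'))
      hiv (fun y hy => by
        have h1 := hiv hy
        simp only [ContinuousMap.neg_apply, ContinuousMap.mul_apply, h1]
        rw [pow_two, mul_inv])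
    smooth_q1 := smooth1_of_hasDerivAt (hdP hP1) (hdP hP2) (hP3.continuousOn.mono hsub) hq1 hq2
    smooth_q2 := smooth1_of_hasDerivAt (hdP hP2) (hdP hP3) (hP4.continuousOn.mono hsub) hq2 hq3
    iv_mul := fun y hy => by rw [hiv hy, inv_mul_cancel₀ (hpos y hy).ne']
    q1_pos := fun y hy => by rw [hq1 hy]; exact hP' y (hpos y hy)
    lg_sub_le := fun y hy z hz => by
      rw [hlg hy, hlg hz]
      refine abs_sub_le_of_hasDerivAt dlog (fun x hx => ?_) hy hz
      rw [abs_of_pos (inv_pos.2 (hpos x hx))]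
      exact inv_anti₀ hm0 hx.1
    le_lg_sub := fun y hy z hz => by
      rw [hlg hy, hlg hz]
      have hmem : ∀ x ∈ Icc m M, Real.log x ∈ Icc (Real.log m) (Real.log M) := fun x hx =>
        ⟨Real.log_le_log hm0 hx.1, Real.log_le_log (hpos x hx) hx.2⟩
      have h1 := abs_sub_le_of_hasDerivAt (K := M) (fun x _ => Real.hasDerivAt_exp x)
        (fun x hx => by
          rw [abs_of_pos (Real.exp_pos x)]
          calc Real.exp x ≤ Real.exp (Real.log M) := Real.exp_le_exp.2 hx.2
            _ = M := Real.exp_log (hm0.trans_le hmM)) (hmem y hy) (hmem z hz)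
      rwa [Real.exp_log (hpos y hy), Real.exp_log (hpos z hz)] at h1 }
  exact ⟨B,
  { ρ_eq := hρe
    u_eq := hue
    ρx_eq := fun x hx => (dp x hx).deriv.symm
    ux_eq := fun x hx => (du x hx).deriv.symm
    q1_eq := hq1
    q2_eq := hq2 }⟩

/-! ### The weak equations in terms of the background -/

theorem coeFn_comb (α β γ : CI) (W F : L2) :
    ⇑(α • one2 + β • W + γ • F) =ᵐ[leb] fun x => ex α x + ex β x * W x + ex γ x * F x := by
  filter_upwards [Lp.coeFn_add (α • one2 + β • W) (γ • F), Lp.coeFn_add (α • one2) (β • W),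
    coeFn_csmul α one2, coeFn_csmul β W, coeFn_csmul γ F, coeFn_one2] with x h1 h2 h3 h4 h5 h6
  rw [h1, Pi.add_apply, h2, Pi.add_apply, h3, h4, h5, h6, mul_one]

theorem IsTest.integral_mul_eq {ψ f : ℝ → ℝ} (hψ : IsTest ψ) {F : L2}
    (h : ∀ᵐ x ∂leb, x ∈ Ioo (0 : ℝ) 1 → F x = f x) :
    ∫ x in Ioo (0 : ℝ) 1, f x * ψ x = inner ℝ F (emb hψ.toCI) := by
  rw [hψ.inner_toCI]
  refine integral_congr_ae ?_
  filter_upwards [h, ae_restrict_mem measurableSet_Ioo] with x h1 h2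
  rw [h1 h2]

theorem IsTest.integral_mul_deriv_eq {ψ f : ℝ → ℝ} (hψ : IsTest ψ) {F : L2}
    (h : ∀ᵐ x ∂leb, x ∈ Ioo (0 : ℝ) 1 → F x = f x) :
    ∫ x in Ioo (0 : ℝ) 1, f x * deriv ψ x = inner ℝ F (emb hψ.derivCI) := by
  rw [hψ.inner_derivCI]
  refine integral_congr_ae ?_
  filter_upwards [h, ae_restrict_mem measurableSet_Ioo] with x h1 h2
  rw [h1 h2]

namespace Background

variable {ν : ℝ} {B : Background ν} {P ρh uh : ℝ → ℝ}

/-- The linear part of the momentum equation. -/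
def linPart (B : Background ν) (F W : L2) : L2 :=
  ((B.ρx * B.u + B.ρ * B.ux) * prim W + B.q2.comp B.ρ * B.ρx * prim F
      + B.ux * (B.u * prim F + B.ρ * prim W)) • one2
    + (B.ρ * B.u) • W + B.q1.comp B.ρ • F

/-- The nonlinear part of the momentum equation. -/
def quadPart (B : Background ν) (F W : L2) : L2 :=
  (B.ux * prim W * prim F + B.q1.comp (B.dens F) * B.ρx - B.q1.comp B.ρ * B.ρx
      - B.q2.comp B.ρ * B.ρx * prim F) • one2
    + (B.u * prim F + B.ρ * prim W + prim W * prim F) • W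
    + (B.q1.comp (B.dens F) - B.q1.comp B.ρ) • F

/-- Nothing is lost by the linearisation: the terms in P'' cancel, (ρ̂û)_x = 0, and the two parts
recombine into the full convective term and force. -/
theorem linPart_add_quadPart (F W : L2) :
    B.linPart F W + B.quadPart F W = (B.dens F * B.vel W) • W + B.force F W := by
  have h : B.ρx * B.u + B.ρ * B.ux = 0 := by
    have := B.mass'
    linear_combination this
  rw [linPart, quadPart, h, force, densx]
  simp only [emb_apply, dens, vel]
  module

theorem isH1_linFlux (F W : L2) :
    IsH1 (B.ρ * B.u * prim W + B.q1.comp B.ρ * prim F)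
      (B.linPart F W - emb (B.ux * (B.u * prim F + B.ρ * prim W))) := by
  refine (((B.isH1_ρ.mul B.isH1_u).mul (isH1_prim W)).add
    ((B.smooth_q1.isH1_comp _ _ B.ρ_mem' B.isH1_ρ).mul (isH1_prim F))).congr_deriv ?_
  rw [linPart]
  simp only [emb_apply]
  module

namespace Rep

theorem ex_ρ (hB : B.Rep P ρh uh) {x : ℝ} (hx : x ∈ Ioo (0 : ℝ) 1) : ex B.ρ x = ρh x := by
  rw [ex_of_mem _ (Ioo_subset_Icc_self hx), hB.ρ_eq]
theorem ex_u (hB : B.Rep P ρh uh) {x : ℝ} (hx : x ∈ Ioo (0 : ℝ) 1) : ex B.u x = uh x := by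
  rw [ex_of_mem _ (Ioo_subset_Icc_self hx), hB.u_eq]
theorem ex_ρx (hB : B.Rep P ρh uh) {x : ℝ} (hx : x ∈ Ioo (0 : ℝ) 1) : ex B.ρx x = deriv ρh x := by
  rw [ex_of_mem _ (Ioo_subset_Icc_self hx), hB.ρx_eq _ hx]
theorem ex_ux (hB : B.Rep P ρh uh) {x : ℝ} (hx : x ∈ Ioo (0 : ℝ) 1) : ex B.ux x = deriv uh x := by
  rw [ex_of_mem _ (Ioo_subset_Icc_self hx), hB.ux_eq _ hx]
theorem ex_q1_ρ (hB : B.Rep P ρh uh) {x : ℝ} (hx : x ∈ Ioo (0 : ℝ) 1) :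
    ex (B.q1.comp B.ρ) x = deriv P (ρh x) := by
  have hx' := Ioo_subset_Icc_self hx
  rw [ex_of_mem _ hx', ContinuousMap.comp_apply, hB.q1_eq (B.ρ_mem' _), hB.ρ_eq]
theorem ex_q2_ρ (hB : B.Rep P ρh uh) {x : ℝ} (hx : x ∈ Ioo (0 : ℝ) 1) :
    ex (B.q2.comp B.ρ) x = deriv (deriv P) (ρh x) := by
  have hx' := Ioo_subset_Icc_self hx
  rw [ex_of_mem _ hx', ContinuousMap.comp_apply, hB.q2_eq (B.ρ_mem' _), hB.ρ_eq]
theorem ex_dens (hB : B.Rep P ρh uh) (F : L2) {x : ℝ} (hx : x ∈ Ioo (0 : ℝ) 1) :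
    ex (B.dens F) x = ρh x + ex (prim F) x := by
  rw [dens, ex_add, hB.ex_ρ hx]
theorem ex_q1_dens (hB : B.Rep P ρh uh) {F : L2} (hF : ‖F‖ ≤ B.δ) {x : ℝ} (hx : x ∈ Ioo (0 : ℝ) 1) :
    ex (B.q1.comp (B.dens F)) x = deriv P (ex (prim F) x + ρh x) := by
  have h := hB.ex_dens F hx
  have hx' := Ioo_subset_Icc_self hx
  rw [ex_of_mem _ hx', ContinuousMap.comp_apply, hB.q1_eq (B.dens_mem hF _), ← ex_of_mem _ hx', h,
    add_comm]
theorem ex_iv_dens (hB : B.Rep P ρh uh) {F : L2} (hF : ‖F‖ ≤ B.δ) {x : ℝ} (hx : x ∈ Ioo (0 : ℝ) 1) :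
    ex (B.iv.comp (B.dens F)) x = (ρh x + ex (prim F) x)⁻¹ := by
  refine eq_inv_of_mul_eq_one_left ?_
  have hx' := Ioo_subset_Icc_self hx
  rw [← hB.ex_dens F hx, ex_of_mem _ hx', ex_of_mem _ hx']
  exact B.iv_mul _ (B.dens_mem hF _)
theorem dens_ne (hB : B.Rep P ρh uh) {F : L2} (hF : ‖F‖ ≤ B.δ) {x : ℝ} (hx : x ∈ Ioo (0 : ℝ) 1) :
    ρh x + ex (prim F) x ≠ 0 := by
  have hx' := Ioo_subset_Icc_self hx
  rw [← hB.ex_dens F hx, ex_of_mem _ hx']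
  exact (B.hm.trans_le (B.dens_mem hF _).1).ne'

theorem mass_eq (hB : B.Rep P ρh uh) {r v : H 1}
    (hr : D 0 r = emb (prim (D 1 r))) (hv : D 0 v = emb (prim (D 1 v)))
    {ψ : ℝ → ℝ} (hψ : IsTest ψ) :
    linMass ρh uh r v ψ + nonlinMass r v ψ
      = inner ℝ (emb (B.dens (D 1 r) * B.vel (D 1 v) - B.ρ * B.u)) (emb hψ.derivCI) := by
  have h1 : linMass ρh uh r v ψ
      = inner ℝ (emb (B.ρ * prim (D 1 v) + B.u * prim (D 1 r))) (emb hψ.derivCI) := by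
    refine hψ.integral_mul_deriv_eq ?_
    rw [hr, hv]
    filter_upwards [coeFn_emb (B.ρ * prim (D 1 v) + B.u * prim (D 1 r)), coeFn_emb (prim (D 1 r)),
      coeFn_emb (prim (D 1 v))] with x a1 a2 a3 hx
    rw [a1, a2, a3, ex_add, ex_mul, ex_mul, hB.ex_ρ hx, hB.ex_u hx]
  have h2 : nonlinMass r v ψ
      = inner ℝ (emb (prim (D 1 r) * prim (D 1 v))) (emb hψ.derivCI) := by
    refine hψ.integral_mul_deriv_eq ?_
    rw [hr, hv]
    filter_upwards [coeFn_emb (prim (D 1 r) * prim (D 1 v)), coeFn_emb (prim (D 1 r)),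
      coeFn_emb (prim (D 1 v))] with x a1 a2 a3 hx
    rw [a1, a2, a3, ex_mul]
  rw [h1, h2, ← inner_add_left, ← map_add]
  congr 2
  rw [dens, vel]
  ring

/-- Since r/(ρ̂ + r) = 1 - ρ̂/ρ, the sum 𝓛₂ + 𝓝₂ is ρ̂/ρ times νv_xx minus the linear and quadratic
parts. The two weak terms in v_x combine into νv_x tested against the derivative of (ρ̂/ρ)ψ. -/
theorem momentum_eq (hB : B.Rep P ρh uh) {r v : H 1} (hr : D 0 r = emb (prim (D 1 r)))
    (hv : D 0 v = emb (prim (D 1 v))) (hF : ‖D 1 r‖ ≤ B.δ) {ψ : ℝ → ℝ} (hψ : IsTest ψ) :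
    linMomentum ν P ρh uh r v ψ + nonlinMomentum ν P ρh uh r v ψ
      = -(ν * inner ℝ (D 1 v) (B.ratio (D 1 r) • emb hψ.derivCI + hψ.toCI • B.ratiox (D 1 r)))
        - inner ℝ (B.ratio (D 1 r) • ((B.dens (D 1 r) * B.vel (D 1 v)) • D 1 v
          + B.force (D 1 r) (D 1 v))) (emb hψ.toCI) := by
  set F := D 1 r with hFdef
  set W := D 1 v with hWdef
  have cr := coeFn_emb (prim F)
  have cv := coeFn_emb (prim W)
  rw [← hr] at cr
  rw [← hv] at cv
  have h1 : ∫ x in Ioo (0 : ℝ) 1, W x * deriv ψ x = inner ℝ W (emb hψ.derivCI) :=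
    (hψ.inner_derivCI W).symm
  have h2 : ∫ x in Ioo (0 : ℝ) 1, (ρh x * uh x * D 0 v x + deriv P (ρh x) * D 0 r x) * deriv ψ x
      = -inner ℝ (B.linPart F W - emb (B.ux * (B.u * prim F + B.ρ * prim W))) (emb hψ.toCI) := by
    rw [← hψ.inner_emb_prim, (B.isH1_linFlux F W).prim_eq (by simp)]
    refine hψ.integral_mul_deriv_eq ?_
    filter_upwards [coeFn_emb (B.ρ * B.u * prim W + B.q1.comp B.ρ * prim F), cr, cv]
      with x a1 a2 a3 hx
    rw [a1, a2, a3, ex_add, ex_mul, ex_mul, ex_mul, hB.ex_ρ hx, hB.ex_u hx, hB.ex_q1_ρ hx]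
  have h3 : ∫ x in Ioo (0 : ℝ) 1, deriv uh x * (uh x * D 0 r x + ρh x * D 0 v x) * ψ x
      = inner ℝ (emb (B.ux * (B.u * prim F + B.ρ * prim W))) (emb hψ.toCI) := by
    refine hψ.integral_mul_eq ?_
    filter_upwards [coeFn_emb (B.ux * (B.u * prim F + B.ρ * prim W)), cr, cv]
      with x a1 a2 a3 hx
    rw [a1, a2, a3, ex_mul, ex_add, ex_mul, ex_mul, hB.ex_ρ hx, hB.ex_u hx, hB.ex_ux hx]
  have h4 : ∫ x in Ioo (0 : ℝ) 1, ρh x / (ρh x + D 0 r x) * quadTerm P ρh uh r v x * ψ x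
      = inner ℝ (B.ratio F • B.quadPart F W) (emb hψ.toCI) := by
    refine hψ.integral_mul_eq ?_
    filter_upwards [coeFn_csmul (B.ratio F) (B.quadPart F W), coeFn_comb (B.ux * prim W * prim F
      + B.q1.comp (B.dens F) * B.ρx - B.q1.comp B.ρ * B.ρx - B.q2.comp B.ρ * B.ρx * prim F)
      (B.u * prim F + B.ρ * prim W + prim W * prim F)
      (B.q1.comp (B.dens F) - B.q1.comp B.ρ) W F, cr, cv] with x a1 a2 a3 a4 hx
    rw [a1, quadPart, a2, quadTerm, a3, a4, ratio]
    simp only [ex_add, ex_mul, ex_sub, hB.ex_ρ hx, hB.ex_u hx, hB.ex_ux hx, hB.ex_ρx hx,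
      hB.ex_q1_ρ hx, hB.ex_q2_ρ hx, hB.ex_q1_dens hF hx, hB.ex_iv_dens hF hx]
    ring
  have h5 : ∫ x in Ioo (0 : ℝ) 1, D 0 r x / (ρh x + D 0 r x) * linTerm P ρh uh r v x * ψ x
      = inner ℝ ((1 - B.ratio F) • B.linPart F W) (emb hψ.toCI) := by
    refine hψ.integral_mul_eq ?_
    filter_upwards [coeFn_csmul (1 - B.ratio F) (B.linPart F W),
      coeFn_comb ((B.ρx * B.u + B.ρ * B.ux) * prim W + B.q2.comp B.ρ * B.ρx * prim F
      + B.ux * (B.u * prim F + B.ρ * prim W)) (B.ρ * B.u) (B.q1.comp B.ρ) W F, cr, cv]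
      with x a1 a2 a3 a4 hx
    have h0 := hB.dens_ne hF hx
    have e : D 0 r x / (ρh x + D 0 r x) = 1 - ρh x * (ρh x + ex (prim F) x)⁻¹ := by
      rw [a3]; field_simp; ring
    rw [e, a1, linPart, a2, linTerm, a3, a4, ratio]
    simp only [ex_add, ex_mul, ex_sub, ex_one, hB.ex_ρ hx, hB.ex_u hx, hB.ex_ux hx, hB.ex_ρx hx,
      hB.ex_q1_ρ hx, hB.ex_q2_ρ hx, hB.ex_iv_dens hF hx]
    ring
  have h6 : ∫ x in Ioo (0 : ℝ) 1, W x * ratioTestDeriv ρh r ψ x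
      = inner ℝ W ((1 - B.ratio F) • emb hψ.derivCI - hψ.toCI • B.ratiox F) := by
    have e : (1 - B.ratio F) • emb hψ.derivCI - hψ.toCI • B.ratiox F
        = ((1 - B.ratio F) * hψ.derivCI + hψ.toCI * (B.ρ * (B.iv * B.iv).comp (B.dens F) * B.ρx
          - B.iv.comp (B.dens F) * B.ρx)) • one2 + (0 : CI) • W
          + (hψ.toCI * B.ρ * (B.iv * B.iv).comp (B.dens F)) • F := by
      have : (-(B.iv * B.iv)).comp (B.dens F) = -(B.iv * B.iv).comp (B.dens F) := rfl
      rw [ratiox, densx, this]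
      simp only [emb_apply]
      module
    rw [e, inner_eq]
    refine integral_congr_ae ?_
    filter_upwards [coeFn_comb ((1 - B.ratio F) * hψ.derivCI + hψ.toCI
      * (B.ρ * (B.iv * B.iv).comp (B.dens F) * B.ρx - B.iv.comp (B.dens F) * B.ρx)) 0
      (hψ.toCI * B.ρ * (B.iv * B.iv).comp (B.dens F)) W F, cr, ae_restrict_mem measurableSet_Ioo]
      with x a1 a2 hx
    have h0 := hB.dens_ne hF hx
    have e1 : ex hψ.toCI x = ψ x := ex_ofOn _ (Ioo_subset_Icc_self hx)
    have e2 : ex hψ.derivCI x = deriv ψ x := ex_ofOn _ (Ioo_subset_Icc_self hx)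
    have e3 : ex ((B.iv * B.iv).comp (B.dens F)) x
        = (ρh x + ex (prim F) x)⁻¹ * (ρh x + ex (prim F) x)⁻¹ := by
      rw [← hB.ex_iv_dens hF hx]; rfl
    rw [a1, ratioTestDeriv, a2, ratio]
    simp only [ex_add, ex_mul, ex_sub, ex_one, ex_zero, hB.ex_ρ hx, hB.ex_ρx hx,
      hB.ex_iv_dens hF hx, e1, e2, e3]
    field_simp
    ring
  rw [linMomentum, nonlinMomentum, h1, h2, h3, h4, h5, h6, ← linPart_add_quadPart]
  simp only [inner_add_left, inner_add_right, inner_sub_left, inner_sub_right, smul_add, sub_smul,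
    one_smul]
  ring

end Rep

end Background

/-! ### Removing the regularisation and the exponential weight -/

theorem tdq_eq_avg {T k s : ℝ} {f V : ℝ → L2} (hf : Continuous f) (hV : Continuous V)
    (h : ∀ t ∈ Icc 0 T, HasDerivWithinAt f (V t) (Icc 0 T) t) (hk : 0 < k) (hs : 0 ≤ s)
    (hT : s + k ≤ T) : tdq k f s = avg k V s := by
  have h1 : ∫ y in s..s + k, V y = f (s + k) - f s := by
    refine integral_eq_sub_of_hasDerivAt_of_le (by linarith) hf.continuousOn (fun y hy => ?_)
      (hV.intervalIntegrable _ _)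
    exact (h y ⟨by linarith [hy.1], by linarith [hy.2]⟩).hasDerivAt
      (Icc_mem_nhds (by linarith [hy.1]) (by linarith [hy.2]))
  rw [tdq, avg, h1]

theorem exists_tdq_approx {T t : ℝ} {f V : ℝ → L2} (hf : Continuous f) (hV : Continuous V)
    (h : ∀ t ∈ Icc 0 T, HasDerivWithinAt f (V t) (Icc 0 T) t) (htT : t < T) {η : ℝ}
    (hη : 0 < η) : ∃ k₀ > 0, ∀ k, 0 < k → k < k₀ → ∀ s ∈ Icc 0 t,
      ‖V s‖ ^ 2 ≤ ‖tdq k f s‖ ^ 2 + η := by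
  obtain ⟨A, hA⟩ := (isCompact_Icc (a := (0 : ℝ)) (b := t)).exists_bound_of_continuousOn
    hV.continuousOn
  set η₁ := η / (2 * (|A| + 1)) with hη₁
  have hη₁0 : 0 < η₁ := by positivity
  obtain ⟨k₀, hk₀, hk⟩ := eventually_avg_sub_le hV t hη₁0
  refine ⟨min k₀ (T - t), lt_min hk₀ (by linarith), fun k hk1 hk2 s hs => ?_⟩
  have h1 := hk k hk1 (hk2.trans_le (min_le_left _ _)) s hs
  have h2 := hk2.trans_le (min_le_right _ _)
  rw [← tdq_eq_avg hf hV h hk1 hs.1 (by linarith [hs.2])] at h1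
  set d := tdq k f s
  have h3 : ‖V s‖ ≤ ‖d‖ + η₁ := by
    have := norm_sub_norm_le (V s) d
    rw [norm_sub_rev] at this
    linarith
  have h4 : ‖V s‖ ≤ |A| + 1 := (hA s hs).trans ((le_abs_self A).trans (by linarith))
  have h5 : 2 * η₁ * ‖V s‖ ≤ η := by
    calc 2 * η₁ * ‖V s‖ ≤ 2 * η₁ * (|A| + 1) := by gcongr
      _ = η := by rw [hη₁]; field_simp
  rcases le_total ‖V s‖ η₁ with h6 | h6
  · nlinarith [sq_nonneg ‖d‖, norm_nonneg (V s)]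
  · have h7 : (‖V s‖ - η₁) ^ 2 ≤ ‖d‖ ^ 2 := pow_le_pow_left₀ (by linarith) (by linarith) 2
    nlinarith [sq_nonneg η₁]

theorem continuous_tdq {f : ℝ → L2} (hf : Continuous f) (k : ℝ) : Continuous (tdq k f) :=
  ((hf.comp (continuous_id.add continuous_const)).sub hf).const_smul k⁻¹

/-- The estimates are first obtained for t < T, because averages look ahead in time; the end point
follows by continuity. -/
theorem le_on_Icc_of_lt {T : ℝ} (hT : 0 < T) {f g : ℝ → ℝ} (hf : Continuous f) (hg : Continuous g)
    (h : ∀ t, 0 ≤ t → t < T → f t ≤ g t) {t : ℝ} (ht : t ∈ Icc 0 T) : f t ≤ g t := by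
  have h1 : Ico 0 T ⊆ {t | f t ≤ g t} := fun t ht => h t ht.1 ht.2
  have h2 := closure_minimal h1 (isClosed_le hf hg)
  rw [closure_Ico hT.ne] at h2
  exact h2 ht

theorem continuous_primitive_real {f : ℝ → ℝ} (hf : Continuous f) :
    Continuous fun t => ∫ s in (0 : ℝ)..t, f s :=
  continuous_primitive (fun a b => hf.intervalIntegrable a b) 0

/-- The energy estimate for the solutions of all linear systems with the same bounds. -/
def ExpEstimate (ν c C ε θ K : ℝ) : Prop :=
  ∀ (T u₀ : ℝ) (ûx : CI) (φ w wb j g G : ℝ → L2) (ρ κ b : ℝ → CI), 0 < T →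
    LinSys ν c C T u₀ ûx φ w wb j g G ρ κ b → LinSys.Small ε T φ w wb →
    (∀ t ∈ Icc 0 T, Real.exp (θ * t) * (‖φ t‖ ^ 2 + ‖w t‖ ^ 2)
        + (∫ s in (0 : ℝ)..t, Real.exp (θ * s) * (‖φ s‖ ^ 2 + ‖w s‖ ^ 2)) ≤
      K * ((‖φ 0‖ ^ 2 + ‖w 0‖ ^ 2) + ∫ s in (0 : ℝ)..t, Real.exp (θ * s) *
        (‖emb (prim (φ s))‖ ^ 2 + ‖emb (prim (w s))‖ ^ 2))) ∧
    ∀ V : ℝ → L2, Continuous V →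
      (∀ t ∈ Icc 0 T, HasDerivWithinAt (fun s => emb (prim (w s))) (V t) (Icc 0 T) t) →
      ∀ t ∈ Icc 0 T, (∫ s in (0 : ℝ)..t, Real.exp (θ * s) * ‖V s‖ ^ 2) ≤
      K * ((‖φ 0‖ ^ 2 + ‖w 0‖ ^ 2) + ∫ s in (0 : ℝ)..t, Real.exp (θ * s) *
        (‖emb (prim (φ s))‖ ^ 2 + ‖emb (prim (w s))‖ ^ 2))

/-- The arbitrary error η is sent to zero. When v_t exists in L², the time quotients of v are
averages of it and converge uniformly on [0,t], so their dissipation integral bounds that of v_t. -/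
theorem exists_exp_estimate {ν c C : ℝ} (hν : 0 < ν) (hc : 0 < c) (hC : 0 ≤ C) :
    ∃ ε > 0, ∃ θ > 0, ∃ K > 0, ExpEstimate ν c C ε θ K := by
  obtain ⟨ε, hε, θ, hθ, K, hK, H⟩ := exists_energy_estimate hν hc hC
  refine ⟨ε, hε, θ, hθ, K, hK, fun T u₀ ûx φ w wb j g G ρ κ b hT hs hsm => ?_⟩
  have cφ := hs.cont_φ
  have cw := hs.cont_w
  have cpw : Continuous fun s => emb (prim (w s)) := (emb.comp prim).continuous.comp cw
  have cpφ : Continuous fun s => emb (prim (φ s)) := (emb.comp prim).continuous.comp cφ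
  have cR : Continuous fun t => K * ((‖φ 0‖ ^ 2 + ‖w 0‖ ^ 2) + ∫ s in (0 : ℝ)..t, Real.exp (θ * s) *
          (‖emb (prim (φ s))‖ ^ 2 + ‖emb (prim (w s))‖ ^ 2)) :=
    continuous_const.mul (continuous_const.add (continuous_primitive_real (by fun_prop)))
  constructor
  · intro t ht
    have cL := (by fun_prop : Continuous fun t => Real.exp (θ * t) * (‖φ t‖ ^ 2 + ‖w t‖ ^ 2)).add
      (continuous_primitive_real
        (by fun_prop : Continuous fun s => Real.exp (θ * s) * (‖φ s‖ ^ 2 + ‖w s‖ ^ 2)))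
    refine le_on_Icc_of_lt hT cL cR (fun t h0 htT => ?_) ht
    · refine le_of_forall_pos_le_add fun η hη => ?_
      obtain ⟨k₀, hk₀, hk⟩ := H T u₀ ûx φ w wb j g G ρ κ b hs hsm t h0 htT η hη
      refine le_trans ?_ (hk (k₀ / 2) (by positivity) (by linarith))
      have ct := continuous_tdq cpw (k₀ / 2)
      refine add_le_add le_rfl ?_
      beta_reduce
      refine integral_mono_on h0 (Continuous.intervalIntegrable (by fun_prop) _ _)
        (Continuous.intervalIntegrable (by fun_prop) _ _) fun s _ => ?_
      exact mul_le_mul_of_nonneg_left (le_add_of_nonneg_right (sq_nonneg _)) (Real.exp_pos _).le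
  · intro V hV hder t ht
    refine le_on_Icc_of_lt hT (continuous_primitive_real (by fun_prop)) cR
      (fun t h0 htT => ?_) ht
    refine le_of_forall_pos_le_add fun η hη => ?_
    set I0 := ∫ s in (0 : ℝ)..t, Real.exp (θ * s) with hI0
    have hI00 : 0 ≤ I0 := integral_nonneg h0 fun s _ => (Real.exp_pos _).le
    obtain ⟨k₀, hk₀, hk⟩ := H T u₀ ûx φ w wb j g G ρ κ b hs hsm t h0 htT (η / 2) (by positivity)
    obtain ⟨k₁, hk₁, hk'⟩ := exists_tdq_approx cpw hV hder htT
      (η := η / (2 * (I0 + 1))) (by positivity)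
    set k := min k₀ k₁ / 2 with hkdef
    have hkpos : 0 < k := by positivity
    have b1 : k < k₀ := by
      have := min_le_left k₀ k₁
      have : 0 < min k₀ k₁ := by positivity
      rw [hkdef]; linarith
    have b2 : k < k₁ := by
      have := min_le_right k₀ k₁
      have : 0 < min k₀ k₁ := by positivity
      rw [hkdef]; linarith
    have h1 := hk k hkpos b1
    have h2 := hk' k hkpos b2
    have ct := continuous_tdq cpw k
    have h3 : (∫ s in (0 : ℝ)..t, Real.exp (θ * s) * ‖V s‖ ^ 2) ≤
        (∫ s in (0 : ℝ)..t, Real.exp (θ * s) * (‖φ s‖ ^ 2 + ‖w s‖ ^ 2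
            + ‖tdq k (fun s => emb (prim (w s))) s‖ ^ 2))
        + η / (2 * (I0 + 1)) * I0 := by
      rw [hI0, ← intervalIntegral.integral_const_mul, ← intervalIntegral.integral_add
        (Continuous.intervalIntegrable (by fun_prop) _ _)
        (Continuous.intervalIntegrable (by fun_prop) _ _)]
      refine integral_mono_on h0 (Continuous.intervalIntegrable (by fun_prop) _ _)
        (Continuous.intervalIntegrable (by fun_prop) _ _) fun s hs' => ?_
      have h4 := mul_le_mul_of_nonneg_left (h2 s hs') (Real.exp_pos (θ * s)).le
      have h5 : 0 ≤ Real.exp (θ * s) * (‖φ s‖ ^ 2 + ‖w s‖ ^ 2) := by positivity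
      linarith
    have h6 : η / (2 * (I0 + 1)) * I0 ≤ η / 2 := by
      rw [div_mul_eq_mul_div, div_le_div_iff₀ (by positivity) (by positivity)]
      nlinarith
    have h7 : 0 ≤ Real.exp (θ * t) * (‖φ t‖ ^ 2 + ‖w t‖ ^ 2) := by positivity
    linarith

/-- Estimates with an exponential weight, rewritten as decay estimates. -/
theorem le_of_exp_weight {θ θ₀ K X E₀ t : ℝ} {S : ℝ → ℝ} (ht : 0 ≤ t) (hK : 0 ≤ K) (hE : 0 ≤ E₀)
    (hS : ContinuousOn S (Icc 0 t)) (hS0 : ∀ s ∈ Icc 0 t, 0 ≤ S s) (hθ : θ ≤ θ₀)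
    (h : Real.exp (θ₀ * t) * X ≤ K * (E₀ + ∫ s in (0 : ℝ)..t, Real.exp (θ₀ * s) * S s)) :
    X ≤ K * Real.exp (-θ * t) * E₀ + K * ∫ s in (0 : ℝ)..t, Real.exp (-θ * (t - s)) * S s := by
  have h1 : X ≤ K * Real.exp (-θ₀ * t) * E₀
      + K * ∫ s in (0 : ℝ)..t, Real.exp (-θ₀ * (t - s)) * S s := by
    have h2 := mul_le_mul_of_nonneg_left h (Real.exp_pos (-θ₀ * t)).le
    have e1 : Real.exp (-θ₀ * t) * (Real.exp (θ₀ * t) * X) = X := by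
      rw [← mul_assoc, ← Real.exp_add]; simp
    have e2 : ∫ s in (0 : ℝ)..t, Real.exp (-θ₀ * (t - s)) * S s
        = Real.exp (-θ₀ * t) * ∫ s in (0 : ℝ)..t, Real.exp (θ₀ * s) * S s := by
      rw [← intervalIntegral.integral_const_mul]
      refine intervalIntegral.integral_congr fun s _ => ?_
      rw [← mul_assoc, ← Real.exp_add]
      congr 2
      ring
    rw [e1] at h2
    rw [e2]
    linarith
  -- Lowering the rate from θ₀ to θ only enlarges both exponentials, as t and t - s are nonnegative.
  -- Negative θ is allowed.
  refine h1.trans ?_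
  have hu : uIcc 0 t = Icc 0 t := uIcc_of_le ht
  have h3 : ∫ s in (0 : ℝ)..t, Real.exp (-θ₀ * (t - s)) * S s
      ≤ ∫ s in (0 : ℝ)..t, Real.exp (-θ * (t - s)) * S s := by
    refine integral_mono_on ht (ContinuousOn.intervalIntegrable ?_)
      (ContinuousOn.intervalIntegrable ?_) fun s hs => ?_
    · rw [hu]; exact (by fun_prop : Continuous fun s => Real.exp (-θ₀ * (t - s))).continuousOn.mul hS
    · rw [hu]; exact (by fun_prop : Continuous fun s => Real.exp (-θ * (t - s))).continuousOn.mul hS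
    · refine mul_le_mul_of_nonneg_right (Real.exp_le_exp.2 ?_) (hS0 s hs)
      have : 0 ≤ t - s := by linarith [hs.2]
      nlinarith
  have h4 : Real.exp (-θ₀ * t) ≤ Real.exp (-θ * t) := Real.exp_le_exp.2 (by nlinarith)
  gcongr

theorem integral_exp_mono {θ t : ℝ} {f g : ℝ → ℝ} (ht : 0 ≤ t) (hf : Continuous f)
    (hg : Continuous g) (h : ∀ s ∈ Icc 0 t, f s ≤ g s) :
    ∫ s in (0 : ℝ)..t, Real.exp (θ * s) * f s ≤ ∫ s in (0 : ℝ)..t, Real.exp (θ * s) * g s :=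
  integral_mono_on ht (Continuous.intervalIntegrable (by fun_prop) _ _)
    (Continuous.intervalIntegrable (by fun_prop) _ _)
    fun s hs => mul_le_mul_of_nonneg_left (h s hs) (Real.exp_pos _).le

theorem integral_exp_le_mul {θ t c : ℝ} {f g : ℝ → ℝ} (ht : 0 ≤ t) (hf : Continuous f)
    (hg : Continuous g) (h : ∀ s ∈ Icc 0 t, f s ≤ c * g s) :
    ∫ s in (0 : ℝ)..t, Real.exp (θ * s) * f s ≤ c * ∫ s in (0 : ℝ)..t, Real.exp (θ * s) * g s := by
  refine (integral_exp_mono ht hf (continuous_const.mul hg) h).trans (le_of_eq ?_)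
  rw [← intervalIntegral.integral_const_mul]
  refine intervalIntegral.integral_congr fun s _ => ?_
  rw [mul_left_comm]
  rfl

namespace Background

variable {ν : ℝ}

/-- The energy estimate for the perturbation equations. -/
def Estimate (B : Background ν) (ε θ K : ℝ) : Prop :=
  ∀ (T : ℝ) (r w : ℝ → L2), 0 < T → B.Pert T r w →
    (∀ t ∈ Icc 0 T, ‖r t‖ ≤ ε ∧ ‖w t‖ ≤ ε) →
    (∀ t ∈ Icc 0 T, Real.exp (θ * t) * (‖r t‖ ^ 2 + ‖w t‖ ^ 2)
        + (∫ s in (0 : ℝ)..t, Real.exp (θ * s) * (‖r s‖ ^ 2 + ‖w s‖ ^ 2)) ≤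
      K * ((‖r 0‖ ^ 2 + ‖w 0‖ ^ 2) + ∫ s in (0 : ℝ)..t, Real.exp (θ * s) *
        (‖emb (prim (r s))‖ ^ 2 + ‖emb (prim (w s))‖ ^ 2))) ∧
    ∀ V : ℝ → L2, Continuous V →
      (∀ t ∈ Icc 0 T, HasDerivWithinAt (fun s => emb (prim (w s))) (V t) (Icc 0 T) t) →
      ∀ t ∈ Icc 0 T, (∫ s in (0 : ℝ)..t, Real.exp (θ * s) * ‖V s‖ ^ 2) ≤
      K * ((‖r 0‖ ^ 2 + ‖w 0‖ ^ 2) + ∫ s in (0 : ℝ)..t, Real.exp (θ * s) *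
        (‖emb (prim (r s))‖ ^ 2 + ‖emb (prim (w s))‖ ^ 2))

/-- The norms of the density perturbation and of its logarithmic form are equivalent, with factor A
in both directions, so the estimate for the linear system transfers with powers of A. -/
theorem Bd.exists_estimate {B : Background ν} {K₁ c C ε θ K : ℝ} (hK₁ : B.Bd K₁) (hc : 0 < c)
    (hcm : c ≤ B.m) (hcd : ∀ F : L2, ‖F‖ ≤ B.δ → ∀ x, c ≤ damp ν B F x) (hC : 9 * K₁ ^ 4 ≤ C)
    (hε : 0 < ε) (hK : 0 < K) (H : ExpEstimate ν c C ε θ K) :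
    ∃ ε' > 0, ∃ K' > 0, B.Estimate ε' θ K' := by
  have hp := hK₁.pos
  have hone := hK₁.one_le
  set A := 2 * K₁ ^ 2 with hA
  have hA1 : 1 ≤ A := by have := one_le_pow₀ hone (n := 2); linarith
  have hA0 : 0 < A := by positivity
  have hA2 : 1 ≤ A ^ 2 := one_le_pow₀ hA1
  have hKA : K₁ ≤ A := by have := hK₁.le_pow two_ne_zero; linarith
  refine ⟨ε / A, by positivity, A ^ 2 * (K * A ^ 2), by positivity,
    fun T r w hT h hsm => ?_⟩
  have hs := (exists_linSys B hK₁ hc hcm hcd h).mono hc le_rfl hC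
  have hsm' : LinSys.Small ε T (fun t => B.logx (r t)) w w := by
    refine Or.inl fun t ht => ⟨rfl, ?_, (hsm t ht).2.trans (div_le_self hε.le hA1)⟩
    refine (hK₁.norm_logx_le (h.r_le t)).trans ?_
    have := (hsm t ht).1
    rw [le_div_iff₀ hA0] at this
    linarith
  obtain ⟨H1, H2⟩ := H T _ _ _ _ _ _ _ _ _ _ _ hT hs hsm'
  have cr := h.cont_r
  have cw := h.cont_w
  have cφ : Continuous fun s => B.logx (r s) := hs.cont_φ
  have cpw : Continuous fun s => emb (prim (w s)) := (emb.comp prim).continuous.comp cw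
  have cpr : Continuous fun s => emb (prim (r s)) := (emb.comp prim).continuous.comp cr
  have cpφ : Continuous fun s => emb (prim (B.logx (r s))) := (emb.comp prim).continuous.comp cφ
  have sq : ∀ {x y : ℝ}, 0 ≤ x → x ≤ A * y → x ^ 2 ≤ A ^ 2 * y ^ 2 := fun hx hxy => by
    rw [← mul_pow]; exact pow_le_pow_left₀ hx hxy 2
  have e1 : ∀ t, ‖r t‖ ^ 2 + ‖w t‖ ^ 2 ≤ A ^ 2 * (‖B.logx (r t)‖ ^ 2 + ‖w t‖ ^ 2) := fun t => by
    have a1 := sq (norm_nonneg _) (hK₁.norm_le_logx (h.r_le t))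
    have a2 := le_mul_of_one_le_left (sq_nonneg ‖w t‖) hA2
    linarith
  have e2 : ‖B.logx (r 0)‖ ^ 2 + ‖w 0‖ ^ 2 ≤ A ^ 2 * (‖r 0‖ ^ 2 + ‖w 0‖ ^ 2) := by
    have a1 := sq (norm_nonneg _) (hK₁.norm_logx_le (h.r_le 0))
    have a2 := le_mul_of_one_le_left (sq_nonneg ‖w 0‖) hA2
    linarith
  have e3 : ∀ t, 0 ≤ t → (∫ s in (0 : ℝ)..t, Real.exp (θ * s) *
      (‖emb (prim (B.logx (r s)))‖ ^ 2 + ‖emb (prim (w s))‖ ^ 2))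
      ≤ A ^ 2 * ∫ s in (0 : ℝ)..t, Real.exp (θ * s) *
        (‖emb (prim (r s))‖ ^ 2 + ‖emb (prim (w s))‖ ^ 2) := fun t ht => by
    refine integral_exp_le_mul ht (by fun_prop) (by fun_prop) fun s _ => ?_
    have a1 := sq (norm_nonneg _) ((hK₁.norm_emb_prim_logx_le (h.r_le s)).trans
      (mul_le_mul_of_nonneg_right hKA (norm_nonneg _)))
    have a2 := le_mul_of_one_le_left (sq_nonneg ‖emb (prim (w s))‖) hA2
    linarith
  have e4 : ∀ t, 0 ≤ t → K * ((‖B.logx (r 0)‖ ^ 2 + ‖w 0‖ ^ 2) + ∫ s in (0 : ℝ)..t,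
      Real.exp (θ * s) * (‖emb (prim (B.logx (r s)))‖ ^ 2 + ‖emb (prim (w s))‖ ^ 2)) ≤
      K * A ^ 2 * ((‖r 0‖ ^ 2 + ‖w 0‖ ^ 2) + ∫ s in (0 : ℝ)..t, Real.exp (θ * s) *
        (‖emb (prim (r s))‖ ^ 2 + ‖emb (prim (w s))‖ ^ 2)) := fun t ht => by
    rw [mul_assoc K]
    refine mul_le_mul_of_nonneg_left ?_ hK.le
    have := e3 t ht
    linarith
  constructor
  · intro t ht
    rw [mul_assoc (A ^ 2)]
    have f1 := integral_exp_le_mul (θ := θ) (f := fun s => ‖r s‖ ^ 2 + ‖w s‖ ^ 2)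
      (g := fun s => ‖B.logx (r s)‖ ^ 2 + ‖w s‖ ^ 2) ht.1 (by fun_prop) (by fun_prop)
      fun s _ => e1 s
    have f2 := mul_le_mul_of_nonneg_left (e1 t) (Real.exp_pos (θ * t)).le
    have f3 := mul_le_mul_of_nonneg_left ((H1 t ht).trans (e4 t ht.1)) (sq_nonneg A)
    linarith
  · intro V hV hder t ht
    have f1 := (H2 V hV hder t ht).trans (e4 t ht.1)
    refine f1.trans ?_
    rw [mul_assoc (A ^ 2)]
    exact le_mul_of_one_le_left ((integral_nonneg ht.1 fun s _ => by positivity).trans f1) hA2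

end Background

/-! ### Decay in H¹ -/

/-- The projection of the real line on `[0,T]`. -/
def clamp (T t : ℝ) : ℝ := max 0 (min T t)

theorem continuous_clamp (T : ℝ) : Continuous (clamp T) := by unfold clamp; fun_prop

theorem clamp_mem {T : ℝ} (hT : 0 ≤ T) (t : ℝ) : clamp T t ∈ Icc 0 T :=
  ⟨le_max_left _ _, max_le hT (min_le_left _ _)⟩

theorem clamp_of_mem {T t : ℝ} (ht : t ∈ Icc 0 T) : clamp T t = t := by
  rw [clamp, min_eq_right ht.2, max_eq_right ht.1]

theorem continuous_D {k : ℕ} (j : Fin (k + 1)) : Continuous (D j : H k → L2) :=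
  (PiLp.continuous_apply 2 (fun _ : Fin (k + 1) => L2) j).comp continuous_subtype_val

theorem norm_sq_eq_sum {k : ℕ} (f : H k) : ‖f‖ ^ 2 = ∑ j, ‖D j f‖ ^ 2 := by
  rw [Submodule.coe_norm, PiLp.norm_sq_eq_of_L2]
  rfl

theorem norm_D_le {k : ℕ} (j : Fin (k + 1)) (f : H k) : ‖D j f‖ ≤ ‖f‖ := by
  refine (pow_le_pow_iff_left₀ (norm_nonneg _) (norm_nonneg _) two_ne_zero).1 ?_
  rw [norm_sq_eq_sum]
  exact Finset.single_le_sum (f := fun j => ‖D j f‖ ^ 2) (fun i _ => sq_nonneg _) (Finset.mem_univ j)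

theorem D_zero_eq {f : H 1} (h : VanishesAt f 0) : D 0 f = emb (prim (D 1 f)) := by
  obtain ⟨a, ha, e⟩ := IsWeakDeriv.exists_eq (f.2 0)
  have h0 : a 0 = 0 := VanishesAt.apply_eq_zero (x := 0) (by simpa using h) e
  change D 0 f = emb a at e
  change IsH1 a (D 1 f) at ha
  rw [e, ha.prim_eq h0]

theorem prim_D_one_eq_zero {f : H 1} (h : VanishesAt f 0) (h1 : VanishesAt f 1) :
    prim (D 1 f) 1 = 0 :=
  VanishesAt.apply_eq_zero (x := 1) (by simpa using h1) (D_zero_eq h)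

/-- Freezing the solution outside [0,T] by `clamp` yields the curves on the whole line that
`Background.Pert` asks for; the equations are needed only on [0,T]. -/
theorem IsSolution.pert {ν : ℝ} {B : Background ν} {P ρh uh : ℝ → ℝ} (hB : B.Rep P ρh uh) {T : ℝ}
    (hT : 0 ≤ T) {r v : ℝ → H 1} (h : IsSolution ν P ρh uh T r v)
    (hr : ∀ t ∈ Icc 0 T, ‖D 1 (r t)‖ ≤ B.δ) (hv : ∀ t ∈ Icc 0 T, ‖D 1 (v t)‖ ≤ B.δ) :
    B.Pert T (fun t => D 1 (r (clamp T t))) (fun t => D 1 (v (clamp T t))) where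
  cont_r := (continuous_D 1).comp (h.cont_r.comp_continuous (continuous_clamp T) (clamp_mem hT))
  cont_w := (continuous_D 1).comp (h.cont_v.comp_continuous (continuous_clamp T) (clamp_mem hT))
  prim_w t := prim_D_one_eq_zero (h.bc_v_left _ (clamp_mem hT t)) (h.bc_v_right _ (clamp_mem hT t))
  r_le t := hr _ (clamp_mem hT t)
  w_le t := hv _ (clamp_mem hT t)
  mass ψ hψ t ht := by
    have h1 := h.mass ψ hψ t ht
    rw [hB.mass_eq (D_zero_eq (h.bc_r t ht)) (D_zero_eq (h.bc_v_left t ht)) hψ] at h1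
    have h2 : ∀ s ∈ Icc 0 T, inner ℝ (emb (prim (D 1 (r (clamp T s))))) (emb hψ.toCI)
        = ∫ x in Ioo (0 : ℝ) 1, D 0 (r s) x * ψ x := fun s hs => by
      rw [clamp_of_mem hs, ← D_zero_eq (h.bc_r s hs), hψ.inner_toCI]
    rw [clamp_of_mem ht]
    exact h1.congr h2 (h2 t ht)
  momentum ψ hψ t ht := by
    have h1 := h.momentum ψ hψ t ht
    rw [hB.momentum_eq (D_zero_eq (h.bc_r t ht)) (D_zero_eq (h.bc_v_left t ht)) (hr t ht) hψ] at h1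
    have h2 : ∀ s ∈ Icc 0 T, inner ℝ (emb (B.ρ * prim (D 1 (v (clamp T s))))) (emb hψ.toCI)
        = ∫ x in Ioo (0 : ℝ) 1, ρh x * D 0 (v s) x * ψ x := fun s hs => by
      rw [clamp_of_mem hs, D_zero_eq (h.bc_v_left s hs)]
      refine (hψ.integral_mul_eq ?_).symm
      filter_upwards [coeFn_emb (B.ρ * prim (D 1 (v s))), coeFn_emb (prim (D 1 (v s)))]
        with x a1 a2 hx
      rw [a1, a2, ex_mul, hB.ex_ρ hx]
    rw [clamp_of_mem ht]
    exact h1.congr h2 (h2 t ht)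

theorem exists_decay_one {ν : ℝ} {P ρh uh : ℝ → ℝ} {B : Background ν} (hB : B.Rep P ρh uh) :
    ∃ ε > (0 : ℝ), ∃ C > (0 : ℝ), ∃ θ₀ > (0 : ℝ), ∀ T > (0 : ℝ), ∀ r v : ℝ → H 1,
        IsSolution ν P ρh uh T r v →
        (∀ t ∈ Icc (0 : ℝ) T, Real.sqrt (‖r t‖ ^ 2 + ‖v t‖ ^ 2) ≤ ε) →
        ∀ t ∈ Icc (0 : ℝ) T, ∀ θ ≤ θ₀,
          ‖r t‖ ^ 2 + ‖v t‖ ^ 2 ≤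
            C * Real.exp (-θ * t) * (‖r 0‖ ^ 2 + ‖v 0‖ ^ 2)
            + C * ∫ s in (0 : ℝ)..t, Real.exp (-θ * (t - s)) *
                (‖D 0 (r s)‖ ^ 2 + ‖D 0 (v s)‖ ^ 2) := by
  obtain ⟨K₁, hK₁⟩ := B.exists_bd
  obtain ⟨c, hc, hcm, hcd⟩ := B.exists_lower
  have hp := hK₁.pos
  obtain ⟨ε', hε', θ₀, hθ₀, K', hK', H'⟩ :=
    exists_exp_estimate (C := 9 * K₁ ^ 4) B.hν hc (by positivity)
  obtain ⟨ε, hε, K, hK, Hest⟩ := hK₁.exists_estimate hc hcm hcd le_rfl hε' hK' H'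
  refine ⟨min ε B.δ, lt_min hε B.hδ, 2 * K, by positivity, θ₀, hθ₀,
    fun T hT r v hsol hsm t ht θ hθ => ?_⟩
  have hnr : ∀ t ∈ Icc 0 T, ‖D 1 (r t)‖ ≤ min ε B.δ := fun t ht =>
    (norm_D_le _ _).trans ((Real.le_sqrt_of_sq_le (by linarith [sq_nonneg ‖v t‖])).trans (hsm t ht))
  have hnv : ∀ t ∈ Icc 0 T, ‖D 1 (v t)‖ ≤ min ε B.δ := fun t ht =>
    (norm_D_le _ _).trans ((Real.le_sqrt_of_sq_le (by linarith [sq_nonneg ‖r t‖])).trans (hsm t ht))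
  have hpert := hsol.pert hB hT.le (fun t ht => (hnr t ht).trans (min_le_right _ _))
    (fun t ht => (hnv t ht).trans (min_le_right _ _))
  have h1 := (Hest T _ _ hT hpert fun t ht => by
    rw [clamp_of_mem ht]
    exact ⟨(hnr t ht).trans (min_le_left _ _), (hnv t ht).trans (min_le_left _ _)⟩).1 t ht
  have e0 : clamp T 0 = 0 := clamp_of_mem ⟨le_rfl, hT.le⟩
  rw [clamp_of_mem ht, e0] at h1
  have e1 : ∫ s in (0 : ℝ)..t, Real.exp (θ₀ * s) * (‖emb (prim (D 1 (r (clamp T s))))‖ ^ 2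
      + ‖emb (prim (D 1 (v (clamp T s))))‖ ^ 2) = ∫ s in (0 : ℝ)..t, Real.exp (θ₀ * s) *
      (‖D 0 (r s)‖ ^ 2 + ‖D 0 (v s)‖ ^ 2) := by
    refine intervalIntegral.integral_congr fun s hs => ?_
    rw [uIcc_of_le ht.1] at hs
    have hs' : s ∈ Icc 0 T := ⟨hs.1, hs.2.trans ht.2⟩
    simp only [clamp_of_mem hs', ← D_zero_eq (hsol.bc_r s hs'), ← D_zero_eq (hsol.bc_v_left s hs')]
  rw [e1] at h1
  have e2 : 0 ≤ ∫ s in (0 : ℝ)..t, Real.exp (θ₀ * s) * (‖D 1 (r (clamp T s))‖ ^ 2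
      + ‖D 1 (v (clamp T s))‖ ^ 2) := integral_nonneg ht.1 fun s _ => by positivity
  have hsub : Icc 0 t ⊆ Icc 0 T := Icc_subset_Icc_right ht.2
  -- Poincaré's inequality for functions vanishing at 0. It is the source of the factor 2 in the
  -- constant 2K.
  have hle : ∀ f : H 1, VanishesAt f 0 → ‖f‖ ^ 2 ≤ 2 * ‖D 1 f‖ ^ 2 := fun f hf => by
    rw [norm_sq_eq_sum, Fin.sum_univ_two, D_zero_eq hf]
    have := pow_le_pow_left₀ (norm_nonneg _) ((norm_emb_le _).trans (norm_prim_le (D 1 f))) 2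
    linarith
  refine le_of_exp_weight (θ₀ := θ₀) ht.1 (by positivity) (by positivity) ?_
    (fun s _ => by positivity) hθ ?_
  · have c1 := (continuous_D 0).comp_continuousOn (hsol.cont_r.mono hsub)
    have c2 := (continuous_D 0).comp_continuousOn (hsol.cont_v.mono hsub)
    exact (c1.norm.pow 2).add (c2.norm.pow 2)
  · have f1 := hle _ (hsol.bc_r t ht)
    have f2 := hle _ (hsol.bc_v_left t ht)
    have f3 := pow_le_pow_left₀ (norm_nonneg _) (norm_D_le 1 (r 0)) 2
    have f4 := pow_le_pow_left₀ (norm_nonneg _) (norm_D_le 1 (v 0)) 2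
    have f5 := mul_le_mul_of_nonneg_left (add_le_add f1 f2) (Real.exp_pos (θ₀ * t)).le
    have f6 := mul_le_mul_of_nonneg_left (add_le_add f3 f4) hK.le
    linarith

/-! ### Bookkeeping of bounds and the coefficients of the time-differentiated system -/

/-- `‖x‖ ≤ Λⁿ S`, where `Λ ≥ 2`: sums and products are bounded in the same way, with a larger
exponent. -/
def Bnd {E : Type*} [SeminormedAddCommGroup E] (Λ : ℝ) (n : ℕ) (S : ℝ) (x : E) : Prop :=
  2 ≤ Λ ∧ 0 ≤ S ∧ ‖x‖ ≤ Λ ^ n * S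

namespace Bnd

variable {E : Type*} [SeminormedAddCommGroup E] {Λ S : ℝ} {n k : ℕ} {x y : E}

theorem le (h : Bnd Λ n S x) : ‖x‖ ≤ Λ ^ n * S := h.2.2

theorem mono (h : Bnd Λ n S x) (hnk : n ≤ k) : Bnd Λ k S x :=
  ⟨h.1, h.2.1, h.2.2.trans (mul_le_mul_of_nonneg_right
    (pow_le_pow_right₀ (by linarith [h.1]) hnk) h.2.1)⟩

theorem neg (h : Bnd Λ n S x) : Bnd Λ n S (-x) := ⟨h.1, h.2.1, by rw [norm_neg]; exact h.2.2⟩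

/-- The condition Λ ≥ 2 is what allows a sum to be absorbed by one more power of Λ. -/
theorem add (hx : Bnd Λ n S x) (hy : Bnd Λ k S y) : Bnd Λ (max n k + 1) S (x + y) := by
  have h1 := (hx.mono (le_max_left n k)).le
  have h2 := (hy.mono (le_max_right n k)).le
  have h3 : 0 ≤ Λ ^ max n k * S := mul_nonneg (pow_nonneg (by linarith [hx.1]) _) hx.2.1
  refine ⟨hx.1, hx.2.1, (norm_add_le x y).trans ?_⟩
  rw [pow_succ]
  nlinarith [hx.1]

theorem sub (hx : Bnd Λ n S x) (hy : Bnd Λ k S y) : Bnd Λ (max n k + 1) S (x - y) := by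
  rw [sub_eq_add_neg]; exact hx.add hy.neg

theorem of_norm_le_mul {E' E'' : Type*} [SeminormedAddCommGroup E'] [SeminormedAddCommGroup E'']
    {y : E'} {z : E''} (h : ‖z‖ ≤ ‖x‖ * ‖y‖) {S' : ℝ} (hx : Bnd Λ n S x) (hy : Bnd Λ k S' y) :
    Bnd Λ (n + k) (S * S') z := by
  refine ⟨hx.1, mul_nonneg hx.2.1 hy.2.1, h.trans ((mul_le_mul hx.le hy.le (norm_nonneg _)
    ((norm_nonneg _).trans hx.le)).trans (le_of_eq ?_))⟩
  rw [pow_add]; ring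

variable {a b : CI} {F : L2}

theorem mul (ha : Bnd Λ n 1 a) (hb : Bnd Λ k S b) : Bnd Λ (n + k) S (a * b) := by
  simpa using of_norm_le_mul (norm_mul_le a b) ha hb

theorem mul' (ha : Bnd Λ n S a) (hb : Bnd Λ k 1 b) : Bnd Λ (n + k) S (a * b) := by
  simpa using of_norm_le_mul (norm_mul_le a b) ha hb

theorem csmul (ha : Bnd Λ n 1 a) (hF : Bnd Λ k S F) : Bnd Λ (n + k) S (a • F) := by
  simpa using of_norm_le_mul (norm_csmul_le a F) ha hF

theorem csmul' (ha : Bnd Λ n S a) (hF : Bnd Λ k 1 F) : Bnd Λ (n + k) S (a • F) := by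
  simpa using of_norm_le_mul (norm_csmul_le a F) ha hF

theorem rsmul {c : ℝ} (hc : Bnd Λ n 1 c) (hF : Bnd Λ k S F) : Bnd Λ (n + k) S (c • F) := by
  simpa using of_norm_le_mul (norm_smul_le c F) hc hF

theorem rsmul_CI {c : ℝ} (hc : Bnd Λ n 1 c) (hF : Bnd Λ k S a) : Bnd Λ (n + k) S (c • a) := by
  simpa using of_norm_le_mul (norm_smul_le c a) hc hF

theorem emb (ha : Bnd Λ n S a) : Bnd Λ n S (CompressibleNS.emb a) :=
  ⟨ha.1, ha.2.1, (norm_emb_le a).trans ha.le⟩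

theorem prim (hF : Bnd Λ n S F) : Bnd Λ n S (CompressibleNS.prim F) :=
  ⟨hF.1, hF.2.1, (norm_prim_le F).trans hF.le⟩

theorem of_le (hΛ : 2 ≤ Λ) (h : ‖x‖ ≤ S) : Bnd Λ 0 S x :=
  ⟨hΛ, (norm_nonneg _).trans h, by simpa using h⟩

theorem of_le_one (hΛ : 2 ≤ Λ) (h : ‖x‖ ≤ Λ) : Bnd Λ 1 1 x :=
  ⟨hΛ, zero_le_one, by simpa using h⟩

end Bnd

namespace Background

variable {ν : ℝ} (B : Background ν)

/-- The relative time derivative of the density. -/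
def relt (F R : L2) : CI := B.iv.comp (B.dens F) * prim R
/-- The space derivative of `relt`. -/
def reltx (F R : L2) : L2 :=
  B.iv.comp (B.dens F) • R - (B.relt F R * B.iv.comp (B.dens F)) • B.densx F
/-- The time derivative of the flux. -/
def fluxt (F W R V : L2) : L2 :=
  (prim R * B.vel W + B.dens F * prim V) • W + (B.dens F * B.vel W) • V
    + ((B.q2.comp (B.dens F) * prim R) • B.densx F + B.q1.comp (B.dens F) • R
      + emb (B.ux * (prim R * prim W + B.dens F * prim V + B.u * prim R)))
/-- The logarithmic derivative of the density. -/
def ldens (rx : CI) : CI := B.iv.comp (B.dens (emb rx)) * (B.ρx + rx)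
/-- The space derivative of `ldens`. -/
def ldensx (rx : CI) (rxx : L2) : L2 :=
  B.iv.comp (B.dens (emb rx)) • (emb B.ρxx + rxx)
    - (B.ldens rx * B.iv.comp (B.dens (emb rx))) • B.densx (emb rx)
/-- The remainder in the damping relation of the system for the time derivatives. -/
def remt (ν : ℝ) (B : Background ν) (rx : CI) (rxx W R V : L2) : L2 :=
  B.fluxt (emb rx) W R V + ν • (B.ldens rx • V + prim V • B.ldensx rx rxx)
    - ((B.dens (emb rx) * B.vel W) • V + prim V • B.momx (emb rx) W)
    - damp ν B (emb rx) • (B.dens (emb rx) • emb (prim V) + ν • B.reltx (emb rx) R)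

theorem densx_emb (rx : CI) : B.densx (emb rx) = emb (B.ρx + rx) := by rw [densx, map_add]
theorem velx_emb (vx : CI) : B.velx (emb vx) = emb (B.ux + vx) := by rw [velx, map_add]

variable {B}

theorem isH1_iv_dens {F : L2} (hF : ‖F‖ ≤ B.δ) : IsH1 (B.iv.comp (B.dens F))
    (-((B.iv.comp (B.dens F) * B.iv.comp (B.dens F)) • B.densx F)) :=
  (B.smooth_iv.isH1_comp _ _ (B.dens_mem hF) (B.isH1_dens F)).congr_deriv (by
    rw [← neg_smul]; rfl)

theorem isH1_relt {F : L2} (hF : ‖F‖ ≤ B.δ) (R : L2) : IsH1 (B.relt F R) (B.reltx F R) :=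
  ((isH1_iv_dens hF).mul (isH1_prim R)).congr_deriv (by
    rw [reltx, relt]; module)

theorem prim_reltx {F : L2} (hF : ‖F‖ ≤ B.δ) (R : L2) : prim (B.reltx F R) = B.relt F R :=
  (isH1_relt hF R).prim_eq (by simp [relt])

theorem isH1_ldens {rx : CI} {rxx : L2} (h : IsH1 rx rxx) (hF : ‖emb rx‖ ≤ B.δ) :
    IsH1 (B.ldens rx) (B.ldensx rx rxx) :=
  ((isH1_iv_dens hF).mul (B.isH1_ρx.add h)).congr_deriv (by
    rw [ldensx, ldens]; module)

theorem dens_mul_relt {F : L2} (hF : ‖F‖ ≤ B.δ) (R : L2) : B.dens F * B.relt F R = prim R := by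
  rw [relt, ← mul_assoc, B.mul_iv_comp (B.dens_mem hF), one_mul]

theorem dens_csmul_reltx {F : L2} (hF : ‖F‖ ≤ B.δ) (R : L2) :
    R = B.dens F • B.reltx F R + B.relt F R • B.densx F := by
  have h := B.mul_iv_comp (B.dens_mem hF)
  have e1 : B.dens F * (B.relt F R * B.iv.comp (B.dens F)) = B.relt F R := by
    linear_combination B.relt F R * h
  rw [reltx, smul_sub, smul_smul, smul_smul, h, one_smul, e1, sub_add_cancel]

/-- The relation between damping and flux in the system for the time derivatives. -/
theorem prim_fluxt_add {rx : CI} {rxx : L2} (h : IsH1 rx rxx) (hF : ‖emb rx‖ ≤ B.δ) (W R V : L2) :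
    prim (B.fluxt (emb rx) W R V) + ν • (B.ldens rx * prim V)
      = B.vel W * (B.dens (emb rx) * prim V)
        + prim (damp ν B (emb rx) • (B.dens (emb rx) • emb (prim V) + ν • B.reltx (emb rx) R)
          + remt ν B rx rxx W R V) := by
  have e2 := (((B.isH1_dens (emb rx)).mul (B.isH1_vel W)).mul (isH1_prim V)).prim_eq (by simp)
  have e3 := ((isH1_ldens h hF).mul (isH1_prim V)).prim_eq (by simp)
  have e4 : prim ((B.dens (emb rx) * B.vel W) • V + prim V • B.momx (emb rx) W)
      = B.vel W * (B.dens (emb rx) * prim V) := by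
    rw [momx, e2]; ring
  rw [remt, add_sub_cancel, map_sub, map_add, e4, map_smul, e3]
  abel

/-- The analogue of the cancellation in `Bd.norm_force_rem_le`: rewriting R as the x-derivative of
ρ·(ρ_t/ρ), the terms in (ρ_t/ρ)_x cancel against the damping, and ρ_t/ρ occurs only
undifferentiated. -/
theorem remt_eq {rx vx : CI} (hF : ‖emb rx‖ ≤ B.δ) (rxx R V : L2) :
    remt ν B rx rxx (emb vx) R V =
      (B.dens (emb rx) * B.vel (emb vx) * vx
        + B.q2.comp (B.dens (emb rx)) * B.dens (emb rx) * (B.ρx + rx)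
        + B.q1.comp (B.dens (emb rx)) * (B.ρx + rx)
        + B.ux * B.vel (emb vx) * B.dens (emb rx)) • emb (B.relt (emb rx) R)
      + ((B.dens (emb rx) * prim V) • emb vx + emb (B.ux * B.dens (emb rx) * prim V)
        + ν • (B.ldens rx • V + prim V • B.ldensx rx rxx) - prim V • B.momx (emb rx) (emb vx)
        - (damp ν B (emb rx) * B.dens (emb rx)) • emb (prim V)) := by
  have hν := B.hν
  have h1 : B.q1.comp (B.dens (emb rx)) • R
      = (B.q1.comp (B.dens (emb rx)) * B.dens (emb rx)) • B.reltx (emb rx) R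
        + (B.q1.comp (B.dens (emb rx)) * (B.ρx + rx)) • emb (B.relt (emb rx) R) := by
    conv_lhs => rw [dens_csmul_reltx hF R]
    rw [densx_emb]
    simp only [emb_apply]
    module
  have h2 : damp ν B (emb rx) • ν • B.reltx (emb rx) R
      = (B.q1.comp (B.dens (emb rx)) * B.dens (emb rx)) • B.reltx (emb rx) R := by
    rw [damp, smul_assoc, smul_comm _ ν, smul_smul ν⁻¹ ν, inv_mul_cancel₀ hν.ne', one_smul]
  have h3 := (dens_mul_relt hF R).symm
  rw [remt, fluxt, h1, smul_add (damp ν B (emb rx)), h2]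
  generalize B.relt (emb rx) R = f at h3 ⊢
  rw [h3, densx_emb]
  simp only [emb_apply, vel]
  module

end Background

namespace Background

variable {ν : ℝ} {B : Background ν}

/-- A small perturbation with bounded second derivative of the density. -/
structure Near (B : Background ν) (rx vx : CI) (rxx : L2) : Prop where
  isH1_rx : IsH1 rx rxx
  rx_le : ‖rx‖ ≤ B.δ
  vx_le : ‖vx‖ ≤ B.δ
  rxx_le : ‖rxx‖ ≤ B.δ

namespace Near

variable {rx vx : CI} {rxx : L2}

theorem emb_rx_le (h : B.Near rx vx rxx) : ‖emb rx‖ ≤ B.δ := (norm_emb_le rx).trans h.rx_le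
theorem emb_vx_le (h : B.Near rx vx rxx) : ‖emb vx‖ ≤ B.δ := (norm_emb_le vx).trans h.vx_le

end Near

/-- Bounds on the coefficients. -/
structure Coef (B : Background ν) (Λ : ℝ) (rx vx : CI) (rxx : L2) : Prop where
  hd : Bnd Λ 1 1 (B.dens (emb rx))
  hu : Bnd Λ 1 1 (B.vel (emb vx))
  hû : Bnd Λ 1 1 B.u
  hv : Bnd Λ 1 1 vx
  hi : Bnd Λ 1 1 (B.iv.comp (B.dens (emb rx)))
  hj : Bnd Λ 1 1 (B.iv.comp (B.vel (emb vx)))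
  hq1 : Bnd Λ 1 1 (B.q1.comp (B.dens (emb rx)))
  hq2 : Bnd Λ 1 1 (B.q2.comp (B.dens (emb rx)))
  hρx : Bnd Λ 1 1 B.ρx
  hux : Bnd Λ 1 1 B.ux
  hρxx : Bnd Λ 1 1 B.ρxx
  huxx : Bnd Λ 1 1 B.uxx
  hN : Bnd Λ 1 1 (B.ρx + rx)
  hU : Bnd Λ 1 1 (B.ux + vx)
  hNx : Bnd Λ 1 1 (emb B.ρxx + rxx)
  hν : Bnd Λ 1 1 ν
  hν' : Bnd Λ 1 1 ν⁻¹

theorem Bd.coef {K : ℝ} (hK : B.Bd K) {rx vx : CI} {rxx : L2} (h : B.Near rx vx rxx) :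
    B.Coef (2 * K) rx vx rxx := by
  have h1 := hK.one_le
  have h2 : 2 ≤ 2 * K := by linarith
  have h3 : K ≤ 2 * K := by linarith
  have hδ := hK.δ_le
  have hd := B.dens_mem h.emb_rx_le
  have hu := B.vel_mem h.emb_vx_le
  have aux : ∀ {E : Type} [SeminormedAddCommGroup E] {x : E}, ‖x‖ ≤ K → Bnd (2 * K) 1 1 x :=
    fun hx => Bnd.of_le_one h2 (hx.trans h3)
  exact
  { hd := aux (hK.mem_le hd)
    hu := aux (hK.mem_le hu)
    hû := aux (hK.mem_le B.u_mem')
    hv := aux (h.vx_le.trans hδ)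
    hi := aux (hK.iv_le _ hd)
    hj := aux (hK.iv_le _ hu)
    hq1 := aux (hK.q1_le _ hd)
    hq2 := aux (hK.q2_le _ hd)
    hρx := aux hK.ρx_le
    hux := aux hK.ux_le
    hρxx := aux hK.ρxx_le
    huxx := aux hK.uxx_le
    hN := Bnd.of_le_one h2 ((norm_add_le _ _).trans (by linarith [hK.ρx_le, h.rx_le]))
    hU := Bnd.of_le_one h2 ((norm_add_le _ _).trans (by linarith [hK.ux_le, h.vx_le]))
    hNx := Bnd.of_le_one h2 ((norm_add_le _ _).trans
      (by linarith [(norm_emb_le B.ρxx).trans hK.ρxx_le, h.rxx_le]))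
    hν := aux (by rw [Real.norm_of_nonneg B.hν.le]; exact hK.ν_le)
    hν' := aux (by rw [Real.norm_of_nonneg (inv_pos.2 B.hν).le]; exact hK.inv_ν_le) }

namespace Coef

variable {Λ S : ℝ} {rx vx : CI} {rxx R V : L2} {n : ℕ}

theorem densx (h : B.Coef Λ rx vx rxx) : Bnd Λ 1 1 (B.densx (emb rx)) := by
  rw [densx_emb]; exact h.hN.emb

theorem velx (h : B.Coef Λ rx vx rxx) : Bnd Λ 1 1 (B.velx (emb vx)) := by
  rw [velx_emb]; exact h.hU.emb

theorem momx (h : B.Coef Λ rx vx rxx) : Bnd Λ 3 1 (B.momx (emb rx) (emb vx)) :=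
  (h.hd.csmul h.velx).add (h.hu.csmul h.densx)

theorem damp (h : B.Coef Λ rx vx rxx) : Bnd Λ 3 1 (damp ν B (emb rx)) :=
  h.hν'.rsmul_CI (h.hq1.mul h.hd)

theorem ldens (h : B.Coef Λ rx vx rxx) : Bnd Λ 2 1 (B.ldens rx) := h.hi.mul h.hN

theorem ldensx (h : B.Coef Λ rx vx rxx) : Bnd Λ 5 1 (B.ldensx rx rxx) :=
  (h.hi.csmul h.hNx).sub ((h.ldens.mul h.hi).csmul h.densx)

/-- The time derivative of the density is controlled by the space derivative of `relt`. -/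
theorem bnd_R (h : B.Coef Λ rx vx rxx) (hF : ‖emb rx‖ ≤ B.δ)
    (hφ : Bnd Λ n S (B.reltx (emb rx) R)) : Bnd Λ (n + 2) S R := by
  have h1 : Bnd Λ n S (B.relt (emb rx) R) := by rw [← prim_reltx hF]; exact hφ.prim
  rw [dens_csmul_reltx hF R]
  exact ((h.hd.csmul hφ).add (h1.csmul' h.densx)).mono (by omega)

theorem fluxt (h : B.Coef Λ rx vx rxx) (hR : Bnd Λ 2 S R) (hV : Bnd Λ 0 S V) :
    Bnd Λ 9 S (B.fluxt (emb rx) (emb vx) R V) := by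
  have pR := hR.prim
  have pV := hV.prim
  have hv := h.hv.emb.prim
  refine Bnd.mono (((((pR.mul' h.hu).add (h.hd.mul pV)).csmul' h.hv.emb).add
    ((h.hd.mul h.hu).csmul hV)).add ((((h.hq2.mul pR).csmul' h.densx).add (h.hq1.csmul hR)).add
      (h.hux.mul (((pR.mul' hv).add (h.hd.mul pV)).add (h.hû.mul pR))).emb)) (by norm_num)

theorem remt (h : B.Coef Λ rx vx rxx) (hF : ‖emb rx‖ ≤ B.δ)
    (hf : Bnd Λ 0 S (emb (B.relt (emb rx) R))) (hV : Bnd Λ 0 S V) :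
    Bnd Λ 13 S (remt ν B rx rxx (emb vx) R V) := by
  have pV := hV.prim
  rw [remt_eq hF]
  refine Bnd.mono (((((((h.hd.mul h.hu).mul h.hv).add ((h.hq2.mul h.hd).mul h.hN)).add
    (h.hq1.mul h.hN)).add ((h.hux.mul h.hu).mul h.hd)).csmul hf).add
    ((((((h.hd.mul pV).csmul' h.hv.emb).add ((h.hux.mul h.hd).mul pV).emb).add
      (h.hν.rsmul ((h.ldens.csmul hV).add (pV.csmul' h.ldensx)))).sub (pV.csmul' h.momx)).sub
      ((h.damp.mul h.hd).csmul pV.emb))) (by norm_num)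

end Coef

end Background

/-! ### The time derivative of a regular perturbation -/

namespace Background

variable {ν : ℝ} {B : Background ν}

/-- A perturbation which is differentiable with respect to time: `rx, vx` and their derivatives
`rxx, vxx, vxxx` are space derivatives, and `R, V` are the time derivatives of `rx, vx`. -/
structure Pert2 (B : Background ν) (T : ℝ) (rx vx vxx : ℝ → CI) (rxx vxxx R V : ℝ → L2) :
    Prop where
  pos : 0 < T
  pert : B.Pert T (fun t => emb (rx t)) (fun t => emb (vx t))
  near : ∀ t, B.Near (rx t) (vx t) (rxx t)
  isH1_vx : ∀ t, IsH1 (vx t) (emb (vxx t))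
  isH1_vxx : ∀ t, IsH1 (vxx t) (vxxx t)
  cont_R : Continuous R
  cont_V : Continuous V
  prim_V : ∀ t, prim (V t) 1 = 0
  deriv_r : ∀ t ∈ Icc 0 T, HasDerivWithinAt (fun s => emb (rx s)) (R t) (Icc 0 T) t
  deriv_w : ∀ t ∈ Icc 0 T, HasDerivWithinAt (fun s => emb (vx s)) (V t) (Icc 0 T) t

namespace Pert2

variable {T t : ℝ} {rx vx vxx : ℝ → CI} {rxx vxxx R V : ℝ → L2}

theorem hasDerivWithinAt_prim {F : ℝ → L2} {F' : L2} {s : Set ℝ} (h : HasDerivWithinAt F F' s t) :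
    HasDerivWithinAt (fun s => prim (F s)) (prim F') s t :=
  prim.hasFDerivAt.comp_hasDerivWithinAt t h

theorem hasDerivWithinAt_emb {a : ℝ → CI} {a' : CI} {s : Set ℝ} (h : HasDerivWithinAt a a' s t) :
    HasDerivWithinAt (fun s => emb (a s)) (emb a') s t :=
  emb.hasFDerivAt.comp_hasDerivWithinAt t h

theorem deriv_dens (h : B.Pert2 T rx vx vxx rxx vxxx R V) (ht : t ∈ Icc 0 T) :
    HasDerivWithinAt (fun s => B.dens (emb (rx s))) (prim (R t)) (Icc 0 T) t :=
  (hasDerivWithinAt_prim (h.deriv_r t ht)).const_add _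

theorem deriv_vel (h : B.Pert2 T rx vx vxx rxx vxxx R V) (ht : t ∈ Icc 0 T) :
    HasDerivWithinAt (fun s => B.vel (emb (vx s))) (prim (V t)) (Icc 0 T) t :=
  (hasDerivWithinAt_prim (h.deriv_w t ht)).const_add _

theorem deriv_densx (h : B.Pert2 T rx vx vxx rxx vxxx R V) (ht : t ∈ Icc 0 T) :
    HasDerivWithinAt (fun s => B.densx (emb (rx s))) (R t) (Icc 0 T) t :=
  (h.deriv_r t ht).const_add _

theorem deriv_velx (h : B.Pert2 T rx vx vxx rxx vxxx R V) (ht : t ∈ Icc 0 T) :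
    HasDerivWithinAt (fun s => B.velx (emb (vx s))) (V t) (Icc 0 T) t :=
  (h.deriv_w t ht).const_add _

theorem uniqueDiff (h : B.Pert2 T rx vx vxx rxx vxxx R V) (ht : t ∈ Icc 0 T) :
    UniqueDiffWithinAt ℝ (Icc 0 T) t := uniqueDiffOn_Icc h.pos t ht

theorem deriv_comp_dens (h : B.Pert2 T rx vx vxx rxx vxxx R V) (ht : t ∈ Icc 0 T)
    {Ψ Ψ' : C(ℝ, ℝ)} (hΨ : Smooth1 B.m B.M Ψ Ψ') :
    HasDerivWithinAt (fun s => Ψ.comp (B.dens (emb (rx s))))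
      (Ψ'.comp (B.dens (emb (rx t))) * prim (R t)) (Icc 0 T) t :=
  hasDerivWithinAt_comp (h.deriv_dens ht) (fun s => B.dens_mem (h.near s).emb_rx_le) hΨ

/-- The equation of conservation of mass. -/
theorem mass (h : B.Pert2 T rx vx vxx rxx vxxx R V) (ht : t ∈ Icc 0 T) :
    prim (R t) = -(B.dens (emb (rx t)) * (B.ux + vx t) + B.vel (emb (vx t)) * (B.ρx + rx t)) := by
  have h1 := (h.uniqueDiff ht).eq_deriv _ (hasDerivWithinAt_emb (h.deriv_dens ht))
    (h.pert.hasDerivWithinAt_dens ht)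
  refine emb_injective ?_
  rw [h1, momx, velx_emb, densx_emb, ← emb_mul, ← emb_mul, ← map_add, ← map_neg]

/-- The mass equation divided by ρ. The right-hand side contains no time derivative, so ρ_t/ρ can be
differentiated in time without assuming a second time derivative of the density. -/
theorem relt_eq (h : B.Pert2 T rx vx vxx rxx vxxx R V) (ht : t ∈ Icc 0 T) :
    B.relt (emb (rx t)) (R t) = -((B.ux + vx t) + B.vel (emb (vx t)) * B.ldens (rx t)) := by
  have h1 := B.iv_comp_mul (B.dens_mem (h.near t).emb_rx_le)
  rw [relt, h.mass ht, ldens]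
  linear_combination (-(B.ux + vx t)) * h1

/-- The mixed derivatives of log ρ commute: the time derivative of (log ρ)_x is (ρ_t/ρ)_x. -/
theorem deriv_ldens (h : B.Pert2 T rx vx vxx rxx vxxx R V) (ht : t ∈ Icc 0 T) :
    HasDerivWithinAt (fun s => emb (B.ldens (rx s))) (B.reltx (emb (rx t)) (R t)) (Icc 0 T) t := by
  have h1 := (h.deriv_comp_dens ht B.smooth_iv).smul (h.deriv_densx ht)
  have e : ∀ s, emb (B.ldens (rx s)) = B.iv.comp (B.dens (emb (rx s))) • B.densx (emb (rx s)) :=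
    fun s => by rw [ldens, emb_mul, densx_emb]
  simp only [e]
  refine h1.congr_deriv ?_
  have : (-(B.iv * B.iv)).comp (B.dens (emb (rx t)))
      = -(B.iv.comp (B.dens (emb (rx t))) * B.iv.comp (B.dens (emb (rx t)))) := rfl
  rw [this, reltx, relt]
  module

/-- Differentiating `relt_eq` in time gives the same transport equation as for the perturbation, now
with b = (log ρ)_x for the actual density. -/
theorem deriv_relt (h : B.Pert2 T rx vx vxx rxx vxxx R V) (ht : t ∈ Icc 0 T) :
    HasDerivWithinAt (fun s => emb (B.relt (emb (rx s)) (R s)))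
      (-(B.vel (emb (vx t)) • B.reltx (emb (rx t)) (R t) + V t
        + emb (B.ldens (rx t) * prim (V t)))) (Icc 0 T) t := by
  have h1 := ((h.deriv_velx ht).add ((h.deriv_vel ht).smul (h.deriv_ldens ht))).neg
  have e : ∀ s ∈ Icc 0 T, emb (B.relt (emb (rx s)) (R s))
      = -(B.velx (emb (vx s)) + B.vel (emb (vx s)) • emb (B.ldens (rx s))) := fun s hs => by
    rw [h.relt_eq hs, map_neg, map_add, emb_mul, velx_emb]
  refine (h1.congr e (e t ht)).congr_deriv ?_
  simp only [emb_apply]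
  module

/-- The equation of conservation of momentum, in integrated form. -/
theorem flux_eq (h : B.Pert2 T rx vx vxx rxx vxxx R V) (ht : t ∈ Icc 0 T) :
    meanFree (emb (prim (B.dens (emb (rx t)) • emb (prim (V t)))))
      = meanFree (ν • emb (vx t) - emb (prim ((B.dens (emb (rx t)) * B.vel (emb (vx t))) • emb (vx t)
        + B.force (emb (rx t)) (emb (vx t))))) := by
  have h1 := (h.deriv_dens ht).smul (hasDerivWithinAt_emb (hasDerivWithinAt_prim (h.deriv_w t ht)))
  have h2 := (meanFree.comp (emb.comp prim)).hasFDerivAt.comp_hasDerivWithinAt t h1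
  -- The integrated momentum has one derivative from the product rule and one from the equation.
  -- Comparing them, the two terms with ρ_tv cancel and leave ρv_t.
  have h3 := (h.uniqueDiff ht).eq_deriv _ h2 (h.pert.hasDerivWithinAt_flux ht)
  have h4 : prim (emb (vx t)) • B.momx (emb (rx t)) (emb (vx t))
      = -(prim (R t) • emb (prim (emb (vx t)))) := by
    have := (h.uniqueDiff ht).eq_deriv _ (hasDerivWithinAt_emb (h.deriv_dens ht))
      (h.pert.hasDerivWithinAt_dens ht)
    rw [← neg_eq_iff_eq_neg.2 this, smul_neg, ← emb_mul, ← emb_mul, mul_comm]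
  rw [h4] at h3
  simp only [ContinuousLinearMap.comp_apply, map_add, map_sub, map_neg] at h3 ⊢
  rw [← sub_eq_zero] at h3 ⊢
  rw [← h3]
  abel

/-- The equation of conservation of momentum. -/
theorem momentum (h : B.Pert2 T rx vx vxx rxx vxxx R V) (ht : t ∈ Icc 0 T) :
    ν • emb (vxx t) = B.dens (emb (rx t)) • emb (prim (V t))
      + (B.dens (emb (rx t)) * B.vel (emb (vx t))) • emb (vx t)
      + B.force (emb (rx t)) (emb (vx t)) := by
  have h1 := h.flux_eq ht
  rw [← sub_eq_zero, ← map_sub, meanFree_apply, sub_eq_zero] at h1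
  set X := B.dens (emb (rx t)) • emb (prim (V t)) with hX
  set Y := (B.dens (emb (rx t)) * B.vel (emb (vx t))) • emb (vx t)
    + B.force (emb (rx t)) (emb (vx t)) with hY
  set k := prim (emb (prim X) - (ν • emb (vx t) - emb (prim Y))) 1
  -- The integrated equation exhibits νv_x as a constant plus a primitive, and uniqueness of the
  -- weak derivative turns it into an equation in L².
  have h2 : ν • vx t = cst (-k) + prim (X + Y) := by
    refine emb_injective ?_
    rw [map_add, map_smul emb ν, emb_apply (cst _), cst_csmul, map_add, map_add, neg_smul, ← h1]
    abel
  have h3 : IsH1 (ν • vx t) (X + Y) := by rw [h2]; exact isH1_cst_add_prim _ _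
  rw [((h.isH1_vx t).smul ν).unique h3, hY, add_assoc]

theorem deriv_force (h : B.Pert2 T rx vx vxx rxx vxxx R V) (ht : t ∈ Icc 0 T) :
    HasDerivWithinAt (fun s => (B.dens (emb (rx s)) * B.vel (emb (vx s))) • emb (vx s)
      + B.force (emb (rx s)) (emb (vx s)))
      (B.fluxt (emb (rx t)) (emb (vx t)) (R t) (V t)) (Icc 0 T) t := by
  have h1 := ((h.deriv_dens ht).mul (h.deriv_vel ht)).smul (h.deriv_w t ht)
  have h2 := (h.deriv_comp_dens ht B.smooth_q1).smul (h.deriv_densx ht)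
  have h3 := hasDerivWithinAt_emb ((((h.deriv_dens ht).mul (hasDerivWithinAt_prim (h.deriv_w t ht))).add
    ((hasDerivWithinAt_prim (h.deriv_r t ht)).const_mul B.u)).const_mul B.ux)
  refine (h1.add ((h2.sub_const (emb (B.q1.comp B.ρ * B.ρx))).add h3)).congr_deriv ?_
  rw [fluxt]
  simp only [emb_apply, Pi.mul_apply]
  module

theorem continuous_reltx (h : B.Pert2 T rx vx vxx rxx vxxx R V) :
    Continuous fun t => B.reltx (emb (rx t)) (R t) := by
  have h1 := (B.continuous_comp_dens B.iv).comp h.pert.cont_r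
  have h2 := prim.continuous.comp h.cont_R
  exact (h1.smul h.cont_R).sub (((h1.mul h2).mul h1).smul
    (B.continuous_densx.comp h.pert.cont_r))

theorem continuous_fluxt (h : B.Pert2 T rx vx vxx rxx vxxx R V) :
    Continuous fun t => B.fluxt (emb (rx t)) (emb (vx t)) (R t) (V t) := by
  have cr := h.pert.cont_r
  have cw := h.pert.cont_w
  have pr := prim.continuous.comp cr
  have pw := prim.continuous.comp cw
  have pR := prim.continuous.comp h.cont_R
  have pV := prim.continuous.comp h.cont_V
  have cd := B.continuous_dens.comp cr
  have cu := B.continuous_vel.comp cw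
  exact ((((pR.mul cu).add (cd.mul pV)).smul cw).add ((cd.mul cu).smul h.cont_V)).add
    ((((((B.continuous_comp_dens B.q2).comp cr).mul pR).smul (B.continuous_densx.comp cr)).add
      (((B.continuous_comp_dens B.q1).comp cr).smul h.cont_R)).add
      (emb.continuous.comp (continuous_const.mul (((pR.mul pw).add (cd.mul pV)).add
        (continuous_const.mul pR)))))

/-- By `flux_eq` the integrated ρv_t equals an expression in quantities that are differentiable in
time. Hence it has a time derivative and satisfies the flux equation, with no assumption on v_tt.
The exponent 13 is that of `Coef.remt`, the largest of the bounds involved. -/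
theorem linSys (h : B.Pert2 T rx vx vxx rxx vxxx R V) {K c : ℝ} (hK : B.Bd K) (hc : 0 < c)
    (hcm : c ≤ B.m) (hcd : ∀ F : L2, ‖F‖ ≤ B.δ → ∀ x, c ≤ damp ν B F x) :
    LinSys ν c ((2 * K) ^ 13) T B.u₀ B.ux (fun t => B.reltx (emb (rx t)) (R t)) V
      (fun t => emb (vx t)) (fun t => B.momx (emb (rx t)) (emb (vx t)))
      (fun t => B.fluxt (emb (rx t)) (emb (vx t)) (R t) (V t))
      (fun t => remt ν B (rx t) (rxx t) (emb (vx t)) (R t) (V t))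
      (fun t => B.dens (emb (rx t))) (fun t => damp ν B (emb (rx t))) (fun t => B.ldens (rx t)) := by
  have hco := fun t => hK.coef (h.near t)
  have hone : 1 ≤ 2 * K := by linarith [hK.one_le]
  have two : 2 ≤ 2 * K := by linarith [hK.one_le]
  have one : ∀ {n : ℕ} {E : Type} [SeminormedAddCommGroup E] {x : E}, Bnd (2 * K) n 1 x → n ≤ 13 →
      ‖x‖ ≤ (2 * K) ^ 13 := fun hx hn => by simpa using (hx.mono hn).le
  exact
  { hν := B.hν
    hc := hc
    cont_φ := h.continuous_reltx
    cont_w := h.cont_V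
    cont_g := h.continuous_fluxt
    cont_ρ := B.continuous_dens.comp h.pert.cont_r
    cont_κ := (((B.continuous_comp_dens _).comp h.pert.cont_r).mul
      (B.continuous_dens.comp h.pert.cont_r)).const_smul (ν⁻¹ : ℝ)
    prim_w := h.prim_V
    transport := fun t ht => by
      simp only [prim_reltx (h.near _).emb_rx_le]
      exact h.deriv_relt ht
    flux := fun t ht => by
      have h1 := ((h.deriv_w t ht).const_smul ν).sub
        (hasDerivWithinAt_emb (hasDerivWithinAt_prim (h.deriv_force ht)))
      have h2 := meanFree.hasFDerivAt.comp_hasDerivWithinAt t h1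
      exact h2.congr (fun s hs => h.flux_eq hs) (h.flux_eq ht)
    density := fun t ht => h.pert.hasDerivWithinAt_dens ht
    rel := fun t => prim_fluxt_add (h.near t).isH1_rx (h.near t).emb_rx_le _ _ _
    le_û := fun x => hcm.trans (B.u_mem' x).1
    le_u := fun t x => hcm.trans (B.vel_mem (h.near t).emb_vx_le x).1
    le_ρ := fun t x => hcm.trans (B.dens_mem (h.near t).emb_rx_le x).1
    le_κ := fun t x => hcd _ (h.near t).emb_rx_le x
    û_le := one (hco 0).hû (by norm_num)
    ûx_le := one (hco 0).hux (by norm_num)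
    ρ_le := fun t => one (hco t).hd (by norm_num)
    κ_le := fun t => one (hco t).damp (by norm_num)
    b_le := fun t => one (hco t).ldens (by norm_num)
    j_le := fun t => one (hco t).momx (by norm_num)
    g_le := fun t => by
      have hφ : Bnd (2 * K) 0 (‖B.reltx (emb (rx t)) (R t)‖ + ‖V t‖) (B.reltx (emb (rx t)) (R t)) :=
        Bnd.of_le two (le_add_of_nonneg_right (norm_nonneg _))
      exact (((hco t).fluxt ((hco t).bnd_R (h.near t).emb_rx_le hφ)
        (Bnd.of_le two (le_add_of_nonneg_left (norm_nonneg _)))).mono (by norm_num)).le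
    G_le := fun t => by
      simp only [prim_reltx (h.near t).emb_rx_le]
      exact ((hco t).remt (h.near t).emb_rx_le
        (Bnd.of_le two (le_add_of_nonneg_right (norm_nonneg _)))
        (Bnd.of_le two (le_add_of_nonneg_left (norm_nonneg _)))).le }

end Pert2

end Background

/-! ### Trading space derivatives for time derivatives -/

namespace Background

variable {ν : ℝ} {B : Background ν}

/-- The space derivative of the force. -/
def forcex (B : Background ν) (rx vx : CI) (rxx : L2) : L2 :=
  B.q1.comp (B.dens (emb rx)) • rxx
    + (B.q1.comp (B.dens (emb rx)) - B.q1.comp B.ρ) • emb B.ρxx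
    + ((B.q2.comp (B.dens (emb rx)) * (B.ρx + rx + B.ρx)) • emb rx
      + (B.q2.comp (B.dens (emb rx)) - B.q2.comp B.ρ) • emb (B.ρx * B.ρx))
    + B.ux • (B.dens (emb rx) • emb vx + prim (emb vx) • B.densx (emb rx) + B.u • emb rx
      + prim (emb rx) • emb B.ux)
    + (B.dens (emb rx) * prim (emb vx) + B.u * prim (emb rx)) • emb B.uxx

theorem isH1_force {rx vx : CI} {rxx : L2} (h : B.Near rx vx rxx) :
    IsH1 (B.q1.comp (B.dens (emb rx)) * (B.ρx + rx) - B.q1.comp B.ρ * B.ρx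
      + B.ux * (B.dens (emb rx) * prim (emb vx) + B.u * prim (emb rx))) (B.forcex rx vx rxx) := by
  refine ((((B.smooth_q1.isH1_comp _ _ (B.dens_mem h.emb_rx_le) (B.isH1_dens _)).mul
    (B.isH1_ρx.add h.isH1_rx)).sub
    ((B.smooth_q1.isH1_comp _ _ B.ρ_mem' B.isH1_ρ).mul B.isH1_ρx)).add (B.isH1_ux.mul
      (((B.isH1_dens (emb rx)).mul (isH1_prim (emb vx))).add
        (B.isH1_u.mul (isH1_prim (emb rx)))))).congr_deriv ?_
  rw [forcex, densx_emb]
  simp only [emb_apply]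
  module

namespace Coef

variable {K S : ℝ} {rx vx vxx : CI} {rxx vxxx R V : L2} {n : ℕ}

theorem bnd_force (hK : B.Bd K) (h : B.Near rx vx rxx) (hS : ‖emb rx‖ + ‖emb vx‖ ≤ S) :
    Bnd (2 * K) 6 S (B.force (emb rx) (emb vx)) := by
  have hp := hK.pos
  have hone := hK.one_le
  have h1 := (hK.norm_force_rem_le (W := emb vx) h.emb_rx_le).1
  have h2 := hK.norm_logx_le h.emb_rx_le
  refine ⟨by linarith, (by positivity : (0 : ℝ) ≤ ‖emb rx‖ + ‖emb vx‖).trans hS, h1.trans ?_⟩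
  have h3 : ‖emb vx‖ ≤ 2 * K ^ 2 * ‖emb vx‖ := by
    have := one_le_pow₀ hone (n := 2)
    refine le_mul_of_one_le_left (norm_nonneg _) (by linarith)
  calc 4 * K ^ 4 * (‖B.logx (emb rx)‖ + ‖emb vx‖)
      ≤ 4 * K ^ 4 * (2 * K ^ 2 * ‖emb rx‖ + 2 * K ^ 2 * ‖emb vx‖) := by gcongr
    _ = 8 * K ^ 6 * (‖emb rx‖ + ‖emb vx‖) := by ring
    _ ≤ 64 * K ^ 6 * S := by gcongr; norm_num
    _ = (2 * K) ^ 6 * S := by ring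

theorem bnd_forcex (hK : B.Bd K) (h : B.Near rx vx rxx) (hr : Bnd (2 * K) 0 S (emb rx))
    (hv : Bnd (2 * K) 0 S (emb vx)) (hrx : Bnd (2 * K) n S rxx) :
    Bnd (2 * K) (n + 9) S (B.forcex rx vx rxx) := by
  have hc := hK.coef h
  have two := hr.1
  have hK0 := hK.pos
  have sub_le : ∀ {Ψ : C(ℝ, ℝ)},
      (∀ y ∈ Icc B.m B.M, ∀ z ∈ Icc B.m B.M, |Ψ z - Ψ y| ≤ K * |z - y|) →
      Bnd (2 * K) 1 S (Ψ.comp (B.dens (emb rx)) - Ψ.comp B.ρ) := fun hΨ => by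
    refine ⟨two, hr.2.1, (Bd.norm_comp_sub_le hΨ hK0.le h.emb_rx_le).trans ?_⟩
    have h1 := hr.prim.le
    rw [pow_zero, one_mul] at h1
    have h2 : K * ‖prim (emb rx)‖ ≤ K * S := by gcongr
    have h3 := mul_nonneg hK0.le hr.2.1
    linarith
  refine Bnd.mono (((((hc.hq1.csmul hrx).add ((sub_le hK.q1_lip).csmul' hc.hρxx.emb)).add
    (((hc.hq2.mul (hc.hN.add hc.hρx)).csmul hr).add
      ((sub_le hK.q2_lip).csmul' (hc.hρx.mul hc.hρx).emb))).add
    (hc.hux.csmul ((((hc.hd.csmul hv).add (hv.prim.csmul' hc.densx)).add (hc.hû.csmul hr)).add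
      (hr.prim.csmul' hc.hux.emb)))).add
    (((hc.hd.mul hv.prim).add (hc.hû.mul hr.prim)).csmul' hc.huxx.emb)) (by omega)

end Coef

/-- The space derivative of the mass flux, without the term containing `rxx`. -/
def massx (B : Background ν) (rx vx vxx : CI) : L2 :=
  prim (emb rx) • emb B.uxx + B.ux • emb rx + (B.dens (emb rx) • emb vxx + (B.ρx + rx) • emb vx)
    + (prim (emb vx) • emb B.ρxx + B.ρx • emb vx) + (B.ux + vx) • emb rx

theorem Coef.bnd_massx {Λ S : ℝ} {rx vx vxx : CI} {rxx : L2} {n : ℕ} (hc : B.Coef Λ rx vx rxx)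
    (hr : Bnd Λ 0 S (emb rx)) (hv : Bnd Λ 0 S (emb vx)) (hvx : Bnd Λ n S (emb vxx)) :
    Bnd Λ (n + 6) S (B.massx rx vx vxx) := by
  refine Bnd.mono (((((hr.prim.csmul' hc.huxx.emb).add (hc.hux.csmul hr)).add
    ((hc.hd.csmul hvx).add (hc.hN.csmul hv))).add ((hv.prim.csmul' hc.hρxx.emb).add
      (hc.hρx.csmul hv))).add (hc.hU.csmul hr)) (by omega)

namespace Pert2

variable {T t S K : ℝ} {rx vx vxx : ℝ → CI} {rxx vxxx R V : ℝ → L2}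

theorem mass_eq (h : B.Pert2 T rx vx vxx rxx vxxx R V) (ht : t ∈ Icc 0 T) :
    prim (R t) = -(prim (emb (rx t)) * B.ux + B.dens (emb (rx t)) * vx t
      + prim (emb (vx t)) * B.ρx + B.vel (emb (vx t)) * rx t) := by
  rw [h.mass ht, dens, vel]
  linear_combination -B.mass'

theorem R_eq (h : B.Pert2 T rx vx vxx rxx vxxx R V) (ht : t ∈ Icc 0 T) :
    R t = -(B.vel (emb (vx t)) • rxx t + B.massx (rx t) (vx t) (vxx t)) := by
  have h1 := (((((isH1_prim (emb (rx t))).mul B.isH1_ux).add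
    ((B.isH1_dens (emb (rx t))).mul (h.isH1_vx t))).add
    ((isH1_prim (emb (vx t))).mul B.isH1_ρx)).add
    ((B.isH1_vel (emb (vx t))).mul (h.near t).isH1_rx)).neg
  rw [← h.mass_eq ht] at h1
  rw [(isH1_prim (R t)).unique h1, massx, densx_emb, velx_emb]
  simp only [emb_apply]
  module

theorem momentum_deriv (h : B.Pert2 T rx vx vxx rxx vxxx R V) (ht : t ∈ Icc 0 T) :
    ν • vxxx t = B.dens (emb (rx t)) • V t + ((B.ρx + rx t) • emb (prim (V t))
      + (B.dens (emb (rx t)) * B.vel (emb (vx t))) • emb (vxx t)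
      + (B.dens (emb (rx t)) * (B.ux + vx t) + B.vel (emb (vx t)) * (B.ρx + rx t)) • emb (vx t)
      + B.forcex (rx t) (vx t) (rxx t)) := by
  have h1 := (((B.isH1_dens (emb (rx t))).mul (isH1_prim (V t))).add
    (((B.isH1_dens (emb (rx t))).mul (B.isH1_vel (emb (vx t)))).mul (h.isH1_vx t))).add
    (isH1_force (h.near t))
  have h2 : ν • vxx t = B.dens (emb (rx t)) * prim (V t)
      + B.dens (emb (rx t)) * B.vel (emb (vx t)) * vx t
      + (B.q1.comp (B.dens (emb (rx t))) * (B.ρx + rx t) - B.q1.comp B.ρ * B.ρx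
      + B.ux * (B.dens (emb (rx t)) * prim (emb (vx t)) + B.u * prim (emb (rx t)))) := by
    refine emb_injective ?_
    rw [map_smul emb ν, h.momentum ht, force, densx_emb]
    simp only [emb_apply]
    module
  rw [← h2] at h1
  rw [((h.isH1_vxx t).smul ν).unique h1, densx_emb, velx_emb]
  simp only [emb_apply]
  module

/-- The mass equation expresses ρ_t/ρ by the perturbation and its first space derivatives. Its
square is therefore integrable against the exponential weight by the first-order dissipation. -/
theorem bnd_relt (h : B.Pert2 T rx vx vxx rxx vxxx R V) (hK : B.Bd K) (ht : t ∈ Icc 0 T) :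
    Bnd (2 * K) 5 (‖emb (rx t)‖ + ‖emb (vx t)‖) (emb (B.relt (emb (rx t)) (R t))) := by
  have hc := hK.coef (h.near t)
  have two := hc.hd.1
  have hr : Bnd (2 * K) 0 (‖emb (rx t)‖ + ‖emb (vx t)‖) (emb (rx t)) :=
    Bnd.of_le two (le_add_of_nonneg_right (norm_nonneg _))
  have hv : Bnd (2 * K) 0 (‖emb (rx t)‖ + ‖emb (vx t)‖) (emb (vx t)) :=
    Bnd.of_le two (le_add_of_nonneg_left (norm_nonneg _))
  rw [relt, h.mass_eq ht, emb_mul, map_neg, map_add, map_add, map_add,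
    emb_mul (B.dens _), emb_mul (B.vel _)]
  exact (hc.hi.csmul (((((hr.prim.mul' hc.hux).emb.add (hc.hd.csmul hv)).add
    (hv.prim.mul' hc.hρx).emb).add (hc.hu.csmul hr)).neg)).mono (by norm_num)

/-- The space derivatives are controlled by the time derivatives. -/
theorem bnd_space (h : B.Pert2 T rx vx vxx rxx vxxx R V) (hK : B.Bd K) (ht : t ∈ Icc 0 T)
    (hS : S = ‖emb (rx t)‖ + ‖emb (vx t)‖ + ‖B.reltx (emb (rx t)) (R t)‖ + ‖V t‖) :
    Bnd (2 * K) 40 S (rxx t) ∧ Bnd (2 * K) 40 S (emb (vxx t)) ∧ Bnd (2 * K) 40 S (vxxx t) := by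
  have hc := hK.coef (h.near t)
  have two := hc.hd.1
  have hν := B.hν.ne'
  have n1 := norm_nonneg (emb (rx t))
  have n2 := norm_nonneg (emb (vx t))
  have n3 := norm_nonneg (B.reltx (emb (rx t)) (R t))
  have n4 := norm_nonneg (V t)
  have hr : Bnd (2 * K) 0 S (emb (rx t)) := Bnd.of_le two (by linarith)
  have hv : Bnd (2 * K) 0 S (emb (vx t)) := Bnd.of_le two (by linarith)
  have hφ : Bnd (2 * K) 0 S (B.reltx (emb (rx t)) (R t)) := Bnd.of_le two (by linarith)
  have hV : Bnd (2 * K) 0 S (V t) := Bnd.of_le two (by linarith)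
  have hR := hc.bnd_R (h.near t).emb_rx_le hφ
  have hf := Coef.bnd_force hK (h.near t) (S := S) (by linarith)
  -- The momentum equation gives v_xx; then the differentiated mass equation, divided by u > 0,
  -- gives r_xx; finally the differentiated momentum equation gives v_xxx.
  have hvxx : Bnd (2 * K) 9 S (emb (vxx t)) := by
    have e : emb (vxx t) = ν⁻¹ • (ν • emb (vxx t)) := by rw [smul_smul, inv_mul_cancel₀ hν, one_smul]
    rw [e, h.momentum ht]
    exact (hc.hν'.rsmul (((hc.hd.csmul hV.prim.emb).add ((hc.hd.mul hc.hu).csmul hv)).add hf)).mono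
      (by norm_num)
  have hrxx : Bnd (2 * K) 17 S (rxx t) := by
    have e1 : B.vel (emb (vx t)) • rxx t = -(R t + B.massx (rx t) (vx t) (vxx t)) := by
      rw [h.R_eq ht]; abel
    have e : rxx t = B.iv.comp (B.vel (emb (vx t))) • B.vel (emb (vx t)) • rxx t := by
      rw [smul_smul, B.iv_comp_mul (B.vel_mem (h.near t).emb_vx_le), one_smul]
    rw [e, e1]
    exact (hc.hj.csmul ((hR.add (hc.bnd_massx hr hv hvxx)).neg)).mono (by norm_num)
  refine ⟨hrxx.mono (by norm_num), hvxx.mono (by norm_num), ?_⟩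
  have e : vxxx t = ν⁻¹ • (ν • vxxx t) := by rw [smul_smul, inv_mul_cancel₀ hν, one_smul]
  rw [e, h.momentum_deriv ht]
  exact (hc.hν'.rsmul ((hc.hd.csmul hV).add ((((hc.hN.csmul hV.prim.emb).add
    ((hc.hd.mul hc.hu).csmul hvxx)).add
    (((hc.hd.mul hc.hU).add (hc.hu.mul hc.hN)).csmul hv)).add
    (Coef.bnd_forcex hK (h.near t) hr hv hrxx)))).mono (by norm_num)

/-- The time derivatives are controlled by the space derivatives. -/
theorem bnd_time (h : B.Pert2 T rx vx vxx rxx vxxx R V) (hK : B.Bd K) (ht : t ∈ Icc 0 T)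
    (hS : S = ‖emb (rx t)‖ + ‖emb (vx t)‖ + ‖rxx t‖ + ‖emb (vxx t)‖ + ‖vxxx t‖) :
    Bnd (2 * K) 40 S (B.reltx (emb (rx t)) (R t)) ∧ Bnd (2 * K) 40 S (V t) := by
  have hc := hK.coef (h.near t)
  have two := hc.hd.1
  have n1 := norm_nonneg (emb (rx t))
  have n2 := norm_nonneg (emb (vx t))
  have n3 := norm_nonneg (rxx t)
  have n4 := norm_nonneg (emb (vxx t))
  have n5 := norm_nonneg (vxxx t)
  have hr : Bnd (2 * K) 0 S (emb (rx t)) := Bnd.of_le two (by linarith)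
  have hv : Bnd (2 * K) 0 S (emb (vx t)) := Bnd.of_le two (by linarith)
  have hrxx : Bnd (2 * K) 0 S (rxx t) := Bnd.of_le two (by linarith)
  have hvxx : Bnd (2 * K) 0 S (emb (vxx t)) := Bnd.of_le two (by linarith)
  have hvxxx : Bnd (2 * K) 0 S (vxxx t) := Bnd.of_le two (by linarith)
  have hf := Coef.bnd_force hK (h.near t) (S := S) (by linarith)
  have hR : Bnd (2 * K) 7 S (R t) := by
    rw [h.R_eq ht]
    exact ((hc.hu.csmul hrxx).add (hc.bnd_massx hr hv hvxx)).neg.mono (by norm_num)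
  have hid := B.iv_comp_mul (B.dens_mem (h.near t).emb_rx_le)
  -- Here v_t is read off from the momentum equation, and below v_xt from its x-derivative, dividing
  -- by ρ each time.
  have hpV : Bnd (2 * K) 9 S (emb (prim (V t))) := by
    have e1 : B.dens (emb (rx t)) • emb (prim (V t)) = ν • emb (vxx t)
        - (B.dens (emb (rx t)) * B.vel (emb (vx t))) • emb (vx t)
        - B.force (emb (rx t)) (emb (vx t)) := by rw [h.momentum ht]; abel
    have e : emb (prim (V t))
        = B.iv.comp (B.dens (emb (rx t))) • B.dens (emb (rx t)) • emb (prim (V t)) := by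
      rw [smul_smul, hid, one_smul]
    rw [e, e1]
    exact (hc.hi.csmul (((hc.hν.rsmul hvxx).sub ((hc.hd.mul hc.hu).csmul hv)).sub hf)).mono
      (by norm_num)
  constructor
  · rw [reltx, relt]
    exact ((hc.hi.csmul hR).sub (((hc.hi.mul hR.prim).mul' hc.hi).csmul' hc.densx)).mono
      (by norm_num)
  · have e1 : B.dens (emb (rx t)) • V t = ν • vxxx t - ((B.ρx + rx t) • emb (prim (V t))
      + (B.dens (emb (rx t)) * B.vel (emb (vx t))) • emb (vxx t)
      + (B.dens (emb (rx t)) * (B.ux + vx t) + B.vel (emb (vx t)) * (B.ρx + rx t)) • emb (vx t)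
      + B.forcex (rx t) (vx t) (rxx t)) := by rw [h.momentum_deriv ht, add_sub_cancel_right]
    have e : V t = B.iv.comp (B.dens (emb (rx t))) • B.dens (emb (rx t)) • V t := by
      rw [smul_smul, hid, one_smul]
    rw [e, e1]
    exact (hc.hi.csmul ((hc.hν.rsmul hvxxx).sub ((((hc.hN.csmul hpV).add
      ((hc.hd.mul hc.hu).csmul hvxx)).add
      (((hc.hd.mul hc.hU).add (hc.hu.mul hc.hN)).csmul hv)).add
      (Coef.bnd_forcex hK (h.near t) hr hv hrxx)))).mono (by norm_num)

end Pert2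

end Background

theorem Bnd.sq_le {E : Type*} [SeminormedAddCommGroup E] {Λ S : ℝ} {n : ℕ} {x : E}
    (h : Bnd Λ n S x) : ‖x‖ ^ 2 ≤ Λ ^ (2 * n) * S ^ 2 := by
  have := pow_le_pow_left₀ (norm_nonneg x) h.le 2
  rwa [mul_pow, ← pow_mul, mul_comm n] at this

namespace Background

variable {ν : ℝ}

/-- The energy estimate is applied to the perturbation and to its time derivative. The sources
‖ρ_t/ρ‖² and ‖v_t‖² of the second application are integrated by the first: the former through
`bnd_relt` and the dissipation of r_x and v_x, the latter through the clause on V in `Estimate`. -/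
theorem exists_estimate_two (B : Background ν) : ∃ ε > 0, ∃ θ > 0, ∃ K > 0,
    ∀ (T : ℝ) (rx vx vxx : ℝ → CI) (rxx vxxx R V : ℝ → L2),
      B.Pert2 T rx vx vxx rxx vxxx R V → (∀ t ∈ Icc 0 T, ‖rx t‖ ≤ ε ∧ ‖vx t‖ ≤ ε) →
      ∀ t ∈ Icc 0 T, Real.exp (θ * t) * (‖emb (rx t)‖ ^ 2 + ‖emb (vx t)‖ ^ 2
          + (‖B.reltx (emb (rx t)) (R t)‖ ^ 2 + ‖V t‖ ^ 2)) ≤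
        K * ((‖emb (rx 0)‖ ^ 2 + ‖emb (vx 0)‖ ^ 2
          + (‖B.reltx (emb (rx 0)) (R 0)‖ ^ 2 + ‖V 0‖ ^ 2))
          + ∫ s in (0 : ℝ)..t, Real.exp (θ * s) *
            (‖emb (prim (emb (rx s)))‖ ^ 2 + ‖emb (prim (emb (vx s)))‖ ^ 2)) := by
  obtain ⟨K₁, hK₁⟩ := B.exists_bd
  obtain ⟨c, hc, hcm, hcd⟩ := B.exists_lower
  have hp := hK₁.pos
  have hone := hK₁.one_le
  obtain ⟨ε₂, hε₂, θ, hθ, K₂, hK₂, H⟩ :=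
    exists_exp_estimate (C := (2 * K₁) ^ 13) B.hν hc (by positivity)
  -- Both systems are treated with the larger constant (2K₁)¹³, so that the two applications share
  -- the rate θ.
  have hC : 9 * K₁ ^ 4 ≤ (2 * K₁) ^ 13 := by
    calc 9 * K₁ ^ 4 ≤ 2 ^ 13 * K₁ ^ 13 := by
          have : K₁ ^ 4 ≤ K₁ ^ 13 := pow_le_pow_right₀ hone (by norm_num)
          have : 0 ≤ K₁ ^ 13 := by positivity
          linarith
      _ = _ := by ring
  obtain ⟨ε₁, hε₁, K₃, hK₃, H₁⟩ := hK₁.exists_estimate hc hcm hcd hC hε₂ hK₂ H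
  set L := (2 * K₁) ^ 10 * 2 with hL
  have hL0 : 0 < L := by positivity
  refine ⟨min ε₁ ε₂, lt_min hε₁ hε₂, θ, hθ, K₃ + K₂ * (1 + (L + 1) * K₃), by positivity,
    fun T rx vx vxx rxx vxxx R V h hsm t ht => ?_⟩
  have hn : ∀ t ∈ Icc 0 T, ‖emb (rx t)‖ ≤ ε₁ ∧ ‖emb (vx t)‖ ≤ ε₁ := fun t ht =>
    ⟨(norm_emb_le _).trans ((hsm t ht).1.trans (min_le_left _ _)),
      (norm_emb_le _).trans ((hsm t ht).2.trans (min_le_left _ _))⟩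
  obtain ⟨P1, P2⟩ := H₁ T _ _ h.pos h.pert hn
  have cr : Continuous fun t => emb (rx t) := h.pert.cont_r
  have cw : Continuous fun t => emb (vx t) := h.pert.cont_w
  have cφ := h.continuous_reltx
  have cV := h.cont_V
  have cpV : Continuous fun s => emb (prim (V s)) := (emb.comp prim).continuous.comp cV
  have cpφ : Continuous fun s => emb (prim (B.reltx (emb (rx s)) (R s))) :=
    (emb.comp prim).continuous.comp cφ
  have P1 := P1 t ht
  have P2 := P2 (fun s => emb (prim (V s))) cpV
    (fun s hs => Pert2.hasDerivWithinAt_emb (Pert2.hasDerivWithinAt_prim (h.deriv_w s hs))) t ht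
  -- The second alternative of smallness: v_x is small in sup norm, while nothing is assumed about
  -- the size of the time derivatives.
  have hsm₂ : LinSys.Small ε₂ T (fun t => B.reltx (emb (rx t)) (R t)) V (fun t => emb (vx t)) := by
    refine Or.inr ⟨hε₂.le, fun t ht => ?_⟩
    filter_upwards [coeFn_emb (vx t)] with x hx
    rw [hx]
    exact (abs_ex_le _ _).trans ((hsm t ht).2.trans (min_le_right _ _))
  have P3 := (H T _ _ _ _ _ _ _ _ _ _ _ h.pos (h.linSys hK₁ hc hcm hcd) hsm₂).1 t ht
  have hsub : ∀ s ∈ Icc 0 t, s ∈ Icc 0 T := fun s hs => ⟨hs.1, hs.2.trans ht.2⟩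
  have e1 : (∫ s in (0 : ℝ)..t, Real.exp (θ * s) *
      (‖emb (prim (B.reltx (emb (rx s)) (R s)))‖ ^ 2 + ‖emb (prim (V s))‖ ^ 2)) ≤
      L * (∫ s in (0 : ℝ)..t, Real.exp (θ * s) * (‖emb (rx s)‖ ^ 2 + ‖emb (vx s)‖ ^ 2))
        + ∫ s in (0 : ℝ)..t, Real.exp (θ * s) * ‖emb (prim (V s))‖ ^ 2 := by
    have a1 := integral_exp_le_mul (θ := θ) (c := L)
      (f := fun s => ‖emb (prim (B.reltx (emb (rx s)) (R s)))‖ ^ 2)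
      (g := fun s => ‖emb (rx s)‖ ^ 2 + ‖emb (vx s)‖ ^ 2) ht.1 (by fun_prop) (by fun_prop)
      (fun s hs => by
        have b1 := (h.bnd_relt hK₁ (hsub s hs)).sq_le
        rw [← prim_reltx (h.near s).emb_rx_le] at b1
        have b2 : (‖emb (rx s)‖ + ‖emb (vx s)‖) ^ 2 ≤ 2 * (‖emb (rx s)‖ ^ 2 + ‖emb (vx s)‖ ^ 2) := by
          linarith [sq_nonneg (‖emb (rx s)‖ - ‖emb (vx s)‖)]
        refine b1.trans ((mul_le_mul_of_nonneg_left b2 (by positivity)).trans (le_of_eq ?_))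
        rw [hL]; ring)
    simp only [mul_add]
    rw [intervalIntegral.integral_add (Continuous.intervalIntegrable (by fun_prop) _ _)
      (Continuous.intervalIntegrable (by fun_prop) _ _)]
    simp only [mul_add] at a1
    linarith
  set I1 := ∫ s in (0 : ℝ)..t, Real.exp (θ * s) *
    (‖emb (prim (emb (rx s)))‖ ^ 2 + ‖emb (prim (emb (vx s)))‖ ^ 2) with hI1
  have hI1' : 0 ≤ I1 := integral_nonneg ht.1 fun s _ => by positivity
  set I2 := ∫ s in (0 : ℝ)..t, Real.exp (θ * s) * (‖emb (rx s)‖ ^ 2 + ‖emb (vx s)‖ ^ 2) with hI2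
  have hI2' : 0 ≤ I2 := integral_nonneg ht.1 fun s _ => by positivity
  have hI3 : 0 ≤ ∫ s in (0 : ℝ)..t, Real.exp (θ * s) *
    (‖B.reltx (emb (rx s)) (R s)‖ ^ 2 + ‖V s‖ ^ 2) := integral_nonneg ht.1 fun s _ => by positivity
  set E1 := ‖emb (rx 0)‖ ^ 2 + ‖emb (vx 0)‖ ^ 2 with hE1
  set E2 := ‖B.reltx (emb (rx 0)) (R 0)‖ ^ 2 + ‖V 0‖ ^ 2 with hE2
  have hE1' : 0 ≤ E1 := by positivity
  have hE2' : 0 ≤ E2 := by positivity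
  have hX : 0 ≤ Real.exp (θ * t) * (‖emb (rx t)‖ ^ 2 + ‖emb (vx t)‖ ^ 2) := by positivity
  have f1 : I2 ≤ K₃ * (E1 + I1) := by linarith
  have f2 := mul_le_mul_of_nonneg_left f1 hL0.le
  have f3 := mul_le_mul_of_nonneg_left (e1.trans (add_le_add f2 P2)) hK₂.le
  have g1 : 0 ≤ K₃ * E2 := by positivity
  have g2 : 0 ≤ K₂ * (E1 + I1) := by positivity
  have g3 : 0 ≤ K₂ * ((L + 1) * K₃) * E2 := by positivity
  rw [mul_add]
  linarith

/-- The energy estimate in terms of the derivatives with respect to the space variable. -/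
theorem exists_estimate_space (B : Background ν) : ∃ ε > 0, ∃ θ > 0, ∃ K > 0,
    ∀ (T : ℝ) (rx vx vxx : ℝ → CI) (rxx vxxx R V : ℝ → L2),
      B.Pert2 T rx vx vxx rxx vxxx R V → (∀ t ∈ Icc 0 T, ‖rx t‖ ≤ ε ∧ ‖vx t‖ ≤ ε) →
      ∀ t ∈ Icc 0 T, Real.exp (θ * t) * (‖emb (rx t)‖ ^ 2 + ‖emb (vx t)‖ ^ 2
          + ‖rxx t‖ ^ 2 + ‖emb (vxx t)‖ ^ 2 + ‖vxxx t‖ ^ 2) ≤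
        K * ((‖emb (rx 0)‖ ^ 2 + ‖emb (vx 0)‖ ^ 2
          + ‖rxx 0‖ ^ 2 + ‖emb (vxx 0)‖ ^ 2 + ‖vxxx 0‖ ^ 2)
          + ∫ s in (0 : ℝ)..t, Real.exp (θ * s) *
            (‖emb (prim (emb (rx s)))‖ ^ 2 + ‖emb (prim (emb (vx s)))‖ ^ 2)) := by
  obtain ⟨K₁, hK₁⟩ := B.exists_bd
  have hp := hK₁.pos
  obtain ⟨ε, hε, θ, hθ, K, hK, H⟩ := B.exists_estimate_two
  -- The exponent is 2·40, from squaring the bounds of `bnd_space` and `bnd_time`. In the constants,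
  -- 12 = 3·4 and 10 = 2·5 count the quantities bounded times the number of summands in the square.
  set L := (2 * K₁) ^ 80 with hL
  have hL0 : 0 < L := by positivity
  have hM : 0 < 1 + 12 * L := by positivity
  have hN : 0 < 1 + 10 * L := by positivity
  refine ⟨ε, hε, θ, hθ, (1 + 12 * L) * (K * (1 + 10 * L)), by positivity,
    fun T rx vx vxx rxx vxxx R V h hsm t ht => ?_⟩
  have h1 := H T rx vx vxx rxx vxxx R V h hsm t ht
  have h2 : ‖emb (rx t)‖ ^ 2 + ‖emb (vx t)‖ ^ 2 + ‖rxx t‖ ^ 2 + ‖emb (vxx t)‖ ^ 2 + ‖vxxx t‖ ^ 2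
      ≤ (1 + 12 * L) * (‖emb (rx t)‖ ^ 2 + ‖emb (vx t)‖ ^ 2
          + (‖B.reltx (emb (rx t)) (R t)‖ ^ 2 + ‖V t‖ ^ 2)) := by
    obtain ⟨a1, a2, a3⟩ := h.bnd_space hK₁ ht rfl
    have a1 := a1.sq_le
    have a2 := a2.sq_le
    have a3 := a3.sq_le
    set p := ‖emb (rx t)‖
    set q := ‖emb (vx t)‖
    set y := ‖B.reltx (emb (rx t)) (R t)‖
    set z := ‖V t‖
    have b : (p + q + y + z) ^ 2 ≤ 4 * (p ^ 2 + q ^ 2 + (y ^ 2 + z ^ 2)) := by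
      linarith [sq_nonneg (p - q), sq_nonneg (p - y), sq_nonneg (p - z), sq_nonneg (q - y),
        sq_nonneg (q - z), sq_nonneg (y - z)]
    have b' := mul_le_mul_of_nonneg_left b hL0.le
    have b3 := sq_nonneg y
    have b4 := sq_nonneg z
    norm_num only at a1 a2 a3
    rw [← hL] at a1 a2 a3
    linarith
  have h3 : ‖emb (rx 0)‖ ^ 2 + ‖emb (vx 0)‖ ^ 2
          + (‖B.reltx (emb (rx 0)) (R 0)‖ ^ 2 + ‖V 0‖ ^ 2) ≤
      (1 + 10 * L) * (‖emb (rx 0)‖ ^ 2 + ‖emb (vx 0)‖ ^ 2 + ‖rxx 0‖ ^ 2 + ‖emb (vxx 0)‖ ^ 2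
        + ‖vxxx 0‖ ^ 2) := by
    obtain ⟨a1, a2⟩ := h.bnd_time hK₁ ⟨le_rfl, h.pos.le⟩ rfl
    have a1 := a1.sq_le
    have a2 := a2.sq_le
    set p := ‖emb (rx 0)‖
    set q := ‖emb (vx 0)‖
    set x := ‖rxx 0‖
    set y := ‖emb (vxx 0)‖
    set z := ‖vxxx 0‖
    have b : (p + q + x + y + z) ^ 2 ≤ 5 * (p ^ 2 + q ^ 2 + x ^ 2 + y ^ 2 + z ^ 2) := by
      linarith [sq_nonneg (p - q), sq_nonneg (p - y), sq_nonneg (p - z), sq_nonneg (q - y),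
        sq_nonneg (q - z), sq_nonneg (y - z), sq_nonneg (p - x), sq_nonneg (q - x),
        sq_nonneg (x - y), sq_nonneg (x - z)]
    have b' := mul_le_mul_of_nonneg_left b hL0.le
    have b3 := sq_nonneg x
    have b4 := sq_nonneg y
    have b5 := sq_nonneg z
    norm_num only at a1 a2
    rw [← hL] at a1 a2
    linarith
  have hI : 0 ≤ ∫ s in (0 : ℝ)..t, Real.exp (θ * s) *
    (‖emb (prim (emb (rx s)))‖ ^ 2 + ‖emb (prim (emb (vx s)))‖ ^ 2) :=
    integral_nonneg ht.1 fun s _ => by positivity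
  set I1 := ∫ s in (0 : ℝ)..t, Real.exp (θ * s) *
    (‖emb (prim (emb (rx s)))‖ ^ 2 + ‖emb (prim (emb (vx s)))‖ ^ 2)
  have h4 := mul_le_mul_of_nonneg_left h2 (Real.exp_pos (θ * t)).le
  have h5 := mul_le_mul_of_nonneg_left h1 hM.le
  have h6 := mul_le_mul_of_nonneg_left h3 hK.le
  have h7 : 0 ≤ 10 * L * K * I1 := by positivity
  have h8 := mul_le_mul_of_nonneg_left (add_le_add h6 (le_add_of_nonneg_right h7 : K * I1 ≤ _)) hM.le
  linarith

end Background

/-! ### Decay in H² × H³ -/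

/-- The weak derivatives as continuous linear maps. -/
def DL {k : ℕ} (j : Fin (k + 1)) : H k →L[ℝ] L2 :=
  (PiLp.proj 2 (fun _ : Fin (k + 1) => L2) j).comp (sobolev k).subtypeL

theorem IsH1.norm_le {a : CI} {a' : L2} (h : IsH1 a a') : ‖a‖ ≤ ‖emb a‖ + 2 * ‖a'‖ := by
  have h1 : emb (cst (a 0)) = emb a - emb (prim a') := by
    conv_rhs => rw [h]
    simp
  have h2 : |a 0| ≤ ‖emb a‖ + ‖a'‖ := by
    have h3 : ‖emb (cst (a 0))‖ = |a 0| := by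
      rw [emb_apply, cst_csmul, norm_smul, norm_one2, mul_one, Real.norm_eq_abs]
    rw [← h3, h1]
    exact (norm_sub_le _ _).trans (add_le_add le_rfl ((norm_emb_le _).trans (norm_prim_le _)))
  rw [ContinuousMap.norm_le _ (by positivity)]
  intro x
  have h4 : a x = a 0 + prim a' x := by
    have := congrArg (fun b : CI => b x) h
    simpa using this
  rw [h4]
  refine (norm_add_le _ _).trans ?_
  have h5 := ((prim a').norm_coe_le_norm x).trans (norm_prim_le a')
  rw [Real.norm_eq_abs]
  linarith

/-- Continuous representatives are chosen separately for each function. No continuity of the choice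
in time is needed, because `Pert2` asks it only of the L² classes. The factor 3 is the sum of the
coefficients 1 and 2 in `IsH1.norm_le`. -/
theorem exists_pert2 {ν : ℝ} {B : Background ν} {P ρh uh : ℝ → ℝ} (hB : B.Rep P ρh uh) {T : ℝ}
    (hT : 0 < T) {r : ℝ → H 2} {v : ℝ → H 3}
    (hr1 : ContDiffOn ℝ 1 (fun t => toH1 (r t)) (Icc 0 T))
    (hv1 : ContDiffOn ℝ 1 (fun t => toH1 (v t)) (Icc 0 T))
    (h : IsSolution ν P ρh uh T (fun t => toH1 (r t)) (fun t => toH1 (v t)))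
    {ε : ℝ} (hr : ∀ t ∈ Icc 0 T, ‖r t‖ ≤ ε) (hv : ∀ t ∈ Icc 0 T, ‖v t‖ ≤ ε)
    (hε : 3 * ε ≤ B.δ) :
    ∃ (rx vx vxx : ℝ → CI) (R V : ℝ → L2),
      B.Pert2 T rx vx vxx (fun t => D 2 (r (clamp T t))) (fun t => D 3 (v (clamp T t))) R V ∧
      (∀ t ∈ Icc 0 T, D 1 (r t) = emb (rx t) ∧ D 1 (v t) = emb (vx t) ∧ D 2 (v t) = emb (vxx t)) ∧
      ∀ t ∈ Icc 0 T, ‖rx t‖ ≤ 3 * ε ∧ ‖vx t‖ ≤ 3 * ε := by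
  have hε0 : 0 ≤ ε := (norm_nonneg _).trans (hr 0 ⟨le_rfl, hT.le⟩)
  have key1 : ∀ f : H 2, ∃ a, IsH1 a (D 2 f) ∧ D 1 f = emb a := fun f =>
    IsWeakDeriv.exists_eq (f.2 1)
  have key2 : ∀ f : H 3, ∃ a, IsH1 a (D 2 f) ∧ D 1 f = emb a := fun f =>
    IsWeakDeriv.exists_eq (f.2 1)
  have key3 : ∀ f : H 3, ∃ a, IsH1 a (D 3 f) ∧ D 2 f = emb a := fun f =>
    IsWeakDeriv.exists_eq (f.2 2)
  choose fr hfr1 hfr2 using key1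
  choose fv hfv1 hfv2 using key2
  choose gv hgv1 hgv2 using key3
  have hc := clamp_mem hT.le
  have hU := uniqueDiffOn_Icc hT
  set R : ℝ → L2 := fun t => D 1 (derivWithin (fun t => toH1 (r t)) (Icc 0 T) (clamp T t)) with hR
  set V : ℝ → L2 := fun t => D 1 (derivWithin (fun t => toH1 (v t)) (Icc 0 T) (clamp T t)) with hV
  have er : (fun t => emb (fr (r (clamp T t)))) = fun t => D 1 (toH1 (r (clamp T t))) :=
    funext fun t => (hfr2 _).symm
  have ev : (fun t => emb (fv (v (clamp T t)))) = fun t => D 1 (toH1 (v (clamp T t))) :=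
    funext fun t => (hfv2 _).symm
  have dR : ∀ t ∈ Icc 0 T, HasDerivWithinAt (fun s => emb (fr (r (clamp T s)))) (R t) (Icc 0 T) t := by
    intro t ht
    have h1 := (DL 1).hasFDerivAt.comp_hasDerivWithinAt t
      ((hr1.differentiableOn (by norm_num) t ht).hasDerivWithinAt)
    have h2 : ∀ s ∈ Icc 0 T, emb (fr (r (clamp T s))) = D 1 (toH1 (r s)) := fun s hs => by
      rw [clamp_of_mem hs]; exact (hfr2 _).symm
    rw [hR]
    simp only [clamp_of_mem ht]
    exact h1.congr h2 (h2 t ht)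
  have dV : ∀ t ∈ Icc 0 T, HasDerivWithinAt (fun s => emb (fv (v (clamp T s)))) (V t) (Icc 0 T) t := by
    intro t ht
    have h1 := (DL 1).hasFDerivAt.comp_hasDerivWithinAt t
      ((hv1.differentiableOn (by norm_num) t ht).hasDerivWithinAt)
    have h2 : ∀ s ∈ Icc 0 T, emb (fv (v (clamp T s))) = D 1 (toH1 (v s)) := fun s hs => by
      rw [clamp_of_mem hs]; exact (hfv2 _).symm
    rw [hV]
    simp only [clamp_of_mem ht]
    exact h1.congr h2 (h2 t ht)
  have br : ∀ f : H 2, ‖f‖ ≤ ε → ‖fr f‖ ≤ 3 * ε := fun f hf => by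
    have h1 := (hfr1 f).norm_le
    rw [← hfr2] at h1
    have h2 := (norm_D_le 1 f).trans hf
    have h3 := (norm_D_le 2 f).trans hf
    linarith
  have bv : ∀ f : H 3, ‖f‖ ≤ ε → ‖fv f‖ ≤ 3 * ε := fun f hf => by
    have h1 := (hfv1 f).norm_le
    rw [← hfv2] at h1
    have h2 := (norm_D_le 1 f).trans hf
    have h3 := (norm_D_le 2 f).trans hf
    linarith
  have hpert := h.pert hB hT.le
    (fun t ht => ((norm_D_le (1 : Fin 3) (r t)).trans (hr t ht)).trans (by linarith))
    (fun t ht => ((norm_D_le (1 : Fin 4) (v t)).trans (hv t ht)).trans (by linarith))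
  refine ⟨fun t => fr (r (clamp T t)), fun t => fv (v (clamp T t)), fun t => gv (v (clamp T t)),
    R, V, ?_, fun t ht => ?_, fun t ht => ?_⟩
  · exact
    { pos := hT
      pert := by rw [er, ev]; exact hpert
      near := fun t =>
        { isH1_rx := hfr1 _
          rx_le := (br _ (hr _ (hc t))).trans hε
          vx_le := (bv _ (hv _ (hc t))).trans hε
          rxx_le := ((norm_D_le 2 _).trans (hr _ (hc t))).trans (by linarith) }
      isH1_vx := fun t => by rw [← hgv2]; exact hfv1 _
      isH1_vxx := fun t => hgv1 _
      cont_R := (continuous_D 1).comp ((hr1.continuousOn_derivWithin hU le_rfl).comp_continuous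
        (continuous_clamp T) hc)
      cont_V := (continuous_D 1).comp ((hv1.continuousOn_derivWithin hU le_rfl).comp_continuous
        (continuous_clamp T) hc)
      -- The boundary value of v at x = 1 vanishes for all times, so its time derivative, the value
      -- of `prim (V t)` there, is zero.
      prim_V := fun t => by
        have e : V t = V (clamp T t) := by simp only [hV, clamp_of_mem (hc t)]
        have h1 := Background.Pert2.hasDerivWithinAt_prim (dV _ (hc t))
        have h2 := (ContinuousMap.evalCLM ℝ (1 : unitInterval)).hasFDerivAt.comp_hasDerivWithinAt _ h1
        have h3 : HasDerivWithinAt (fun _ : ℝ => (0 : ℝ)) 0 (Icc 0 T) (clamp T t) :=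
          hasDerivWithinAt_const _ _ _
        have h4 : ∀ s ∈ Icc 0 T, (0 : ℝ) = prim (emb (fv (v (clamp T s)))) 1 := fun s hs => by
          rw [← hfv2]
          exact (prim_D_one_eq_zero (f := toH1 (v (clamp T s))) (h.bc_v_left _ (hc s))
            (h.bc_v_right _ (hc s))).symm
        have h5 := (hU _ (hc t)).eq_deriv _ (h2.congr h4 (h4 _ (hc t))) h3
        rw [e]
        exact h5
      deriv_r := dR
      deriv_w := dV }
  · simp only [clamp_of_mem ht]
    exact ⟨hfr2 _, hfv2 _, hgv2 _⟩
  · simp only [clamp_of_mem ht]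
    exact ⟨br _ (hr t ht), bv _ (hv t ht)⟩

theorem exists_decay_two {ν : ℝ} {P ρh uh : ℝ → ℝ} {B : Background ν} (hB : B.Rep P ρh uh) :
    ∃ ε > (0 : ℝ), ∃ C > (0 : ℝ), ∃ θ₁ > (0 : ℝ),
      ∀ T > (0 : ℝ), ∀ (r : ℝ → H 2) (v : ℝ → H 3),
        ContinuousOn r (Icc 0 T) → ContinuousOn v (Icc 0 T) →
        ContDiffOn ℝ 1 (fun t => toH1 (r t)) (Icc 0 T) →
        ContDiffOn ℝ 1 (fun t => toH1 (v t)) (Icc 0 T) →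
        IsSolution ν P ρh uh T (fun t => toH1 (r t)) (fun t => toH1 (v t)) →
        (∀ t ∈ Icc (0 : ℝ) T, Real.sqrt (‖r t‖ ^ 2 + ‖v t‖ ^ 2) ≤ ε) →
        ∀ t ∈ Icc (0 : ℝ) T, ∀ θ < θ₁,
          ‖r t‖ ^ 2 + ‖v t‖ ^ 2 ≤
            C * Real.exp (-θ * t) * (‖r 0‖ ^ 2 + ‖v 0‖ ^ 2)
            + C * ∫ s in (0 : ℝ)..t, Real.exp (-θ * (t - s)) *
                (‖D 0 (r s)‖ ^ 2 + ‖D 0 (v s)‖ ^ 2) := by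
  obtain ⟨ε, hε, θ₁, hθ₁, K, hK, Hest⟩ := B.exists_estimate_space
  have hm : 0 < min ε B.δ := lt_min hε B.hδ
  refine ⟨min ε B.δ / 3, by positivity, 2 * K, by positivity, θ₁, hθ₁,
    fun T hT r v hrc hvc hr1 hv1 hsol hsm t ht θ hθ => ?_⟩
  have hnr : ∀ t ∈ Icc 0 T, ‖r t‖ ≤ min ε B.δ / 3 := fun t ht =>
    (Real.le_sqrt_of_sq_le (by linarith [sq_nonneg ‖v t‖])).trans (hsm t ht)
  have hnv : ∀ t ∈ Icc 0 T, ‖v t‖ ≤ min ε B.δ / 3 := fun t ht =>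
    (Real.le_sqrt_of_sq_le (by linarith [sq_nonneg ‖r t‖])).trans (hsm t ht)
  have e3 : 3 * (min ε B.δ / 3) = min ε B.δ := by ring
  obtain ⟨rx, vx, vxx, R, V, hp, heq, hsm'⟩ := exists_pert2 hB hT hr1 hv1 hsol hnr hnv
    (by rw [e3]; exact min_le_right _ _)
  rw [e3] at hsm'
  have h1 := Hest T rx vx vxx _ _ R V hp (fun t ht => ⟨(hsm' t ht).1.trans (min_le_left _ _),
    (hsm' t ht).2.trans (min_le_left _ _)⟩) t ht
  have h0T : (0 : ℝ) ∈ Icc 0 T := ⟨le_rfl, hT.le⟩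
  have hD0r : ∀ t ∈ Icc 0 T, D 0 (r t) = emb (prim (D 1 (r t))) := fun t ht =>
    D_zero_eq (f := toH1 (r t)) (hsol.bc_r t ht)
  have hD0v : ∀ t ∈ Icc 0 T, D 0 (v t) = emb (prim (D 1 (v t))) := fun t ht =>
    D_zero_eq (f := toH1 (v t)) (hsol.bc_v_left t ht)
  simp only [clamp_of_mem ht, clamp_of_mem h0T] at h1
  rw [← (heq t ht).1, ← (heq t ht).2.1, ← (heq t ht).2.2, ← (heq 0 h0T).1, ← (heq 0 h0T).2.1,
    ← (heq 0 h0T).2.2] at h1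
  have e1 : ∫ s in (0 : ℝ)..t, Real.exp (θ₁ * s) * (‖emb (prim (emb (rx s)))‖ ^ 2
      + ‖emb (prim (emb (vx s)))‖ ^ 2) = ∫ s in (0 : ℝ)..t, Real.exp (θ₁ * s) *
      (‖D 0 (r s)‖ ^ 2 + ‖D 0 (v s)‖ ^ 2) := by
    refine intervalIntegral.integral_congr fun s hs => ?_
    rw [uIcc_of_le ht.1] at hs
    have hs' : s ∈ Icc 0 T := ⟨hs.1, hs.2.trans ht.2⟩
    simp only [hD0r s hs', hD0v s hs', (heq s hs').1, (heq s hs').2.1]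
  rw [e1] at h1
  have nr : ∀ f : H 2, ‖f‖ ^ 2 = ‖D 0 f‖ ^ 2 + ‖D 1 f‖ ^ 2 + ‖D 2 f‖ ^ 2 := fun f => by
    rw [norm_sq_eq_sum, Fin.sum_univ_three]
  have nv : ∀ f : H 3, ‖f‖ ^ 2 = ‖D 0 f‖ ^ 2 + ‖D 1 f‖ ^ 2 + ‖D 2 f‖ ^ 2 + ‖D 3 f‖ ^ 2 :=
    fun f => by rw [norm_sq_eq_sum, Fin.sum_univ_four]
  have hle : ∀ F : L2, ‖emb (prim F)‖ ^ 2 ≤ ‖F‖ ^ 2 := fun F =>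
    pow_le_pow_left₀ (norm_nonneg _) ((norm_emb_le _).trans (norm_prim_le F)) 2
  have hsub : Icc 0 t ⊆ Icc 0 T := Icc_subset_Icc_right ht.2
  refine le_of_exp_weight (θ₀ := θ₁) ht.1 (by positivity) (by positivity) ?_
    (fun s _ => by positivity) hθ.le ?_
  · have c1 := (continuous_D 0).comp_continuousOn (hrc.mono hsub)
    have c2 := (continuous_D 0).comp_continuousOn (hvc.mono hsub)
    exact (c1.norm.pow 2).add (c2.norm.pow 2)
  -- The zeroth-order norms are bounded by the first-order ones, since r and v vanish at 0; this
  -- accounts for the factor 2.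
  · have f1 : ‖r t‖ ^ 2 + ‖v t‖ ^ 2 ≤ 2 * (‖D 1 (r t)‖ ^ 2 + ‖D 1 (v t)‖ ^ 2 + ‖D 2 (r t)‖ ^ 2
        + ‖D 2 (v t)‖ ^ 2 + ‖D 3 (v t)‖ ^ 2) := by
      rw [nr, nv, hD0r t ht, hD0v t ht]
      linarith [hle (D 1 (r t)), hle (D 1 (v t)), sq_nonneg ‖D 2 (r t)‖, sq_nonneg ‖D 2 (v t)‖,
        sq_nonneg ‖D 3 (v t)‖]
    have f2 : ‖D 1 (r 0)‖ ^ 2 + ‖D 1 (v 0)‖ ^ 2 + ‖D 2 (r 0)‖ ^ 2 + ‖D 2 (v 0)‖ ^ 2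
        + ‖D 3 (v 0)‖ ^ 2 ≤ ‖r 0‖ ^ 2 + ‖v 0‖ ^ 2 := by
      rw [nr, nv]
      linarith [sq_nonneg ‖D 0 (r 0)‖, sq_nonneg ‖D 0 (v 0)‖]
    have f3 := mul_le_mul_of_nonneg_left f1 (Real.exp_pos (θ₁ * t)).le
    have f4 := mul_le_mul_of_nonneg_left f2 hK.le
    linarith

end CompressibleNS

end

theorem proposition6p1 (ν : ℝ) (hν : 0 < ν) (P : ℝ → ℝ)
    (hP : ContDiffOn ℝ ∞ P (Ioi 0)) (hP' : ∀ y : ℝ, 0 < y → 0 < deriv P y)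
    (ρ₀ u₀ u₁ : ℝ) (hρ₀ : 0 < ρ₀) (hu₀ : 0 < u₀) (hu₁ : 0 < u₁)
    (ρh uh : ℝ → ℝ) (hsteady : CompressibleNS.IsSteady ν P ρ₀ u₀ u₁ ρh uh) :
    (∃ ε > (0 : ℝ), ∃ C > (0 : ℝ), ∃ θ₀ > (0 : ℝ),
      ∀ T > (0 : ℝ), ∀ r v : ℝ → CompressibleNS.H 1,
        CompressibleNS.IsSolution ν P ρh uh T r v →
        (∀ t ∈ Icc (0 : ℝ) T, Real.sqrt (‖r t‖ ^ 2 + ‖v t‖ ^ 2) ≤ ε) →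
        ∀ t ∈ Icc (0 : ℝ) T, ∀ θ ≤ θ₀,
          ‖r t‖ ^ 2 + ‖v t‖ ^ 2 ≤
            C * Real.exp (-θ * t) * (‖r 0‖ ^ 2 + ‖v 0‖ ^ 2)
            + C * ∫ s in (0 : ℝ)..t, Real.exp (-θ * (t - s)) *
                (‖CompressibleNS.D 0 (r s)‖ ^ 2 + ‖CompressibleNS.D 0 (v s)‖ ^ 2)) ∧
    (∃ ε > (0 : ℝ), ∃ C > (0 : ℝ), ∃ θ₁ > (0 : ℝ),
      ∀ T > (0 : ℝ), ∀ (r : ℝ → CompressibleNS.H 2) (v : ℝ → CompressibleNS.H 3),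
        ContinuousOn r (Icc 0 T) → ContinuousOn v (Icc 0 T) →
        ContDiffOn ℝ 1 (fun t => CompressibleNS.toH1 (r t)) (Icc 0 T) →
        ContDiffOn ℝ 1 (fun t => CompressibleNS.toH1 (v t)) (Icc 0 T) →
        CompressibleNS.IsSolution ν P ρh uh T
          (fun t => CompressibleNS.toH1 (r t)) (fun t => CompressibleNS.toH1 (v t)) →
        (∀ t ∈ Icc (0 : ℝ) T, Real.sqrt (‖r t‖ ^ 2 + ‖v t‖ ^ 2) ≤ ε) →
        ∀ t ∈ Icc (0 : ℝ) T, ∀ θ < θ₁,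
          ‖r t‖ ^ 2 + ‖v t‖ ^ 2 ≤
            C * Real.exp (-θ * t) * (‖r 0‖ ^ 2 + ‖v 0‖ ^ 2)
            + C * ∫ s in (0 : ℝ)..t, Real.exp (-θ * (t - s)) *
                (‖CompressibleNS.D 0 (r s)‖ ^ 2 + ‖CompressibleNS.D 0 (v s)‖ ^ 2)) := by
  obtain ⟨B, hB⟩ := hsteady.exists_rep hν hP hP' hρ₀ hu₀
  exact ⟨CompressibleNS.exists_decay_one hB, CompressibleNS.exists_decay_two hB⟩
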